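/- **Setting.** Let $\mathbb T=\mathbb R/2\pi\mathbb Z$, $\mathcal Ff(n)=\frac1{2\pi}\int_0^{2\pi}f(x)e^{-inx}dx$, $\langle n\rangle=(1+n^2)^{1/2}$, $\|a\|_{\ell^2_s}=\|\langle n\rangle^s a(n)\|_{\ell^2(\mathbb Z)}$, $\|f\|_{H^s}=\|\mathcal Ff\|_{\ell^2_s}$, $C_TX=C([0,T];X)$ for $T>0$. Let $P_\pm,P_c,P_{\ne c}$ be the Fourier projections onto $\{\pm n>0\},\{n=0\},\{n\ne0\}$, $\mathcal H$ the Hilbert transform (symbol $-i\,\mathrm{sgn}\,n$), $\partial_x^{-1}$ the mean-zero primitive, and $\sigma\in\{\pm1\}$. Consider real-valued solutions, in the sense of distributions on $(0,T)\times\mathbb T$, of $$\partial_tu=-\mathcal H\partial_x^2u+2\sigma P_{\neq c}(u^2)\,\partial_xu .\qquad(1)$$ For $u\in C_TH^s$ put $F=F[u]=\partial_x^{-1}P_{\ne c}(u^2)$, $g=P_+u+\frac12P_cu$, $v=e^{-i\sigma F}g$, $\omega(t,n)=e^{itn|n|}\mathcal F[v(t)](n)$, $\omega^*(t,n)=\overline{\omega(t,-n)}$,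 $W_k(t)=\mathcal F[e^{ikF[u(t)]}]$, $h=P_{\neq c}(u^2)\partial_xu$ and $$\begin{aligned}R[u]=&-ie^{-i\sigma F}P_{\ne c}[(P_{\ne c}(u^2))^2]g-\mathcal H[e^{-i\sigma F}(P_{\ne c}(u^2))^2g]-2\sigma P_c(u\,i\mathcal H\partial_xu)e^{-i\sigma F}g+2\sigma P_c[e^{-i\sigma F}u\,g\,i\mathcal H\partial_xu]\\&+2\sigma(P_c+P_-)[e^{-i\sigma F}P_+h]-2\sigma P_+[e^{-i\sigma F}(P_c+P_-)h]-2\sigma P_c(u^2)\big(P_+[e^{-i\sigma F}\partial_xP_-u]+P_-[e^{-i\sigma F}\partial_xP_+u]\big)\\&+iP_c[e^{-i\sigma F}P_+\partial_x^2u]-2\sigma P_c(u^2)P_-[\partial_x^{-1}P_-(e^{-i\sigma F})\,\partial_x^2P_+u].\end{aligned}$$ **Multipliers.** For $(n_1,\dots,n_5)\in\mathbb Z^5$ write $n=n_1+\dots+n_5$, $n_{ij\dots}=n_i+n_j+\cdots$, $\Phi=n|n|-n_1|n_1|-n_3|n_3|-n_5|n_5|$ and $m_1=-2i\sigma\,n_{45}\mathbf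 1_{n>0>n_{45}}$, $m_2=-m_1$, $m_3=2i\sigma\,n_{45}(2+\frac n{n_{123}})\mathbf 1_{n<0<n_{45}}$, $m_4=4i\sigma\,n_{45}(1+\frac n{n_{123}})\mathbf 1_{n<0<n_{45}}$, $m_5=2i\sigma\frac{n\,n_{45}}{n_{123}}\mathbf 1_{n<0<n_{45}}$, $m_6=-2i\sigma\frac{n_{23}n_{45}}{n_{2345}}\mathbf 1_{n_{23},n_{45}>0}$, $m_7=2i\sigma\frac{n_{23}n_{45}}{n_{2345}}\mathbf 1_{n_{23},n_{45}<0}$. With $\eta=2^{-10}$ and $\mu=|n_2|\vee|n_4|$, let $\mathcal A_1$ be the set where $n_{15}n_{35}=0$, or $\mu\ge\eta^2(|n_5|\wedge|n|)$, or [$\mu<\eta^2|n_5|$, $|n_5|<\eta(|n_1|\wedge|n_3|)$, $|n_{24}|\ge\eta|n_{13}|$], or [$\mu<\eta^2|n_5|$, $|n_3|<\eta(|n_1|\wedge|n_5|)$, $|n_{24}|\ge\eta|n_{15}|$, $|n_5|\le2|n_1|$]; let $\mathcal A_2$ be the set where $n_{13}n_{15}=0$ or $\mu\ge\eta(|n_3|\wedge|n_5|)$.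 Let $\hat m_i=m_i$ where $|\Phi|>\mu^2$ and $(n_l)\notin\mathcal A_1$ (for $i\le5$), resp. $(n_l)\notin\mathcal A_2$ (for $i=6,7$), and $\hat m_i=0$ elsewhere; $\hat{\hat m}_i=m_i-\hat m_i$; $\hat m_i^*(n_1,\dots,n_5)=\overline{\hat m_i(-n_1,\dots,-n_5)}$. The five slots of type $i$ carry the factors $$\begin{array}{ll}1:(\omega,W_\sigma,\omega,W_{-\sigma},\omega^*)&2:(\omega^*,W_{-3\sigma},\omega^*,W_{-\sigma},\omega^*)\\3,6:(\omega,W_\sigma,\omega,W_\sigma,\omega)&4:(\omega,W_{-\sigma},\omega^*,W_\sigma,\omega)\\5:(\omega^*,W_{-3\sigma},\omega^*,W_\sigma,\omega)&7:(\omega,W_{-\sigma},\omega^*,W_{-\sigma},\omega^*).\end{array}$$ $\mathcal R^{(0)}[u,\omega](t,n)$ is the sum over $i=1,\dots,7$ and over $n_1+\dots+n_5=n$ of $e^{it\Phi}\hat{\hat m}_i$ times the five factors of type $i$ at $n_1,\dots,n_5$, plus $e^{itn|n|}\mathcal F(R[u(t)])(n)$. **Trees.** A tree $\mathcal T\in\mathfrak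 T(J)$ has a root and $J$ numbered parents $a^1,\dots,a^J$, each with five numbered children $a^j_1,\dots,a^j_5$ ($5J+1$ elements in all); $a^1$ is the root, and every other parent is the first, third or fifth child of a parent with a smaller number. $\mathcal T^\infty_1$ is the set of all second and fourth children, $\mathcal T^\infty_2$ the set of all other childless elements. Index functions are maps $\mathbf n:\mathcal T\to\mathbb Z$ with $n_{a^j}=\sum_ln_{a^j_l}$ for all $j$; $\Phi_j$ is $\Phi$ at the children of $a^j$, and $\tilde\Phi_j=\Phi_1+\dots+\Phi_j$. Given types $\mathbf i\in\{1,\dots,7\}^J$, the root is unstarred; the children of $a^j$ carry the factors of type $i_j$ if $a^j$ is unstarred, and the same with $\omega\leftrightarrow\omega^*$, $W_k\leftrightarrow W_{-k}$ if $a^j$ is starred; a first, third or fifth child is starred if its factor is $\omega^*$. This defines $W_a$ ($a\in\mathcal T^\infty_1$) and $\omega_b$ ($b\in\mathcal T^\infty_2$). Put $\mathcal R^{(0)}_b(n)=\mathcal R^{(0)}(n)$, resp. $\overline{\mathcal R^{(0)}(-n)}$, if $b$ is unstarred, resp. starred, and let $\mathbf m_J$ be the product over $j\le J$ of $\hat m_{i_j}$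 (of $\hat m^*_{i_j}$ if $a^j$ is starred) at the children of $a^j$. For $M>1$, $(\Phi_j)_{j\le J}$ is *nonresonant* if $|\Phi_1|>M$ and $|\tilde\Phi_j|>2|\tilde\Phi_{j-1}|$ for $2\le j\le J$. It is *resonant* if $|\Phi_1|\le M$ (when $J=1$), or if $(\Phi_j)_{j\le J-1}$ is nonresonant and $|\tilde\Phi_J|\le2|\tilde\Phi_{J-1}|$ (when $J\ge2$). For $J\ge1$ define, summing over all $\mathbf i\in\{1,\dots,7\}^J$, $\mathcal T\in\mathfrak T(J)$ and index functions with $n_{\rm root}=n$, $$\begin{aligned} \mathcal N_R^{(J)}&=i^{J-1}\!\!\sum_{\text{resonant}}\frac{e^{it\tilde\Phi_J}\mathbf m_J}{\prod_{j\le J-1}\tilde\Phi_j}\prod_{\mathcal T^\infty_1}W_a(n_a)\prod_{\mathcal T^\infty_2}\omega_b(n_b),\qquad \mathcal N_0^{(J)}=-i^{J}\!\!\sum_{\text{nonres.}}\frac{e^{it\tilde\Phi_J}\mathbf m_J}{\prod_{j\le J}\tilde\Phi_j}\prod_{\mathcal T^\infty_1}W_a(n_a)\prod_{\mathcal T^\infty_2}\omega_b(n_b),\\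 \mathcal N_1^{(J)}&=i^J\!\!\sum_{\text{nonres.}}\frac{e^{it\tilde\Phi_J}\mathbf m_J}{\prod_{j\le J}\tilde\Phi_j}\,\partial_t\Big[\prod_{\mathcal T^\infty_1}W_a(n_a)\Big]\prod_{\mathcal T^\infty_2}\omega_b(n_b),\\ \mathcal R^{(J)}&=i^J\!\!\sum_{\text{nonres.}}\frac{e^{it\tilde\Phi_J}\mathbf m_J}{\prod_{j\le J}\tilde\Phi_j}\prod_{\mathcal T^\infty_1}W_a(n_a)\sum_{b\in\mathcal T^\infty_2}\mathcal R^{(0)}_b(n_b)\prod_{b'\ne b}\omega_{b'}(n_{b'}).\end{aligned}$$ For $J\ge0$ let $$\mathcal N^{(J+1)}=i^J\sum\frac{e^{it\tilde\Phi_{J+1}}\mathbf m_{J+1}}{\prod_{j\le J}\tilde\Phi_j}\prod_{\mathcal T^\infty_1}W_a(n_a)\prod_{\mathcal T^\infty_2}\omega_b(n_b),$$ the sum being over $\mathbf i\in\{1,\dots,7\}^{J+1}$, $\mathcal T\in\mathfrak T(J+1)$ and index functions with $n_{\rm root}=n$ and $(\Phi_j)_{j\le J}$ nonresonant (no condition if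 $J=0$). **Proposition.** Let $1/2<s\le1$. (i) There is $\delta\in(0,1/2)$ depending only on $s$ such that the following holds. Let $u\in C_TH^s$ be a real-valued distributional solution of (1) and $\omega$ as above. Then $\omega\in C_T\ell^2_s$, the coefficients $W_k(\cdot,n)$ ($k=\pm1,\pm3$) are differentiable on $[0,T]$, all series over frequencies in the definitions of $\mathcal R^{(0)}$, $\mathcal N^{(J)}_R$, $\mathcal N^{(J)}_0$, $\mathcal N^{(J)}_1$, $\mathcal R^{(J)}$, $\mathcal N^{(J)}$ converge absolutely, these objects belong to the spaces below, and there is $C_0>0$, depending only on $s$ and (an upper bound of) $\|u\|_{C_TH^s}$, such that for all $M>1$ and all $J\ge1$ $$\begin{aligned} \|\mathcal R^{(0)}[u,\omega]\|_{C_T\ell^2_s}+\|\mathcal N^{(1)}[u,\omega]\|_{C_T\ell^2_{s-1}}&\le C_0, & \|\mathcal N^{(J)}_R[u,\omega]\|_{C_T\ell^2_s}&\le M(C_0M^{-1/2})^J,\\ \|\mathcal N^{(J)}_0[u,\omega]\|_{C_T\ell^2_s}&\le (C_0M^{-1/2})^J, & \|\mathcal N^{(J)}_1[u,\omega]\|_{C_T\ell^2_s}&\le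 C_0M^{1/2}(C_0M^{-1/2})^J,\\ \|\mathcal R^{(J)}[u,\omega]\|_{C_T\ell^2_s}&\le C_0(C_0M^{-1/2})^J, & \|\mathcal N^{(J+1)}[u,\omega]\|_{C_T\ell^2_{s-1}}&\le C_0(C_0M^{-\delta})^J.\end{aligned}$$ (ii) If $\tilde u\in C_TH^s$ is another real-valued distributional solution of (1) (same $\sigma$, $T$), with corresponding $\tilde\omega$, then there is $\tilde C_0>0$, depending only on $s$ and (upper bounds of) $\|u\|_{C_TH^s}$, $\|\tilde u\|_{C_TH^s}$, such that with $D=\|u-\tilde u\|_{C_TH^s}+\|\omega-\tilde\omega\|_{C_T\ell^2_s}$, for all $M>1$ and $J\ge1$, $$\begin{aligned} \|\mathcal R^{(0)}[u,\omega]-\mathcal R^{(0)}[\tilde u,\tilde\omega]\|_{C_T\ell^2_s}&\le\tilde C_0D,\\ \|\mathcal N^{(J)}_R[u,\omega]-\mathcal N^{(J)}_R[\tilde u,\tilde\omega]\|_{C_T\ell^2_s}&\le M(\tilde C_0M^{-1/2})^JD,\\ \|\mathcal N^{(J)}_0[u,\omega]-\mathcal N^{(J)}_0[\tilde u,\tilde\omega]\|_{C_T\ell^2_s}&\le(\tilde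 C_0M^{-1/2})^JD,\\ \|\mathcal N^{(J)}_1[u,\omega]-\mathcal N^{(J)}_1[\tilde u,\tilde\omega]\|_{C_T\ell^2_s}&\le\tilde C_0M^{1/2}(\tilde C_0M^{-1/2})^JD,\\ \|\mathcal R^{(J)}[u,\omega]-\mathcal R^{(J)}[\tilde u,\tilde\omega]\|_{C_T\ell^2_s}&\le\tilde C_0(\tilde C_0M^{-1/2})^JD.\end{aligned}$$ -/

import Mathlib

namespace MBO

noncomputable section

/-! ### Periodic functions, Fourier coefficients, weighted sequence spaces -/

/-- The torus `ℝ / 2πℤ`. -/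
abbrev Torus : Type := AddCircle (2 * Real.pi)

instance instFactTwoPiPos : Fact (0 < 2 * Real.pi) := ⟨Real.two_pi_pos⟩

/-- Fourier coefficients `(2π)⁻¹ ∫ f(x) e^{-inx} dx` of a real-valued function. -/
def coeff (f : Torus → ℝ) : ℤ → ℂ := fourierCoeff (fun x => (f x : ℂ))

/-- Fourier coefficients of `f²`. -/
def sqCoeff (f : Torus → ℝ) : ℤ → ℂ := fourierCoeff (fun x => (f x : ℂ) ^ 2)

/-- Inverse Fourier transform `∑ g(n) e^{inx}`. -/
def invFourier (g : ℤ → ℂ) (x : Torus) : ℂ := ∑' n : ℤ, g n * fourier n x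

/-- The bracket `⟨n⟩ = (1 + n²)^{1/2}`. -/
def bracket (n : ℤ) : ℝ := Real.sqrt (1 + (n : ℝ) ^ 2)

/-- Membership in the weighted space `ℓ²_s(ℤ)`. -/
def MemL2 (s : ℝ) (a : ℤ → ℂ) : Prop := Summable fun n : ℤ => (bracket n ^ s * ‖a n‖) ^ 2

/-- The norm of `ℓ²_s(ℤ)`. -/
def l2Norm (s : ℝ) (a : ℤ → ℂ) : ℝ := Real.sqrt (∑' n : ℤ, (bracket n ^ s * ‖a n‖) ^ 2)

/-- Membership in `C([0,T]; ℓ²_s)`. -/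
def InCT (s T : ℝ) (f : ℝ → ℤ → ℂ) : Prop :=
  (∀ t ∈ Set.Icc 0 T, MemL2 s (f t)) ∧
    ∀ t₀ ∈ Set.Icc 0 T,
      Filter.Tendsto (fun t => l2Norm s (f t - f t₀)) (nhdsWithin t₀ (Set.Icc 0 T)) (nhds 0)

/-- The norm of `C([0,T]; ℓ²_s)`. -/
def ctNorm (s T : ℝ) (f : ℝ → ℤ → ℂ) : ℝ := ⨆ t : Set.Icc (0 : ℝ) T, l2Norm s (f t)

/-- The norm `‖u‖_{C([0,T]; H^s)}`, where `‖f‖_{H^s} = ‖𝓕 f‖_{ℓ²_s}`. -/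
def ctHsNorm (s T : ℝ) (u : ℝ → Torus → ℝ) : ℝ := ctNorm s T fun t => coeff (u t)

/-! ### Operators on periodic distributions, written on Fourier coefficients -/

/-- Product of periodic distributions: convolution of the Fourier coefficients. -/
def conv (a b : ℤ → ℂ) (n : ℤ) : ℂ := ∑' k : ℤ, a (n - k) * b k

def projPos (a : ℤ → ℂ) (n : ℤ) : ℂ := if 0 < n then a n else 0

def projNeg (a : ℤ → ℂ) (n : ℤ) : ℂ := if n < 0 then a n else 0

/-- `P_c`, the projection onto constants. -/
def projConst (a : ℤ → ℂ) (n : ℤ) : ℂ := if n = 0 then a n else 0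

/-- `P_{≠c} = 1 - P_c`. -/
def projNonconst (a : ℤ → ℂ) (n : ℤ) : ℂ := if n = 0 then 0 else a n

def hilbert (a : ℤ → ℂ) (n : ℤ) : ℂ := -Complex.I * (n.sign : ℂ) * a n

def dx (a : ℤ → ℂ) (n : ℤ) : ℂ := Complex.I * (n : ℂ) * a n

/-- The periodic primitive `∂_x⁻¹` (of mean zero). -/
def dxInv (a : ℤ → ℂ) (n : ℤ) : ℂ := if n = 0 then 0 else a n / (Complex.I * (n : ℂ))

/-! ### Distributional solutions of `∂ₜu = -H∂ₓ²u + 2σ P_{≠c}(u²) ∂ₓu` -/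

/-- Fourier coefficients of `P_{≠c}(f²) ∂ₓf`. -/
def cubicCoeff (f : Torus → ℝ) : ℤ → ℂ := conv (projNonconst (sqCoeff f)) (dx (coeff f))

/-- Fourier coefficients of `-H∂ₓ²f + 2σ P_{≠c}(f²) ∂ₓf`. -/
def rhsCoeff (σ : ℤ) (f : Torus → ℝ) (n : ℤ) : ℂ :=
  -hilbert (dx (dx (coeff f))) n + 2 * (σ : ℂ) * cubicCoeff f n

/-- Duality pairing of the periodic distribution with Fourier coefficients `a` and a smooth
function `ψ`; it is `∫₀^{2π} f ψ dx` if `a` are the coefficients of a function `f`. -/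
def pairing (a : ℤ → ℂ) (ψ : Torus → ℂ) : ℂ :=
  2 * (Real.pi : ℂ) * ∑' n : ℤ, a n * fourierCoeff ψ (-n)

/-- Test functions: `C_c^∞((0,T) × 𝕋)`. -/
def IsTest (T : ℝ) (φ : ℝ → Torus → ℂ) : Prop :=
  ContDiff ℝ (⊤ : ℕ∞) (fun p : ℝ × ℝ => φ p.1 (p.2 : Torus)) ∧
    ∃ a b : ℝ, 0 < a ∧ b < T ∧ ∀ t, t ∉ Set.Icc a b → ∀ x, φ t x = 0

/-- `u ∈ C([0,T]; H^s)` is a real-valued solution in the sense of distributions on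
`(0,T) × 𝕋`. -/
structure IsSolution (σ : ℤ) (s T : ℝ) (u : ℝ → Torus → ℝ) : Prop where
  memLp : ∀ t ∈ Set.Icc 0 T, MeasureTheory.MemLp (u t) 2 AddCircle.haarAddCircle
  inCT : InCT s T fun t => coeff (u t)
  weak : ∀ φ : ℝ → Torus → ℂ, IsTest T φ →
    ∫ t in (0 : ℝ)..T,
      (pairing (coeff (u t)) (fun x => deriv (fun τ => φ τ x) t)
        + pairing (rhsCoeff σ (u t)) (φ t)) = 0

/-! ### Gauge transform -/

/-- `F[f] = ∂ₓ⁻¹ P_{≠c}(f²)`. -/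
def gaugePhase (f : Torus → ℝ) : Torus → ℂ := invFourier (dxInv (projNonconst (sqCoeff f)))

/-- Fourier coefficients of `e^{ikF[f]}`. -/
def gaugeCoeff (f : Torus → ℝ) (k : ℤ) : ℤ → ℂ :=
  fourierCoeff fun x => Complex.exp (Complex.I * (k : ℂ) * gaugePhase f x)

/-- The gauge transform `v = e^{-iσF[u]} (P₊u + ½ P_c u)`. -/
def gaugeTransform (σ : ℤ) (f : Torus → ℝ) (x : Torus) : ℂ :=
  Complex.exp (-Complex.I * (σ : ℂ) * gaugePhase f x)
    * (invFourier (projPos (coeff f)) x + 1 / 2 * coeff f 0)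

/-- `ω(t,n) = e^{itn|n|} 𝓕[v(t)](n)`. -/
def omega (σ : ℤ) (u : ℝ → Torus → ℝ) (t : ℝ) (n : ℤ) : ℂ :=
  Complex.exp (Complex.I * (t : ℂ) * ((n * |n| : ℤ) : ℂ))
    * fourierCoeff (gaugeTransform σ (u t)) n

/-- `ω*(t,n) = conj ω(t,-n)`. -/
def starSeq (ω : ℝ → ℤ → ℂ) (t : ℝ) (n : ℤ) : ℂ := starRingEnd ℂ (ω t (-n))

/-- Fourier coefficients of the remainder `R[f]` in the equation
`(∂ₜ + H∂ₓ²) v = (cubic terms) + R[u]` for the gauge transform. Here `w`, `a`, `g`, `q` are the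
coefficients of `e^{-iσF[f]}`, `f`, `P₊f + ½ P_c f`, `P_{≠c}(f²)`. -/
def remainder (σ : ℤ) (f : Torus → ℝ) (n : ℤ) : ℂ :=
  let w := gaugeCoeff f (-σ)
  let a := coeff f
  let g := projPos a + (1 / 2 : ℂ) • projConst a
  let q := projNonconst (sqCoeff f)
  let ihdx := Complex.I • hilbert (dx a)
  (-Complex.I) * conv (conv w (projNonconst (conv q q))) g n
    - hilbert (conv (conv w (conv q q)) g) n
    - 2 * (σ : ℂ) * conv a ihdx 0 * conv w g n
    + 2 * (σ : ℂ) * projConst (conv (conv (conv w a) g) ihdx) n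
    + 2 * (σ : ℂ) * (projConst (conv w (projPos (cubicCoeff f))) n
        + projNeg (conv w (projPos (cubicCoeff f))) n)
    - 2 * (σ : ℂ) * projPos (conv w (projConst (cubicCoeff f) + projNeg (cubicCoeff f))) n
    - 2 * (σ : ℂ) * sqCoeff f 0
        * (projPos (conv w (dx (projNeg a))) n + projNeg (conv w (dx (projPos a))) n)
    + Complex.I * projConst (conv w (projPos (dx (dx a)))) n
    - 2 * (σ : ℂ) * sqCoeff f 0
        * projNeg (conv (dxInv (projNeg w)) (dx (dx (projPos a)))) n

/-! ### Quintilinear multipliers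

The frequencies `(n₁,…,n₅)` are `q 0, …, q 4`, and always `n = n₁ + ⋯ + n₅`. The seven types
`i = 1,…,7` are indexed by `Fin 7`, the five slots `1,…,5` by `Fin 5`. -/

/-- `Φ = n|n| - n₁|n₁| - n₃|n₃| - n₅|n₅|`. -/
def phase (q : Fin 5 → ℤ) : ℤ :=
  (∑ l, q l) * |∑ l, q l| - q 0 * |q 0| - q 2 * |q 2| - q 4 * |q 4|

/-- The constants `c₁,…,c₇` of the multipliers. -/
def multConst (σ : ℤ) (i : Fin 7) : ℂ :=
  Complex.I * (σ : ℂ) * (![-2, 2, 2, 4, 2, -2, 2] : Fin 7 → ℂ) i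

/-- The multipliers `m₁,…,m₇` without their constants. -/
def multCore (i : Fin 7) (q : Fin 5 → ℤ) : ℝ :=
  let n : ℤ := ∑ l, q l
  let n₁₂₃ : ℤ := q 0 + q 1 + q 2
  let n₂₃ : ℤ := q 1 + q 2
  let n₄₅ : ℤ := q 3 + q 4
  let n₂₃₄₅ : ℤ := q 1 + q 2 + q 3 + q 4
  (![if 0 < n ∧ n₄₅ < 0 then (n₄₅ : ℝ) else 0,
     if 0 < n ∧ n₄₅ < 0 then (n₄₅ : ℝ) else 0,
     if n < 0 ∧ 0 < n₄₅ then (n₄₅ : ℝ) * (2 + (n : ℝ) / (n₁₂₃ : ℝ)) else 0,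
     if n < 0 ∧ 0 < n₄₅ then (n₄₅ : ℝ) * (1 + (n : ℝ) / (n₁₂₃ : ℝ)) else 0,
     if n < 0 ∧ 0 < n₄₅ then (n₄₅ : ℝ) * (n : ℝ) / (n₁₂₃ : ℝ) else 0,
     if 0 < n₂₃ ∧ 0 < n₄₅ then (n₂₃ : ℝ) * (n₄₅ : ℝ) / (n₂₃₄₅ : ℝ) else 0,
     if n₂₃ < 0 ∧ n₄₅ < 0 then (n₂₃ : ℝ) * (n₄₅ : ℝ) / (n₂₃₄₅ : ℝ) else 0] : Fin 7 → ℝ) i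

/-- The multipliers `m_i`. -/
def mult (σ : ℤ) (i : Fin 7) (q : Fin 5 → ℤ) : ℂ := multConst σ i * (multCore i q : ℂ)

/-- The small parameter `η`. -/
def eta : ℝ := 2⁻¹ ^ 10

/-- `|n₂| ∨ |n₄|`. -/
def gaugeMax (q : Fin 5 → ℤ) : ℝ := max |(q 1 : ℝ)| |(q 3 : ℝ)|

/-- The set `𝒜₁`. -/
def exclA (q : Fin 5 → ℤ) : Prop :=
  (q 0 + q 4) * (q 2 + q 4) = 0
    ∨ eta ^ 2 * min |(q 4 : ℝ)| |((∑ l, q l : ℤ) : ℝ)| ≤ gaugeMax q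
    ∨ (gaugeMax q < eta ^ 2 * |(q 4 : ℝ)| ∧ |(q 4 : ℝ)| < eta * min |(q 0 : ℝ)| |(q 2 : ℝ)|
        ∧ eta * |(q 0 : ℝ) + q 2| ≤ |(q 1 : ℝ) + q 3|)
    ∨ (gaugeMax q < eta ^ 2 * |(q 4 : ℝ)| ∧ |(q 2 : ℝ)| < eta * min |(q 0 : ℝ)| |(q 4 : ℝ)|
        ∧ eta * |(q 0 : ℝ) + q 4| ≤ |(q 1 : ℝ) + q 3| ∧ |(q 4 : ℝ)| ≤ 2 * |(q 0 : ℝ)|)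

/-- The set `𝒜₂`. -/
def exclB (q : Fin 5 → ℤ) : Prop :=
  (q 0 + q 2) * (q 0 + q 4) = 0 ∨ eta * min |(q 2 : ℝ)| |(q 4 : ℝ)| ≤ gaugeMax q

/-- The frequencies kept in the main part of the `i`-th multiplier. -/
def IsMain (i : Fin 7) (q : Fin 5 → ℤ) : Prop :=
  (if (i : ℕ) < 5 then ¬ exclA q else ¬ exclB q) ∧ gaugeMax q ^ 2 < |(phase q : ℝ)|

open Classical in
/-- The main part (single hat) of `m_i`. -/
def multHat (σ : ℤ) (i : Fin 7) (q : Fin 5 → ℤ) : ℂ := if IsMain i q then mult σ i q else 0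

open Classical in
/-- The harmless part (double hat) of `m_i`. -/
def multHatHat (σ : ℤ) (i : Fin 7) (q : Fin 5 → ℤ) : ℂ := if IsMain i q then 0 else mult σ i q

/-- The main part of `m_i^*`, that is `conj m_i(-n,-n₁,…,-n₅)`. -/
def multHatStar (σ : ℤ) (i : Fin 7) (q : Fin 5 → ℤ) : ℂ := starRingEnd ℂ (multHat σ i (-q))

/-- Whether slot `l` of the form `𝒬_i` carries `ω*` (`true`) or `ω` (`false`); only the slots
`1, 3, 5` (here `0, 2, 4`) matter. -/
def slotStar : Fin 7 → Fin 5 → Bool :=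
  ![![false, false, false, false, true],
    ![true, false, true, false, true],
    ![false, false, false, false, false],
    ![false, false, true, false, false],
    ![true, false, true, false, false],
    ![false, false, false, false, false],
    ![false, false, true, false, true]]

/-- The number `k` such that slot `l` of `𝒬_i` carries `𝓕(e^{ikσF[u]})`; only the slots `2, 4`
(here `1, 3`) matter. -/
def slotGauge : Fin 7 → Fin 5 → ℤ :=
  ![![0, 1, 0, -1, 0],
    ![0, -3, 0, -1, 0],
    ![0, 1, 0, 1, 0],
    ![0, -1, 0, 1, 0],
    ![0, -3, 0, 1, 0],
    ![0, 1, 0, 1, 0],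
    ![0, -1, 0, -1, 0]]

/-- The slots that carry a gauge factor (the second and the fourth). -/
def IsGaugeSlot (l : Fin 5) : Prop := l = 1 ∨ l = 3

instance (l : Fin 5) : Decidable (IsGaugeSlot l) := by unfold IsGaugeSlot; infer_instance

/-- The function in slot `l` of `𝒬_i(· ; u, ω)` at time `t`. -/
def slotFun (σ : ℤ) (u : ℝ → Torus → ℝ) (ω : ℝ → ℤ → ℂ) (i : Fin 7) (l : Fin 5) (t : ℝ) : ℤ → ℂ :=
  if IsGaugeSlot l then gaugeCoeff (u t) (σ * slotGauge i l)
  else if slotStar i l then starSeq ω t else ω t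

/-- The summand of `𝒬_i(e^{itΦ} m ; u(t), ω(t))` for the harmless part `m` of `m_i`. -/
def harmlessTerm (σ : ℤ) (u : ℝ → Torus → ℝ) (ω : ℝ → ℤ → ℂ) (t : ℝ) (i : Fin 7)
    (q : Fin 5 → ℤ) : ℂ :=
  Complex.exp (Complex.I * (t : ℂ) * (phase q : ℂ)) * multHatHat σ i q
    * ∏ l, slotFun σ u ω i l t (q l)

/-- `ℛ^{(0)}[u,ω](t,n)`. -/
def R0 (σ : ℤ) (u : ℝ → Torus → ℝ) (ω : ℝ → ℤ → ℂ) (t : ℝ) (n : ℤ) : ℂ :=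
  (∑ i : Fin 7, ∑' q : {q : Fin 5 → ℤ // ∑ l, q l = n}, harmlessTerm σ u ω t i q.1)
    + Complex.exp (Complex.I * (t : ℂ) * ((n * |n| : ℤ) : ℂ)) * remainder σ (u t) n

/-! ### Trees -/

/-- The `5J + 1` elements of a tree of the `J`-th generation: `none` is the root and
`some (j, l)` is the child in slot `l` of the `j`-th parent. -/
abbrev Node (J : ℕ) : Type := Option (Fin J × Fin 5)

/-- A tree of the `J`-th generation is given by its numbered parents, `p j` being the `j`-th one:
the first parent is the root, and every later parent is a child, in the first, third or fifth
slot, of a parent with a smaller number. The order is generated by the parent-child relation. -/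
def IsTree {J : ℕ} (p : Fin J → Node J) : Prop :=
  Function.Injective p ∧ (∀ j, p j = none ↔ (j : ℕ) = 0) ∧
    ∀ j k l, p j = some (k, l) → k < j ∧ ¬ IsGaugeSlot l

instance {J : ℕ} (p : Fin J → Node J) : Decidable (IsTree p) := by
  unfold IsTree Function.Injective; infer_instance

/-- `𝔗(J)`. -/
abbrev Tree (J : ℕ) : Type := {p : Fin J → Node J // IsTree p}

/-- `ℑ(J) = {1,…,7}^J`. -/
abbrev Types (J : ℕ) : Type := Fin J → Fin 7

/-- `𝒯^∞_1`: all children in the second and fourth slots. -/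
def gaugeLeaves (J : ℕ) : Finset (Node J) :=
  Finset.univ.filter fun a => ∃ j l, a = some (j, l) ∧ IsGaugeSlot l

/-- `𝒯^∞_2`: all other elements without children. -/
def solLeaves {J : ℕ} (p : Tree J) : Finset (Node J) :=
  Finset.univ.filter fun a => (∀ j, p.1 j ≠ a) ∧ a ∉ gaugeLeaves J

/-- Whether an element stands for `ω*` (`true`) or `ω` (`false`): the root stands for `ω`, and
replacing a factor by its equation replaces `ω*` by the conjugated (starred) form. -/
def starred {J : ℕ} (i : Types J) (p : Tree J) : Node J → Bool
  | none => false
  | some (j, l) => xor (slotStar (i j) l) (starred i p (p.1 j))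
termination_by a => a.elim 0 fun b => (b.1 : ℕ) + 1
decreasing_by
  cases h : p.1 j with
  | none => simp
  | some b =>
    have := (p.2.2.2 j b.1 b.2 h).1
    simpa using this

/-- The frequencies at the children of the `j`-th parent. -/
def childFreq {J : ℕ} (ν : Node J → ℤ) (j : Fin J) : Fin 5 → ℤ := fun l => ν (some (j, l))

/-- Index functions `𝐧 ∈ 𝔑(𝒯)` with `n_root = n`. -/
def indexSet {J : ℕ} (p : Tree J) (n : ℤ) : Set (Node J → ℤ) :=
  {ν | (∀ j, ν (p.1 j) = ∑ l, ν (some (j, l))) ∧ ν none = n}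

/-- `Φ̃_k = Φ₁ + ⋯ + Φ_k`. -/
def phaseSum {J : ℕ} (ν : Node J → ℤ) (k : ℕ) : ℤ :=
  ∑ j ∈ Finset.univ.filter (fun j : Fin J => (j : ℕ) < k), phase (childFreq ν j)

/-- `(Φ_j)_{j=1}^k ∈ ℳ_{NR}^{(k)}` (no condition if `k = 0`). -/
def NonRes {J : ℕ} (M : ℝ) (ν : Node J → ℤ) (k : ℕ) : Prop :=
  (1 ≤ k → M < |(phaseSum ν 1 : ℝ)|) ∧
    ∀ j, 2 ≤ j → j ≤ k → 2 * |(phaseSum ν (j - 1) : ℝ)| < |(phaseSum ν j : ℝ)|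

/-- `(Φ_j)_{j=1}^k ∈ ℳ_R^{(k)}`, for `k ≥ 1`. -/
def Res {J : ℕ} (M : ℝ) (ν : Node J → ℤ) (k : ℕ) : Prop :=
  NonRes M ν (k - 1) ∧
    if k = 1 then |(phaseSum ν 1 : ℝ)| ≤ M
    else |(phaseSum ν k : ℝ)| ≤ 2 * |(phaseSum ν (k - 1) : ℝ)|

/-- The multiplier at the `j`-th parent. -/
def parentMult {J : ℕ} (σ : ℤ) (i : Types J) (p : Tree J) (ν : Node J → ℤ) (j : Fin J) : ℂ :=
  if starred i p (p.1 j) then multHatStar σ (i j) (childFreq ν j)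
  else multHat σ (i j) (childFreq ν j)

/-- `e^{itΦ̃_J} ∏_{j ≤ J} m_{i_j} / ∏_{j ≤ k} Φ̃_j`. -/
def amplitude {J : ℕ} (σ : ℤ) (k : ℕ) (t : ℝ) (i : Types J) (p : Tree J) (ν : Node J → ℤ) : ℂ :=
  Complex.exp (Complex.I * (t : ℂ) * (phaseSum ν J : ℂ)) * (∏ j, parentMult σ i p ν j)
    / ∏ j ∈ Finset.Icc 1 k, (phaseSum ν j : ℂ)

/-- `W_a(t,·)` for `a ∈ 𝒯^∞_1` (the value at the root is immaterial). -/
def leafGauge {J : ℕ} (σ : ℤ) (u : ℝ → Torus → ℝ) (i : Types J) (p : Tree J) (t : ℝ) :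
    Node J → ℤ → ℂ
  | none => 0
  | some (j, l) =>
    gaugeCoeff (u t) ((if starred i p (p.1 j) then -1 else 1) * (σ * slotGauge (i j) l))

/-- `ω_b`, or any other sequence with the star convention, for `b ∈ 𝒯^∞_2`. -/
def leafSol {J : ℕ} (ω : ℝ → ℤ → ℂ) (i : Types J) (p : Tree J) (t : ℝ) (b : Node J) : ℤ → ℂ :=
  if starred i p b then starSeq ω t else ω t

/-- `∏_{a ∈ 𝒯^∞_1} W_a(t,n_a)`. -/
def gaugeProd {J : ℕ} (σ : ℤ) (u : ℝ → Torus → ℝ) (i : Types J) (p : Tree J) (ν : Node J → ℤ)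
    (t : ℝ) : ℂ := ∏ a ∈ gaugeLeaves J, leafGauge σ u i p t a (ν a)

/-- `∏_{b ∈ 𝒯^∞_2} ω_b(t,n_b)`. -/
def solProd {J : ℕ} (ω : ℝ → ℤ → ℂ) (i : Types J) (p : Tree J) (ν : Node J → ℤ) (t : ℝ) : ℂ :=
  ∏ b ∈ solLeaves p, leafSol ω i p t b (ν b)

/-! ### The terms of the normal form reduction -/

/-- A summand depending on `(𝐢, 𝒯) ∈ 𝔘(J)` and on an index function. -/
abbrev Summand (J : ℕ) : Type := Types J → Tree J → (Node J → ℤ) → ℂ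

/-- `∑_{(𝐢,𝒯)} ∑_{𝐧 ∈ 𝔑(𝒯), n_root = n}`. -/
def treeSum {J : ℕ} (f : Summand J) (n : ℤ) : ℂ :=
  ∑ i : Types J, ∑ p : Tree J, ∑' ν : indexSet p n, f i p ν.1

/-- Absolute convergence of all the series in `treeSum f n`, at every time in `[0,T]` and for
every `n`. -/
def TreeConverges {J : ℕ} (T : ℝ) (f : ℝ → Summand J) : Prop :=
  ∀ t ∈ Set.Icc 0 T, ∀ (n : ℤ) (i : Types J) (p : Tree J),
    Summable fun ν : indexSet p n => f t i p ν.1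

open Classical in
/-- Summand of `𝒩_R^{(J)}`. -/
def summandR (σ : ℤ) (M : ℝ) (u : ℝ → Torus → ℝ) (ω : ℝ → ℤ → ℂ) (J : ℕ) (t : ℝ) : Summand J :=
  fun i p ν => if Res M ν J then
    Complex.I ^ (J - 1) * (amplitude σ (J - 1) t i p ν * gaugeProd σ u i p ν t * solProd ω i p ν t)
  else 0

open Classical in
/-- Summand of `𝒩_0^{(J)}`. -/
def summand0 (σ : ℤ) (M : ℝ) (u : ℝ → Torus → ℝ) (ω : ℝ → ℤ → ℂ) (J : ℕ) (t : ℝ) : Summand J :=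
  fun i p ν => if NonRes M ν J then
    -Complex.I ^ J * (amplitude σ J t i p ν * gaugeProd σ u i p ν t * solProd ω i p ν t)
  else 0

open Classical in
/-- Summand of `𝒩_1^{(J)}`; the time derivative on `[0,T]` is one-sided at the end points. -/
def summand1 (σ : ℤ) (T M : ℝ) (u : ℝ → Torus → ℝ) (ω : ℝ → ℤ → ℂ) (J : ℕ) (t : ℝ) : Summand J :=
  fun i p ν => if NonRes M ν J then
    Complex.I ^ J * (amplitude σ J t i p ν
      * derivWithin (gaugeProd σ u i p ν) (Set.Icc 0 T) t * solProd ω i p ν t)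
  else 0

open Classical in
/-- Summand of `ℛ^{(J)}`. -/
def summandRem (σ : ℤ) (M : ℝ) (u : ℝ → Torus → ℝ) (ω : ℝ → ℤ → ℂ) (J : ℕ) (t : ℝ) : Summand J :=
  fun i p ν => if NonRes M ν J then
    Complex.I ^ J * (amplitude σ J t i p ν * gaugeProd σ u i p ν t
      * ∑ b ∈ solLeaves p, leafSol (R0 σ u ω) i p t b (ν b)
          * ∏ b' ∈ (solLeaves p).erase b, leafSol ω i p t b' (ν b'))
  else 0

open Classical in
/-- Summand of `𝒩^{(J+1)}`, for `J ≥ 0`. -/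
def summandNext (σ : ℤ) (M : ℝ) (u : ℝ → Torus → ℝ) (ω : ℝ → ℤ → ℂ) (J : ℕ) (t : ℝ) :
    Summand (J + 1) :=
  fun i p ν => if NonRes M ν J then
    Complex.I ^ J * (amplitude σ J t i p ν * gaugeProd σ u i p ν t * solProd ω i p ν t)
  else 0

/-- Resonant part `𝒩_R^{(J)}[u,ω](t,n)`. -/
def NR (σ : ℤ) (M : ℝ) (u : ℝ → Torus → ℝ) (ω : ℝ → ℤ → ℂ) (J : ℕ) (t : ℝ) : ℤ → ℂ :=
  treeSum (summandR σ M u ω J t)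

/-- Boundary term `𝒩_0^{(J)}[u,ω](t,n)`. -/
def N0 (σ : ℤ) (M : ℝ) (u : ℝ → Torus → ℝ) (ω : ℝ → ℤ → ℂ) (J : ℕ) (t : ℝ) : ℤ → ℂ :=
  treeSum (summand0 σ M u ω J t)

/-- `𝒩_1^{(J)}[u,ω](t,n)`. -/
def N1 (σ : ℤ) (T M : ℝ) (u : ℝ → Torus → ℝ) (ω : ℝ → ℤ → ℂ) (J : ℕ) (t : ℝ) : ℤ → ℂ :=
  treeSum (summand1 σ T M u ω J t)

/-- `ℛ^{(J)}[u,ω](t,n)` for `J ≥ 1`. -/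
def Rem (σ : ℤ) (M : ℝ) (u : ℝ → Torus → ℝ) (ω : ℝ → ℤ → ℂ) (J : ℕ) (t : ℝ) : ℤ → ℂ :=
  treeSum (summandRem σ M u ω J t)

/-- `𝒩^{(J+1)}[u,ω](t,n)` for `J ≥ 0`; for `J = 0` it does not depend on `M`. -/
def Next (σ : ℤ) (M : ℝ) (u : ℝ → Torus → ℝ) (ω : ℝ → ℤ → ℂ) (J : ℕ) (t : ℝ) : ℤ → ℂ :=
  treeSum (summandNext σ M u ω J t)

/-- All objects in the estimates are well defined: `ω ∈ C([0,T]; ℓ²_s)`, the Fourier coefficients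
of the gauge factors are differentiable in time on `[0,T]`, and all series converge absolutely. -/
def WellDefined (σ : ℤ) (s T M : ℝ) (u : ℝ → Torus → ℝ) (ω : ℝ → ℤ → ℂ) : Prop :=
  InCT s T ω
    ∧ (∀ k ∈ ({1, -1, 3, -3} : Set ℤ), ∀ n : ℤ,
        DifferentiableOn ℝ (fun t => gaugeCoeff (u t) k n) (Set.Icc 0 T))
    ∧ (∀ t ∈ Set.Icc 0 T, ∀ (n : ℤ) (i : Fin 7),
        Summable fun q : {q : Fin 5 → ℤ // ∑ l, q l = n} => harmlessTerm σ u ω t i q.1)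
    ∧ TreeConverges T (summandNext σ M u ω 0)
    ∧ ∀ J : ℕ, 1 ≤ J →
        TreeConverges T (summandR σ M u ω J) ∧ TreeConverges T (summand0 σ M u ω J)
        ∧ TreeConverges T (summand1 σ T M u ω J) ∧ TreeConverges T (summandRem σ M u ω J)
        ∧ TreeConverges T (summandNext σ M u ω J)

/-- `f ∈ C([0,T]; ℓ²_r)` with norm at most `B`. -/
def CTBound (r T : ℝ) (f : ℝ → ℤ → ℂ) (B : ℝ) : Prop := InCT r T f ∧ ctNorm r T f ≤ B

end

end MBO

open scoped ENNReal NNReal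

namespace MBO

noncomputable section

/-! ### Square-summable sequences with values in `[0,∞]` -/

/-- The `ℓ²` norm of a family with values in `[0,∞]`. -/
def n2 {ι : Type*} (f : ι → ℝ≥0∞) : ℝ≥0∞ := (∑' i, f i ^ 2) ^ (1 / 2 : ℝ)

theorem n2_sq {ι : Type*} (f : ι → ℝ≥0∞) : n2 f ^ 2 = ∑' i, f i ^ 2 := by
  unfold n2
  rw [← ENNReal.rpow_two, ← ENNReal.rpow_mul]
  norm_num

theorem n2_mono {ι : Type*} {f g : ι → ℝ≥0∞} (h : ∀ i, f i ≤ g i) : n2 f ≤ n2 g := by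
  unfold n2
  gcongr
  exact h _

theorem n2_le_of_sq_le {ι : Type*} {f : ι → ℝ≥0∞} {C : ℝ≥0∞} (h : ∑' i, f i ^ 2 ≤ C ^ 2) :
    n2 f ≤ C := by
  rw [← n2_sq] at h
  exact (ENNReal.pow_right_strictMono two_ne_zero).le_iff_le.1 h

theorem tsum_mul_le_n2 {ι : Type*} (f g : ι → ℝ≥0∞) : ∑' i, f i * g i ≤ n2 f * n2 g := by
  let _ : MeasurableSpace ι := ⊤
  have h := ENNReal.lintegral_mul_le_Lp_mul_Lq (MeasureTheory.Measure.count : MeasureTheory.Measure ι)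
    Real.HolderConjugate.two_two (f := f) (g := g) (measurable_from_top).aemeasurable
    (measurable_from_top).aemeasurable
  simpa [MeasureTheory.lintegral_count, n2] using h

theorem n2_add_le {ι : Type*} (f g : ι → ℝ≥0∞) : n2 (fun i => f i + g i) ≤ n2 f + n2 g := by
  let _ : MeasurableSpace ι := ⊤
  have h := ENNReal.lintegral_Lp_add_le (μ := (MeasureTheory.Measure.count : MeasureTheory.Measure ι))
    (f := f) (g := g) (measurable_from_top).aemeasurable
    (measurable_from_top).aemeasurable (p := 2) (by norm_num)
  simpa [MeasureTheory.lintegral_count, n2] using h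

theorem n2_const_mul {ι : Type*} (c : ℝ≥0∞) (f : ι → ℝ≥0∞) : n2 (fun i => c * f i) = c * n2 f := by
  unfold n2
  simp_rw [mul_pow]
  rw [ENNReal.tsum_mul_left, ENNReal.mul_rpow_of_nonneg _ _ (by norm_num), ← ENNReal.rpow_two,
    ← ENNReal.rpow_mul]
  norm_num

theorem n2_equiv {ι κ : Type*} (e : ι ≃ κ) (f : κ → ℝ≥0∞) : n2 (fun i => f (e i)) = n2 f := by
  unfold n2
  rw [e.tsum_eq fun i => f i ^ 2]

theorem le_n2 {ι : Type*} (f : ι → ℝ≥0∞) (i : ι) : f i ≤ n2 f := by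
  refine (ENNReal.pow_right_strictMono two_ne_zero).le_iff_le.1 ?_
  rw [n2_sq]
  exact ENNReal.le_tsum (f := fun i => f i ^ 2) i

theorem n2_le_of_dual {ι : Type*} {h : ι → ℝ≥0∞} {C : ℝ≥0∞}
    (H : ∀ g : ι → ℝ≥0∞, ∑' i, h i * g i ≤ C * n2 g) : n2 h ≤ C := by
  classical
  apply n2_le_of_sq_le
  have key : ∀ (S : Finset ι) (k : ℕ), ∑ i ∈ S, (min (h i) k) ^ 2 ≤ C ^ 2 := by
    intro S k
    set g : ι → ℝ≥0∞ := fun i => if i ∈ S then min (h i) k else 0 with hg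
    have e1 : ∑' i, g i ^ 2 = ∑ i ∈ S, (min (h i) k) ^ 2 := by
      rw [tsum_eq_sum (s := S)]
      · exact Finset.sum_congr rfl fun i hi => by simp [hg, hi]
      · intro i hi; simp [hg, hi]
    have e2 : ∑' i, g i ^ 2 ≤ ∑' i, h i * g i := by
      apply ENNReal.tsum_le_tsum
      intro i
      by_cases hi : i ∈ S
      · simp only [hg, hi, if_true, sq]
        gcongr
        exact min_le_left _ _
      · simp [hg, hi]
    have fin : n2 g ≠ ⊤ := by
      intro ht
      have : n2 g ^ 2 = ⊤ := by rw [ht]; rfl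
      rw [n2_sq, e1] at this
      refine absurd this (ENNReal.sum_lt_top.2 fun i _ => ?_).ne
      exact ENNReal.pow_lt_top ((min_le_right _ _).trans_lt (ENNReal.natCast_lt_top k))
    rw [← e1, ← n2_sq]
    have h3 : n2 g * n2 g ≤ C * n2 g := by
      rw [← sq, n2_sq]; exact e2.trans (H g)
    rcases eq_or_ne (n2 g) 0 with h0 | h0
    · simp [h0]
    · have := (ENNReal.mul_le_mul_iff_left h0 fin).1 h3
      gcongr
  rw [ENNReal.tsum_eq_iSup_sum]
  refine iSup_le fun S => ?_
  have lim : Filter.Tendsto (fun k : ℕ => ∑ i ∈ S, (min (h i) k) ^ 2) Filter.atTop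
      (nhds (∑ i ∈ S, h i ^ 2)) := by
    refine tendsto_finsetSum _ fun i _ => ?_
    have : Filter.Tendsto (fun k : ℕ => min (h i) (k : ℝ≥0∞)) Filter.atTop (nhds (min (h i) ⊤)) :=
      tendsto_const_nhds.min ENNReal.tendsto_nat_nhds_top
    rw [min_top_right] at this
    exact ENNReal.Tendsto.pow this
  exact le_of_tendsto' lim fun k => key S k

/-! ### Brackets -/

theorem one_le_bracket (n : ℤ) : 1 ≤ bracket n := by
  unfold bracket
  rw [Real.one_le_sqrt]
  nlinarith [sq_nonneg (n : ℝ)]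

theorem bracket_pos (n : ℤ) : 0 < bracket n := lt_of_lt_of_le one_pos (one_le_bracket n)

theorem abs_le_bracket (n : ℤ) : |(n : ℝ)| ≤ bracket n := by
  unfold bracket
  apply Real.abs_le_sqrt
  linarith

theorem bracket_le (n : ℤ) : bracket n ≤ 1 + |(n : ℝ)| := by
  unfold bracket
  rw [Real.sqrt_le_left (by positivity)]
  nlinarith [sq_abs (n : ℝ), abs_nonneg (n : ℝ)]

theorem bracket_neg (n : ℤ) : bracket (-n) = bracket n := by simp [bracket]

theorem bracket_sq (n : ℤ) : bracket n ^ 2 = 1 + (n : ℝ) ^ 2 := by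
  unfold bracket; rw [Real.sq_sqrt]; positivity

theorem bracket_mono {m n : ℤ} (h : |m| ≤ |n|) : bracket m ≤ bracket n := by
  unfold bracket
  apply Real.sqrt_le_sqrt
  have : (m : ℝ) ^ 2 ≤ (n : ℝ) ^ 2 := by
    rw [sq_le_sq]; exact_mod_cast h
  linarith

theorem bracket_add_le (m n : ℤ) : bracket (m + n) ≤ bracket m + bracket n := by
  unfold bracket
  rw [Real.sqrt_le_left (by positivity)]
  have h1 := Real.sq_sqrt (show (0 : ℝ) ≤ 1 + (m : ℝ) ^ 2 by positivity)
  have h2 := Real.sq_sqrt (show (0 : ℝ) ≤ 1 + (n : ℝ) ^ 2 by positivity)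
  have h3 := abs_le_bracket m
  have h4 := abs_le_bracket n
  unfold bracket at h3 h4
  have h5 : (m : ℝ) * n ≤ √(1 + (m : ℝ) ^ 2) * √(1 + (n : ℝ) ^ 2) := by
    calc (m : ℝ) * n ≤ |(m : ℝ) * n| := le_abs_self _
      _ = |(m : ℝ)| * |(n : ℝ)| := abs_mul _ _
      _ ≤ _ := by gcongr
  push_cast
  nlinarith

theorem bracket_zero : bracket 0 = 1 := by simp [bracket]

theorem bracket_rpow_pos (n : ℤ) (r : ℝ) : 0 < bracket n ^ r := Real.rpow_pos_of_pos (bracket_pos n) r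

/-- The weight `⟨n⟩^r` in `[0,∞]`. -/
def wt (r : ℝ) (n : ℤ) : ℝ≥0∞ := ENNReal.ofReal (bracket n ^ r)

theorem wt_ne_zero (r : ℝ) (n : ℤ) : wt r n ≠ 0 := by
  simpa [wt] using bracket_rpow_pos n r

theorem wt_mul_wt (r r' : ℝ) (n : ℤ) : wt r n * wt r' n = wt (r + r') n := by
  unfold wt
  rw [← ENNReal.ofReal_mul (bracket_rpow_pos n r).le, Real.rpow_add (bracket_pos n)]

theorem wt_zero (n : ℤ) : wt 0 n = 1 := by simp [wt]

theorem wt_mono {r r' : ℝ} (h : r ≤ r') (n : ℤ) : wt r n ≤ wt r' n := by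
  unfold wt
  exact ENNReal.ofReal_le_ofReal (Real.rpow_le_rpow_of_exponent_le (one_le_bracket n) h)

theorem summable_bracket_rpow {r : ℝ} (hr : 1 < r) : Summable fun n : ℤ => bracket n ^ (-r) := by
  have h0 : Summable fun n : ℤ => |(n : ℝ)| ^ (-r) := Real.summable_abs_int_rpow hr
  have h1 := h0.add (summable_of_hasFiniteSupport (f := fun n : ℤ => if n = 0 then (1 : ℝ) else 0)
    ((Set.finite_singleton (0 : ℤ)).subset (by intro n; simp)))
  refine Summable.of_nonneg_of_le (fun n => (bracket_rpow_pos n _).le) (fun n => ?_) h1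
  by_cases hn : n = 0
  · subst hn
    simp [bracket_zero]
    positivity
  · simp only [hn, if_false, add_zero]
    exact Real.rpow_le_rpow_of_nonpos (by positivity) (abs_le_bracket n) (by linarith)

theorem tsum_wt_ne_top {r : ℝ} (hr : 1 < r) : ∑' n, wt (-r) n ≠ ⊤ := by
  unfold wt
  rw [← ENNReal.ofReal_tsum_of_nonneg (fun n => (bracket_rpow_pos n _).le) (summable_bracket_rpow hr)]
  exact ENNReal.ofReal_ne_top

theorem n2_wt_ne_top {r : ℝ} (hr : 1 / 2 < r) : n2 (wt (-r)) ≠ ⊤ := by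
  unfold n2
  apply ENNReal.rpow_ne_top_of_nonneg (by norm_num)
  simp_rw [sq, wt_mul_wt]
  have := tsum_wt_ne_top (r := 2 * r) (by linarith)
  convert this using 4
  ring

/-! ### Weighted norms -/

/-- The norm of `ℓ²_r` for sequences with values in `[0,∞]`. -/
def lN (r : ℝ) (f : ℤ → ℝ≥0∞) : ℝ≥0∞ := n2 fun n => wt r n * f n

theorem lN_mono {r : ℝ} {f g : ℤ → ℝ≥0∞} (h : ∀ n, f n ≤ g n) : lN r f ≤ lN r g :=
  n2_mono fun n => by gcongr; exact h n

theorem lN_mono_exponent {r r' : ℝ} (h : r ≤ r') (f : ℤ → ℝ≥0∞) : lN r f ≤ lN r' f :=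
  n2_mono fun n => by gcongr; exact wt_mono h n

theorem lN_add_le (r : ℝ) (f g : ℤ → ℝ≥0∞) : lN r (fun n => f n + g n) ≤ lN r f + lN r g := by
  unfold lN
  simp_rw [mul_add]
  exact n2_add_le _ _

theorem lN_const_mul (r : ℝ) (c : ℝ≥0∞) (f : ℤ → ℝ≥0∞) : lN r (fun n => c * f n) = c * lN r f := by
  unfold lN
  rw [← n2_const_mul]
  congr 1; ext n; ring

theorem lN_zero (r : ℝ) : lN r (fun _ => 0) = 0 := by simp [lN, n2]

theorem lN_sum_le {ι : Type*} (r : ℝ) (S : Finset ι) (f : ι → ℤ → ℝ≥0∞) :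
    lN r (fun n => ∑ i ∈ S, f i n) ≤ ∑ i ∈ S, lN r (f i) := by
  classical
  induction S using Finset.induction_on with
  | empty => simp [lN_zero]
  | insert a S ha ih =>
    simp only [Finset.sum_insert ha]
    exact (lN_add_le r _ _).trans (by gcongr)

theorem le_lN (r : ℝ) (f : ℤ → ℝ≥0∞) (n : ℤ) : wt r n * f n ≤ lN r f :=
  le_n2 (fun n => wt r n * f n) n

theorem lN_lt_top_apply {r : ℝ} {f : ℤ → ℝ≥0∞} (h : lN r f ≠ ⊤) (n : ℤ) : f n ≠ ⊤ := by
  intro hn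
  have := le_lN r f n
  rw [hn, ENNReal.mul_top (wt_ne_zero r n)] at this
  exact h (top_le_iff.1 this)

theorem tsum_le_lN {r : ℝ} (f : ℤ → ℝ≥0∞) : ∑' n, f n ≤ n2 (wt (-r)) * lN r f := by
  refine le_trans (le_of_eq ?_) (tsum_mul_le_n2 _ _)
  congr 1; ext n
  rw [← mul_assoc, wt_mul_wt]; simp [wt_zero]

theorem lN_wt_mul (r r' : ℝ) (f : ℤ → ℝ≥0∞) : lN r (fun n => wt r' n * f n) = lN (r + r') f := by
  unfold lN
  congr 1; ext n
  rw [← mul_assoc, wt_mul_wt]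

theorem lN_sq_enorm (r : ℝ) (a : ℤ → ℂ) :
    lN r (fun n => ‖a n‖ₑ) ^ 2 = ∑' n, ENNReal.ofReal ((bracket n ^ r * ‖a n‖) ^ 2) := by
  unfold lN
  rw [n2_sq]
  congr 1; ext n
  rw [ENNReal.ofReal_pow (by have := bracket_rpow_pos n r; positivity),
    ENNReal.ofReal_mul (bracket_rpow_pos n r).le, ofReal_norm]
  rfl

theorem memL2_iff (r : ℝ) (a : ℤ → ℂ) : MemL2 r a ↔ lN r (fun n => ‖a n‖ₑ) ≠ ⊤ := by
  have h : lN r (fun n => ‖a n‖ₑ) ≠ ⊤ ↔ lN r (fun n => ‖a n‖ₑ) ^ 2 ≠ ⊤ := by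
    simp
  rw [h, lN_sq_enorm, MemL2]
  constructor
  · intro hs
    rw [← ENNReal.ofReal_tsum_of_nonneg (fun n => sq_nonneg _) hs]
    exact ENNReal.ofReal_ne_top
  · intro hs
    have := ENNReal.summable_toReal hs
    refine this.congr fun n => ?_
    rw [ENNReal.toReal_ofReal (sq_nonneg _)]

theorem l2Norm_nonneg (r : ℝ) (a : ℤ → ℂ) : 0 ≤ l2Norm r a := Real.sqrt_nonneg _

theorem ofReal_l2Norm {r : ℝ} {a : ℤ → ℂ} (h : MemL2 r a) :
    ENNReal.ofReal (l2Norm r a) = lN r (fun n => ‖a n‖ₑ) := by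
  rw [← (ENNReal.pow_right_strictMono two_ne_zero).injective.eq_iff, lN_sq_enorm,
    ← ENNReal.ofReal_tsum_of_nonneg (fun n => sq_nonneg _) h, ← ENNReal.ofReal_pow (l2Norm_nonneg r a),
    l2Norm, Real.sq_sqrt]
  exact tsum_nonneg fun n => sq_nonneg _

theorem memL2_of_lN_le {r : ℝ} {a : ℤ → ℂ} {C : ℝ} (h : lN r (fun n => ‖a n‖ₑ) ≤ ENNReal.ofReal C) :
    MemL2 r a := (memL2_iff r a).2 (h.trans_lt ENNReal.ofReal_lt_top).ne

theorem l2Norm_le_of_lN_le {r : ℝ} {a : ℤ → ℂ} {C : ℝ} (hC : 0 ≤ C)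
    (h : lN r (fun n => ‖a n‖ₑ) ≤ ENNReal.ofReal C) : l2Norm r a ≤ C := by
  rw [← ofReal_l2Norm (memL2_of_lN_le h)] at h
  exact (ENNReal.ofReal_le_ofReal_iff hC).1 h

theorem lN_le_of_l2Norm_le {r : ℝ} {a : ℤ → ℂ} {C : ℝ} (ha : MemL2 r a)
    (h : l2Norm r a ≤ C) : lN r (fun n => ‖a n‖ₑ) ≤ ENNReal.ofReal C := by
  rw [← ofReal_l2Norm ha]
  exact ENNReal.ofReal_le_ofReal h

theorem lN_enorm_add_le (r : ℝ) (a b : ℤ → ℂ) :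
    lN r (fun n => ‖(a + b) n‖ₑ) ≤ lN r (fun n => ‖a n‖ₑ) + lN r (fun n => ‖b n‖ₑ) :=
  (lN_mono fun _ => enorm_add_le _ _).trans (lN_add_le r _ _)

theorem lN_enorm_sub_le (r : ℝ) (a b : ℤ → ℂ) :
    lN r (fun n => ‖(a - b) n‖ₑ) ≤ lN r (fun n => ‖a n‖ₑ) + lN r (fun n => ‖b n‖ₑ) :=
  (lN_mono fun _ => enorm_sub_le).trans (lN_add_le r _ _)

theorem MemL2.add {r : ℝ} {a b : ℤ → ℂ} (ha : MemL2 r a) (hb : MemL2 r b) : MemL2 r (a + b) := by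
  rw [memL2_iff] at *
  exact ((lN_enorm_add_le r a b).trans_lt (ENNReal.add_lt_top.2 ⟨ha.lt_top, hb.lt_top⟩)).ne

theorem MemL2.sub {r : ℝ} {a b : ℤ → ℂ} (ha : MemL2 r a) (hb : MemL2 r b) : MemL2 r (a - b) := by
  rw [memL2_iff] at *
  exact ((lN_enorm_sub_le r a b).trans_lt (ENNReal.add_lt_top.2 ⟨ha.lt_top, hb.lt_top⟩)).ne

theorem l2Norm_add_le {r : ℝ} {a b : ℤ → ℂ} (ha : MemL2 r a) (hb : MemL2 r b) :
    l2Norm r (a + b) ≤ l2Norm r a + l2Norm r b := by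
  apply l2Norm_le_of_lN_le (add_nonneg (l2Norm_nonneg _ _) (l2Norm_nonneg _ _))
  rw [ENNReal.ofReal_add (l2Norm_nonneg _ _) (l2Norm_nonneg _ _), ofReal_l2Norm ha, ofReal_l2Norm hb]
  exact lN_enorm_add_le r a b

theorem l2Norm_neg (r : ℝ) (a : ℤ → ℂ) : l2Norm r (-a) = l2Norm r a := by simp [l2Norm]

theorem l2Norm_sub_comm (r : ℝ) (a b : ℤ → ℂ) : l2Norm r (a - b) = l2Norm r (b - a) := by
  rw [← l2Norm_neg, neg_sub]

theorem MemL2.mono {r r' : ℝ} (h : r ≤ r') {a : ℤ → ℂ} (ha : MemL2 r' a) : MemL2 r a := by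
  rw [memL2_iff] at *
  exact ((lN_mono_exponent h _).trans_lt ha.lt_top).ne

theorem l2Norm_mono_exponent {r r' : ℝ} (h : r ≤ r') {a : ℤ → ℂ} (ha : MemL2 r' a) :
    l2Norm r a ≤ l2Norm r' a := by
  apply l2Norm_le_of_lN_le (l2Norm_nonneg _ _)
  rw [ofReal_l2Norm ha]
  exact lN_mono_exponent h _

theorem MemL2.zero (r : ℝ) : MemL2 r 0 := by
  rw [memL2_iff]; simp [lN_zero]

theorem l2Norm_zero (r : ℝ) : l2Norm r 0 = 0 := by simp [l2Norm]

theorem MemL2.sum {ι : Type*} {r : ℝ} (S : Finset ι) {a : ι → ℤ → ℂ} (h : ∀ i ∈ S, MemL2 r (a i)) :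
    MemL2 r (∑ i ∈ S, a i) := by
  classical
  induction S using Finset.induction_on with
  | empty => simpa using MemL2.zero r
  | insert i S hi ih =>
    rw [Finset.sum_insert hi]
    exact (h i (by simp)).add (ih fun j hj => h j (by simp [hj]))

theorem l2Norm_sum_le {ι : Type*} {r : ℝ} (S : Finset ι) {a : ι → ℤ → ℂ}
    (h : ∀ i ∈ S, MemL2 r (a i)) : l2Norm r (∑ i ∈ S, a i) ≤ ∑ i ∈ S, l2Norm r (a i) := by
  classical
  induction S using Finset.induction_on with
  | empty => simp [l2Norm_zero]
  | insert i S hi ih =>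
    have h' : ∀ j ∈ S, MemL2 r (a j) := fun j hj => h j (by simp [hj])
    rw [Finset.sum_insert hi, Finset.sum_insert hi]
    exact (l2Norm_add_le (h i (by simp)) (MemL2.sum S h')).trans (by gcongr; exact ih h')

theorem memL2_le {r : ℝ} {a b : ℤ → ℂ} {c : ℝ} (hc : 0 ≤ c) (h : ∀ n, ‖a n‖ ≤ c * ‖b n‖)
    (hb : MemL2 r b) : MemL2 r a ∧ l2Norm r a ≤ c * l2Norm r b := by
  have key : lN r (fun n => ‖a n‖ₑ) ≤ ENNReal.ofReal (c * l2Norm r b) := by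
    rw [ENNReal.ofReal_mul hc, ofReal_l2Norm hb, ← lN_const_mul]
    refine lN_mono fun n => ?_
    rw [← ofReal_norm, ← ofReal_norm, ← ENNReal.ofReal_mul hc]
    exact ENNReal.ofReal_le_ofReal (h n)
  exact ⟨memL2_of_lN_le key, l2Norm_le_of_lN_le (mul_nonneg hc (l2Norm_nonneg _ _)) key⟩

section

/-! ### Continuous functions with values in `ℓ²_r` -/

theorem abs_l2Norm_sub_le {r : ℝ} {a b : ℤ → ℂ} (ha : MemL2 r a) (hb : MemL2 r b) :
    |l2Norm r a - l2Norm r b| ≤ l2Norm r (a - b) := by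
  rw [abs_sub_le_iff]
  constructor
  · have := l2Norm_add_le (ha.sub hb) hb
    rw [sub_add_cancel] at this
    linarith
  · have := l2Norm_add_le (hb.sub ha) ha
    rw [sub_add_cancel, l2Norm_sub_comm] at this
    linarith

theorem InCT.continuousOn_l2Norm {r T : ℝ} {f : ℝ → ℤ → ℂ} (hf : InCT r T f) :
    ContinuousOn (fun t => l2Norm r (f t)) (Set.Icc 0 T) := by
  intro t₀ ht₀
  have h := hf.2 t₀ ht₀
  rw [ContinuousWithinAt, tendsto_iff_dist_tendsto_zero]
  refine squeeze_zero' (Filter.Eventually.of_forall fun t => dist_nonneg) ?_ h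
  filter_upwards [self_mem_nhdsWithin] with t ht
  exact abs_l2Norm_sub_le (hf.1 t ht) (hf.1 t₀ ht₀)

theorem InCT.exists_bound {r T : ℝ} {f : ℝ → ℤ → ℂ} (hf : InCT r T f) :
    ∃ R : ℝ, 0 ≤ R ∧ ∀ t ∈ Set.Icc 0 T, l2Norm r (f t) ≤ R := by
  obtain ⟨C, hC⟩ := isCompact_Icc.exists_bound_of_continuousOn hf.continuousOn_l2Norm
  refine ⟨max C 0, le_max_right _ _, fun t ht => ?_⟩
  exact ((le_abs_self _).trans (hC t ht)).trans (le_max_left _ _)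

theorem InCT.le_ctNorm {r T : ℝ} {f : ℝ → ℤ → ℂ} (hf : InCT r T f) {t : ℝ}
    (ht : t ∈ Set.Icc 0 T) : l2Norm r (f t) ≤ ctNorm r T f := by
  obtain ⟨R, -, hR⟩ := hf.exists_bound
  refine le_ciSup (f := fun t : Set.Icc (0 : ℝ) T => l2Norm r (f t)) ⟨R, ?_⟩ ⟨t, ht⟩
  rintro _ ⟨τ, rfl⟩
  exact hR τ τ.2

theorem ctNorm_le {r T B : ℝ} (hT : 0 < T) {f : ℝ → ℤ → ℂ}
    (h : ∀ t ∈ Set.Icc 0 T, l2Norm r (f t) ≤ B) : ctNorm r T f ≤ B := by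
  have : Nonempty (Set.Icc (0 : ℝ) T) := ⟨⟨0, by simp [hT.le]⟩⟩
  exact ciSup_le fun t => h t t.2

theorem ctNorm_nonneg (r T : ℝ) (f : ℝ → ℤ → ℂ) : 0 ≤ ctNorm r T f :=
  Real.iSup_nonneg fun _ => l2Norm_nonneg _ _

theorem InCT.add {r T : ℝ} {f g : ℝ → ℤ → ℂ} (hf : InCT r T f) (hg : InCT r T g) :
    InCT r T (f + g) := by
  refine ⟨fun t ht => (hf.1 t ht).add (hg.1 t ht), fun t₀ ht₀ => ?_⟩
  have h := (hf.2 t₀ ht₀).add (hg.2 t₀ ht₀)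
  rw [add_zero] at h
  refine squeeze_zero' (Filter.Eventually.of_forall fun t => l2Norm_nonneg _ _) ?_ h
  filter_upwards [self_mem_nhdsWithin] with t ht
  refine le_trans (le_of_eq ?_)
    (l2Norm_add_le ((hf.1 t ht).sub (hf.1 t₀ ht₀)) ((hg.1 t ht).sub (hg.1 t₀ ht₀)))
  congr 1
  simp only [Pi.add_apply]
  abel

theorem InCT.of_le {r r' T c : ℝ} {f g : ℝ → ℤ → ℂ} (hf : InCT r T f)
    (h : ∀ t ∈ Set.Icc 0 T, MemL2 r' (g t))
    (h' : ∀ t ∈ Set.Icc 0 T, ∀ t' ∈ Set.Icc 0 T, l2Norm r' (g t - g t') ≤ c * l2Norm r (f t - f t')) :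
    InCT r' T g := by
  refine ⟨h, fun t₀ ht₀ => ?_⟩
  have hl := (hf.2 t₀ ht₀).const_mul c
  rw [mul_zero] at hl
  refine squeeze_zero' (Filter.Eventually.of_forall fun t => l2Norm_nonneg _ _) ?_ hl
  filter_upwards [self_mem_nhdsWithin] with t ht
  exact h' t ht t₀ ht₀

theorem InCT.neg {r T : ℝ} {f : ℝ → ℤ → ℂ} (hf : InCT r T f) : InCT r T (-f) := by
  refine hf.of_le (c := 1) (fun t ht => ?_) (fun t ht t' ht' => ?_)
  · exact (memL2_le zero_le_one (fun n => by simp) (hf.1 t ht)).1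
  · rw [one_mul, ← l2Norm_neg]
    apply le_of_eq
    congr 1
    simp only [Pi.neg_apply]
    abel

theorem InCT.sub {r T : ℝ} {f g : ℝ → ℤ → ℂ} (hf : InCT r T f) (hg : InCT r T g) :
    InCT r T (f - g) := by
  rw [sub_eq_add_neg]; exact hf.add hg.neg

theorem InCT.zero (r T : ℝ) : InCT r T 0 := by
  refine ⟨fun t _ => MemL2.zero r, fun t₀ _ => ?_⟩
  simp only [Pi.zero_apply, sub_zero, l2Norm_zero]
  exact tendsto_const_nhds

theorem InCT.sum {ι : Type*} {r T : ℝ} (S : Finset ι) {f : ι → ℝ → ℤ → ℂ}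
    (h : ∀ i ∈ S, InCT r T (f i)) : InCT r T (∑ i ∈ S, f i) := by
  classical
  induction S using Finset.induction_on with
  | empty => simpa using InCT.zero r T
  | insert i S hi ih =>
    rw [Finset.sum_insert hi]
    exact (h i (by simp)).add (ih fun j hj => h j (by simp [hj]))

theorem InCT.congr {r T : ℝ} {f g : ℝ → ℤ → ℂ} (hf : InCT r T f)
    (h : ∀ t ∈ Set.Icc 0 T, g t = f t) : InCT r T g := by
  refine hf.of_le (c := 1) (fun t ht => h t ht ▸ hf.1 t ht) fun t ht t' ht' => ?_
  rw [h t ht, h t' ht', one_mul]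

/-! ### Multilinear forms given by absolutely convergent sums -/

/-- The sum `∑ₓ A(n,x) ∏_{a ∈ S} f_a(ev n x a)`. -/
def mform {ι Λ : Type*} (S : Finset Λ) (ev : ℤ → ι → Λ → ℤ) (A : ℤ → ι → ℂ) (f : Λ → ℤ → ℂ)
    (n : ℤ) : ℂ := ∑' x, A n x * ∏ a ∈ S, f a (ev n x a)

/-- The form with amplitude `|A|` is bounded from `∏ ℓ²_{e a}` to `ℓ²_r`, with constant `B`. -/
def MBound {ι Λ : Type*} (S : Finset Λ) (ev : ℤ → ι → Λ → ℤ) (A : ℤ → ι → ℂ) (r : ℝ) (e : Λ → ℝ)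
    (B : ℝ) : Prop :=
  ∀ g : Λ → ℤ → ℝ≥0∞, lN r (fun n => ∑' x, ‖A n x‖ₑ * ∏ a ∈ S, g a (ev n x a))
    ≤ ENNReal.ofReal B * ∏ a ∈ S, lN (e a) (g a)

variable {ι Λ : Type*} {S : Finset Λ} {ev : ℤ → ι → Λ → ℤ} {A A' : ℤ → ι → ℂ} {r : ℝ} {e : Λ → ℝ}
  {B : ℝ}

theorem MBound.mono {B' : ℝ} (h : MBound S ev A r e B) (hB : B ≤ B') : MBound S ev A r e B' :=
  fun g => (h g).trans (by gcongr)

theorem MBound.of_norm_le (h : MBound S ev A r e B) (hA : ∀ n x, ‖A' n x‖ ≤ ‖A n x‖) :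
    MBound S ev A' r e B := fun g => by
  refine le_trans (lN_mono fun n => ?_) (h g)
  refine ENNReal.tsum_le_tsum fun x => ?_
  gcongr
  rw [← ofReal_norm, ← ofReal_norm]
  exact ENNReal.ofReal_le_ofReal (hA n x)

theorem lN_prod_le {f : Λ → ℤ → ℂ} {R : Λ → ℝ} (hf : ∀ a ∈ S, MemL2 (e a) (f a))
    (hR : ∀ a ∈ S, l2Norm (e a) (f a) ≤ R a) :
    ∏ a ∈ S, lN (e a) (fun n => ‖f a n‖ₑ) ≤ ENNReal.ofReal (∏ a ∈ S, R a) := by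
  rw [ENNReal.ofReal_prod_of_nonneg fun a ha => (l2Norm_nonneg _ _).trans (hR a ha)]
  exact Finset.prod_le_prod' fun a ha => lN_le_of_l2Norm_le (hf a ha) (hR a ha)

theorem enorm_mul_prod (z : ℂ) (w : Λ → ℂ) : ‖z * ∏ a ∈ S, w a‖ₑ = ‖z‖ₑ * ∏ a ∈ S, ‖w a‖ₑ := by
  simp only [enorm_mul]
  congr 1
  simp only [enorm, nnnorm_prod, ENNReal.ofNNReal_finsetProd]

theorem MBound.lN_le (h : MBound S ev A r e B) {f : Λ → ℤ → ℂ} {R : Λ → ℝ}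
    (hB : 0 ≤ B) (hf : ∀ a ∈ S, MemL2 (e a) (f a)) (hR : ∀ a ∈ S, l2Norm (e a) (f a) ≤ R a) :
    lN r (fun n => ∑' x, ‖A n x * ∏ a ∈ S, f a (ev n x a)‖ₑ) ≤ ENNReal.ofReal (B * ∏ a ∈ S, R a) := by
  simp_rw [enorm_mul_prod]
  refine (h fun a n => ‖f a n‖ₑ).trans ?_
  rw [ENNReal.ofReal_mul hB]
  gcongr
  exact lN_prod_le hf hR

theorem MBound.summable (h : MBound S ev A r e B) (hB : 0 ≤ B) {f : Λ → ℤ → ℂ}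
    (hf : ∀ a ∈ S, MemL2 (e a) (f a)) (n : ℤ) :
    Summable fun x => A n x * ∏ a ∈ S, f a (ev n x a) := by
  have h1 := h.lN_le hB hf fun a _ => le_rfl
  have h2 := lN_lt_top_apply (h1.trans_lt ENNReal.ofReal_lt_top).ne n
  rw [← summable_norm_iff]
  refine (ENNReal.summable_toReal h2).congr fun x => ?_
  exact toReal_enorm _

theorem enorm_tsum_le_tsum (f : ι → ℂ) : ‖∑' x, f x‖ₑ ≤ ∑' x, ‖f x‖ₑ :=
  enorm_tsum_le_tsum_enorm

theorem MBound.bound (h : MBound S ev A r e B) (hB : 0 ≤ B) {f : Λ → ℤ → ℂ} {R : Λ → ℝ}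
    (hf : ∀ a ∈ S, MemL2 (e a) (f a)) (hR : ∀ a ∈ S, l2Norm (e a) (f a) ≤ R a) :
    MemL2 r (mform S ev A f) ∧ l2Norm r (mform S ev A f) ≤ B * ∏ a ∈ S, R a := by
  have h1 : lN r (fun n => ‖mform S ev A f n‖ₑ) ≤ ENNReal.ofReal (B * ∏ a ∈ S, R a) :=
    (lN_mono fun n => enorm_tsum_le_tsum _).trans (h.lN_le hB hf hR)
  exact ⟨memL2_of_lN_le h1, l2Norm_le_of_lN_le
    (mul_nonneg hB (Finset.prod_nonneg fun a ha => (l2Norm_nonneg _ _).trans (hR a ha))) h1⟩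

theorem norm_prod_sub_prod_le [DecidableEq Λ] (S : Finset Λ) (x y : Λ → ℂ) :
    ‖∏ a ∈ S, x a - ∏ a ∈ S, y a‖ ≤ ∑ a ∈ S, ∏ b ∈ S, if b = a then ‖x b - y b‖ else ‖x b‖ + ‖y b‖ := by
  induction S using Finset.induction_on with
  | empty => simp
  | insert c S hc ih =>
    rw [Finset.prod_insert hc, Finset.prod_insert hc, Finset.sum_insert hc]
    have e1 : x c * ∏ a ∈ S, x a - y c * ∏ a ∈ S, y a
        = (x c - y c) * ∏ a ∈ S, x a + y c * (∏ a ∈ S, x a - ∏ a ∈ S, y a) := by ring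
    rw [e1]
    refine (norm_add_le _ _).trans (add_le_add ?_ ?_)
    · rw [Finset.prod_insert hc, if_pos rfl, norm_mul, norm_prod]
      gcongr with b hb
      rw [if_neg (by rintro rfl; exact hc hb)]
      linarith [norm_nonneg (y b)]
    · rw [norm_mul]
      calc ‖y c‖ * ‖∏ a ∈ S, x a - ∏ a ∈ S, y a‖
          ≤ (‖x c‖ + ‖y c‖) * ∑ a ∈ S, ∏ b ∈ S, if b = a then ‖x b - y b‖ else ‖x b‖ + ‖y b‖ := by
            gcongr
            linarith [norm_nonneg (x c)]
        _ = _ := by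
            rw [Finset.mul_sum]
            refine Finset.sum_congr rfl fun a ha => ?_
            rw [Finset.prod_insert hc, if_neg (by rintro rfl; exact hc ha)]

theorem MBound.diff [DecidableEq Λ] (h : MBound S ev A r e B) (hB : 0 ≤ B) {f f' : Λ → ℤ → ℂ}
    {R d : Λ → ℝ}
    (hf : ∀ a ∈ S, MemL2 (e a) (f a)) (hR : ∀ a ∈ S, l2Norm (e a) (f a) ≤ R a)
    (hf' : ∀ a ∈ S, MemL2 (e a) (f' a)) (hR' : ∀ a ∈ S, l2Norm (e a) (f' a) ≤ R a)
    (hd : ∀ a ∈ S, l2Norm (e a) (f a - f' a) ≤ d a) :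
    l2Norm r (mform S ev A f - mform S ev A f')
      ≤ B * ∑ a ∈ S, ∏ b ∈ S, if b = a then d b else 2 * R b := by
  have hRn : ∀ a ∈ S, 0 ≤ R a := fun a ha => (l2Norm_nonneg _ _).trans (hR a ha)
  have hdn : ∀ a ∈ S, 0 ≤ d a := fun a ha => (l2Norm_nonneg _ _).trans (hd a ha)
  have nn : ∀ a ∈ S, 0 ≤ ∏ b ∈ S, if b = a then d b else 2 * R b := fun a _ =>
    Finset.prod_nonneg fun b hb => by
      split_ifs
      · exact hdn b hb
      · linarith [hRn b hb]
  apply l2Norm_le_of_lN_le (mul_nonneg hB (Finset.sum_nonneg nn))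
  let g : Λ → Λ → ℤ → ℝ≥0∞ := fun a b n =>
    if b = a then ‖f b n - f' b n‖ₑ else ‖f b n‖ₑ + ‖f' b n‖ₑ
  have hg : ∀ a ∈ S, ∀ b ∈ S, lN (e b) (g a b)
      ≤ ENNReal.ofReal (if b = a then d b else 2 * R b) := by
    intro a _ b hb
    by_cases hba : b = a
    · simp only [g, if_pos hba]
      exact lN_le_of_l2Norm_le ((hf b hb).sub (hf' b hb)) (hd b hb)
    · simp only [g, if_neg hba]
      refine (lN_add_le _ _ _).trans ?_
      rw [two_mul, ENNReal.ofReal_add (hRn b hb) (hRn b hb)]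
      exact add_le_add (lN_le_of_l2Norm_le (hf b hb) (hR b hb))
        (lN_le_of_l2Norm_le (hf' b hb) (hR' b hb))
  have pt : ∀ n, ‖(mform S ev A f - mform S ev A f') n‖ₑ
      ≤ ∑ a ∈ S, ∑' x, ‖A n x‖ₑ * ∏ b ∈ S, g a b (ev n x b) := by
    intro n
    rw [Pi.sub_apply, mform, mform, ← (h.summable hB hf n).tsum_sub (h.summable hB hf' n)]
    refine (enorm_tsum_le_tsum _).trans ?_
    rw [← Summable.tsum_finsetSum fun a _ => ENNReal.summable]
    refine ENNReal.tsum_le_tsum fun x => ?_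
    rw [← mul_sub, enorm_mul, ← Finset.mul_sum]
    gcongr
    rw [← ofReal_norm]
    refine (ENNReal.ofReal_le_ofReal (norm_prod_sub_prod_le S _ _)).trans (le_of_eq ?_)
    have pos : ∀ a b, 0 ≤ (if b = a then ‖f b (ev n x b) - f' b (ev n x b)‖
        else ‖f b (ev n x b)‖ + ‖f' b (ev n x b)‖) := fun a b => by split_ifs <;> positivity
    rw [ENNReal.ofReal_sum_of_nonneg fun a _ => Finset.prod_nonneg fun b _ => pos a b]
    refine Finset.sum_congr rfl fun a _ => ?_
    rw [ENNReal.ofReal_prod_of_nonneg fun b _ => pos a b]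
    refine Finset.prod_congr rfl fun b _ => ?_
    simp only [g]
    split_ifs
    · exact ofReal_norm _
    · rw [ENNReal.ofReal_add (norm_nonneg _) (norm_nonneg _), ofReal_norm, ofReal_norm]
  refine (lN_mono pt).trans ((lN_sum_le r S _).trans ?_)
  rw [Finset.mul_sum, ENNReal.ofReal_sum_of_nonneg fun a ha => mul_nonneg hB (nn a ha)]
  refine Finset.sum_le_sum fun a ha => (h (g a)).trans ?_
  rw [ENNReal.ofReal_mul hB, ENNReal.ofReal_prod_of_nonneg]
  · gcongr with b hb
    exact hg a ha b hb
  · intro b hb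
    split_ifs
    · exact hdn b hb
    · linarith [hRn b hb]

/-- Amplitudes with a time oscillation. -/
def phased (θ : ℤ → ι → ℝ) (A : ℤ → ι → ℂ) (t : ℝ) (n : ℤ) (x : ι) : ℂ :=
  Complex.exp (Complex.I * t * θ n x) * A n x

theorem norm_exp_I_mul (t θ : ℝ) : ‖Complex.exp (Complex.I * t * θ)‖ = 1 := by
  rw [show Complex.I * t * θ = ((t * θ : ℝ) : ℂ) * Complex.I by push_cast; ring]
  exact Complex.norm_exp_ofReal_mul_I _

theorem norm_phased (θ : ℤ → ι → ℝ) (A : ℤ → ι → ℂ) (t : ℝ) (n : ℤ) (x : ι) :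
    ‖phased θ A t n x‖ = ‖A n x‖ := by
  rw [phased, norm_mul, norm_exp_I_mul, one_mul]

theorem MBound.phased (h : MBound S ev A r e B) (θ : ℤ → ι → ℝ) (t : ℝ) :
    MBound S ev (phased θ A t) r e B := h.of_norm_le fun n x => (norm_phased θ A t n x).le

theorem MBound.tendsto_phased (h : MBound S ev A r e B) (hB : 0 ≤ B) (θ : ℤ → ι → ℝ)
    {f : Λ → ℤ → ℂ} (hf : ∀ a ∈ S, MemL2 (e a) (f a)) (t₀ : ℝ) :
    Filter.Tendsto (fun t => l2Norm r (mform S ev (MBO.phased θ A t) f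
      - mform S ev (MBO.phased θ A t₀) f)) (nhds t₀) (nhds 0) := by
  have h1 := h.lN_le hB hf fun a _ => le_rfl
  set G : ℤ → ι → ℝ := fun n x => ‖A n x * ∏ a ∈ S, f a (ev n x a)‖ with hG
  have hs : ∀ n, Summable (G n) := fun n => (h.summable hB hf n).norm
  have term : ∀ t n x, ‖MBO.phased θ A t n x * ∏ a ∈ S, f a (ev n x a)‖ = G n x := by
    intro t n x
    simp only [hG, norm_mul, norm_phased]
  have hst : ∀ t n, Summable fun x => MBO.phased θ A t n x * ∏ a ∈ S, f a (ev n x a) :=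
    fun t n => (h.phased θ t).summable hB hf n
  set H : ℤ → ℝ := fun n => ∑' x, G n x with hH
  have hHnn : ∀ n, 0 ≤ H n := fun n => tsum_nonneg fun x => norm_nonneg _
  have hHs : MemL2 r (fun n => (H n : ℂ)) := by
    apply memL2_of_lN_le (le_trans (lN_mono fun n => ?_) h1)
    rw [← ofReal_norm, Complex.norm_real, Real.norm_of_nonneg (hHnn n), hH,
      ENNReal.ofReal_tsum_of_nonneg (fun x => norm_nonneg _) (hs n)]
    exact le_of_eq (tsum_congr fun x => ofReal_norm _)
  have lim1 : ∀ n, Filter.Tendsto (fun t => mform S ev (MBO.phased θ A t) f n) (nhds t₀)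
      (nhds (mform S ev (MBO.phased θ A t₀) f n)) := by
    intro n
    refine tendsto_tsum_of_dominated_convergence (hs n) (fun x => ?_) ?_
    · refine Filter.Tendsto.mul_const _ ?_
      have : Continuous fun t : ℝ => MBO.phased θ A t n x := by unfold MBO.phased; fun_prop
      exact this.tendsto t₀
    · exact Filter.Eventually.of_forall fun t x => (term t n x).le
  have bd : ∀ t n, ‖mform S ev (MBO.phased θ A t) f n‖ ≤ H n := by
    intro t n
    refine (norm_tsum_le_tsum_norm (hst t n).norm).trans (le_of_eq ?_)
    exact tsum_congr fun x => term t n x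
  have lim2 : Filter.Tendsto (fun t => ∑' n : ℤ, (bracket n ^ r * ‖(mform S ev (MBO.phased θ A t) f
      - mform S ev (MBO.phased θ A t₀) f) n‖) ^ 2) (nhds t₀) (nhds (∑' _ : ℤ, 0)) := by
    have dom : Summable fun n : ℤ => 4 * (bracket n ^ r * H n) ^ 2 := by
      refine (Summable.mul_left 4 hHs).congr fun n => ?_
      rw [Complex.norm_real, Real.norm_of_nonneg (hHnn n)]
    refine tendsto_tsum_of_dominated_convergence dom (fun n => ?_) ?_
    · have := ((((lim1 n).sub_const (mform S ev (MBO.phased θ A t₀) f n)).norm).const_mul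
        (bracket n ^ r)).pow 2
      simpa using this
    · refine Filter.Eventually.of_forall fun t n => ?_
      rw [Real.norm_of_nonneg (sq_nonneg _), Pi.sub_apply]
      have h3 : ‖mform S ev (MBO.phased θ A t) f n - mform S ev (MBO.phased θ A t₀) f n‖ ≤ 2 * H n :=
        (norm_sub_le _ _).trans (by linarith [bd t n, bd t₀ n])
      calc _ ≤ (bracket n ^ r * (2 * H n)) ^ 2 := by
            have := bracket_rpow_pos n r
            gcongr
        _ = _ := by ring
  have := (Real.continuous_sqrt.tendsto _).comp lim2
  simpa [l2Norm, Function.comp_def] using this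

theorem MBound.inCT (h : MBound S ev A r e B) (hB : 0 ≤ B) (θ : ℤ → ι → ℝ) {T : ℝ}
    {f : ℝ → Λ → ℤ → ℂ} (hf : ∀ a ∈ S, InCT (e a) T fun t => f t a) :
    InCT r T fun t => mform S ev (MBO.phased θ A t) (f t) := by
  classical
  have hR : ∀ a, ∃ R : ℝ, 0 ≤ R ∧ (a ∈ S → ∀ t ∈ Set.Icc 0 T, l2Norm (e a) (f t a) ≤ R) := by
    intro a
    by_cases ha : a ∈ S
    · obtain ⟨R, hR, h⟩ := (hf a ha).exists_bound
      exact ⟨R, hR, fun _ => h⟩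
    · exact ⟨0, le_rfl, fun h => absurd h ha⟩
  choose R hRn hR using hR
  refine ⟨fun t ht => ((h.phased θ t).bound hB (fun a ha => (hf a ha).1 t ht)
    (fun a ha => hR a ha t ht)).1, fun t₀ ht₀ => ?_⟩
  have lim1 := (h.tendsto_phased hB θ (fun a ha => (hf a ha).1 t₀ ht₀) t₀).mono_left
    (nhdsWithin_le_nhds (s := Set.Icc 0 T))
  have lim2 : Filter.Tendsto (fun t => B * ∑ a ∈ S, ∏ b ∈ S,
      if b = a then l2Norm (e b) (f t b - f t₀ b) else 2 * R b) (nhdsWithin t₀ (Set.Icc 0 T))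
      (nhds (B * ∑ a ∈ S, ∏ b ∈ S, if b = a then 0 else 2 * R b)) := by
    refine Filter.Tendsto.const_mul _ (tendsto_finsetSum _ fun a _ =>
      tendsto_finsetProd _ fun b hb => ?_)
    by_cases hba : b = a
    · simp only [if_pos hba]; exact (hf b hb).2 t₀ ht₀
    · simp only [if_neg hba]; exact tendsto_const_nhds
  have z : B * ∑ a ∈ S, ∏ b ∈ S, (if b = a then 0 else 2 * R b) = 0 := by
    rw [Finset.sum_eq_zero, mul_zero]
    intro a ha
    exact Finset.prod_eq_zero ha (by simp)
  rw [z] at lim2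
  have lim := lim2.add lim1
  rw [add_zero] at lim
  refine squeeze_zero' (Filter.Eventually.of_forall fun t => l2Norm_nonneg _ _) ?_ lim
  filter_upwards [self_mem_nhdsWithin] with t ht
  have m : ∀ t t', t' ∈ Set.Icc 0 T → MemL2 r (mform S ev (MBO.phased θ A t) (f t')) :=
    fun t t' ht' => ((h.phased θ t).bound hB (fun a ha => (hf a ha).1 t' ht')
      (fun a ha => hR a ha t' ht')).1
  have := l2Norm_add_le ((m t t ht).sub (m t t₀ ht₀)) ((m t t₀ ht₀).sub (m t₀ t₀ ht₀))
  rw [sub_add_sub_cancel] at this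
  refine this.trans (add_le_add ?_ le_rfl)
  exact (h.phased θ t).diff hB (fun a ha => (hf a ha).1 t ht) (fun a ha => hR a ha t ht)
    (fun a ha => (hf a ha).1 t₀ ht₀) (fun a ha => hR a ha t₀ ht₀) fun a ha => le_rfl

theorem InCT.oscillate {r T : ℝ} {f : ℝ → ℤ → ℂ} (hf : InCT r T f) (θ : ℤ → ℝ) :
    InCT r T fun t n => Complex.exp (Complex.I * t * θ n) * f t n := by
  have h : MBound (ι := Unit) ({()} : Finset Unit) (fun n _ _ => n) (fun _ _ => 1) r (fun _ => r) 1 := by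
    intro g; simp
  have := h.inCT zero_le_one (fun n _ => θ n) (T := T) (f := fun t _ => f t) (fun _ _ => hf)
  refine this.congr fun t _ => ?_
  ext n
  simp [mform, MBO.phased]

end

/-! ### Bounded forms of six square-summable functions -/

/-- The kernel `K` defines a bounded form of six square-summable functions, five of them evaluated
at the entries of `q` and one at their sum. -/
def FormBdd (K : (Fin 5 → ℤ) → ℝ) : Prop :=
  ∃ C : ℝ≥0, ∀ (g₀ : ℤ → ℝ≥0∞) (g : Fin 5 → ℤ → ℝ≥0∞),
    ∑' q : Fin 5 → ℤ, ENNReal.ofReal (K q) * (g₀ (∑ l, q l) * ∏ l, g l (q l))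
      ≤ C * (n2 g₀ * ∏ l, n2 (g l))

theorem FormBdd.mono {K K' : (Fin 5 → ℤ) → ℝ} (h : FormBdd K') {c : ℝ} (hc : 0 ≤ c)
    (hK : ∀ q, K q ≤ c * K' q) : FormBdd K := by
  obtain ⟨C, hC⟩ := h
  refine ⟨c.toNNReal * C, fun g₀ g => ?_⟩
  calc _ ≤ ∑' q : Fin 5 → ℤ, ENNReal.ofReal c *
        (ENNReal.ofReal (K' q) * (g₀ (∑ l, q l) * ∏ l, g l (q l))) := by
        refine ENNReal.tsum_le_tsum fun q => ?_
        rw [← mul_assoc (ENNReal.ofReal c), ← ENNReal.ofReal_mul hc]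
        gcongr
        exact hK q
    _ ≤ ENNReal.ofReal c * (C * (n2 g₀ * ∏ l, n2 (g l))) := by
        rw [ENNReal.tsum_mul_left]
        gcongr
        exact hC g₀ g
    _ = _ := by
        rw [ENNReal.coe_mul, mul_assoc]; rfl

theorem FormBdd.add {K K' : (Fin 5 → ℤ) → ℝ} (h : FormBdd K) (h' : FormBdd K') :
    FormBdd fun q => K q + K' q := by
  obtain ⟨C, hC⟩ := h
  obtain ⟨C', hC'⟩ := h'
  refine ⟨C + C', fun g₀ g => ?_⟩
  calc _ ≤ ∑' q : Fin 5 → ℤ, (ENNReal.ofReal (K q) * (g₀ (∑ l, q l) * ∏ l, g l (q l))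
        + ENNReal.ofReal (K' q) * (g₀ (∑ l, q l) * ∏ l, g l (q l))) := by
        refine ENNReal.tsum_le_tsum fun q => ?_
        rw [← add_mul]
        gcongr
        exact ENNReal.ofReal_add_le
    _ ≤ _ := by
        rw [ENNReal.tsum_add, ENNReal.coe_add, add_mul]
        exact add_le_add (hC g₀ g) (hC' g₀ g)

theorem FormBdd.perm {K : (Fin 5 → ℤ) → ℝ} (h : FormBdd K) (π : Equiv.Perm (Fin 5)) :
    FormBdd fun q => K fun l => q (π l) := by
  obtain ⟨C, hC⟩ := h
  refine ⟨C, fun g₀ g => ?_⟩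
  have e := hC g₀ fun l => g (π l)
  rw [Equiv.prod_comp π fun l => n2 (g l)] at e
  refine le_trans (le_of_eq ?_) e
  rw [← (Equiv.arrowCongr π (Equiv.refl ℤ)).tsum_eq]
  refine tsum_congr fun q => ?_
  simp only [Equiv.arrowCongr_apply, Equiv.coe_refl, Function.comp_def, id,
    Equiv.symm_apply_apply]
  rw [← Equiv.sum_comp π, ← Equiv.prod_comp π]
  simp only [Equiv.symm_apply_apply]

theorem n2_neg (g : ℤ → ℝ≥0∞) : n2 (fun n => g (-n)) = n2 g := n2_equiv (Equiv.neg ℤ) g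

theorem n2_add_right (g : ℤ → ℝ≥0∞) (c : ℤ) : n2 (fun n => g (n + c)) = n2 g :=
  n2_equiv (Equiv.addRight c) g

theorem n2_sub_left (g : ℤ → ℝ≥0∞) (c : ℤ) : n2 (fun n => g (c - n)) = n2 g :=
  n2_equiv (Equiv.subLeft c) g

/-- Exchange of the output frequency with the frequency in slot `l`, up to sign. -/
def exch (l : Fin 5) (q : Fin 5 → ℤ) : Fin 5 → ℤ := Function.update q l (-∑ k, q k)

theorem sum_exch (l : Fin 5) (q : Fin 5 → ℤ) : ∑ k, exch l q k = -q l := by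
  unfold exch
  rw [Finset.sum_update_of_mem (Finset.mem_univ l), ← Finset.add_sum_erase _ _ (Finset.mem_univ l),
    Finset.sdiff_singleton_eq_erase]
  ring

theorem exch_exch (l : Fin 5) (q : Fin 5 → ℤ) : exch l (exch l q) = q := by
  ext k
  conv_lhs => rw [exch]
  rw [sum_exch]
  by_cases h : k = l
  · subst h; simp
  · simp [Function.update_of_ne h, exch]

theorem FormBdd.exch {K : (Fin 5 → ℤ) → ℝ} (h : FormBdd K) (l : Fin 5) :
    FormBdd fun q => K (exch l q) := by
  obtain ⟨C, hC⟩ := h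
  refine ⟨C, fun g₀ g => ?_⟩
  let E : (Fin 5 → ℤ) ≃ (Fin 5 → ℤ) := ⟨MBO.exch l, MBO.exch l, exch_exch l, exch_exch l⟩
  have e := hC (fun n => g l (-n)) (Function.update g l fun n => g₀ (-n))
  have e1 : n2 (fun n => g l (-n)) * ∏ k, n2 (Function.update g l (fun n => g₀ (-n)) k)
      = n2 g₀ * ∏ k, n2 (g k) := by
    rw [n2_neg (g l), ← Finset.mul_prod_erase _ _ (Finset.mem_univ l),
      ← Finset.mul_prod_erase _ (fun k => n2 (g k)) (Finset.mem_univ l), Function.update_self,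
      n2_neg g₀]
    rw [Finset.prod_congr rfl (g := fun k => n2 (g k)) fun k hk => by
      rw [Function.update_of_ne (Finset.ne_of_mem_erase hk)]]
    ring
  rw [e1] at e
  refine le_trans (le_of_eq ?_) e
  rw [← E.tsum_eq]
  refine tsum_congr fun q => ?_
  change ENNReal.ofReal (K (MBO.exch l (MBO.exch l q))) * (g₀ (∑ k, MBO.exch l q k)
    * ∏ k, g k (MBO.exch l q k)) = _
  rw [exch_exch, sum_exch, ← Finset.mul_prod_erase _ _ (Finset.mem_univ l),
    ← Finset.mul_prod_erase _ (fun k => Function.update g l (fun n => g₀ (-n)) k (q k))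
      (Finset.mem_univ l), Function.update_self]
  rw [Finset.prod_congr rfl (g := fun k => Function.update g l (fun n => g₀ (-n)) k (q k))
    fun k hk => by
      rw [Function.update_of_ne (Finset.ne_of_mem_erase hk), MBO.exch,
        Function.update_of_ne (Finset.ne_of_mem_erase hk)]]
  rw [MBO.exch, Function.update_self]
  ring

theorem tsum_equiv_quintuple (E : ℤ × ℤ × ℤ × ℤ × ℤ ≃ (Fin 5 → ℤ)) (F : (Fin 5 → ℤ) → ℝ≥0∞) :
    ∑' q, F q = ∑' (a : ℤ) (b : ℤ) (c : ℤ) (d : ℤ) (e : ℤ), F (E (a, b, c, d, e)) := by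
  rw [← E.tsum_eq]
  rw [ENNReal.tsum_prod (f := fun a x => F (E (a, x)))]
  refine tsum_congr fun a => ?_
  rw [ENNReal.tsum_prod (f := fun b x => F (E (a, b, x)))]
  refine tsum_congr fun b => ?_
  rw [ENNReal.tsum_prod (f := fun c x => F (E (a, b, c, x)))]
  refine tsum_congr fun c => ?_
  rw [ENNReal.tsum_prod (f := fun d x => F (E (a, b, c, d, x)))]

theorem tsum_wt_mul_le {r : ℝ} (g : ℤ → ℝ≥0∞) : ∑' n, wt (-r) n * g n ≤ n2 (wt (-r)) * n2 g :=
  tsum_mul_le_n2 _ _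

theorem tsum_mul_shift_le (g g' : ℤ → ℝ≥0∞) (c : ℤ) : ∑' x, g x * g' (x + c) ≤ n2 g * n2 g' := by
  refine (tsum_mul_le_n2 _ _).trans (le_of_eq ?_)
  rw [n2_add_right]

theorem tsum_mul_reflect_le (g g' : ℤ → ℝ≥0∞) (c : ℤ) : ∑' x, g (c - x) * g' x ≤ n2 g * n2 g' := by
  refine (tsum_mul_le_n2 _ _).trans (le_of_eq ?_)
  rw [n2_sub_left]

/-- Coordinates with the entry in slot `0` last. -/
def equivFirst : ℤ × ℤ × ℤ × ℤ × ℤ ≃ (Fin 5 → ℤ) where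
  toFun p := ![p.2.2.2.2, p.1, p.2.1, p.2.2.1, p.2.2.2.1]
  invFun q := (q 1, q 2, q 3, q 4, q 0)
  left_inv p := by simp
  right_inv q := by ext i; fin_cases i <;> rfl

/-- Coordinates `(q₁, q₃, q₀ + q₂, q₂, q₄)`. -/
def equivPair : ℤ × ℤ × ℤ × ℤ × ℤ ≃ (Fin 5 → ℤ) where
  toFun p := ![p.2.2.1 - p.2.2.2.1, p.1, p.2.2.2.1, p.2.1, p.2.2.2.2]
  invFun q := (q 1, q 3, q 0 + q 2, q 2, q 4)
  left_inv p := by simp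
  right_inv q := by ext i; fin_cases i <;> simp

/-- Coordinates `(q₁, q₃, ∑ q, q₀ + q₄, q₂ + q₄)`. -/
def equivRes : ℤ × ℤ × ℤ × ℤ × ℤ ≃ (Fin 5 → ℤ) where
  toFun p := ![p.2.2.1 - (p.1 + p.2.1) - p.2.2.2.2, p.1, p.2.2.1 - (p.1 + p.2.1) - p.2.2.2.1, p.2.1,
    p.2.2.2.1 + p.2.2.2.2 - p.2.2.1 + (p.1 + p.2.1)]
  invFun q := (q 1, q 3, q 0 + q 1 + q 2 + q 3 + q 4, q 0 + q 4, q 2 + q 4)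
  left_inv p := by
    ext <;> simp <;> ring
  right_inv q := by ext i; fin_cases i <;> simp <;> ring

theorem tsum_mul_le_of_le {ι : Type*} {H X : ι → ℝ≥0∞} {a M : ℝ≥0∞} (hH : ∑' i, H i ≤ a)
    (hX : ∀ i, X i ≤ M) : ∑' i, H i * X i ≤ a * M := by
  calc _ ≤ ∑' i, H i * M := ENNReal.tsum_le_tsum fun i => by gcongr; exact hX i
    _ ≤ _ := by rw [ENNReal.tsum_mul_right]; gcongr

theorem formBdd_first {r : ℝ} (hr : 1 / 2 < r) :
    FormBdd fun q => bracket (q 1) ^ (-r) * bracket (q 2) ^ (-r) * bracket (q 3) ^ (-r)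
      * bracket (q 4) ^ (-r) := by
  lift n2 (wt (-r)) to ℝ≥0 using n2_wt_ne_top hr with c hc
  refine ⟨c ^ 4, fun g₀ g => ?_⟩
  rw [tsum_equiv_quintuple equivFirst]
  have pt : ∀ b c d e a : ℤ, ENNReal.ofReal (bracket (equivFirst (b, c, d, e, a) 1) ^ (-r)
      * bracket (equivFirst (b, c, d, e, a) 2) ^ (-r) * bracket (equivFirst (b, c, d, e, a) 3) ^ (-r)
      * bracket (equivFirst (b, c, d, e, a) 4) ^ (-r))
      * (g₀ (∑ l, equivFirst (b, c, d, e, a) l) * ∏ l, g l (equivFirst (b, c, d, e, a) l))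
      = (wt (-r) b * g 1 b) * ((wt (-r) c * g 2 c) * ((wt (-r) d * g 3 d) * ((wt (-r) e * g 4 e)
        * (g 0 a * g₀ (a + (b + c + d + e)))))) := by
    intro b c d e a
    have h := fun n => (bracket_rpow_pos n (-r)).le
    simp only [equivFirst, Equiv.coe_fn_mk, Fin.sum_univ_five, Fin.prod_univ_five]
    change ENNReal.ofReal (bracket b ^ (-r) * bracket c ^ (-r) * bracket d ^ (-r) * bracket e ^ (-r))
      * (g₀ (a + b + c + d + e) * (g 0 a * g 1 b * g 2 c * g 3 d * g 4 e)) = _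
    rw [ENNReal.ofReal_mul (mul_nonneg (mul_nonneg (h b) (h c)) (h d)),
      ENNReal.ofReal_mul (mul_nonneg (h b) (h c)), ENNReal.ofReal_mul (h b)]
    change wt (-r) b * wt (-r) c * wt (-r) d * wt (-r) e * _ = _
    rw [show a + b + c + d + e = a + (b + c + d + e) by ring]
    ring
  simp_rw [pt, ENNReal.tsum_mul_left]
  have hw : ∀ l, ∑' n, wt (-r) n * g l n ≤ c * n2 (g l) := fun l => by
    rw [hc]; exact tsum_wt_mul_le (g l)
  refine (tsum_mul_le_of_le (hw 1) fun b => tsum_mul_le_of_le (hw 2) fun c' =>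
    tsum_mul_le_of_le (hw 3) fun d => tsum_mul_le_of_le (hw 4) fun e =>
      tsum_mul_shift_le (g 0) g₀ _).trans (le_of_eq ?_)
  rw [Fin.prod_univ_five]
  push_cast
  ring

theorem formBdd_pair {r : ℝ} (hr : 1 / 2 < r) {k : ℤ → ℤ → ℤ → ℝ} {C : ℝ≥0}
    (hk : ∀ b d, ∑' a, ENNReal.ofReal (k a b d) ≤ C) :
    FormBdd fun q => bracket (q 1) ^ (-r) * bracket (q 3) ^ (-r) * k (q 0 + q 2) (q 1) (q 3) := by
  lift n2 (wt (-r)) to ℝ≥0 using n2_wt_ne_top hr with c hc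
  refine ⟨c ^ 2 * C, fun g₀ g => ?_⟩
  rw [tsum_equiv_quintuple equivPair]
  have pt : ∀ b d a x y : ℤ, ENNReal.ofReal (bracket (equivPair (b, d, a, x, y) 1) ^ (-r)
      * bracket (equivPair (b, d, a, x, y) 3) ^ (-r)
      * k (equivPair (b, d, a, x, y) 0 + equivPair (b, d, a, x, y) 2) (equivPair (b, d, a, x, y) 1)
        (equivPair (b, d, a, x, y) 3))
      * (g₀ (∑ l, equivPair (b, d, a, x, y) l) * ∏ l, g l (equivPair (b, d, a, x, y) l))
      = (wt (-r) b * g 1 b) * ((wt (-r) d * g 3 d) * (ENNReal.ofReal (k a b d)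
        * ((g 0 (a - x) * g 2 x) * (g 4 y * g₀ (y + (a + b + d)))))) := by
    intro b d a x y
    have h := fun n => (bracket_rpow_pos n (-r)).le
    simp only [equivPair, Equiv.coe_fn_mk, Fin.sum_univ_five, Fin.prod_univ_five]
    change ENNReal.ofReal (bracket b ^ (-r) * bracket d ^ (-r) * k (a - x + x) b d)
      * (g₀ (a - x + b + x + d + y) * (g 0 (a - x) * g 1 b * g 2 x * g 3 d * g 4 y)) = _
    rw [ENNReal.ofReal_mul (mul_nonneg (h b) (h d)), ENNReal.ofReal_mul (h b)]
    change wt (-r) b * wt (-r) d * _ * _ = _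
    rw [show a - x + b + x + d + y = y + (a + b + d) by ring, sub_add_cancel]
    ring
  simp_rw [pt, ENNReal.tsum_mul_left]
  have hw : ∀ l, ∑' n, wt (-r) n * g l n ≤ c * n2 (g l) := fun l => by
    rw [hc]; exact tsum_wt_mul_le (g l)
  refine (tsum_mul_le_of_le (hw 1) fun b => tsum_mul_le_of_le (hw 3) fun d =>
    tsum_mul_le_of_le (hk b d) fun a => tsum_mul_le_of_le (tsum_mul_reflect_le (g 0) (g 2) a) fun x =>
      tsum_mul_shift_le (g 4) g₀ _).trans (le_of_eq ?_)
  rw [Fin.prod_univ_five]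
  push_cast
  ring

theorem formBdd_res {r : ℝ} (hr : 1 / 2 < r) {k : ℤ → ℤ → ℤ → ℤ → ℤ → ℝ} {C : ℝ≥0}
    (hk : ∀ n b d, n2 (fun p : ℤ × ℤ => ENNReal.ofReal (k n b d p.1 p.2)) ≤ C) :
    FormBdd fun q => bracket (q 1) ^ (-r) * bracket (q 3) ^ (-r)
      * k (∑ l, q l) (q 1) (q 3) (q 0 + q 4) (q 2 + q 4) := by
  lift n2 (wt (-r)) to ℝ≥0 using n2_wt_ne_top hr with c hc
  refine ⟨c ^ 2 * C, fun g₀ g => ?_⟩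
  rw [tsum_equiv_quintuple equivRes]
  have pt : ∀ b d n x y : ℤ, ENNReal.ofReal (bracket (equivRes (b, d, n, x, y) 1) ^ (-r)
      * bracket (equivRes (b, d, n, x, y) 3) ^ (-r)
      * k (∑ l, equivRes (b, d, n, x, y) l) (equivRes (b, d, n, x, y) 1) (equivRes (b, d, n, x, y) 3)
        (equivRes (b, d, n, x, y) 0 + equivRes (b, d, n, x, y) 4)
        (equivRes (b, d, n, x, y) 2 + equivRes (b, d, n, x, y) 4))
      * (g₀ (∑ l, equivRes (b, d, n, x, y) l) * ∏ l, g l (equivRes (b, d, n, x, y) l))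
      = (wt (-r) b * g 1 b) * ((wt (-r) d * g 3 d) * (g₀ n * (ENNReal.ofReal (k n b d x y)
        * (g 0 (n - (b + d) - y) * (g 2 (n - (b + d) - x) * g 4 (x + y - n + (b + d))))))) := by
    intro b d n x y
    have h := fun n => (bracket_rpow_pos n (-r)).le
    simp only [equivRes, Equiv.coe_fn_mk, Fin.sum_univ_five, Fin.prod_univ_five]
    change ENNReal.ofReal (bracket b ^ (-r) * bracket d ^ (-r)
      * k (n - (b + d) - y + b + (n - (b + d) - x) + d + (x + y - n + (b + d))) b d
        (n - (b + d) - y + (x + y - n + (b + d))) (n - (b + d) - x + (x + y - n + (b + d))))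
      * (g₀ (n - (b + d) - y + b + (n - (b + d) - x) + d + (x + y - n + (b + d)))
      * (g 0 (n - (b + d) - y) * g 1 b * g 2 (n - (b + d) - x) * g 3 d
        * g 4 (x + y - n + (b + d)))) = _
    rw [show n - (b + d) - y + b + (n - (b + d) - x) + d + (x + y - n + (b + d)) = n by ring,
      show n - (b + d) - y + (x + y - n + (b + d)) = x by ring,
      show n - (b + d) - x + (x + y - n + (b + d)) = y by ring]
    rw [ENNReal.ofReal_mul (mul_nonneg (h b) (h d)), ENNReal.ofReal_mul (h b)]
    change wt (-r) b * wt (-r) d * _ * _ = _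
    ring
  simp_rw [pt, ENNReal.tsum_mul_left]
  have hw : ∀ l, ∑' n, wt (-r) n * g l n ≤ c * n2 (g l) := fun l => by
    rw [hc]; exact tsum_wt_mul_le (g l)
  have inner : ∀ b d : ℤ, ∑' n : ℤ, g₀ n * ∑' (x : ℤ) (y : ℤ), ENNReal.ofReal (k n b d x y)
        * (g 0 (n - (b + d) - y) * (g 2 (n - (b + d) - x) * g 4 (x + y - n + (b + d))))
      ≤ C * n2 g₀ * (n2 (g 0) * n2 (g 2) * n2 (g 4)) := by
    intro b d
    set G : ℤ → ℤ × ℤ → ℝ≥0∞ := fun n p =>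
      g 0 (n - (b + d) - p.2) * (g 2 (n - (b + d) - p.1) * g 4 (p.1 + p.2 - n + (b + d))) with hG
    have h1 : ∀ n, ∑' (x : ℤ) (y : ℤ), ENNReal.ofReal (k n b d x y)
        * (g 0 (n - (b + d) - y) * (g 2 (n - (b + d) - x) * g 4 (x + y - n + (b + d))))
        ≤ C * n2 (G n) := by
      intro n
      rw [← ENNReal.tsum_prod (f := fun x y => ENNReal.ofReal (k n b d x y)
        * (g 0 (n - (b + d) - y) * (g 2 (n - (b + d) - x) * g 4 (x + y - n + (b + d)))))]
      refine (tsum_mul_le_n2 (fun p : ℤ × ℤ => ENNReal.ofReal (k n b d p.1 p.2)) (G n)).trans ?_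
      gcongr
      exact hk n b d
    have h2 : n2 (fun n => n2 (G n)) ≤ n2 (g 0) * n2 (g 2) * n2 (g 4) := by
      apply n2_le_of_sq_le
      simp_rw [n2_sq, mul_pow, n2_sq, hG, mul_pow]
      have e1 : ∀ n, ∑' p : ℤ × ℤ, g 0 (n - (b + d) - p.2) ^ 2
          * (g 2 (n - (b + d) - p.1) ^ 2 * g 4 (p.1 + p.2 - n + (b + d)) ^ 2)
          = ∑' (x : ℤ) (u : ℤ), g 0 u ^ 2 * (g 2 (n - (b + d) - x) ^ 2 * g 4 (x - u) ^ 2) := by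
        intro n
        rw [ENNReal.tsum_prod (f := fun x y => g 0 (n - (b + d) - y) ^ 2
          * (g 2 (n - (b + d) - x) ^ 2 * g 4 (x + y - n + (b + d)) ^ 2))]
        refine tsum_congr fun x => ?_
        rw [← (Equiv.subLeft (n - (b + d))).tsum_eq]
        refine tsum_congr fun u => ?_
        simp only [Equiv.subLeft_apply]
        rw [show n - (b + d) - (n - (b + d) - u) = u by ring,
          show x + (n - (b + d) - u) - n + (b + d) = x - u by ring]
      simp_rw [e1]
      rw [ENNReal.tsum_comm]
      have e2 : ∀ x : ℤ, ∑' (n : ℤ) (u : ℤ), g 0 u ^ 2 * (g 2 (n - (b + d) - x) ^ 2 * g 4 (x - u) ^ 2)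
          = (∑' u, g 0 u ^ 2 * g 4 (x - u) ^ 2) * ∑' n, g 2 n ^ 2 := by
        intro x
        rw [← (Equiv.subRight (b + d + x)).tsum_eq fun n => g 2 n ^ 2, ← ENNReal.tsum_mul_left]
        refine tsum_congr fun n => ?_
        rw [← ENNReal.tsum_mul_right]
        refine tsum_congr fun u => ?_
        simp only [Equiv.subRight_apply]
        rw [show n - (b + d) - x = n - (b + d + x) by ring]
        ring
      simp_rw [e2]
      rw [ENNReal.tsum_mul_right, ENNReal.tsum_comm]
      simp_rw [ENNReal.tsum_mul_left]
      have e3 : ∀ u : ℤ, ∑' x, g 4 (x - u) ^ 2 = ∑' x, g 4 x ^ 2 := fun u =>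
        (Equiv.subRight u).tsum_eq fun x => g 4 x ^ 2
      simp_rw [e3]
      rw [ENNReal.tsum_mul_right]
      exact le_of_eq (by ring)
    calc _ ≤ ∑' n, g₀ n * (C * n2 (G n)) := ENNReal.tsum_le_tsum fun n => by gcongr; exact h1 n
      _ = C * ∑' n, g₀ n * n2 (G n) := by
          rw [← ENNReal.tsum_mul_left]; exact tsum_congr fun n => by ring
      _ ≤ C * (n2 g₀ * n2 fun n => n2 (G n)) := by gcongr; exact tsum_mul_le_n2 _ _
      _ ≤ C * (n2 g₀ * (n2 (g 0) * n2 (g 2) * n2 (g 4))) := by gcongr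
      _ = _ := by ring
  refine (tsum_mul_le_of_le (hw 1) fun b => tsum_mul_le_of_le (hw 3) fun d =>
    inner b d).trans (le_of_eq ?_)
  rw [Fin.prod_univ_five]
  push_cast
  ring

/-! ### The divisor bound -/

theorem card_divisors_le_rpow {ε : ℝ} (hε : 0 < ε) :
    ∃ C : ℝ, 0 ≤ C ∧ ∀ n : ℕ, n ≠ 0 → (n.divisors.card : ℝ) ≤ C * (n : ℝ) ^ ε := by
  have hl : 0 < Real.log 2 := Real.log_pos (by norm_num)
  set c : ℝ := 1 + 1 / (ε * Real.log 2) with hc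
  have hc1 : 1 ≤ c := by rw [hc]; have := mul_pos hε hl; linarith [one_div_pos.2 this]
  obtain ⟨N, hN⟩ := exists_nat_ge ((2 : ℝ) ^ (1 / ε))
  refine ⟨c ^ N, by positivity, fun n hn => ?_⟩
  have small : ∀ v : ℕ, ((v : ℝ) + 1) ≤ c * (2 : ℝ) ^ ((v : ℝ) * ε) := by
    intro v
    have h1 : 1 + (v : ℝ) * (ε * Real.log 2) ≤ (2 : ℝ) ^ ((v : ℝ) * ε) := by
      rw [Real.rpow_def_of_pos (by norm_num)]
      have := Real.add_one_le_exp (Real.log 2 * ((v : ℝ) * ε))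
      linarith
    have h2 : (v : ℝ) + 1 ≤ c * (1 + (v : ℝ) * (ε * Real.log 2)) := by
      have hp := mul_pos hε hl
      have : c * (1 + (v : ℝ) * (ε * Real.log 2)) = 1 + v + v * (ε * Real.log 2) + 1 / (ε * Real.log 2) := by
        rw [hc]; field_simp; ring
      rw [this]
      have : 0 ≤ (v : ℝ) * (ε * Real.log 2) := by positivity
      linarith [one_div_pos.2 hp]
    exact h2.trans (by gcongr)
  have factor : ∀ p ∈ n.primeFactors, ((n.factorization p + 1 : ℕ) : ℝ)
      ≤ (if p < N then c else 1) * (((p : ℝ) ^ (n.factorization p)) ^ ε) := by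
    intro p hp
    have hp2 : (2 : ℝ) ≤ p := by exact_mod_cast (Nat.prime_of_mem_primeFactors hp).two_le
    have e1 : ((p : ℝ) ^ (n.factorization p)) ^ ε = ((p : ℝ) ^ ε) ^ (n.factorization p) := by
      rw [← Real.rpow_natCast, ← Real.rpow_mul (by positivity), ← Real.rpow_natCast,
        ← Real.rpow_mul (by positivity), mul_comm]
    push_cast
    split_ifs with h
    · refine (small _).trans ?_
      rw [Real.rpow_mul (by norm_num), Real.rpow_natCast]
      gcongr
    · rw [one_mul, e1]
      have : (2 : ℝ) ≤ (p : ℝ) ^ ε := by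
        calc (2 : ℝ) = ((2 : ℝ) ^ (1 / ε)) ^ ε := by
              rw [← Real.rpow_mul (by norm_num), one_div_mul_cancel hε.ne', Real.rpow_one]
          _ ≤ (p : ℝ) ^ ε := by
              gcongr
              exact hN.trans (by exact_mod_cast not_lt.1 h)
      calc (n.factorization p : ℝ) + 1 ≤ (2 : ℝ) ^ (n.factorization p) := by
            exact_mod_cast Nat.lt_two_pow_self (n := n.factorization p)
        _ ≤ _ := by gcongr
  rw [Nat.card_divisors hn]
  push_cast
  calc ∏ p ∈ n.primeFactors, ((n.factorization p : ℝ) + 1)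
      ≤ ∏ p ∈ n.primeFactors, ((if p < N then c else 1) * (((p : ℝ) ^ (n.factorization p)) ^ ε)) := by
        refine Finset.prod_le_prod (fun p _ => by positivity) fun p hp => ?_
        have := factor p hp
        push_cast at this
        exact this
    _ = (∏ p ∈ n.primeFactors, if p < N then c else 1) * (n : ℝ) ^ ε := by
        rw [Finset.prod_mul_distrib, Real.finsetProd_rpow _ _ (fun p _ => by positivity)]
        congr 2
        conv_rhs => rw [← Nat.prod_factorization_pow_eq_self hn]
        rw [Finsupp.prod, Nat.support_factorization]
        push_cast
        rfl
    _ ≤ c ^ N * (n : ℝ) ^ ε := by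
        gcongr
        rw [Finset.prod_ite, Finset.prod_const, Finset.prod_const_one, mul_one]
        refine pow_le_pow_right₀ hc1 ?_
        calc _ ≤ (Finset.range N).card := Finset.card_le_card fun p hp => by
              simpa using (Finset.mem_filter.1 hp).2
          _ = N := Finset.card_range N

theorem encard_factor_pairs_le (m : ℤ) (hm : m ≠ 0) :
    ENat.card ((fun p : ℤ × ℤ => p.1 * p.2) ⁻¹' {m}) ≤ ((2 * m.natAbs.divisors.card : ℕ) : ℕ∞) := by
  classical
  set D : Finset ℤ := m.natAbs.divisors.image (fun d : ℕ => (d : ℤ))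
    ∪ m.natAbs.divisors.image (fun d : ℕ => -(d : ℤ)) with hD
  have hcard : D.card ≤ 2 * m.natAbs.divisors.card := by
    refine (Finset.card_union_le _ _).trans ?_
    rw [two_mul]
    exact add_le_add Finset.card_image_le Finset.card_image_le
  have hmem : ∀ p : ((fun p : ℤ × ℤ => p.1 * p.2) ⁻¹' {m}), p.1.1 ∈ D := by
    rintro ⟨⟨x, y⟩, h⟩
    have h' : x * y = m := h
    have hd : x.natAbs ∈ m.natAbs.divisors := by
      rw [Nat.mem_divisors]
      refine ⟨?_, by simpa using hm⟩
      rw [Int.natAbs_dvd_natAbs]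
      exact ⟨y, h'.symm⟩
    rw [hD, Finset.mem_union, Finset.mem_image, Finset.mem_image]
    rcases Int.natAbs_eq x with hx | hx
    · exact Or.inl ⟨x.natAbs, hd, hx.symm⟩
    · exact Or.inr ⟨x.natAbs, hd, hx.symm⟩
  let F : ((fun p : ℤ × ℤ => p.1 * p.2) ⁻¹' {m}) → D := fun p => ⟨p.1.1, hmem p⟩
  have hF : Function.Injective F := by
    rintro ⟨⟨x, y⟩, h⟩ ⟨⟨x', y'⟩, h'⟩ e
    have e1 : x = x' := congrArg Subtype.val e
    have h1 : x * y = m := h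
    have h2 : x' * y' = m := h'
    subst e1
    have hx : x ≠ 0 := by rintro rfl; simp at h1; exact hm h1.symm
    have : y = y' := mul_left_cancel₀ hx (h1.trans h2.symm)
    subst this
    rfl
  refine (ENat.card_le_card_of_injective hF).trans ?_
  rw [ENat.card_eq_coe_fintype_card, Fintype.card_coe]
  exact_mod_cast hcard

/-! ### The resonant kernel -/

/-- The kernel that controls nearly resonant interactions of comparable frequencies. -/
def resKernel (ε : ℝ) (n b d x y : ℤ) : ℝ :=
  if x * y = 0 then 0 else bracket (x * y) ^ (-ε)
    * bracket (2 * (x * y) + (2 * n * (b + d) - (b + d) ^ 2)) ^ (-(1 / 2 + ε))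

theorem n2_resKernel_le {ε : ℝ} (hε : 0 < ε) : ∃ C : ℝ≥0, ∀ n b d,
    n2 (fun p : ℤ × ℤ => ENNReal.ofReal (resKernel ε n b d p.1 p.2)) ≤ C := by
  obtain ⟨C, hC0, hC⟩ := card_divisors_le_rpow (ε := 2 * ε) (by linarith)
  have hsum : ∑' m, wt (-(1 + 2 * ε)) m ≠ ⊤ := tsum_wt_ne_top (by linarith)
  have fin : (ENNReal.ofReal (2 * C) * ∑' m, wt (-(1 + 2 * ε)) m) ^ (1 / 2 : ℝ) ≠ ⊤ :=
    ENNReal.rpow_ne_top_of_nonneg (by norm_num) (ENNReal.mul_ne_top ENNReal.ofReal_ne_top hsum)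
  refine ⟨((ENNReal.ofReal (2 * C) * ∑' m, wt (-(1 + 2 * ε)) m) ^ (1 / 2 : ℝ)).toNNReal,
    fun n b d => ?_⟩
  rw [ENNReal.coe_toNNReal fin]
  unfold n2
  gcongr
  set c := 2 * n * (b + d) - (b + d) ^ 2 with hcdef
  set h : ℤ → ℝ≥0∞ := fun m => if m = 0 then 0 else wt (-(2 * ε)) m * wt (-(1 + 2 * ε)) (2 * m + c)
    with hh
  have e1 : ∀ p : ℤ × ℤ, ENNReal.ofReal (resKernel ε n b d p.1 p.2) ^ 2 = h (p.1 * p.2) := by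
    intro p
    simp only [hh, resKernel, ← hcdef]
    split_ifs with h0
    · simp
    · rw [ENNReal.ofReal_mul (bracket_rpow_pos _ _).le, mul_pow]
      change wt (-ε) _ ^ 2 * wt (-(1 / 2 + ε)) _ ^ 2 = _
      rw [sq, sq, wt_mul_wt, wt_mul_wt]
      congr 2 <;> ring
  simp_rw [e1]
  rw [← ENNReal.tsum_fiberwise (fun p : ℤ × ℤ => h (p.1 * p.2)) (fun p => p.1 * p.2)]
  have e2 : ∀ m : ℤ, ∑' p : ((fun p : ℤ × ℤ => p.1 * p.2) ⁻¹' {m}), h (p.1.1 * p.1.2)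
      ≤ ENNReal.ofReal (2 * C) * wt (-(1 + 2 * ε)) (2 * m + c) := by
    intro m
    have : ∀ p : ((fun p : ℤ × ℤ => p.1 * p.2) ⁻¹' {m}), h (p.1.1 * p.1.2) = h m := fun p =>
      congrArg h p.2
    simp_rw [this, ENNReal.tsum_const]
    by_cases hm : m = 0
    · simp [hh, hm]
    · simp only [hh, hm, if_false]
      rw [← mul_assoc]
      gcongr
      calc _ ≤ ((2 * m.natAbs.divisors.card : ℕ) : ℝ≥0∞) * wt (-(2 * ε)) m := by
            gcongr
            have := encard_factor_pairs_le m hm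
            exact_mod_cast ENat.toENNReal_le.2 this
        _ ≤ ENNReal.ofReal (2 * C * bracket m ^ (2 * ε)) * wt (-(2 * ε)) m := by
            gcongr
            rw [← ENNReal.ofReal_natCast]
            apply ENNReal.ofReal_le_ofReal
            push_cast
            rw [mul_assoc]
            gcongr
            refine (hC m.natAbs (by simpa using hm)).trans ?_
            gcongr
            rw [Nat.cast_natAbs, Int.cast_abs]
            exact abs_le_bracket m
        _ = _ := by
            rw [ENNReal.ofReal_mul (by linarith), mul_assoc]
            change _ * (wt (2 * ε) m * wt (-(2 * ε)) m) = _
            rw [wt_mul_wt, add_neg_cancel, wt_zero, mul_one]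
  refine (ENNReal.tsum_le_tsum e2).trans ?_
  rw [ENNReal.tsum_mul_left]
  exact mul_le_mul' le_rfl (ENNReal.tsum_comp_le_tsum_of_injective (f := fun m : ℤ => 2 * m + c)
    (fun m m' hm => by simpa using hm) (wt (-(1 + 2 * ε))))

/-! ### Quintilinear operators -/

/-- The operator `∑_{q₁+⋯+q₅=n} K(q) ∏ f_l(q_l)` on sequences with values in `[0,∞]`. -/
def Q5 (K : (Fin 5 → ℤ) → ℝ) (f : Fin 5 → ℤ → ℝ≥0∞) (n : ℤ) : ℝ≥0∞ :=
  ∑' q : Fin 5 → ℤ, if ∑ l, q l = n then ENNReal.ofReal (K q) * ∏ l, f l (q l) else 0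

theorem FormBdd.lN_Q5_le {K : (Fin 5 → ℤ) → ℝ} {r : ℝ} {e : Fin 5 → ℝ} (hK : ∀ q, 0 ≤ K q)
    (h : FormBdd fun q => bracket (∑ l, q l) ^ r * K q * ∏ l, bracket (q l) ^ (-e l)) :
    ∃ C : ℝ≥0, ∀ f, lN r (Q5 K f) ≤ C * ∏ l, lN (e l) (f l) := by
  obtain ⟨C, hC⟩ := h
  refine ⟨C, fun f => n2_le_of_dual fun g => ?_⟩
  have key := hC g fun l n => wt (e l) n * f l n
  calc ∑' n, wt r n * Q5 K f n * g n
      = ∑' n, ∑' q : Fin 5 → ℤ, if ∑ l, q l = n then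
          wt r n * (ENNReal.ofReal (K q) * ∏ l, f l (q l)) * g n else 0 := by
        refine tsum_congr fun n => ?_
        rw [Q5, ← ENNReal.tsum_mul_left, ← ENNReal.tsum_mul_right]
        refine tsum_congr fun q => ?_
        split_ifs <;> simp
    _ = ∑' q : Fin 5 → ℤ, wt r (∑ l, q l) * (ENNReal.ofReal (K q) * ∏ l, f l (q l))
          * g (∑ l, q l) := by
        rw [ENNReal.tsum_comm]
        exact tsum_congr fun q => tsum_ite_eq' _ _
    _ = _ := ?_
    _ ≤ _ := key
    _ = _ := by ring_nf; rfl
  refine tsum_congr fun q => ?_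
  have hb := fun n r => (bracket_rpow_pos n r).le
  rw [ENNReal.ofReal_mul (mul_nonneg (hb _ _) (hK q)), ENNReal.ofReal_mul (hb _ _),
    ENNReal.ofReal_prod_of_nonneg fun l _ => hb _ _, Finset.prod_mul_distrib]
  have : (∏ l, ENNReal.ofReal (bracket (q l) ^ (-e l))) * ∏ l, wt (e l) (q l) = 1 := by
    rw [← Finset.prod_mul_distrib]
    refine Finset.prod_eq_one fun l _ => ?_
    change wt (-e l) (q l) * wt (e l) (q l) = 1
    rw [wt_mul_wt, neg_add_cancel, wt_zero]
  change wt r (∑ l, q l) * (ENNReal.ofReal (K q) * ∏ l, f l (q l)) * g (∑ l, q l) = wt r (∑ l, q l)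
    * ENNReal.ofReal (K q) * _ * _
  calc _ = wt r (∑ l, q l) * ENNReal.ofReal (K q) * (1 * (g (∑ l, q l) * ∏ l, f l (q l))) := by ring
    _ = _ := by rw [← this]; ring

/-! ### Lower bounds for the phase -/

theorem resonance_of_two_mul_le {p q x y e : ℤ} (hqp : q ≤ p) (hy : 0 ≤ y) (hsum : p + q = x + y + e)
    (he : 500 * e ≤ q) (he' : -(500 * e) ≤ q) (h : 2 * y ≤ q) :
    x * q ≤ 20 * |p ^ 2 + q ^ 2 - x ^ 2 - y ^ 2| := by
  have h0 : 0 ≤ q := by omega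
  have h1 : 49 * q ≤ 100 * (x - p) := by omega
  have h2 : x ≤ 5 * (p - y) := by omega
  have hx : q ≤ x := by omega
  have h3 : (49 * q) * x ≤ (100 * (x - p)) * (5 * (p - y)) :=
    mul_le_mul h1 h2 (by omega) (by omega)
  have h4 : q * (500 * e) ≤ q * q := mul_le_mul_of_nonneg_left he h0
  have h5 : q * q ≤ q * x := mul_le_mul_of_nonneg_left hx h0
  have hphi : -(p ^ 2 + q ^ 2 - x ^ 2 - y ^ 2) = 2 * ((x - p) * (p - y)) - 2 * (q * e) + e ^ 2 := by
    have : q = x + y + e - p := by omega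
    subst this; ring
  have h6 := neg_abs_le (p ^ 2 + q ^ 2 - x ^ 2 - y ^ 2)
  nlinarith [sq_nonneg e]

theorem resonance_of_le_two_mul {p q x y e : ℤ} (hq : 0 ≤ q) (hyx : y ≤ x)
    (hsum : p + q = x + y + e) (he : 500 * e ≤ y) (he' : -(500 * e) ≤ y) (h : 2 * q ≤ y) :
    x * y ≤ 20 * |p ^ 2 + q ^ 2 - x ^ 2 - y ^ 2| := by
  have h0 : 0 ≤ y := by omega
  have h1 : 49 * y ≤ 100 * (p - x) := by omega
  have h2 : x ≤ 5 * (p - y) := by omega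
  have h3 : (49 * y) * x ≤ (100 * (p - x)) * (5 * (p - y)) :=
    mul_le_mul h1 h2 (by omega) (by omega)
  have h4 : q * (-(500 * e)) ≤ q * y := mul_le_mul_of_nonneg_left he' hq
  have h4' : 2 * (q * y) ≤ x * y := by nlinarith
  have h5 : (500 * e) * (500 * e) ≤ y * y := by nlinarith
  have hphi : p ^ 2 + q ^ 2 - x ^ 2 - y ^ 2 = 2 * ((p - x) * (p - y)) + 2 * (q * e) - e ^ 2 := by
    have : q = x + y + e - p := by omega
    subst this; ring
  have h6 := le_abs_self (p ^ 2 + q ^ 2 - x ^ 2 - y ^ 2)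
  nlinarith

theorem resonance_of_comparable {p q x y e m : ℤ} (hq : 0 < q) (hsum : p + q = x + y + e)
    (he : 200 * e ≤ q) (he' : -(200 * e) ≤ q) (hem : e ≤ 2 * m) (hem' : -e ≤ 2 * m)
    (h3 : 10 * q ≤ x) :
    x * |p - x| ≤ |p ^ 2 + q ^ 2 - x ^ 2 - y ^ 2| ∨ x * |p - x| ≤ 8 * (q * m) := by
  by_contra hcon
  push Not at hcon
  obtain ⟨hc1, hc2⟩ := hcon
  have hphi : p ^ 2 + q ^ 2 - x ^ 2 - y ^ 2 = 2 * ((p - x) * (p - y)) + 2 * (q * e) - e ^ 2 := by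
    have : q = x + y + e - p := by omega
    subst this; ring
  have h4 : 8 * x ≤ 10 * (p - y) := by omega
  have hB := abs_nonneg (p - x)
  have h5 : |p - x| * (8 * x) ≤ |p - x| * (10 * (p - y)) := mul_le_mul_of_nonneg_left h4 hB
  have h6 : 2 * (|p - x| * (p - y)) = |2 * ((p - x) * (p - y))| := by
    rw [abs_mul, abs_mul, abs_of_nonneg (show 0 ≤ p - y by omega)]; norm_num
  have h7 : |2 * ((p - x) * (p - y))| ≤ |p ^ 2 + q ^ 2 - x ^ 2 - y ^ 2| + |2 * (q * e) - e ^ 2| := by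
    rw [hphi]
    have := abs_sub (2 * ((p - x) * (p - y)) + 2 * (q * e) - e ^ 2) (2 * (q * e) - e ^ 2)
    calc _ = |(2 * ((p - x) * (p - y)) + 2 * (q * e) - e ^ 2) - (2 * (q * e) - e ^ 2)| := by
          congr 1; ring
      _ ≤ _ := this
  have h8 : |2 * (q * e) - e ^ 2| ≤ 3 * (q * (2 * m)) := by
    have e1 : 2 * (q * e) - e ^ 2 = e * (2 * q - e) := by ring
    rw [e1, abs_mul]
    have e2 : |e| ≤ 2 * m := abs_le.2 ⟨by omega, hem⟩
    have e3 : |2 * q - e| ≤ 3 * q := abs_le.2 ⟨by omega, by omega⟩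
    calc |e| * |2 * q - e| ≤ (2 * m) * (3 * q) := mul_le_mul e2 e3 (abs_nonneg _) (by omega)
      _ = _ := by ring
  nlinarith

theorem nonresonance {a b c e : ℤ} (ha : 0 < a) (hb : 0 < b) (hc : 0 ≤ c)
    (he' : -(500 * e) ≤ a) (hf' : -(500 * e) ≤ b) :
    a * b + c * (a + b) ≤ |(a + b + c + e) ^ 2 - a ^ 2 - b ^ 2 - c ^ 2| := by
  have hphi : (a + b + c + e) ^ 2 - a ^ 2 - b ^ 2 - c ^ 2
      = 2 * (a * b + c * (a + b)) + 2 * (e * (a + b + c)) + e ^ 2 := by ring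
  rw [hphi]
  refine le_trans ?_ (le_abs_self _)
  have h1 : b * (-(500 * e)) ≤ b * a := mul_le_mul_of_nonneg_left he' hb.le
  have h2 : a * (-(500 * e)) ≤ a * b := mul_le_mul_of_nonneg_left hf' ha.le
  have h3 : c * (-(500 * e)) ≤ c * a := mul_le_mul_of_nonneg_left he' hc
  nlinarith [mul_pos ha hb, mul_nonneg hc hb.le, sq_nonneg e]

/-! ### Logarithms of brackets -/

/-- `log ⟨n⟩`. -/
def lb (n : ℤ) : ℝ := Real.log (bracket n)

/-- A large constant for comparisons of logarithms. -/
def kap : ℝ := Real.log 10000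

theorem kap_pos : 0 < kap := Real.log_pos (by norm_num)

theorem lb_nonneg (n : ℤ) : 0 ≤ lb n := Real.log_nonneg (one_le_bracket n)

theorem bracket_rpow (n : ℤ) (r : ℝ) : bracket n ^ r = Real.exp (r * lb n) := by
  rw [Real.rpow_def_of_pos (bracket_pos n), mul_comm]; rfl

theorem bracket_eq_exp (n : ℤ) : bracket n = Real.exp (lb n) := by
  rw [lb, Real.exp_log (bracket_pos n)]

theorem lb_neg (n : ℤ) : lb (-n) = lb n := by simp [lb, bracket_neg]

theorem lb_le_of_bracket_le {a b : ℤ} (h : bracket a ≤ 10000 * bracket b) : lb a ≤ kap + lb b := by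
  unfold lb kap
  rw [← Real.log_mul (by norm_num) (bracket_pos b).ne']
  exact Real.log_le_log (bracket_pos a) h

theorem lb_le {a b : ℤ} (h : |a| ≤ 10000 * |b|) : lb a ≤ kap + lb b := by
  apply lb_le_of_bracket_le
  unfold bracket
  rw [Real.sqrt_le_left (by positivity), mul_pow, Real.sq_sqrt (by positivity)]
  have h' : |(a : ℝ)| ≤ 10000 * |(b : ℝ)| := by exact_mod_cast h
  have : |(a : ℝ)| ^ 2 ≤ (10000 * |(b : ℝ)|) ^ 2 := by gcongr
  rw [sq_abs, mul_pow, sq_abs] at this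
  nlinarith [sq_nonneg (b : ℝ)]

theorem bracket_le_two_mul {a : ℤ} (ha : a ≠ 0) : bracket a ≤ 2 * |(a : ℝ)| := by
  have h1 : (1 : ℝ) ≤ |(a : ℝ)| := by exact_mod_cast Int.one_le_abs ha
  linarith [bracket_le a]

theorem lb_add_le {a b : ℤ} {Ψ : ℝ} (ha : a ≠ 0) (hb : b ≠ 0)
    (h : |(a : ℝ)| * |(b : ℝ)| ≤ 2500 * Ψ) : lb a + lb b ≤ kap + Real.log Ψ := by
  have h1 : 1 ≤ |(a : ℝ)| * |(b : ℝ)| := by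
    rw [← abs_mul]; exact_mod_cast Int.one_le_abs (mul_ne_zero ha hb)
  have hΨ : 0 < Ψ := by linarith
  unfold lb kap
  rw [← Real.log_mul (bracket_pos a).ne' (bracket_pos b).ne', ← Real.log_mul (by norm_num) hΨ.ne']
  apply Real.log_le_log (mul_pos (bracket_pos a) (bracket_pos b))
  calc bracket a * bracket b ≤ (2 * |(a : ℝ)|) * (2 * |(b : ℝ)|) :=
        mul_le_mul (bracket_le_two_mul ha) (bracket_le_two_mul hb) (bracket_pos b).le (by positivity)
    _ ≤ _ := by linarith

/-- `|n₂| ∨ |n₄|` as an integer. -/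
def mu (q : Fin 5 → ℤ) : ℤ := max |q 1| |q 3|

theorem gaugeMax_eq (q : Fin 5 → ℤ) : gaugeMax q = (mu q : ℝ) := by
  simp [gaugeMax, mu]

theorem mu_nonneg (q : Fin 5 → ℤ) : 0 ≤ mu q := (abs_nonneg _).trans (le_max_left _ _)

/-- A positive substitute of the size of the phase. -/
def psi (q : Fin 5 → ℤ) : ℝ := 1 + (mu q : ℝ) ^ 2 + |(phase q : ℝ)|

theorem one_le_psi (q : Fin 5 → ℤ) : 1 ≤ psi q := by
  unfold psi; linarith [sq_nonneg (mu q : ℝ), abs_nonneg (phase q : ℝ)]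

theorem psi_pos (q : Fin 5 → ℤ) : 0 < psi q := lt_of_lt_of_le one_pos (one_le_psi q)

/-- `log` of `psi`. -/
def lpsi (q : Fin 5 → ℤ) : ℝ := Real.log (psi q)

theorem lpsi_nonneg (q : Fin 5 → ℤ) : 0 ≤ lpsi q := Real.log_nonneg (one_le_psi q)

theorem psi_rpow (q : Fin 5 → ℤ) (r : ℝ) : psi q ^ r = Real.exp (r * lpsi q) := by
  rw [Real.rpow_def_of_pos (psi_pos q), mul_comm]; rfl

theorem two_mul_lb_mu_le (q : Fin 5 → ℤ) : 2 * lb (mu q) ≤ lpsi q := by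
  have : 2 * lb (mu q) = Real.log (bracket (mu q) ^ 2) := by rw [Real.log_pow]; rfl
  rw [this, lpsi, bracket_sq]
  apply Real.log_le_log (by positivity)
  unfold psi
  linarith [abs_nonneg (phase q : ℝ)]

theorem lb_phase_le (q : Fin 5 → ℤ) : lb (phase q) ≤ kap + lpsi q := by
  unfold lb kap lpsi
  rw [← Real.log_mul (by norm_num) (psi_pos q).ne']
  apply Real.log_le_log (bracket_pos _)
  refine (bracket_le _).trans ?_
  unfold psi
  nlinarith [sq_nonneg (mu q : ℝ), abs_nonneg (phase q : ℝ)]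

theorem lb_add_le_lpsi {q : Fin 5 → ℤ} {a b : ℤ} (ha : a ≠ 0) (hb : b ≠ 0)
    (h : |a * b| ≤ 2500 * |phase q|) : lb a + lb b ≤ kap + lpsi q := by
  apply lb_add_le ha hb
  have : |(a : ℝ)| * |(b : ℝ)| ≤ 2500 * |(phase q : ℝ)| := by
    rw [← abs_mul]; exact_mod_cast h
  unfold psi
  nlinarith [sq_nonneg (mu q : ℝ)]

theorem lb_mul_le (a b : ℤ) : lb (a * b) ≤ lb a + lb b := by
  unfold lb
  rw [← Real.log_mul (bracket_pos a).ne' (bracket_pos b).ne']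
  apply Real.log_le_log (bracket_pos _)
  unfold bracket
  rw [← Real.sqrt_mul (by positivity)]
  apply Real.sqrt_le_sqrt
  push_cast
  nlinarith [sq_nonneg (a : ℝ), sq_nonneg (b : ℝ)]

theorem resonance_trichotomy {p q x y e m : ℤ} (hq : 0 ≤ q) (hqp : q ≤ p) (hy : 0 ≤ y) (hyx : y ≤ x)
    (hsum : p + q = x + y + e) (hem : e ≤ 2 * m) (hem' : -e ≤ 2 * m)
    (h : 1000 * m < q ∨ 1000 * m < y) :
    (x * q ≤ 20 * |p ^ 2 + q ^ 2 - x ^ 2 - y ^ 2| ∧ x * y ≤ 20 * |p ^ 2 + q ^ 2 - x ^ 2 - y ^ 2|)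
    ∨ (q < 2 * y ∧ y < 2 * q ∧ 10 * q ≤ x ∧ (x * |p - x| ≤ |p ^ 2 + q ^ 2 - x ^ 2 - y ^ 2|
        ∨ x * |p - x| ≤ 8 * (q * m)))
    ∨ (q < 2 * y ∧ y < 2 * q ∧ x < 10 * q) := by
  rcases le_or_gt (2 * y) q with h1 | h1
  · have := resonance_of_two_mul_le hqp hy hsum (by omega) (by omega) h1
    refine Or.inl ⟨this, le_trans ?_ this⟩
    exact mul_le_mul_of_nonneg_left (by omega) (by omega)
  rcases le_or_gt (2 * q) y with h2 | h2
  · have := resonance_of_le_two_mul hq hyx hsum (by omega) (by omega) h2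
    refine Or.inl ⟨le_trans ?_ this, this⟩
    exact mul_le_mul_of_nonneg_left (by omega) (by omega)
  rcases le_or_gt (10 * q) x with h3 | h3
  · exact Or.inr (Or.inl ⟨h1, h2, h3,
      resonance_of_comparable (by omega) hsum (by omega) (by omega) hem hem' h3⟩)
  · exact Or.inr (Or.inr ⟨h1, h2, h3⟩)

theorem lb_le_of_le {a b : ℤ} (h : a ≤ 10000 * b) (h' : -a ≤ 10000 * b) : lb a ≤ kap + lb b := by
  apply lb_le
  have := le_abs_self b
  exact abs_le.2 ⟨by linarith, by linarith⟩

theorem lb_le_of_le_mul {a b c : ℤ} (ha : 0 < a) (h : a ≤ 8 * (b * c)) : lb a ≤ kap + lb b + lb c := by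
  unfold lb kap
  rw [← Real.log_mul (by norm_num) (bracket_pos b).ne',
    ← Real.log_mul (mul_pos (by norm_num) (bracket_pos b)).ne' (bracket_pos c).ne']
  apply Real.log_le_log (bracket_pos a)
  have h1 := bracket_le_two_mul ha.ne'
  rw [abs_of_pos (by exact_mod_cast ha)] at h1
  have h2 : (a : ℝ) ≤ 8 * ((b : ℝ) * c) := by exact_mod_cast h
  have h3 : (b : ℝ) * c ≤ bracket b * bracket c := by
    calc (b : ℝ) * c ≤ |(b : ℝ) * c| := le_abs_self _
      _ = |(b : ℝ)| * |(c : ℝ)| := abs_mul _ _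
      _ ≤ _ := mul_le_mul (abs_le_bracket b) (abs_le_bracket c) (abs_nonneg _) (bracket_pos b).le
  nlinarith [mul_pos (bracket_pos b) (bracket_pos c)]

/-- Consequences of the trichotomy in the comparable case, when the frequency differences are
`p - x` (exact) and `y - q` (up to `e`). -/
theorem comparable_cases {p q x y e m Φ : ℤ} (hq : 0 < q) (hm : 0 ≤ m)
    (hsum : p + q = x + y + e) (hem : e ≤ 2 * m) (hem' : -e ≤ 2 * m) (h3 : 10 * q ≤ x)
    (h : x * |p - x| ≤ |Φ| ∨ x * |p - x| ≤ 8 * (q * m)) :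
    (|y - q| ≤ 20 * m ∨ (y - q ≠ 0 ∧ |x * (y - q)| ≤ 2500 * |Φ|))
    ∧ (x * |p - x| ≤ |Φ| ∨ (|p - x| ≤ m ∧ x * |p - x| ≤ 8 * (q * m))) := by
  have hsmall : x * |p - x| ≤ 8 * (q * m) → |p - x| ≤ m := by
    intro hc
    have h4 : 10 * q * |p - x| ≤ x * |p - x| := mul_le_mul_of_nonneg_right h3 (abs_nonneg _)
    have h5 : q * (10 * |p - x|) ≤ q * (8 * m) := by linarith
    have := le_of_mul_le_mul_left h5 hq
    have := abs_nonneg (p - x)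
    omega
  have e1 : y - q = (p - x) - e := by omega
  have e2 : |y - q| ≤ |p - x| + 2 * m := by
    rw [e1]
    refine (abs_sub _ _).trans ?_
    have : |e| ≤ 2 * m := abs_le.2 ⟨by omega, hem⟩
    omega
  constructor
  · by_cases h20 : |y - q| ≤ 20 * m
    · exact Or.inl h20
    · right
      push Not at h20
      refine ⟨by intro h0; rw [h0, abs_zero] at h20; omega, ?_⟩
      rcases h with h | h
      · rw [abs_mul, abs_of_nonneg (show 0 ≤ x by omega)]
        have : |y - q| ≤ 2 * |p - x| := by omega
        calc x * |y - q| ≤ x * (2 * |p - x|) := mul_le_mul_of_nonneg_left this (by omega)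
          _ ≤ 2500 * |Φ| := by nlinarith [abs_nonneg Φ]
      · have := hsmall h
        omega
  · rcases h with h | h
    · exact Or.inl h
    · exact Or.inr ⟨hsmall h, h⟩

theorem abs_le_mu (q : Fin 5 → ℤ) : q 1 ≤ mu q ∧ -q 1 ≤ mu q ∧ q 3 ≤ mu q ∧ -q 3 ≤ mu q := by
  have h1 : |q 1| ≤ mu q := le_max_left _ _
  have h2 : |q 3| ≤ mu q := le_max_right _ _
  rw [abs_le] at h1 h2
  omega

/-- Support conditions of the first five multipliers. -/
def CondA (q : Fin 5 → ℤ) : Prop :=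
  (∑ l, q l) * q 4 < 0 ∧ (q 0 + q 4) * (q 2 + q 4) ≠ 0 ∧ 2 ^ 20 * mu q < |q 4|
    ∧ 2 ^ 20 * mu q < |∑ l, q l|

/-- Support conditions of the last two multipliers. -/
def CondB (q : Fin 5 → ℤ) : Prop :=
  0 < q 2 * q 4 ∧ (q 0 + q 2) * (q 0 + q 4) ≠ 0 ∧ 2 ^ 10 * mu q < |q 2| ∧ 2 ^ 10 * mu q < |q 4|

theorem phase_eq_of_condA {q : Fin 5 → ℤ} (hn : 0 < ∑ l, q l) (h4 : q 4 < 0) (h0 : 0 ≤ q 0)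
    (h2 : 0 ≤ q 2) : phase q = (∑ l, q l) ^ 2 + (-q 4) ^ 2 - q 0 ^ 2 - q 2 ^ 2 := by
  unfold phase
  rw [abs_of_pos hn, abs_of_neg h4, abs_of_nonneg h0, abs_of_nonneg h2]
  ring

theorem phase_eq_of_condB {q : Fin 5 → ℤ} (hn : 0 ≤ ∑ l, q l) (h4 : 0 < q 4) (h0 : q 0 ≤ 0)
    (h2 : 0 < q 2) : phase q = (∑ l, q l) ^ 2 + (-q 0) ^ 2 - q 2 ^ 2 - q 4 ^ 2 := by
  unfold phase
  rw [abs_of_nonneg hn, abs_of_pos h4, abs_of_nonpos h0, abs_of_pos h2]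
  ring

theorem facts_of_condA {q : Fin 5 → ℤ} (h : CondA q) (hn : 0 < ∑ l, q l) (h20 : |q 2| ≤ |q 0|) :
    (lb (∑ l, q l) ≤ kap + lb (q 0) ∧ lb (q 4) ≤ kap + lb (q 0)) ∧
    ((lb (∑ l, q l) + lb (q 4) ≤ kap + lpsi q
        ∧ (lb (∑ l, q l) + lb (q 0) ≤ kap + lpsi q ∨ lb (q 0) ≤ kap + lb (∑ l, q l)))
    ∨ (lb (q 0) ≤ kap + lb (∑ l, q l) ∧ lb (q 4) ≤ kap + lb (q 2) ∧ (|q 2 + q 4| ≤ 20 * mu q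
        ∨ (lb (q 0) + lb (q 2 + q 4) ≤ kap + lpsi q ∧ lb (q 2 + q 4) ≤ kap + lb (q 4))))
    ∨ (lb (∑ l, q l) ≤ kap + lb (q 2) ∧ lb (q 0 + q 4) ≤ kap + lb (∑ l, q l)
        ∧ (lb (q 0) + lb (q 0 + q 4) ≤ kap + lpsi q
          ∨ (|q 0 + q 4| ≤ 20 * mu q ∧ lb (q 0) ≤ kap + lb (∑ l, q l) + lb (mu q)
            ∧ lb (mu q) ≤ kap + lb (q 0))))
    ∨ (lb (q 0) ≤ kap + lb (∑ l, q l) ∧ lb (q 0) ≤ kap + lb (q 2) ∧ lb (q 0) ≤ kap + lb (q 4)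
        ∧ 0 ≤ q 0 ∧ 0 ≤ q 2)) := by
  obtain ⟨hs, hne, hm4, hmn⟩ := h
  have h4 : q 4 < 0 := by nlinarith
  rw [abs_of_neg h4] at hm4
  rw [abs_of_pos hn] at hmn
  obtain ⟨m1, m2, m3, m4⟩ := abs_le_mu q
  have hmu := mu_nonneg q
  have hsum : (∑ l, q l) = q 0 + q 1 + q 2 + q 3 + q 4 := Fin.sum_univ_five q
  have h0 : 0 < q 0 := by
    by_contra hc
    rw [abs_of_nonpos (not_lt.1 hc), abs_le] at h20
    omega
  rw [abs_of_pos h0, abs_le] at h20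
  rw [← lb_neg (q 4)]
  have hA1 : q 0 + q 4 ≠ 0 := left_ne_zero_of_mul hne
  set n := ∑ l, q l with hndef
  set μ := mu q
  set x := q 0
  set y := q 2
  set m := -q 4 with hm
  set e := q 1 + q 3 with he
  have hsum' : n + m = x + y + e := by omega
  refine ⟨⟨lb_le_of_le (by omega) (by omega), lb_le_of_le (by omega) (by omega)⟩, ?_⟩
  have e4 : q 4 = -m := by omega
  rw [e4] at hA1 ⊢
  rcases le_or_gt 0 y with hy | hy
  · have hph : phase q = n ^ 2 + m ^ 2 - x ^ 2 - y ^ 2 := phase_eq_of_condA hn h4 h0.le hy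
    rcases le_total m n with hmn' | hmn'
    · rcases resonance_trichotomy (p := n) (q := m) (x := x) (y := y) (e := e) (m := μ) (by omega) hmn'
        hy (by omega) hsum' (by omega) (by omega) (Or.inl (by omega)) with ⟨r1, r2⟩ | ⟨c1, c2, c3, c4⟩ | ⟨c1, c2, c3⟩
      · left
        rw [← hph] at r1 r2
        refine ⟨lb_add_le_lpsi (by omega) (by omega) ?_, Or.inr (lb_le_of_le (by omega) (by omega))⟩
        rw [abs_of_nonneg (by nlinarith)]
        have : n * m ≤ 4 * x * m := mul_le_mul_of_nonneg_right (by omega) (by omega)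
        linarith [abs_nonneg (phase q)]
      · right; left
        rw [← hph] at c4
        have := (comparable_cases (by omega) hmu hsum' (by omega) (by omega) c3 c4).1
        refine ⟨lb_le_of_le (by omega) (by omega), lb_le_of_le (by omega) (by omega), ?_⟩
        rcases this with t | ⟨t1, t2⟩
        · exact Or.inl t
        · exact Or.inr ⟨lb_add_le_lpsi h0.ne' t1 t2, lb_le_of_le (by omega) (by omega)⟩
      · right; right; right
        exact ⟨lb_le_of_le (by omega) (by omega), lb_le_of_le (by omega) (by omega),
          lb_le_of_le (by omega) (by omega), h0.le, hy⟩
    · rcases resonance_trichotomy (p := m) (q := n) (x := x) (y := y) (e := e) (m := μ) (by omega) hmn'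
        hy (by omega) (by omega) (by omega) (by omega) (Or.inl (by omega)) with ⟨r1, r2⟩ | ⟨c1, c2, c3, c4⟩ | ⟨c1, c2, c3⟩
      · left
        rw [show m ^ 2 + n ^ 2 - x ^ 2 - y ^ 2 = phase q by rw [hph]; ring] at r1 r2
        refine ⟨lb_add_le_lpsi (by omega) (by omega) ?_, Or.inl (lb_add_le_lpsi (by omega) h0.ne' ?_)⟩
        · rw [abs_of_nonneg (by nlinarith)]
          have : m * n ≤ 4 * x * n := mul_le_mul_of_nonneg_right (by omega) (by omega)
          linarith [abs_nonneg (phase q)]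
        · rw [abs_of_nonneg (by nlinarith)]
          linarith [abs_nonneg (phase q)]
      · right; right; left
        rw [show m ^ 2 + n ^ 2 - x ^ 2 - y ^ 2 = phase q by rw [hph]; ring] at c4
        have := (comparable_cases (p := m) (q := n) (x := x) (y := y) (e := e) (by omega) hmu (by omega) (by omega) (by omega) c3 c4).2
        have hab : |m - x| = |x + -m| := by rw [abs_sub_comm]; rfl
        rw [hab] at this
        refine ⟨lb_le_of_le (by omega) (by omega), lb_le_of_le (by omega) (by omega), ?_⟩
        rcases this with t | ⟨t1, t2⟩
        · left
          refine lb_add_le_lpsi h0.ne' hA1 ?_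
          rw [abs_mul, abs_of_pos h0]
          linarith [abs_nonneg (phase q)]
        · right
          refine ⟨by omega, lb_le_of_le_mul h0 ?_, lb_le_of_le (by omega) (by omega)⟩
          have : x * 1 ≤ x * |x + -m| := mul_le_mul_of_nonneg_left (Int.one_le_abs hA1) h0.le
          linarith
      · right; right; right
        exact ⟨lb_le_of_le (by omega) (by omega), lb_le_of_le (by omega) (by omega),
          lb_le_of_le (by omega) (by omega), h0.le, hy⟩
  · left
    have hph : |phase q| = |(n + m + (-y) + (-e)) ^ 2 - n ^ 2 - m ^ 2 - (-y) ^ 2| := by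
      unfold phase
      rw [← hndef, abs_of_pos hn, abs_of_neg h4, abs_of_pos h0, abs_of_neg hy, ← abs_neg]
      congr 1
      rw [show n + m + -y + -e = x by omega]
      change -(n * n - x * x - y * -y - q 4 * m) = _
      rw [e4]; ring
    have hnr := nonresonance (a := n) (b := m) (c := -y) (e := -e) (by omega) (by omega) (by omega)
      (by omega) (by omega)
    rw [← hph] at hnr
    have k1 : 0 ≤ -y * (n + m) := mul_nonneg (by omega) (by omega)
    have k2 : 0 ≤ n * m := mul_nonneg (by omega) (by omega)
    refine ⟨lb_add_le_lpsi (by omega) (by omega) ?_, ?_⟩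
    · rw [abs_of_nonneg k2]; linarith
    · rcases le_total (m + -y) n with hc | hc
      · exact Or.inr (lb_le_of_le (by omega) (by omega))
      · left
        refine lb_add_le_lpsi (by omega) h0.ne' ?_
        rw [abs_of_nonneg (mul_nonneg (by omega) (by omega))]
        have : n * x ≤ n * (3 * (m + -y)) := mul_le_mul_of_nonneg_left (by omega) (by omega)
        have k3 : 0 ≤ -y * m := mul_nonneg (by omega) (by omega)
        nlinarith

theorem facts_of_condB {q : Fin 5 → ℤ} (h : CondB q) (h4 : 0 < q 4) (h42 : q 4 ≤ q 2) :
    (lb (q 4) ≤ kap + lb (q 2) ∧ (lb (q 4) ≤ kap + lb (∑ l, q l)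
      ∨ (lb (∑ l, q l) ≤ kap + lb (q 4) ∧ lb (q 2) ≤ kap + lb (q 0)))) ∧
    ((lb (q 2) + lb (q 4) ≤ kap + lpsi q
        ∧ (lb (∑ l, q l) ≤ kap + lb (q 2) ∨ lb (∑ l, q l) ≤ kap + lb (q 0))
        ∧ ((lb (q 2) ≤ kap + lb (∑ l, q l) ∧ lb (q 0) ≤ kap + lb (∑ l, q l))
          ∨ (lb (q 0) ≤ kap + lb (q 2) ∧ lb (q 2) ≤ kap + lb (q 0)
            ∧ lb (∑ l, q l) ≤ kap + lb (q 2))))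
    ∨ (lb (q 2) ≤ kap + lb (∑ l, q l) ∧ lb (∑ l, q l) ≤ kap + lb (q 2)
        ∧ lb (q 0) ≤ kap + lb (∑ l, q l) ∧ lb (q 4) ≤ kap + lb (q 0) ∧ (|q 0 + q 4| ≤ 20 * mu q
        ∨ (lb (q 2) + lb (q 0 + q 4) ≤ kap + lpsi q ∧ lb (q 0 + q 4) ≤ kap + lb (q 4))))
    ∨ (lb (∑ l, q l) ≤ kap + lb (q 4) ∧ lb (q 4) ≤ kap + lb (∑ l, q l) ∧ lb (q 2) ≤ kap + lb (q 0)
        ∧ lb (q 0) ≤ kap + lb (q 2) ∧ lb (q 0 + q 2) ≤ kap + lb (q 4)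
        ∧ (lb (q 2) + lb (q 0 + q 2) ≤ kap + lpsi q ∨ |q 0 + q 2| ≤ 20 * mu q))
    ∨ (lb (q 2) ≤ kap + lb (∑ l, q l) ∧ lb (q 2) ≤ kap + lb (q 4) ∧ lb (q 2) ≤ kap + lb (q 0)
        ∧ lb (∑ l, q l) ≤ kap + lb (q 2) ∧ lb (q 0) ≤ kap + lb (q 2)
        ∧ q 0 ≤ 0 ∧ 0 ≤ ∑ l, q l)) := by
  obtain ⟨hs, hne, hm2, hm4⟩ := h
  have h2 : 0 < q 2 := by omega
  rw [abs_of_pos h4] at hm4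
  rw [abs_of_pos h2] at hm2
  obtain ⟨m1, m2, m3, m4⟩ := abs_le_mu q
  have hmu := mu_nonneg q
  have hsum : (∑ l, q l) = q 0 + q 1 + q 2 + q 3 + q 4 := Fin.sum_univ_five q
  have hA1 : q 0 + q 2 ≠ 0 := left_ne_zero_of_mul hne
  rw [← lb_neg (q 0)]
  set n := ∑ l, q l with hndef
  set μ := mu q
  set x := q 2
  set y := q 4
  set k := -q 0 with hk
  set e := q 1 + q 3 with he
  have e0 : q 0 = -k := by omega
  rw [e0] at hA1 ⊢
  have hsum' : n + k = x + y + e := by omega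
  constructor
  · refine ⟨lb_le_of_le (by omega) (by omega), ?_⟩
    rcases le_or_gt y n with c | c
    · exact Or.inl (lb_le_of_le (by omega) (by omega))
    rcases le_or_gt y (-n) with c' | c'
    · left
      rw [← lb_neg n]
      exact lb_le_of_le (by omega) (by omega)
    · exact Or.inr ⟨lb_le_of_le (by omega) (by omega), lb_le_of_le (by omega) (by omega)⟩
  rcases le_or_gt k 0 with hk0 | hk0
  · left
    have hph : phase q = (x + y + (-k) + e) ^ 2 - x ^ 2 - y ^ 2 - (-k) ^ 2 := by
      unfold phase
      rw [← hndef, abs_of_nonneg (show 0 ≤ n by omega), abs_of_pos h4, abs_of_pos h2,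
        abs_of_nonneg (show 0 ≤ q 0 by omega), show x + y + -k + e = n by omega, e0]
      ring
    have hnr := nonresonance (a := x) (b := y) (c := -k) (e := e) h2 h4 (by omega)
      (by omega) (by omega)
    rw [← hph] at hnr
    have k1 : 0 ≤ -k * (x + y) := mul_nonneg (by omega) (by omega)
    have k2 : 0 ≤ x * y := mul_nonneg (by omega) (by omega)
    refine ⟨lb_add_le_lpsi h2.ne' h4.ne' (by rw [abs_of_nonneg k2]; linarith), ?_,
      Or.inl ⟨lb_le_of_le (by omega) (by omega), lb_le_of_le (by omega) (by omega)⟩⟩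
    rcases le_total (-k) x with c | c
    · exact Or.inl (lb_le_of_le (by omega) (by omega))
    · right
      rw [← lb_neg k]
      exact lb_le_of_le (by omega) (by omega)
  rcases lt_or_ge n 0 with hn | hn
  · left
    have hph : phase q = (x + y + (-n) + e) ^ 2 - x ^ 2 - y ^ 2 - (-n) ^ 2 := by
      unfold phase
      rw [← hndef, abs_of_neg hn, abs_of_pos h4, abs_of_pos h2,
        abs_of_neg (show q 0 < 0 by omega), show x + y + -n + e = k by omega, ← hk, e0]
      ring
    have hnr := nonresonance (a := x) (b := y) (c := -n) (e := e) h2 h4 (by omega)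
      (by omega) (by omega)
    rw [← hph] at hnr
    have k1 : 0 ≤ -n * (x + y) := mul_nonneg (by omega) (by omega)
    have k2 : 0 ≤ x * y := mul_nonneg (by omega) (by omega)
    rw [← lb_neg n]
    refine ⟨lb_add_le_lpsi h2.ne' h4.ne' (by rw [abs_of_nonneg k2]; linarith),
      Or.inr (lb_le_of_le (by omega) (by omega)), ?_⟩
    rcases le_total x (-n) with c | c
    · exact Or.inl ⟨lb_le_of_le (by omega) (by omega), lb_le_of_le (by omega) (by omega)⟩
    · exact Or.inr ⟨lb_le_of_le (by omega) (by omega), lb_le_of_le (by omega) (by omega),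
        lb_le_of_le (by omega) (by omega)⟩
  · have hph : phase q = n ^ 2 + k ^ 2 - x ^ 2 - y ^ 2 := phase_eq_of_condB hn h4 (by omega) h2
    rcases le_total k n with hkn | hkn
    · rcases resonance_trichotomy (p := n) (q := k) (x := x) (y := y) (e := e) (m := μ) (by omega) hkn
        h4.le h42 hsum' (by omega) (by omega) (Or.inr (by omega)) with ⟨r1, r2⟩ | ⟨c1, c2, c3, c4⟩ | ⟨c1, c2, c3⟩
      · left
        rw [← hph] at r1 r2
        refine ⟨lb_add_le_lpsi h2.ne' h4.ne' ?_, Or.inl (lb_le_of_le (by omega) (by omega)),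
          Or.inl ⟨lb_le_of_le (by omega) (by omega), lb_le_of_le (by omega) (by omega)⟩⟩
        rw [abs_of_nonneg (mul_nonneg (by omega) (by omega))]
        linarith [abs_nonneg (phase q)]
      · right; left
        rw [← hph] at c4
        have := (comparable_cases (by omega) hmu hsum' (by omega) (by omega) c3 c4).1
        rw [show y - k = -k + y by ring] at this
        refine ⟨lb_le_of_le (by omega) (by omega), lb_le_of_le (by omega) (by omega),
          lb_le_of_le (by omega) (by omega), lb_le_of_le (by omega) (by omega), ?_⟩
        rcases this with t | ⟨t1, t2⟩
        · exact Or.inl t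
        · exact Or.inr ⟨lb_add_le_lpsi h2.ne' t1 t2, lb_le_of_le (by omega) (by omega)⟩
      · right; right; right
        exact ⟨lb_le_of_le (by omega) (by omega), lb_le_of_le (by omega) (by omega),
          lb_le_of_le (by omega) (by omega), lb_le_of_le (by omega) (by omega),
          lb_le_of_le (by omega) (by omega), by omega, hn⟩
    · rcases resonance_trichotomy (p := k) (q := n) (x := x) (y := y) (e := e) (m := μ) (by omega) hkn
        h4.le h42 (by omega) (by omega) (by omega) (Or.inr (by omega)) with ⟨r1, r2⟩ | ⟨c1, c2, c3, c4⟩ | ⟨c1, c2, c3⟩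
      · left
        rw [show k ^ 2 + n ^ 2 - x ^ 2 - y ^ 2 = phase q by rw [hph]; ring] at r1 r2
        refine ⟨lb_add_le_lpsi h2.ne' h4.ne' ?_, Or.inl (lb_le_of_le (by omega) (by omega)),
          Or.inr ⟨lb_le_of_le (by omega) (by omega), lb_le_of_le (by omega) (by omega),
            lb_le_of_le (by omega) (by omega)⟩⟩
        rw [abs_of_nonneg (mul_nonneg (by omega) (by omega))]
        linarith [abs_nonneg (phase q)]
      · right; right; left
        rw [show k ^ 2 + n ^ 2 - x ^ 2 - y ^ 2 = phase q by rw [hph]; ring] at c4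
        have := (comparable_cases (p := k) (q := n) (x := x) (y := y) (e := e) (by omega) hmu (by omega) (by omega) (by omega) c3 c4).2
        have hab : |k - x| = |-k + x| := by rw [← abs_neg]; congr 1; ring
        rw [hab] at this
        refine ⟨lb_le_of_le (by omega) (by omega), lb_le_of_le (by omega) (by omega),
          lb_le_of_le (by omega) (by omega), lb_le_of_le (by omega) (by omega),
          lb_le_of_le (by omega) (by omega), ?_⟩
        rcases this with t | ⟨t1, t2⟩
        · left
          refine lb_add_le_lpsi h2.ne' hA1 ?_
          rw [abs_mul, abs_of_pos h2]
          linarith [abs_nonneg (phase q)]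
        · right
          omega
      · right; right; right
        exact ⟨lb_le_of_le (by omega) (by omega), lb_le_of_le (by omega) (by omega),
          lb_le_of_le (by omega) (by omega), lb_le_of_le (by omega) (by omega),
          lb_le_of_le (by omega) (by omega), by omega, hn⟩

/-! ### Base kernels -/

theorem FormBdd.neg {K : (Fin 5 → ℤ) → ℝ} (h : FormBdd K) : FormBdd fun q => K (-q) := by
  obtain ⟨C, hC⟩ := h
  refine ⟨C, fun g₀ g => ?_⟩
  have e := hC (fun n => g₀ (-n)) fun l n => g l (-n)
  simp only [n2_neg] at e
  refine le_trans (le_of_eq ?_) e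
  rw [← (Equiv.neg (Fin 5 → ℤ)).tsum_eq]
  refine tsum_congr fun q => ?_
  simp

theorem FormBdd.of_symmetric {W K : (Fin 5 → ℤ) → ℝ} {c : ℝ} (hc : 0 ≤ c) (hK : FormBdd K)
    (hK0 : ∀ q, 0 ≤ K q) (π : Equiv.Perm (Fin 5)) (hπ : ∀ q, W (fun l => q (π l)) = W q)
    (hn : ∀ q, W (-q) = W q) (P : (Fin 5 → ℤ) → Prop)
    (hP : ∀ q, W q ≤ 0 ∨ P q ∨ P (fun l => q (π l)) ∨ P (-q) ∨ P (fun l => (-q) (π l)))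
    (h : ∀ q, P q → W q ≤ c * K q) : FormBdd W := by
  refine ((hK.add (hK.perm π)).add (hK.add (hK.perm π)).neg).mono hc fun q => ?_
  have k1 := mul_nonneg hc (hK0 q)
  have k2 := mul_nonneg hc (hK0 fun l => q (π l))
  have k3 := mul_nonneg hc (hK0 (-q))
  have k4 := mul_nonneg hc (hK0 fun l => (-q) (π l))
  rcases hP q with h0 | h0 | h0 | h0 | h0
  · linarith
  · linarith [h _ h0]
  · have := h _ h0
    rw [hπ] at this
    linarith
  · have := h _ h0
    rw [hn] at this
    linarith
  · have := h _ h0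
    rw [hπ, hn] at this
    linarith

/-- Decay in the slots `2, 3, 4, 5`. -/
def kerO0 (ρ : ℝ) (q : Fin 5 → ℤ) : ℝ := Real.exp (-ρ * (lb (q 1) + lb (q 2) + lb (q 3) + lb (q 4)))

/-- Decay in the slots `1, 2, 4, 5`. -/
def kerO2 (ρ : ℝ) (q : Fin 5 → ℤ) : ℝ := Real.exp (-ρ * (lb (q 1) + lb (q 0) + lb (q 3) + lb (q 4)))

/-- Decay in the slots `1, 2, 3, 4`. -/
def kerO4 (ρ : ℝ) (q : Fin 5 → ℤ) : ℝ := Real.exp (-ρ * (lb (q 1) + lb (q 2) + lb (q 3) + lb (q 0)))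

/-- Decay in the output frequency and in the slots `2, 3, 4`. -/
def kerS0 (ρ : ℝ) (q : Fin 5 → ℤ) : ℝ :=
  Real.exp (-ρ * (lb (q 1) + lb (q 2) + lb (q 3) + lb (∑ l, q l)))

/-- Decay in the output frequency and in the slots `1, 2, 4`. -/
def kerS2 (ρ : ℝ) (q : Fin 5 → ℤ) : ℝ :=
  Real.exp (-ρ * (lb (q 1) + lb (q 0) + lb (q 3) + lb (∑ l, q l)))

/-- Decay in the slots `2, 4` and in a frequency `a`. -/
def kerT (ρ : ℝ) (q : Fin 5 → ℤ) (a : ℤ) : ℝ :=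
  Real.exp (-ρ * (lb (q 1) + lb (q 3)))
    * (Real.exp (-(2 * ρ) * lb a) + if |a| ≤ 10000 * mu q then Real.exp (-lb (mu q)) else 0)

/-- The resonant kernel with decay in the slots `2, 4`. -/
def kerR (ρ ε : ℝ) (q : Fin 5 → ℤ) (a b : ℤ) : ℝ :=
  Real.exp (-ρ * (lb (q 1) + lb (q 3))) * resKernel ε (∑ l, q l) (q 1) (q 3) a b

theorem formBdd_kerO0 {ρ : ℝ} (hρ : 1 / 2 < ρ) : FormBdd (kerO0 ρ) := by
  refine (formBdd_first hρ).mono zero_le_one fun q => le_of_eq ?_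
  simp only [kerO0, bracket_rpow, ← Real.exp_add, one_mul]
  congr 1; ring

theorem formBdd_kerO2 {ρ : ℝ} (hρ : 1 / 2 < ρ) : FormBdd (kerO2 ρ) :=
  (formBdd_kerO0 hρ).perm (Equiv.swap 0 2)

theorem formBdd_kerO4 {ρ : ℝ} (hρ : 1 / 2 < ρ) : FormBdd (kerO4 ρ) :=
  (formBdd_kerO0 hρ).perm (Equiv.swap 0 4)

theorem formBdd_kerS0 {ρ : ℝ} (hρ : 1 / 2 < ρ) : FormBdd (kerS0 ρ) := by
  refine ((formBdd_kerO0 hρ).exch 4).mono zero_le_one fun q => le_of_eq ?_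
  simp [kerS0, kerO0, exch, Function.update, lb_neg]

theorem formBdd_kerS2 {ρ : ℝ} (hρ : 1 / 2 < ρ) : FormBdd (kerS2 ρ) := by
  refine ((formBdd_kerS0 hρ).perm (Equiv.swap 0 2)).mono zero_le_one fun q => le_of_eq ?_
  simp only [kerS2, kerS0, one_mul]
  rw [Equiv.sum_comp (Equiv.swap 0 2)]
  rfl

theorem tsum_indicator_abs_le (m : ℤ) (hm : 0 ≤ m) (c : ℝ≥0∞) :
    ∑' a : ℤ, (if |a| ≤ m then c else 0) = (2 * m.toNat + 1 : ℕ) * c := by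
  rw [tsum_eq_sum (s := Finset.Icc (-m) m)]
  · rw [Finset.sum_congr rfl (g := fun _ => c), Finset.sum_const, nsmul_eq_mul, Int.card_Icc]
    · congr 2; omega
    · intro a ha
      rw [Finset.mem_Icc] at ha
      rw [if_pos (abs_le.2 ha)]
  · intro a ha
    rw [if_neg]
    rw [abs_le]
    simpa using ha

theorem formBdd_kerT02 {ρ : ℝ} (hρ : 1 / 2 < ρ) : FormBdd fun q => kerT ρ q (q 0 + q 2) := by
  have hs : ∑' m, wt (-(2 * ρ)) m ≠ ⊤ := tsum_wt_ne_top (by linarith)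
  refine (formBdd_pair hρ (k := fun a b d => Real.exp (-(2 * ρ) * lb a)
    + if |a| ≤ 10000 * max |b| |d| then Real.exp (-lb (max |b| |d|)) else 0)
    (C := (∑' m, wt (-(2 * ρ)) m).toNNReal + 20001) ?_).mono zero_le_one fun q => le_of_eq ?_
  · intro b d
    set m := max |b| |d|
    have hm : 0 ≤ m := (abs_nonneg b).trans (le_max_left _ _)
    calc _ ≤ ∑' a : ℤ, (wt (-(2 * ρ)) a
          + if |a| ≤ 10000 * m then ENNReal.ofReal (Real.exp (-lb m)) else 0) := by
          refine ENNReal.tsum_le_tsum fun a => ?_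
          refine ENNReal.ofReal_add_le.trans (add_le_add (le_of_eq ?_) (le_of_eq ?_))
          · rw [wt, bracket_rpow]
          · split_ifs <;> simp
      _ ≤ _ := by
          rw [ENNReal.tsum_add, ENNReal.coe_add, ENNReal.coe_toNNReal hs]
          gcongr
          rw [tsum_indicator_abs_le _ (by positivity), ← ENNReal.ofReal_natCast,
            ← ENNReal.ofReal_mul (by positivity)]
          rw [show ((20001 : ℝ≥0) : ℝ≥0∞) = ENNReal.ofReal 20001 by norm_num]
          apply ENNReal.ofReal_le_ofReal
          rw [Real.exp_neg, ← div_eq_mul_inv, div_le_iff₀ (Real.exp_pos _), ← bracket_eq_exp]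
          have h1 : ((10000 * m).toNat : ℝ) = 10000 * m := by
            have : ((10000 * m).toNat : ℤ) = 10000 * m := Int.toNat_of_nonneg (by positivity)
            exact_mod_cast this
          push_cast
          rw [h1]
          have h2 := abs_le_bracket m
          rw [abs_of_nonneg (by exact_mod_cast hm)] at h2
          linarith [one_le_bracket m]
  · simp only [kerT, bracket_rpow, ← Real.exp_add, one_mul, mu]
    congr 2; ring

theorem formBdd_kerT04 {ρ : ℝ} (hρ : 1 / 2 < ρ) : FormBdd fun q => kerT ρ q (q 0 + q 4) :=
  (formBdd_kerT02 hρ).perm (Equiv.swap 2 4)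

theorem formBdd_kerT24 {ρ : ℝ} (hρ : 1 / 2 < ρ) : FormBdd fun q => kerT ρ q (q 2 + q 4) := by
  refine ((formBdd_kerT02 hρ).perm (Equiv.swap 0 4)).mono zero_le_one fun q => ?_
  rw [one_mul, add_comm]
  exact le_rfl

theorem formBdd_kerRA {ρ ε : ℝ} (hρ : 1 / 2 < ρ) (hε : 0 < ε) :
    FormBdd fun q => kerR ρ ε q (q 0 + q 4) (q 2 + q 4) := by
  obtain ⟨C, hC⟩ := n2_resKernel_le hε
  refine (formBdd_res hρ hC).mono zero_le_one fun q => le_of_eq ?_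
  simp only [kerR, bracket_rpow, ← Real.exp_add, one_mul]
  congr 2; ring

theorem formBdd_kerRB {ρ ε : ℝ} (hρ : 1 / 2 < ρ) (hε : 0 < ε) :
    FormBdd fun q => kerR ρ ε q (q 4 + q 0) (q 2 + q 0) := by
  refine ((formBdd_kerRA hρ hε).perm (Equiv.swap 0 4)).mono zero_le_one fun q => le_of_eq ?_
  rw [one_mul]
  simp only [kerR]
  rw [Equiv.sum_comp (Equiv.swap 0 4)]
  rfl

/-- The sum of all base kernels. -/
def kerBase (ρ ε : ℝ) (q : Fin 5 → ℤ) : ℝ :=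
  kerO0 ρ q + kerO2 ρ q + kerO4 ρ q + kerS0 ρ q + kerS2 ρ q + kerT ρ q (q 0 + q 2)
    + kerT ρ q (q 0 + q 4) + kerT ρ q (q 2 + q 4) + kerR ρ ε q (q 0 + q 4) (q 2 + q 4)
    + kerR ρ ε q (q 4 + q 0) (q 2 + q 0)

theorem formBdd_kerBase {ρ ε : ℝ} (hρ : 1 / 2 < ρ) (hε : 0 < ε) : FormBdd (kerBase ρ ε) :=
  (((((((((formBdd_kerO0 hρ).add (formBdd_kerO2 hρ)).add (formBdd_kerO4 hρ)).add
    (formBdd_kerS0 hρ)).add (formBdd_kerS2 hρ)).add (formBdd_kerT02 hρ)).add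
    (formBdd_kerT04 hρ)).add (formBdd_kerT24 hρ)).add (formBdd_kerRA hρ hε)).add
    (formBdd_kerRB hρ hε)

theorem resKernel_nonneg (ε : ℝ) (n b d x y : ℤ) : 0 ≤ resKernel ε n b d x y := by
  unfold resKernel
  split_ifs
  · exact le_rfl
  · exact mul_nonneg (bracket_rpow_pos _ _).le (bracket_rpow_pos _ _).le

theorem kerT_nonneg (ρ : ℝ) (q : Fin 5 → ℤ) (a : ℤ) : 0 ≤ kerT ρ q a := by
  unfold kerT; split_ifs <;> positivity

theorem kerR_nonneg (ρ ε : ℝ) (q : Fin 5 → ℤ) (a b : ℤ) : 0 ≤ kerR ρ ε q a b :=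
  mul_nonneg (Real.exp_pos _).le (resKernel_nonneg _ _ _ _ _ _)

theorem le_kerBase (ρ ε : ℝ) (q : Fin 5 → ℤ) :
    kerO0 ρ q ≤ kerBase ρ ε q ∧ kerO2 ρ q ≤ kerBase ρ ε q ∧ kerO4 ρ q ≤ kerBase ρ ε q
    ∧ kerS0 ρ q ≤ kerBase ρ ε q ∧ kerS2 ρ q ≤ kerBase ρ ε q
    ∧ kerT ρ q (q 0 + q 2) ≤ kerBase ρ ε q ∧ kerT ρ q (q 0 + q 4) ≤ kerBase ρ ε q
    ∧ kerT ρ q (q 2 + q 4) ≤ kerBase ρ ε q ∧ kerR ρ ε q (q 0 + q 4) (q 2 + q 4) ≤ kerBase ρ ε q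
    ∧ kerR ρ ε q (q 4 + q 0) (q 2 + q 0) ≤ kerBase ρ ε q := by
  have h1 : 0 ≤ kerO0 ρ q := (Real.exp_pos _).le
  have h2 : 0 ≤ kerO2 ρ q := (Real.exp_pos _).le
  have h3 : 0 ≤ kerO4 ρ q := (Real.exp_pos _).le
  have h4 : 0 ≤ kerS0 ρ q := (Real.exp_pos _).le
  have h5 : 0 ≤ kerS2 ρ q := (Real.exp_pos _).le
  have t := kerT_nonneg ρ q
  have r := kerR_nonneg ρ ε q
  have t1 := t (q 0 + q 2)
  have t2 := t (q 0 + q 4)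
  have t3 := t (q 2 + q 4)
  have r1 := r (q 0 + q 4) (q 2 + q 4)
  have r2 := r (q 4 + q 0) (q 2 + q 0)
  unfold kerBase
  refine ⟨?_, ?_, ?_, ?_, ?_, ?_, ?_, ?_, ?_, ?_⟩ <;> linarith

theorem kerBase_nonneg (ρ ε : ℝ) (q : Fin 5 → ℤ) : 0 ≤ kerBase ρ ε q :=
  (Real.exp_pos _).le.trans (le_kerBase ρ ε q).1

/-- Logarithmic upper bounds by one of the base kernels. -/
def LogBase (ρ ε : ℝ) (q : Fin 5 → ℤ) (w : ℝ) : Prop :=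
  w ≤ -ρ * (lb (q 1) + lb (q 2) + lb (q 3) + lb (q 4))
  ∨ w ≤ -ρ * (lb (q 1) + lb (q 0) + lb (q 3) + lb (q 4))
  ∨ w ≤ -ρ * (lb (q 1) + lb (q 2) + lb (q 3) + lb (q 0))
  ∨ w ≤ -ρ * (lb (q 1) + lb (q 2) + lb (q 3) + lb (∑ l, q l))
  ∨ w ≤ -ρ * (lb (q 1) + lb (q 0) + lb (q 3) + lb (∑ l, q l))
  ∨ (∃ a, (a = q 0 + q 2 ∨ a = q 0 + q 4 ∨ a = q 2 + q 4) ∧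
    (w ≤ -ρ * (lb (q 1) + lb (q 3)) - (2 * ρ) * lb a
      ∨ (|a| ≤ 10000 * mu q ∧ w ≤ -ρ * (lb (q 1) + lb (q 3)) - lb (mu q))))
  ∨ (∃ a b, ((a = q 0 + q 4 ∧ b = q 2 + q 4) ∨ (a = q 4 + q 0 ∧ b = q 2 + q 0)) ∧ a * b ≠ 0 ∧
    2 * (a * b) + (2 * (∑ l, q l) * (q 1 + q 3) - (q 1 + q 3) ^ 2) = phase q ∧
    w ≤ -ρ * (lb (q 1) + lb (q 3)) - ε * (lb a + lb b) - (1 / 2 + ε) * lb (phase q))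

theorem LogBase.exp_le {ρ ε : ℝ} (hε : 0 ≤ ε) {q : Fin 5 → ℤ} {w c : ℝ} (h : LogBase ρ ε q (w - c)) :
    Real.exp w ≤ Real.exp c * kerBase ρ ε q := by
  obtain ⟨k1, k2, k3, k4, k5, k6, k7, k8, k9, k10⟩ := le_kerBase ρ ε q
  suffices hh : Real.exp (w - c) ≤ kerBase ρ ε q by
    calc Real.exp w = Real.exp c * Real.exp (w - c) := by rw [← Real.exp_add]; congr 1; ring
      _ ≤ _ := by gcongr
  have hT : ∀ a, (w - c ≤ -ρ * (lb (q 1) + lb (q 3)) - (2 * ρ) * lb a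
      ∨ (|a| ≤ 10000 * mu q ∧ w - c ≤ -ρ * (lb (q 1) + lb (q 3)) - lb (mu q))) →
      Real.exp (w - c) ≤ kerT ρ q a := by
    rintro a (h | ⟨h, h'⟩)
    · refine (Real.exp_le_exp.2 h).trans ?_
      rw [sub_eq_add_neg, Real.exp_add, kerT, neg_mul]
      gcongr
      rw [neg_mul]
      split_ifs
      · linarith [Real.exp_pos (-lb (mu q))]
      · linarith
    · refine (Real.exp_le_exp.2 h').trans ?_
      rw [sub_eq_add_neg, Real.exp_add, kerT, neg_mul, if_pos h]
      gcongr
      linarith [Real.exp_pos (-(2 * ρ) * lb a)]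
  rcases h with h | h | h | h | h | ⟨a, ha, h⟩ | ⟨a, b, ha, hab, hph, h⟩
  · exact (Real.exp_le_exp.2 h).trans k1
  · exact (Real.exp_le_exp.2 h).trans k2
  · exact (Real.exp_le_exp.2 h).trans k3
  · exact (Real.exp_le_exp.2 h).trans k4
  · exact (Real.exp_le_exp.2 h).trans k5
  · have := hT a h
    rcases ha with rfl | rfl | rfl
    · exact this.trans k6
    · exact this.trans k7
    · exact this.trans k8
  · have : Real.exp (w - c) ≤ kerR ρ ε q a b := by
      refine (Real.exp_le_exp.2 h).trans ?_
      rw [kerR, resKernel, if_neg hab, hph, bracket_rpow, bracket_rpow, ← Real.exp_add, ← Real.exp_add]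
      apply Real.exp_le_exp.2
      have := mul_le_mul_of_nonneg_left (lb_mul_le a b) hε
      linarith
    rcases ha with ⟨rfl, rfl⟩ | ⟨rfl, rfl⟩
    · exact this.trans k9
    · exact this.trans k10

/-! ### Pointwise bounds of the multipliers by the base kernels -/

theorem affine_le {f g : ℝ → ℝ}
    (hlin : ∀ d, f d - g d = (1 - 4 * d) * (f 0 - g 0) + 4 * d * (f (1 / 4) - g (1 / 4)))
    (hf0 : f 0 ≤ g 0) (hf1 : f (1 / 4) ≤ g (1 / 4)) (δ : ℝ) (h0 : 0 ≤ δ) (h1 : δ ≤ 1 / 4) : f δ ≤ g δ := by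
  have := hlin δ
  nlinarith

theorem lb_add_le_of_le {a b : ℤ} {c : ℝ} (ha : lb a ≤ c) (hb : lb b ≤ c) : lb (a + b) ≤ kap + c := by
  unfold lb kap at *
  rw [Real.log_le_iff_le_exp (bracket_pos _)] at *
  rw [Real.exp_add, Real.exp_log (by norm_num)]
  linarith [bracket_add_le a b, Real.exp_pos c]

theorem sq_le_of_lb_le {a : ℤ} {c : ℝ} (h : lb a ≤ c) : 1 + (a : ℝ) ^ 2 ≤ Real.exp (2 * c) := by
  rw [← bracket_sq, two_mul, Real.exp_add, ← sq]
  have : bracket a ≤ Real.exp c := by rw [bracket_eq_exp]; exact Real.exp_le_exp.2 h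
  have := bracket_pos a
  gcongr

theorem lpsi_le {q : Fin 5 → ℤ} {c : ℝ} (hn : lb (∑ l, q l) ≤ c) (h0 : lb (q 0) ≤ c)
    (h2 : lb (q 2) ≤ c) (h4 : lb (q 4) ≤ c) (hm : lb (mu q) ≤ c) : lpsi q ≤ kap + 2 * c := by
  unfold lpsi kap
  rw [Real.log_le_iff_le_exp (psi_pos q), Real.exp_add, Real.exp_log (by norm_num)]
  have e1 := sq_le_of_lb_le hn
  have e2 := sq_le_of_lb_le h0
  have e3 := sq_le_of_lb_le h2
  have e4 := sq_le_of_lb_le h4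
  have e5 := sq_le_of_lb_le hm
  have hp : |(phase q : ℝ)| ≤ ((∑ l, q l : ℤ) : ℝ) ^ 2 + (q 0 : ℝ) ^ 2 + (q 2 : ℝ) ^ 2 + (q 4 : ℝ) ^ 2 := by
    have ab : ∀ x : ℤ, abs (x * |x|) = x ^ 2 := fun x => by rw [abs_mul, abs_abs, ← sq, sq_abs]
    have : |phase q| ≤ (∑ l, q l) ^ 2 + q 0 ^ 2 + q 2 ^ 2 + q 4 ^ 2 := by
      unfold phase
      refine (abs_sub _ _).trans ?_
      rw [ab]
      gcongr
      refine (abs_sub _ _).trans ?_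
      rw [ab]
      gcongr
      refine (abs_sub _ _).trans ?_
      rw [ab, ab]
    exact_mod_cast this
  unfold psi
  linarith [Real.exp_pos (2 * c)]

theorem lb_mu_le {q : Fin 5 → ℤ} {a : ℤ} (h : mu q ≤ |a|) : lb (mu q) ≤ kap + lb a := by
  apply lb_le
  rw [abs_of_nonneg (mu_nonneg q)]
  linarith [abs_nonneg a]

theorem logBase_of_condA (δ : ℝ) (hδ : 0 ≤ δ) (hδ' : δ ≤ 1 / 4) {q : Fin 5 → ℤ} (h : CondA q)
    (hn : 0 < ∑ l, q l) (h20 : |q 2| ≤ |q 0|) :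
    LogBase (1 / 2 + δ) δ q ((1 / 2 + 2 * δ) * lb (∑ l, q l) + lb (q 4) - 1 / 2 * lpsi q
      - (1 / 2 + 2 * δ) * (lb (q 0) + lb (q 1) + lb (q 2) + lb (q 3) + lb (q 4)) - 100 * kap)
    ∧ LogBase (1 / 2 + δ) δ q ((1 / 2 + 2 * δ - 1) * lb (∑ l, q l) + lb (q 4) - (1 - δ) * lpsi q
      + max (lb (q 0)) (max (lb (q 2)) (lb (q 4)))
      - (1 / 2 + 2 * δ) * (lb (q 0) + lb (q 1) + lb (q 2) + lb (q 3) + lb (q 4)) - 100 * kap)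
    ∧ LogBase (1 / 2 + δ) δ q ((1 / 2 + 2 * δ - 1) * lb (∑ l, q l) + lb (q 4)
      - (1 / 2 + 2 * δ) * (lb (q 0) + lb (q 1) + lb (q 2) + lb (q 3) + lb (q 4)) - 100 * kap) := by
  obtain ⟨⟨f1, f2⟩, f3⟩ := facts_of_condA h hn h20
  have hκ := kap_pos
  have f4 : lb (q 2) ≤ kap + lb (q 0) := lb_le (by linarith [abs_nonneg (q 0)])
  have hM : max (lb (q 0)) (max (lb (q 2)) (lb (q 4))) ≤ kap + lb (q 0) :=
    max_le (by linarith) (max_le f4 f2)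
  have hμ := two_mul_lb_mu_le q
  have hmF : lb (mu q) ≤ kap + lb (q 4) := lb_mu_le (by have := h.2.2.1; have := mu_nonneg q; omega)
  have n0 := lb_nonneg (∑ l, q l)
  have p0 := lb_nonneg (q 0)
  have p1 := lb_nonneg (q 1)
  have p2 := lb_nonneg (q 2)
  have p3 := lb_nonneg (q 3)
  have p4 := lb_nonneg (q 4)
  have pm := lb_nonneg (mu q)
  have pP := lpsi_nonneg q
  have pA := lb_nonneg (q 0 + q 4)
  have pB := lb_nonneg (q 2 + q 4)
  set M := max (lb (q 0)) (max (lb (q 2)) (lb (q 4)))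
  have third : LogBase (1 / 2 + δ) δ q ((1 / 2 + 2 * δ - 1) * lb (∑ l, q l) + lb (q 4)
      - (1 / 2 + 2 * δ) * (lb (q 0) + lb (q 1) + lb (q 2) + lb (q 3) + lb (q 4)) - 100 * kap) := by
    refine Or.inr (Or.inr (Or.inr (Or.inl ?_)))
    revert δ; refine affine_le ?_ ?_ ?_ <;> first | (intro d; ring) | linarith
  rw [← and_assoc]
  refine ⟨?_, third⟩
  clear third
  rcases f3 with ⟨o1, o2⟩ | ⟨o1, o2, o3⟩ | ⟨o1, o2, o3⟩ | ⟨o1, o2, o3, o4, o5⟩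
  · constructor
    · left
      revert δ; refine affine_le ?_ ?_ ?_ <;> first | (intro d; ring) | linarith
    · rcases o2 with o2 | o2
      · refine Or.inr (Or.inr (Or.inr (Or.inl ?_)))
        revert δ; refine affine_le ?_ ?_ ?_ <;> first | (intro d; ring) | linarith
      · left
        revert δ; refine affine_le ?_ ?_ ?_ <;> first | (intro d; ring) | linarith
  · constructor <;> refine Or.inr (Or.inr (Or.inr (Or.inr (Or.inr (Or.inl
      ⟨q 2 + q 4, Or.inr (Or.inr rfl), ?_⟩))))) <;> rcases o3 with o3 | ⟨o3, o4⟩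
    · refine Or.inr ⟨by have := mu_nonneg q; omega, ?_⟩
      revert δ; refine affine_le ?_ ?_ ?_ <;> first | (intro d; ring) | linarith
    · left
      revert δ; refine affine_le ?_ ?_ ?_ <;> first | (intro d; ring) | linarith
    · refine Or.inr ⟨by have := mu_nonneg q; omega, ?_⟩
      revert δ; refine affine_le ?_ ?_ ?_ <;> first | (intro d; ring) | linarith
    · left
      revert δ; refine affine_le ?_ ?_ ?_ <;> first | (intro d; ring) | linarith
  · constructor <;> refine Or.inr (Or.inr (Or.inr (Or.inr (Or.inr (Or.inl
      ⟨q 0 + q 4, Or.inr (Or.inl rfl), ?_⟩))))) <;> rcases o3 with o3 | ⟨o3, o4, o5⟩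
    · left
      revert δ; refine affine_le ?_ ?_ ?_ <;> first | (intro d; ring) | linarith
    · refine Or.inr ⟨by have := mu_nonneg q; omega, ?_⟩
      revert δ; refine affine_le ?_ ?_ ?_ <;> first | (intro d; ring) | linarith
    · left
      revert δ; refine affine_le ?_ ?_ ?_ <;> first | (intro d; ring) | linarith
    · refine Or.inr ⟨by have := mu_nonneg q; omega, ?_⟩
      revert δ; refine affine_le ?_ ?_ ?_ <;> first | (intro d; ring) | linarith
  · have h4 : q 4 < 0 := by nlinarith [h.1]
    have hph := phase_eq_of_condA hn h4 o4 o5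
    have hphE : 2 * ((q 0 + q 4) * (q 2 + q 4))
        + (2 * (∑ l, q l) * (q 1 + q 3) - (q 1 + q 3) ^ 2) = phase q := by
      rw [hph, Fin.sum_univ_five]; ring
    have hP : lpsi q ≤ kap + 2 * (2 * kap + lb (q 0)) :=
      lpsi_le (by linarith) (by linarith) (by linarith) (by linarith) (by linarith)
    have hA : lb (q 0 + q 4) ≤ kap + (kap + lb (q 0)) := lb_add_le_of_le (by linarith) f2
    have hB : lb (q 2 + q 4) ≤ kap + (kap + lb (q 0)) := lb_add_le_of_le f4 f2
    have hΦ := lb_phase_le q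
    have pΦ := lb_nonneg (phase q)
    constructor <;> refine Or.inr (Or.inr (Or.inr (Or.inr (Or.inr (Or.inr
      ⟨q 0 + q 4, q 2 + q 4, Or.inl ⟨rfl, rfl⟩, h.2.1, hphE, ?_⟩))))) <;>
    · revert δ; refine affine_le ?_ ?_ ?_ <;> first | (intro d; ring) | linarith

theorem logBase_of_condB (δ : ℝ) (hδ : 0 ≤ δ) (hδ' : δ ≤ 1 / 4) {q : Fin 5 → ℤ} (h : CondB q)
    (h4 : 0 < q 4) (h42 : q 4 ≤ q 2) :
    LogBase (1 / 2 + δ) δ q ((1 / 2 + 2 * δ) * lb (∑ l, q l) + lb (q 4) - 1 / 2 * lpsi q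
      - (1 / 2 + 2 * δ) * (lb (q 0) + lb (q 1) + lb (q 2) + lb (q 3) + lb (q 4)) - 100 * kap)
    ∧ LogBase (1 / 2 + δ) δ q ((1 / 2 + 2 * δ - 1) * lb (∑ l, q l) + lb (q 4) - (1 - δ) * lpsi q
      + max (lb (q 0)) (max (lb (q 2)) (lb (q 4)))
      - (1 / 2 + 2 * δ) * (lb (q 0) + lb (q 1) + lb (q 2) + lb (q 3) + lb (q 4)) - 100 * kap)
    ∧ LogBase (1 / 2 + δ) δ q ((1 / 2 + 2 * δ - 1) * lb (∑ l, q l) + lb (q 4)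
      - (1 / 2 + 2 * δ) * (lb (q 0) + lb (q 1) + lb (q 2) + lb (q 3) + lb (q 4)) - 100 * kap) := by
  obtain ⟨⟨f1, f2⟩, f3⟩ := facts_of_condB h h4 h42
  have hκ := kap_pos
  have hM : max (lb (q 0)) (max (lb (q 2)) (lb (q 4))) ≤ kap + lb (q 0)
      ∨ max (lb (q 0)) (max (lb (q 2)) (lb (q 4))) ≤ kap + lb (q 2) := by
    rcases le_total (lb (q 0)) (lb (q 2)) with c | c
    · exact Or.inr (max_le (by linarith) (max_le (by linarith) f1))
    · exact Or.inl (max_le (by linarith) (max_le (by linarith) (by linarith)))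
  have hμ := two_mul_lb_mu_le q
  have hmF : lb (mu q) ≤ kap + lb (q 4) := lb_mu_le (by have := h.2.2.2; have := mu_nonneg q; omega)
  have n0 := lb_nonneg (∑ l, q l)
  have p0 := lb_nonneg (q 0)
  have p1 := lb_nonneg (q 1)
  have p2 := lb_nonneg (q 2)
  have p3 := lb_nonneg (q 3)
  have p4 := lb_nonneg (q 4)
  have pm := lb_nonneg (mu q)
  have pP := lpsi_nonneg q
  have pA := lb_nonneg (q 0 + q 4)
  have pB := lb_nonneg (q 0 + q 2)
  set M := max (lb (q 0)) (max (lb (q 2)) (lb (q 4)))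
  have third : LogBase (1 / 2 + δ) δ q ((1 / 2 + 2 * δ - 1) * lb (∑ l, q l) + lb (q 4)
      - (1 / 2 + 2 * δ) * (lb (q 0) + lb (q 1) + lb (q 2) + lb (q 3) + lb (q 4)) - 100 * kap) := by
    rcases f2 with f2 | ⟨f2, f2'⟩
    · refine Or.inr (Or.inr (Or.inl ?_))
      revert δ; refine affine_le ?_ ?_ ?_ <;> first | (intro d; ring) | linarith
    · refine Or.inr (Or.inr (Or.inr (Or.inl ?_)))
      revert δ; refine affine_le ?_ ?_ ?_ <;> first | (intro d; ring) | linarith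
  rw [← and_assoc]
  refine ⟨?_, third⟩
  clear third
  rcases f3 with ⟨o1, o2, o3⟩ | ⟨o1, o2, o2', o2'', o3⟩ | ⟨o1, o2, o2', o2'', o2''', o3⟩
    | ⟨o1, o2, o3, o4, o5, o6, o7⟩
  · have hfst : LogBase (1 / 2 + δ) δ q ((1 / 2 + 2 * δ) * lb (∑ l, q l) + lb (q 4) - 1 / 2 * lpsi q
      - (1 / 2 + 2 * δ) * (lb (q 0) + lb (q 1) + lb (q 2) + lb (q 3) + lb (q 4)) - 100 * kap) := by
      rcases o2 with o2 | o2
      · refine Or.inr (Or.inl ?_)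
        revert δ; refine affine_le ?_ ?_ ?_ <;> first | (intro d; ring) | linarith
      · left
        revert δ; refine affine_le ?_ ?_ ?_ <;> first | (intro d; ring) | linarith
    refine ⟨hfst, ?_⟩
    clear hfst
    rcases o3 with ⟨o3, o4⟩ | ⟨o3, o4, o5⟩
    · have hM' : M ≤ 2 * kap + lb (∑ l, q l) := by rcases hM with hM | hM <;> linarith
      rcases o2 with o2 | o2
      · refine Or.inr (Or.inl ?_)
        revert δ; refine affine_le ?_ ?_ ?_ <;> first | (intro d; ring) | linarith
      · left
        revert δ; refine affine_le ?_ ?_ ?_ <;> first | (intro d; ring) | linarith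
    · have hM' : M ≤ 2 * kap + lb (q 2) := by rcases hM with hM | hM <;> linarith
      left
      revert δ; refine affine_le ?_ ?_ ?_ <;> first | (intro d; ring) | linarith
  · have hM' : M ≤ 2 * kap + lb (∑ l, q l) := by rcases hM with hM | hM <;> linarith
    constructor <;> refine Or.inr (Or.inr (Or.inr (Or.inr (Or.inr (Or.inl
      ⟨q 0 + q 4, Or.inr (Or.inl rfl), ?_⟩))))) <;> rcases o3 with o3 | ⟨o3, o4⟩
    · refine Or.inr ⟨by have := mu_nonneg q; omega, ?_⟩
      revert δ; refine affine_le ?_ ?_ ?_ <;> first | (intro d; ring) | linarith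
    · left
      revert δ; refine affine_le ?_ ?_ ?_ <;> first | (intro d; ring) | linarith
    · refine Or.inr ⟨by have := mu_nonneg q; omega, ?_⟩
      revert δ; refine affine_le ?_ ?_ ?_ <;> first | (intro d; ring) | linarith
    · left
      revert δ; refine affine_le ?_ ?_ ?_ <;> first | (intro d; ring) | linarith
  · have hM' : M ≤ 2 * kap + lb (q 2) := by rcases hM with hM | hM <;> linarith
    constructor <;> refine Or.inr (Or.inr (Or.inr (Or.inr (Or.inr (Or.inl
      ⟨q 0 + q 2, Or.inl rfl, ?_⟩))))) <;> rcases o3 with o3 | o3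
    · left
      revert δ; refine affine_le ?_ ?_ ?_ <;> first | (intro d; ring) | linarith
    · refine Or.inr ⟨by have := mu_nonneg q; omega, ?_⟩
      revert δ; refine affine_le ?_ ?_ ?_ <;> first | (intro d; ring) | linarith
    · left
      revert δ; refine affine_le ?_ ?_ ?_ <;> first | (intro d; ring) | linarith
    · refine Or.inr ⟨by have := mu_nonneg q; omega, ?_⟩
      revert δ; refine affine_le ?_ ?_ ?_ <;> first | (intro d; ring) | linarith
  · have hM' : M ≤ 3 * kap + lb (∑ l, q l) := by rcases hM with hM | hM <;> linarith
    have hph := phase_eq_of_condB o7 h4 o6 (by omega)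
    have hphE : 2 * ((q 4 + q 0) * (q 2 + q 0))
        + (2 * (∑ l, q l) * (q 1 + q 3) - (q 1 + q 3) ^ 2) = phase q := by
      rw [hph, Fin.sum_univ_five]; ring
    have hP : lpsi q ≤ kap + 2 * (2 * kap + lb (q 2)) :=
      lpsi_le (by linarith) (by linarith) (by linarith) (by linarith) (by linarith)
    have hA : lb (q 4 + q 0) ≤ kap + (kap + lb (q 2)) := lb_add_le_of_le (by linarith) (by linarith)
    have hB : lb (q 2 + q 0) ≤ kap + (kap + lb (q 2)) := lb_add_le_of_le (by linarith) (by linarith)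
    have hΦ := lb_phase_le q
    have pΦ := lb_nonneg (phase q)
    have hne : (q 4 + q 0) * (q 2 + q 0) ≠ 0 := by
      have := h.2.1
      rwa [mul_comm, add_comm (q 4), add_comm (q 2)]
    constructor <;> refine Or.inr (Or.inr (Or.inr (Or.inr (Or.inr (Or.inr
      ⟨q 4 + q 0, q 2 + q 0, Or.inr ⟨rfl, rfl⟩, hne, hphE, ?_⟩))))) <;>
    · revert δ; refine affine_le ?_ ?_ ?_ <;> first | (intro d; ring) | linarith

/-! ### Symmetric majorants of the main multipliers -/

theorem mu_neg (q : Fin 5 → ℤ) : mu (-q) = mu q := by simp [mu]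

theorem phase_neg (q : Fin 5 → ℤ) : phase (-q) = -phase q := by
  unfold phase
  simp only [Pi.neg_apply, Finset.sum_neg_distrib, abs_neg]
  ring

theorem psi_neg (q : Fin 5 → ℤ) : psi (-q) = psi q := by
  unfold psi; rw [mu_neg, phase_neg]; simp

theorem mu_swap02 (q : Fin 5 → ℤ) : mu (fun l => q (Equiv.swap 0 2 l)) = mu q := rfl

theorem mu_swap24 (q : Fin 5 → ℤ) : mu (fun l => q (Equiv.swap 2 4 l)) = mu q := rfl

theorem phase_swap02 (q : Fin 5 → ℤ) : phase (fun l => q (Equiv.swap 0 2 l)) = phase q := by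
  unfold phase
  rw [Equiv.sum_comp (Equiv.swap 0 2)]
  change _ - q 2 * |q 2| - q 0 * |q 0| - q 4 * |q 4| = _
  ring

theorem phase_swap24 (q : Fin 5 → ℤ) : phase (fun l => q (Equiv.swap 2 4 l)) = phase q := by
  unfold phase
  rw [Equiv.sum_comp (Equiv.swap 2 4)]
  change _ - q 0 * |q 0| - q 4 * |q 4| - q 2 * |q 2| = _
  ring

open Classical in
/-- Majorant of the first five main multipliers. -/
def kerA (q : Fin 5 → ℤ) : ℝ := if CondA q then |(q 4 : ℝ)| else 0

open Classical in
/-- Majorant of the last two main multipliers. -/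
def kerB (q : Fin 5 → ℤ) : ℝ := if CondB q then min |(q 2 : ℝ)| |(q 4 : ℝ)| else 0

/-- Majorant of the main multipliers. -/
def kerM (q : Fin 5 → ℤ) : ℝ := kerA q + kerB q

theorem kerA_nonneg (q : Fin 5 → ℤ) : 0 ≤ kerA q := by unfold kerA; split_ifs <;> positivity

theorem kerB_nonneg (q : Fin 5 → ℤ) : 0 ≤ kerB q := by unfold kerB; split_ifs <;> positivity

theorem kerM_nonneg (q : Fin 5 → ℤ) : 0 ≤ kerM q := add_nonneg (kerA_nonneg q) (kerB_nonneg q)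

theorem condA_neg (q : Fin 5 → ℤ) : CondA (-q) ↔ CondA q := by
  unfold CondA
  rw [mu_neg]
  simp only [Pi.neg_apply, Finset.sum_neg_distrib, neg_mul_neg, abs_neg, ← neg_add]

theorem condB_neg (q : Fin 5 → ℤ) : CondB (-q) ↔ CondB q := by
  unfold CondB
  rw [mu_neg]
  simp only [Pi.neg_apply, neg_mul_neg, abs_neg, ← neg_add]

theorem condA_swap02 (q : Fin 5 → ℤ) : CondA (fun l => q (Equiv.swap 0 2 l)) ↔ CondA q := by
  unfold CondA
  rw [Equiv.sum_comp (Equiv.swap 0 2), mu_swap02]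
  change _ ∧ (q 2 + q 4) * (q 0 + q 4) ≠ 0 ∧ _ ↔ _
  rw [mul_comm (q 2 + q 4)]
  rfl

theorem condB_swap24 (q : Fin 5 → ℤ) : CondB (fun l => q (Equiv.swap 2 4 l)) ↔ CondB q := by
  unfold CondB
  rw [mu_swap24]
  change 0 < q 4 * q 2 ∧ (q 0 + q 4) * (q 0 + q 2) ≠ 0 ∧ 2 ^ 10 * mu q < |q 4| ∧ 2 ^ 10 * mu q < |q 2| ↔ _
  rw [mul_comm (q 0 + q 4), mul_comm (q 4), and_comm (a := 2 ^ 10 * mu q < |q 4|)]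

theorem kerA_neg (q : Fin 5 → ℤ) : kerA (-q) = kerA q := by
  unfold kerA
  by_cases h : CondA q
  · rw [if_pos h, if_pos ((condA_neg q).2 h)]; simp
  · rw [if_neg h, if_neg (mt (condA_neg q).1 h)]

theorem kerB_neg (q : Fin 5 → ℤ) : kerB (-q) = kerB q := by
  unfold kerB
  by_cases h : CondB q
  · rw [if_pos h, if_pos ((condB_neg q).2 h)]; simp
  · rw [if_neg h, if_neg (mt (condB_neg q).1 h)]

theorem kerM_neg (q : Fin 5 → ℤ) : kerM (-q) = kerM q := by
  unfold kerM; rw [kerA_neg, kerB_neg]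

theorem kerA_swap02 (q : Fin 5 → ℤ) : kerA (fun l => q (Equiv.swap 0 2 l)) = kerA q := by
  unfold kerA
  by_cases h : CondA q
  · rw [if_pos h, if_pos ((condA_swap02 q).2 h)]; rfl
  · rw [if_neg h, if_neg (mt (condA_swap02 q).1 h)]

theorem kerB_swap24 (q : Fin 5 → ℤ) : kerB (fun l => q (Equiv.swap 2 4 l)) = kerB q := by
  unfold kerB
  by_cases h : CondB q
  · rw [if_pos h, if_pos ((condB_swap24 q).2 h)]; exact min_comm _ _
  · rw [if_neg h, if_neg (mt (condB_swap24 q).1 h)]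

/-- Logarithm of the weights in the estimates of the main multipliers. -/
def logW (α β γ s : ℝ) (q : Fin 5 → ℤ) : ℝ :=
  α * lb (∑ l, q l) - β * lpsi q + γ * max (lb (q 0)) (max (lb (q 2)) (lb (q 4)))
    - s * ∑ l, lb (q l)

theorem logW_neg (α β γ s : ℝ) (q : Fin 5 → ℤ) : logW α β γ s (-q) = logW α β γ s q := by
  unfold logW lpsi
  simp only [Pi.neg_apply, Finset.sum_neg_distrib, lb_neg, psi_neg]

theorem logW_swap02 (α β γ s : ℝ) (q : Fin 5 → ℤ) :
    logW α β γ s (fun l => q (Equiv.swap 0 2 l)) = logW α β γ s q := by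
  unfold logW lpsi psi
  rw [Equiv.sum_comp (Equiv.swap 0 2), phase_swap02, mu_swap02,
    Equiv.sum_comp (Equiv.swap 0 2) (fun l => lb (q l))]
  change _ + γ * max (lb (q 2)) (max (lb (q 0)) (lb (q 4))) - _ = _
  rw [max_left_comm]

theorem logW_swap24 (α β γ s : ℝ) (q : Fin 5 → ℤ) :
    logW α β γ s (fun l => q (Equiv.swap 2 4 l)) = logW α β γ s q := by
  unfold logW lpsi psi
  rw [Equiv.sum_comp (Equiv.swap 2 4), phase_swap24, mu_swap24,
    Equiv.sum_comp (Equiv.swap 2 4) (fun l => lb (q l))]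
  change _ + γ * max (lb (q 0)) (max (lb (q 4)) (lb (q 2))) - _ = _
  rw [max_comm (lb (q 4))]

theorem formBdd_kerA {ρ δ α β γ s : ℝ} (hρ : 1 / 2 < ρ) (hδ : 0 < δ)
    (h : ∀ q, CondA q → 0 < ∑ l, q l → |q 2| ≤ |q 0| →
      LogBase ρ δ q (logW α β γ s q + lb (q 4) - 100 * kap)) :
    FormBdd fun q => kerA q * Real.exp (logW α β γ s q) := by
  refine FormBdd.of_symmetric (Real.exp_pos (100 * kap)).le (formBdd_kerBase hρ hδ)
    (kerBase_nonneg ρ δ) (Equiv.swap 0 2) (fun q => ?_) (fun q => ?_)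
    (fun q => CondA q ∧ 0 < ∑ l, q l ∧ |q 2| ≤ |q 0|) (fun q => ?_) fun q hq => ?_
  · rw [kerA_swap02, logW_swap02]
  · rw [kerA_neg, logW_neg]
  · by_cases hc : CondA q
    · right
      rw [condA_swap02, condA_neg, condA_swap02, condA_neg]
      simp only [hc, true_and, Pi.neg_apply, Finset.sum_neg_distrib, abs_neg,
        Equiv.sum_comp (Equiv.swap 0 2) q]
      change _ ∨ (_ ∧ |q 0| ≤ |q 2|) ∨ _ ∨ (_ ∧ |q 0| ≤ |q 2|)
      have hne : ∑ l, q l ≠ 0 := by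
        intro h0
        have := hc.1
        rw [h0] at this
        simp at this
      rcases lt_or_gt_of_ne hne with c | c <;> rcases le_total |q 2| |q 0| with d | d
      · exact Or.inr (Or.inr (Or.inl ⟨by omega, d⟩))
      · exact Or.inr (Or.inr (Or.inr ⟨by omega, d⟩))
      · exact Or.inl ⟨c, d⟩
      · exact Or.inr (Or.inl ⟨c, d⟩)
    · left
      simp [kerA, hc]
  · refine le_trans ?_ ((h q hq.1 hq.2.1 hq.2.2).exp_le hδ.le)
    rw [add_comm, Real.exp_add, ← bracket_eq_exp]
    gcongr
    rw [kerA, if_pos hq.1]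
    exact abs_le_bracket _

theorem formBdd_kerB {ρ δ α β γ s : ℝ} (hρ : 1 / 2 < ρ) (hδ : 0 < δ)
    (h : ∀ q, CondB q → 0 < q 4 → q 4 ≤ q 2 →
      LogBase ρ δ q (logW α β γ s q + lb (q 4) - 100 * kap)) :
    FormBdd fun q => kerB q * Real.exp (logW α β γ s q) := by
  refine FormBdd.of_symmetric (Real.exp_pos (100 * kap)).le (formBdd_kerBase hρ hδ)
    (kerBase_nonneg ρ δ) (Equiv.swap 2 4) (fun q => ?_) (fun q => ?_)
    (fun q => CondB q ∧ 0 < q 4 ∧ q 4 ≤ q 2) (fun q => ?_) fun q hq => ?_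
  · rw [kerB_swap24, logW_swap24]
  · rw [kerB_neg, logW_neg]
  · by_cases hc : CondB q
    · right
      rw [condB_swap24, condB_neg, condB_swap24, condB_neg]
      simp only [hc, true_and]
      change _ ∨ (0 < q 2 ∧ q 2 ≤ q 4) ∨ (0 < -q 4 ∧ -q 4 ≤ -q 2) ∨ (0 < -q 2 ∧ -q 2 ≤ -q 4)
      rcases pos_and_pos_or_neg_and_neg_of_mul_pos hc.1 with ⟨c, d⟩ | ⟨c, d⟩ <;> omega
    · left
      simp [kerB, hc]
  · refine le_trans ?_ ((h q hq.1 hq.2.1 hq.2.2).exp_le hδ.le)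
    rw [add_comm, Real.exp_add, ← bracket_eq_exp]
    gcongr
    rw [kerB, if_pos hq.1]
    exact (min_le_right _ _).trans (abs_le_bracket _)

theorem formBdd_kerM {δ : ℝ} (hδ : 0 < δ) (hδ' : δ ≤ 1 / 4) :
    (FormBdd fun q => kerM q * Real.exp (logW (1 / 2 + 2 * δ) (1 / 2) 0 (1 / 2 + 2 * δ) q))
    ∧ (FormBdd fun q => kerM q * Real.exp (logW (1 / 2 + 2 * δ - 1) (1 - δ) 1 (1 / 2 + 2 * δ) q))
    ∧ (FormBdd fun q => kerM q * Real.exp (logW (1 / 2 + 2 * δ - 1) 0 0 (1 / 2 + 2 * δ) q)) := by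
  have hρ : 1 / 2 < 1 / 2 + δ := by linarith
  simp only [kerM, add_mul (kerA _)]
  refine ⟨(formBdd_kerA hρ hδ fun q h1 h2 h3 => ?_).add (formBdd_kerB hρ hδ fun q h1 h2 h3 => ?_),
    (formBdd_kerA hρ hδ fun q h1 h2 h3 => ?_).add (formBdd_kerB hρ hδ fun q h1 h2 h3 => ?_),
    (formBdd_kerA hρ hδ fun q h1 h2 h3 => ?_).add (formBdd_kerB hρ hδ fun q h1 h2 h3 => ?_)⟩
  · convert (logBase_of_condA δ hδ.le hδ' h1 h2 h3).1 using 1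
    rw [logW, Fin.sum_univ_five (fun l => lb (q l))]; ring
  · convert (logBase_of_condB δ hδ.le hδ' h1 h2 h3).1 using 1
    rw [logW, Fin.sum_univ_five (fun l => lb (q l))]; ring
  · convert (logBase_of_condA δ hδ.le hδ' h1 h2 h3).2.1 using 1
    rw [logW, Fin.sum_univ_five (fun l => lb (q l))]; ring
  · convert (logBase_of_condB δ hδ.le hδ' h1 h2 h3).2.1 using 1
    rw [logW, Fin.sum_univ_five (fun l => lb (q l))]; ring
  · convert (logBase_of_condA δ hδ.le hδ' h1 h2 h3).2.2 using 1
    rw [logW, Fin.sum_univ_five (fun l => lb (q l))]; ring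
  · convert (logBase_of_condB δ hδ.le hδ' h1 h2 h3).2.2 using 1
    rw [logW, Fin.sum_univ_five (fun l => lb (q l))]; ring

/-! ### Quintilinear estimates for the main multipliers -/

theorem prod_bracket_rpow (s : ℝ) (q : Fin 5 → ℤ) :
    ∏ l, bracket (q l) ^ (-s) = Real.exp (-s * ∑ l, lb (q l)) := by
  rw [Finset.mul_sum, Real.exp_sum]
  exact Finset.prod_congr rfl fun l _ => bracket_rpow _ _

theorem prod_bracket_rpow_update (s : ℝ) (q : Fin 5 → ℤ) (b : Fin 5) :
    ∏ l, bracket (q l) ^ (-(if l = b then s - 1 else s))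
      = Real.exp (lb (q b) - s * ∑ l, lb (q l)) := by
  have h : ∀ l, bracket (q l) ^ (-(if l = b then s - 1 else s))
      = Real.exp ((if l = b then lb (q l) else 0) - s * lb (q l)) := by
    intro l
    rw [bracket_rpow]
    split_ifs <;> congr 1 <;> ring
  rw [Finset.prod_congr rfl fun l _ => h l, ← Real.exp_sum, Finset.sum_sub_distrib, Finset.mul_sum,
    Finset.sum_ite_eq' Finset.univ b, if_pos (Finset.mem_univ b)]

theorem main_estimate {s : ℝ} (hs : 1 / 2 < s) (hs1 : s ≤ 1) :
    ∃ C : ℝ≥0, ∀ f, lN s (Q5 (fun q => kerM q * psi q ^ (-(1 / 2) : ℝ)) f) ≤ C * ∏ l, lN s (f l) := by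
  have h := (formBdd_kerM (δ := (s - 1 / 2) / 2) (by linarith) (by linarith)).1
  rw [show 1 / 2 + 2 * ((s - 1 / 2) / 2) = s by ring] at h
  refine FormBdd.lN_Q5_le (e := fun _ => s)
    (fun q => mul_nonneg (kerM_nonneg q) (Real.rpow_nonneg (psi_pos q).le _)) ?_
  refine h.mono zero_le_one fun q => le_of_eq ?_
  rw [bracket_rpow, psi_rpow, prod_bracket_rpow, one_mul]
  rw [show logW s (1 / 2) 0 s q = s * lb (∑ l, q l) + (-(1 / 2) * lpsi q + -s * ∑ l, lb (q l)) by
    rw [logW]; ring, Real.exp_add, Real.exp_add]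
  ring

theorem main_estimate_low {s : ℝ} (hs : 1 / 2 < s) (hs1 : s ≤ 1) {b : Fin 5} (hb : ¬ IsGaugeSlot b) :
    ∃ C : ℝ≥0, ∀ f, lN (s - 1) (Q5 (fun q => kerM q * psi q ^ (-(1 - (s - 1 / 2) / 2))) f)
      ≤ C * ∏ l, lN (if l = b then s - 1 else s) (f l) := by
  have h := (formBdd_kerM (δ := (s - 1 / 2) / 2) (by linarith) (by linarith)).2.1
  rw [show 1 / 2 + 2 * ((s - 1 / 2) / 2) = s by ring] at h
  refine FormBdd.lN_Q5_le (e := fun l => if l = b then s - 1 else s)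
    (fun q => mul_nonneg (kerM_nonneg q) (Real.rpow_nonneg (psi_pos q).le _)) ?_
  refine h.mono zero_le_one fun q => ?_
  rw [bracket_rpow, psi_rpow, prod_bracket_rpow_update, one_mul]
  have hbm : lb (q b) ≤ max (lb (q 0)) (max (lb (q 2)) (lb (q 4))) := by
    fin_cases b
    · exact le_max_left _ _
    · exact absurd (Or.inl rfl) hb
    · exact (le_max_left _ _).trans (le_max_right _ _)
    · exact absurd (Or.inr rfl) hb
    · exact (le_max_right _ _).trans (le_max_right _ _)
  calc _ = kerM q * Real.exp ((s - 1) * lb (∑ l, q l) + -(1 - (s - 1 / 2) / 2) * lpsi q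
        + (lb (q b) - s * ∑ l, lb (q l))) := by rw [Real.exp_add, Real.exp_add]; ring
    _ ≤ _ := by
        have := kerM_nonneg q
        gcongr
        rw [logW]
        linarith

theorem main_estimate_last {s : ℝ} (hs : 1 / 2 < s) (hs1 : s ≤ 1) :
    ∃ C : ℝ≥0, ∀ f, lN (s - 1) (Q5 kerM f) ≤ C * ∏ l, lN s (f l) := by
  have h := (formBdd_kerM (δ := (s - 1 / 2) / 2) (by linarith) (by linarith)).2.2
  rw [show 1 / 2 + 2 * ((s - 1 / 2) / 2) = s by ring] at h
  refine FormBdd.lN_Q5_le (e := fun _ => s) kerM_nonneg ?_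
  refine h.mono zero_le_one fun q => le_of_eq ?_
  rw [bracket_rpow, prod_bracket_rpow, one_mul]
  rw [show logW (s - 1) 0 0 s q = (s - 1) * lb (∑ l, q l) + (-s * ∑ l, lb (q l)) by
    rw [logW]; ring, Real.exp_add]
  ring

/-! ### Bounds of the main multipliers -/

theorem eta_eq : eta = 1 / 1024 := by norm_num [eta]

theorem norm_multConst_le {σ : ℤ} (hσ : σ = 1 ∨ σ = -1) (i : Fin 7) : ‖multConst σ i‖ ≤ 4 := by
  have h1 : ‖(σ : ℂ)‖ = 1 := by rcases hσ with rfl | rfl <;> simp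
  have h2 : ‖(![-2, 2, 2, 4, 2, -2, 2] : Fin 7 → ℂ) i‖ ≤ 4 := by
    fin_cases i <;> norm_num
  rw [multConst, norm_mul, norm_mul, Complex.norm_I, h1, one_mul, one_mul]
  exact h2

theorem abs_multCore_le_of_lt {i : Fin 7} (hi : (i : ℕ) < 5) (q : Fin 5 → ℤ) :
    (multCore i q = 0 ∨ (∑ l, q l) * (q 3 + q 4) < 0) ∧ |multCore i q| ≤ 3 * |((q 3 + q 4 : ℤ) : ℝ)| := by
  have hsum : (∑ l, q l) = (q 0 + q 1 + q 2) + (q 3 + q 4) := by rw [Fin.sum_univ_five]; ring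
  set n := ∑ l, q l
  set a := q 0 + q 1 + q 2 with ha
  set b := q 3 + q 4 with hb
  have ratio : n < 0 ∧ 0 < b → 0 ≤ (n : ℝ) / (a : ℝ) ∧ (n : ℝ) / (a : ℝ) ≤ 1 := by
    rintro ⟨h1, h2⟩
    have h3 : (a : ℝ) < 0 := by exact_mod_cast (show a < 0 by omega)
    have h4 : (a : ℝ) ≤ n := by exact_mod_cast (show a ≤ n by omega)
    have h5 : (n : ℝ) < 0 := by exact_mod_cast h1
    exact ⟨div_nonneg_of_nonpos h5.le h3.le, (div_le_one_of_neg h3).2 h4⟩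
  have hnb := abs_nonneg (b : ℝ)
  have key : ∀ c : ℝ, |c| ≤ 3 → |(b : ℝ) * c| ≤ 3 * |(b : ℝ)| := by
    intro c hc
    rw [abs_mul, mul_comm]
    gcongr
  have c1 : ∀ x : ℝ, multCore i q = (if 0 < n ∧ b < 0 then (b : ℝ) else 0) →
      (multCore i q = 0 ∨ n * b < 0) ∧ |multCore i q| ≤ 3 * |(b : ℝ)| := by
    intro _ h
    rw [h]
    split_ifs with hc
    · exact ⟨Or.inr (by nlinarith), by linarith⟩
    · exact ⟨Or.inl rfl, by rw [abs_zero]; linarith⟩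
  have c2 : ∀ x : ℝ, (n < 0 ∧ 0 < b → |x| ≤ 3) → multCore i q = (if n < 0 ∧ 0 < b then (b : ℝ) * x else 0) →
      (multCore i q = 0 ∨ n * b < 0) ∧ |multCore i q| ≤ 3 * |(b : ℝ)| := by
    intro x hx h
    rw [h]
    split_ifs with hc
    · exact ⟨Or.inr (by nlinarith), key x (hx hc)⟩
    · exact ⟨Or.inl rfl, by rw [abs_zero]; linarith⟩
  fin_cases i
  · exact c1 0 rfl
  · exact c1 0 rfl
  · refine c2 (2 + (n : ℝ) / (a : ℝ)) (fun hc => ?_) rfl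
    obtain ⟨r1, r2⟩ := ratio hc
    rw [abs_of_nonneg (by linarith)]; linarith
  · refine c2 (1 + (n : ℝ) / (a : ℝ)) (fun hc => ?_) rfl
    obtain ⟨r1, r2⟩ := ratio hc
    rw [abs_of_nonneg (by linarith)]; linarith
  · refine c2 ((n : ℝ) / (a : ℝ)) (fun hc => ?_) ?_
    · obtain ⟨r1, r2⟩ := ratio hc
      rw [abs_of_nonneg (by linarith)]; linarith
    · rw [← mul_div_assoc]; rfl
  · simp at hi
  · simp at hi

theorem abs_multCore_le_of_ge {i : Fin 7} (hi : ¬ (i : ℕ) < 5) (q : Fin 5 → ℤ) :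
    (multCore i q = 0 ∨ 0 < (q 1 + q 2) * (q 3 + q 4))
      ∧ |multCore i q| ≤ |((q 1 + q 2 : ℤ) : ℝ)| ∧ |multCore i q| ≤ |((q 3 + q 4 : ℤ) : ℝ)| := by
  have hsum : q 1 + q 2 + q 3 + q 4 = (q 1 + q 2) + (q 3 + q 4) := by ring
  set a := q 1 + q 2 with ha
  set b := q 3 + q 4 with hb
  have pos : ∀ x y : ℝ, 0 < x → 0 < y → |x * y / (x + y)| ≤ |x| ∧ |x * y / (x + y)| ≤ |y| := by
    intro x y hx hy
    rw [abs_of_pos (by positivity), abs_of_pos hx, abs_of_pos hy, div_le_iff₀ (by positivity),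
      div_le_iff₀ (by positivity)]
    constructor <;> nlinarith [mul_pos hx hy]
  fin_cases i <;> try simp at hi
  · change ((if 0 < a ∧ 0 < b then (a : ℝ) * (b : ℝ) / ((q 1 + q 2 + q 3 + q 4 : ℤ) : ℝ) else 0) = 0 ∨ _)
      ∧ |(if 0 < a ∧ 0 < b then (a : ℝ) * (b : ℝ) / ((q 1 + q 2 + q 3 + q 4 : ℤ) : ℝ) else 0)| ≤ _
      ∧ |(if 0 < a ∧ 0 < b then (a : ℝ) * (b : ℝ) / ((q 1 + q 2 + q 3 + q 4 : ℤ) : ℝ) else 0)| ≤ _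
    rw [hsum]
    split_ifs with hc
    · refine ⟨Or.inr (mul_pos hc.1 hc.2), ?_⟩
      have := pos a b (by exact_mod_cast hc.1) (by exact_mod_cast hc.2)
      push_cast at this ⊢
      exact this
    · exact ⟨Or.inl rfl, by simp, by simp⟩
  · change ((if a < 0 ∧ b < 0 then (a : ℝ) * (b : ℝ) / ((q 1 + q 2 + q 3 + q 4 : ℤ) : ℝ) else 0) = 0 ∨ _)
      ∧ |(if a < 0 ∧ b < 0 then (a : ℝ) * (b : ℝ) / ((q 1 + q 2 + q 3 + q 4 : ℤ) : ℝ) else 0)| ≤ _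
      ∧ |(if a < 0 ∧ b < 0 then (a : ℝ) * (b : ℝ) / ((q 1 + q 2 + q 3 + q 4 : ℤ) : ℝ) else 0)| ≤ _
    rw [hsum]
    split_ifs with hc
    · refine ⟨Or.inr (mul_pos_of_neg_of_neg hc.1 hc.2), ?_⟩
      have := pos (-a) (-b) (by simpa using hc.1) (by simpa using hc.2)
      rw [neg_mul_neg, ← neg_add, div_neg, abs_neg, abs_neg, abs_neg] at this
      push_cast at this ⊢
      exact this
    · exact ⟨Or.inl rfl, by simp, by simp⟩

theorem not_exclA {q : Fin 5 → ℤ} (h : ¬ exclA q) :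
    (q 0 + q 4) * (q 2 + q 4) ≠ 0 ∧ 2 ^ 20 * mu q < |q 4| ∧ 2 ^ 20 * mu q < |∑ l, q l| := by
  unfold exclA at h
  push Not at h
  obtain ⟨h1, h2, -⟩ := h
  rw [gaugeMax_eq, eta_eq] at h2
  refine ⟨h1, ?_, ?_⟩
  · have := min_le_left |(q 4 : ℝ)| |((∑ l, q l : ℤ) : ℝ)|
    have h3 : (2 : ℝ) ^ 20 * (mu q : ℝ) < |(q 4 : ℝ)| := by linarith
    exact_mod_cast h3
  · have := min_le_right |(q 4 : ℝ)| |((∑ l, q l : ℤ) : ℝ)|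
    have h3 : (2 : ℝ) ^ 20 * (mu q : ℝ) < |((∑ l, q l : ℤ) : ℝ)| := by linarith
    exact_mod_cast h3

theorem not_exclB {q : Fin 5 → ℤ} (h : ¬ exclB q) :
    (q 0 + q 2) * (q 0 + q 4) ≠ 0 ∧ 2 ^ 10 * mu q < |q 2| ∧ 2 ^ 10 * mu q < |q 4| := by
  unfold exclB at h
  push Not at h
  obtain ⟨h1, h2⟩ := h
  rw [gaugeMax_eq, eta_eq] at h2
  refine ⟨h1, ?_, ?_⟩
  · have := min_le_left |(q 2 : ℝ)| |(q 4 : ℝ)|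
    have h3 : (2 : ℝ) ^ 10 * (mu q : ℝ) < |(q 2 : ℝ)| := by linarith
    exact_mod_cast h3
  · have := min_le_right |(q 2 : ℝ)| |(q 4 : ℝ)|
    have h3 : (2 : ℝ) ^ 10 * (mu q : ℝ) < |(q 4 : ℝ)| := by linarith
    exact_mod_cast h3

theorem mul_neg_of_small {n a b m : ℤ} (h : n * (a + b) < 0) (ha : a ≤ m) (ha' : -a ≤ m)
    (hb : 2 ^ 10 * m < |b|) : n * b < 0 := by
  rcases lt_trichotomy n 0 with c | c | c
  · have h1 : 0 < a + b := by nlinarith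
    have : 0 < b := by
      rcases abs_cases b with ⟨e1, e2⟩ | ⟨e1, e2⟩ <;> omega
    nlinarith
  · subst c; simp at h
  · have h1 : a + b < 0 := by nlinarith
    have : b < 0 := by
      rcases abs_cases b with ⟨e1, e2⟩ | ⟨e1, e2⟩ <;> omega
    nlinarith

theorem abs_add_le_two_mul {a b m : ℤ} (ha : a ≤ m) (ha' : -a ≤ m) (hb : 2 ^ 10 * m < |b|) :
    |a + b| ≤ 2 * |b| := by
  rcases abs_cases b with ⟨e1, e2⟩ | ⟨e1, e2⟩ <;> rcases abs_cases (a + b) with ⟨e3, e4⟩ | ⟨e3, e4⟩ <;>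
    omega

theorem abs_multCore_le_kerA {i : Fin 7} (hi : (i : ℕ) < 5) {q : Fin 5 → ℤ} (h : ¬ exclA q) :
    |multCore i q| ≤ 6 * kerM q := by
  obtain ⟨h1, h2, h3⟩ := not_exclA h
  obtain ⟨m1, m2, m3, m4⟩ := abs_le_mu q
  have hm := mu_nonneg q
  obtain ⟨c, d⟩ := abs_multCore_le_of_lt hi q
  rcases c with c | c
  · rw [c, abs_zero]
    linarith [kerM_nonneg q]
  · have hA : CondA q := ⟨mul_neg_of_small c m3 m4 (by omega), h1, h2, h3⟩
    have : |((q 3 + q 4 : ℤ) : ℝ)| ≤ 2 * |(q 4 : ℝ)| := by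
      exact_mod_cast abs_add_le_two_mul (a := q 3) (b := q 4) m3 m4 (by omega)
    have hk : kerA q = |(q 4 : ℝ)| := if_pos hA
    have := kerB_nonneg q
    unfold kerM
    linarith

theorem abs_multCore_le_kerB {i : Fin 7} (hi : ¬ (i : ℕ) < 5) {q : Fin 5 → ℤ} (h : ¬ exclB q) :
    |multCore i q| ≤ 6 * kerM q := by
  obtain ⟨h1, h2, h3⟩ := not_exclB h
  obtain ⟨m1, m2, m3, m4⟩ := abs_le_mu q
  have hm := mu_nonneg q
  obtain ⟨c, d, d'⟩ := abs_multCore_le_of_ge hi q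
  rcases c with c | c
  · rw [c, abs_zero]
    linarith [kerM_nonneg q]
  · have hB : CondB q := by
      refine ⟨?_, h1, h2, h3⟩
      have s1 := mul_neg_of_small (n := -(q 1 + q 2)) (a := q 3) (b := q 4) (by linarith) m3 m4 h3
      have s2 := mul_neg_of_small (n := -q 4) (a := q 1) (b := q 2) (by linarith) m1 m2 h2
      linarith
    have e1 : |((q 3 + q 4 : ℤ) : ℝ)| ≤ 2 * |(q 4 : ℝ)| := by
      exact_mod_cast abs_add_le_two_mul (a := q 3) (b := q 4) m3 m4 (by omega)
    have e2 : |((q 1 + q 2 : ℤ) : ℝ)| ≤ 2 * |(q 2 : ℝ)| := by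
      exact_mod_cast abs_add_le_two_mul (a := q 1) (b := q 2) m1 m2 (by omega)
    have hk : kerB q = min |(q 2 : ℝ)| |(q 4 : ℝ)| := if_pos hB
    have := kerA_nonneg q
    unfold kerM
    rw [hk]
    rcases min_cases |(q 2 : ℝ)| |(q 4 : ℝ)| with ⟨e, -⟩ | ⟨e, -⟩ <;> rw [e] <;> linarith [abs_nonneg (q 2 : ℝ), abs_nonneg (q 4 : ℝ)]

theorem norm_mult_le {σ : ℤ} (hσ : σ = 1 ∨ σ = -1) (i : Fin 7) (q : Fin 5 → ℤ) :
    ‖mult σ i q‖ ≤ 4 * |multCore i q| := by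
  rw [mult, norm_mul, Complex.norm_real, Real.norm_eq_abs]
  gcongr
  exact norm_multConst_le hσ i

theorem norm_multHat_le {σ : ℤ} (hσ : σ = 1 ∨ σ = -1) (i : Fin 7) (q : Fin 5 → ℤ) :
    ‖multHat σ i q‖ ≤ 24 * kerM q := by
  unfold multHat
  split_ifs with h
  · refine (norm_mult_le hσ i q).trans ?_
    obtain ⟨h1, -⟩ := h
    have : |multCore i q| ≤ 6 * kerM q := by
      split_ifs at h1 with hi
      · exact abs_multCore_le_kerA hi h1
      · exact abs_multCore_le_kerB hi h1
    linarith
  · rw [norm_zero]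
    linarith [kerM_nonneg q]

theorem psi_le_of_isMain {i : Fin 7} {q : Fin 5 → ℤ} (h : IsMain i q) :
    psi q ≤ 3 * |(phase q : ℝ)| := by
  have h2 := h.2
  rw [gaugeMax_eq] at h2
  have h3 : mu q ^ 2 < |phase q| := by exact_mod_cast h2
  have h4 : 1 ≤ |phase q| := by nlinarith [sq_nonneg (mu q)]
  have h5 : (1 : ℝ) ≤ |(phase q : ℝ)| := by exact_mod_cast h4
  unfold psi
  linarith

theorem psi_le_of_multHat_ne {σ : ℤ} {i : Fin 7} {q : Fin 5 → ℤ} (h : multHat σ i q ≠ 0) :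
    psi q ≤ 3 * |(phase q : ℝ)| := by
  unfold multHat at h
  split_ifs at h with hm
  · exact psi_le_of_isMain hm
  · exact absurd rfl h

/-! ### The harmless part of the multipliers -/

theorem lb_le_two {a b : ℤ} (h : |a| ≤ 2 ^ 20 * |b|) : lb a ≤ 2 * kap + lb b := by
  have h1 : lb a ≤ kap + lb (2 ^ 10 * b) := lb_le (by
    rw [abs_mul]; norm_num; linarith [abs_nonneg b])
  have h2 : lb (2 ^ 10 * b) ≤ kap + lb b := lb_le (by
    rw [abs_mul]; norm_num; linarith [abs_nonneg b])
  linarith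

theorem lb_mu_cases (q : Fin 5 → ℤ) :
    lb (mu q) = lb (q 1) ∨ lb (mu q) = lb (q 3) := by
  have ab : ∀ a : ℤ, lb |a| = lb a := fun a => by
    rcases abs_choice a with h | h <;> rw [h]
    rw [lb_neg]
  unfold mu
  rcases max_choice |q 1| |q 3| with h | h <;> rw [h, ab]
  · exact Or.inl rfl
  · exact Or.inr rfl

theorem lb_add_le_or (a b : ℤ) : lb (a + b) ≤ kap + lb a ∨ lb (a + b) ≤ kap + lb b := by
  rcases le_total (lb a) (lb b) with h | h
  · exact Or.inr (lb_add_le_of_le h le_rfl)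
  · exact Or.inl (lb_add_le_of_le le_rfl h)

theorem lb_le_lb {a b : ℤ} (h : |a| ≤ |b|) : lb a ≤ lb b :=
  Real.log_le_log (bracket_pos a) (bracket_mono h)

theorem exclA_cases {q : Fin 5 → ℤ} (h : exclA q) :
    (q 0 + q 4) * (q 2 + q 4) = 0 ∨ |q 4| ≤ 2 ^ 20 * mu q ∨ |∑ l, q l| ≤ 2 ^ 20 * mu q
    ∨ |q 0 + q 2| ≤ 2 ^ 10 * |q 1 + q 3|
    ∨ (|q 0 + q 4| ≤ 2 ^ 10 * |q 1 + q 3| ∧ |q 4| ≤ 2 * |q 0|) := by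
  unfold exclA at h
  rw [gaugeMax_eq, eta_eq] at h
  rcases h with h | h | ⟨-, -, h⟩ | ⟨-, -, h, h'⟩
  · exact Or.inl h
  · rcases min_choice |(q 4 : ℝ)| |((∑ l, q l : ℤ) : ℝ)| with e | e <;> rw [e] at h
    · right; left
      have : |(q 4 : ℝ)| ≤ 2 ^ 20 * (mu q : ℝ) := by linarith
      exact_mod_cast this
    · right; right; left
      have : |((∑ l, q l : ℤ) : ℝ)| ≤ 2 ^ 20 * (mu q : ℝ) := by linarith
      exact_mod_cast this
  · right; right; right; left
    have : |(q 0 : ℝ) + q 2| ≤ 2 ^ 10 * |(q 1 : ℝ) + q 3| := by linarith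
    exact_mod_cast this
  · right; right; right; right
    have : |(q 0 : ℝ) + q 4| ≤ 2 ^ 10 * |(q 1 : ℝ) + q 3| := by linarith
    exact ⟨by exact_mod_cast this, by exact_mod_cast h'⟩

theorem exclB_cases {q : Fin 5 → ℤ} (h : exclB q) :
    (q 0 + q 2) * (q 0 + q 4) = 0 ∨ |q 2| ≤ 2 ^ 10 * mu q ∨ |q 4| ≤ 2 ^ 10 * mu q := by
  unfold exclB at h
  rw [gaugeMax_eq, eta_eq] at h
  rcases h with h | h
  · exact Or.inl h
  · rcases min_choice |(q 2 : ℝ)| |(q 4 : ℝ)| with e | e <;> rw [e] at h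
    · right; left
      have : |(q 2 : ℝ)| ≤ 2 ^ 10 * (mu q : ℝ) := by linarith
      exact_mod_cast this
    · right; right
      have : |(q 4 : ℝ)| ≤ 2 ^ 10 * (mu q : ℝ) := by linarith
      exact_mod_cast this

theorem abs_le_of_opposite {n a b : ℤ} (h : n * b < 0) (hn : n = a + b) : |n| ≤ |a| ∧ |b| ≤ |a| := by
  rcases lt_trichotomy n 0 with c | c | c
  · have h1 : 0 < b := by nlinarith
    rw [abs_of_neg c, abs_of_pos h1, abs_of_neg (show a < 0 by omega)]
    omega
  · subst c; simp at h
  · have h1 : b < 0 := by nlinarith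
    rw [abs_of_pos c, abs_of_neg h1, abs_of_pos (show 0 < a by omega)]
    omega

theorem logBase_harmlessA (δ : ℝ) (hδ : 0 ≤ δ) (hδ' : δ ≤ 1 / 4) {q : Fin 5 → ℤ}
    (hs : (∑ l, q l) * (q 3 + q 4) < 0) (h : exclA q) :
    LogBase (1 / 2 + δ) δ q ((1 / 2 + 2 * δ) * lb (∑ l, q l) + lb (q 3 + q 4)
      - (1 / 2 + 2 * δ) * (lb (q 0) + lb (q 2) + lb (q 4))
      - (1 / 2 + 2 * δ + 1) * (lb (q 1) + lb (q 3)) - 100 * kap) := by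
  have hκ := kap_pos
  have n0 := lb_nonneg (∑ l, q l)
  have p0 := lb_nonneg (q 0)
  have p1 := lb_nonneg (q 1)
  have p2 := lb_nonneg (q 2)
  have p3 := lb_nonneg (q 3)
  have p4 := lb_nonneg (q 4)
  have pG := lb_nonneg (q 3 + q 4)
  have pm := lb_nonneg (mu q)
  have hmu := mu_nonneg q
  obtain ⟨m1, m2, m3, m4⟩ := abs_le_mu q
  have hsum : (∑ l, q l) = (q 0 + q 1 + q 2) + (q 3 + q 4) := by rw [Fin.sum_univ_five]; ring
  obtain ⟨ho1, ho2⟩ := abs_le_of_opposite hs hsum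
  have hN := lb_le_lb ho1
  have hG := lb_le_lb ho2
  have hG' := lb_add_le_or (q 3) (q 4)
  have hμ : lb (mu q) ≤ lb (q 1) + lb (q 3) := by rcases lb_mu_cases q with e | e <;> linarith
  have h012 : lb (q 0 + q 1 + q 2) ≤ 2 * kap + lb (q 1)
      ∨ lb (q 0 + q 1 + q 2) ≤ 2 * kap + lb (q 0) ∨ lb (q 0 + q 1 + q 2) ≤ 2 * kap + lb (q 2) := by
    rcases lb_add_le_or (q 0 + q 1) (q 2) with c | c
    · rcases lb_add_le_or (q 0) (q 1) with d | d
      · exact Or.inr (Or.inl (by linarith))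
      · exact Or.inl (by linarith)
    · exact Or.inr (Or.inr (by linarith))
  rcases h012 with hU | hXY
  · refine Or.inr (Or.inr (Or.inl ?_))
    rcases hG' with hG' | hG' <;>
    · revert δ; refine affine_le ?_ ?_ ?_ <;> first | (intro d; ring) | linarith
  have small : lb (q 3 + q 4) ≤ 4 * kap + (lb (q 1) + lb (q 3)) → LogBase (1 / 2 + δ) δ q
      ((1 / 2 + 2 * δ) * lb (∑ l, q l) + lb (q 3 + q 4)
      - (1 / 2 + 2 * δ) * (lb (q 0) + lb (q 2) + lb (q 4))
      - (1 / 2 + 2 * δ + 1) * (lb (q 1) + lb (q 3)) - 100 * kap) := by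
    intro hsm
    rcases hXY with hX | hY
    · left
      revert δ; refine affine_le ?_ ?_ ?_ <;> first | (intro d; ring) | linarith
    · refine Or.inr (Or.inl ?_)
      revert δ; refine affine_le ?_ ?_ ?_ <;> first | (intro d; ring) | linarith
  rcases le_or_gt |q 4| (2 ^ 20 * mu q) with hb1 | hb1
  · apply small
    have : lb (q 4) ≤ 2 * kap + lb (mu q) := lb_le_two (by rwa [abs_of_nonneg hmu])
    rcases hG' with hG' | hG' <;> linarith
  clear small
  have hn4 : (∑ l, q l) * q 4 < 0 := mul_neg_of_small hs m3 m4 (by omega)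
  have hmF : lb (mu q) ≤ kap + lb (q 4) := lb_mu_le (by omega)
  have hGF : lb (q 3 + q 4) ≤ kap + lb (q 4) := lb_le (by
    have := abs_add_le_two_mul (a := q 3) (b := q 4) m3 m4 (by omega)
    linarith [abs_nonneg (q 4)])
  have h02 : |q 4| ≤ 2 * |q 0 + q 2| := by
    have e : (∑ l, q l) = (q 0 + q 1 + q 2 + q 3) + q 4 := by rw [Fin.sum_univ_five]
    obtain ⟨-, o⟩ := abs_le_of_opposite hn4 e
    have e2 : |q 0 + q 1 + q 2 + q 3| ≤ |q 0 + q 2| + 2 * mu q := by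
      rcases abs_cases (q 0 + q 1 + q 2 + q 3) with ⟨e1, e1'⟩ | ⟨e1, e1'⟩ <;>
      rcases abs_cases (q 0 + q 2) with ⟨e3, e3'⟩ | ⟨e3, e3'⟩ <;> omega
    omega
  have hF : lb (q 4) ≤ 2 * kap + lb (q 0) ∨ lb (q 4) ≤ 2 * kap + lb (q 2) := by
    have e : lb (q 4) ≤ kap + lb (q 0 + q 2) := lb_le (by linarith [abs_nonneg (q 0 + q 2)])
    rcases lb_add_le_or (q 0) (q 2) with c | c
    · exact Or.inl (by linarith)
    · exact Or.inr (by linarith)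
  have low : lb (∑ l, q l) ≤ 2 * kap + lb (mu q) → LogBase (1 / 2 + δ) δ q
      ((1 / 2 + 2 * δ) * lb (∑ l, q l) + lb (q 3 + q 4)
      - (1 / 2 + 2 * δ) * (lb (q 0) + lb (q 2) + lb (q 4))
      - (1 / 2 + 2 * δ + 1) * (lb (q 1) + lb (q 3)) - 100 * kap) := by
    intro hlow
    rcases hF with hF | hF
    · refine Or.inr (Or.inr (Or.inr (Or.inl ?_)))
      revert δ; refine affine_le ?_ ?_ ?_ <;> first | (intro d; ring) | linarith
    · refine Or.inr (Or.inr (Or.inr (Or.inr (Or.inl ?_))))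
      revert δ; refine affine_le ?_ ?_ ?_ <;> first | (intro d; ring) | linarith
  rcases le_or_gt |∑ l, q l| (2 ^ 20 * mu q) with hb2 | hb2
  · exact low (lb_le_two (by rwa [abs_of_nonneg hmu]))
  have e13 : |q 1 + q 3| ≤ 2 * mu q := abs_le.2 ⟨by omega, by omega⟩
  have z : lb 0 = 0 := by simp [lb, bracket_zero]
  rcases exclA_cases h with c | c | c | c | ⟨c, c'⟩
  · clear low
    rcases mul_eq_zero.1 c with c | c
    · refine Or.inr (Or.inr (Or.inr (Or.inr (Or.inr (Or.inl
        ⟨q 0 + q 4, Or.inr (Or.inl rfl), Or.inl ?_⟩)))))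
      have e0 : lb (q 0) = lb (q 4) := by rw [← lb_neg (q 4)]; congr 1; omega
      have eN : lb (∑ l, q l) ≤ kap + lb (q 2) := lb_le (by
        have e : (∑ l, q l) = q 1 + q 2 + q 3 := by omega
        rcases abs_cases (∑ l, q l) with ⟨e1, e1'⟩ | ⟨e1, e1'⟩ <;>
        rcases abs_cases (q 2) with ⟨e3, e3'⟩ | ⟨e3, e3'⟩ <;> omega)
      rw [c, z, e0]
      revert δ; refine affine_le ?_ ?_ ?_ <;> first | (intro d; ring) | linarith
    · refine Or.inr (Or.inr (Or.inr (Or.inr (Or.inr (Or.inl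
        ⟨q 2 + q 4, Or.inr (Or.inr rfl), Or.inl ?_⟩)))))
      have e0 : lb (q 2) = lb (q 4) := by rw [← lb_neg (q 4)]; congr 1; omega
      have eN : lb (∑ l, q l) ≤ kap + lb (q 0) := lb_le (by
        have e : (∑ l, q l) = q 1 + q 0 + q 3 := by omega
        rcases abs_cases (∑ l, q l) with ⟨e1, e1'⟩ | ⟨e1, e1'⟩ <;>
        rcases abs_cases (q 0) with ⟨e3, e3'⟩ | ⟨e3, e3'⟩ <;> omega)
      rw [c, z, e0]
      revert δ; refine affine_le ?_ ?_ ?_ <;> first | (intro d; ring) | linarith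
  · exact absurd c (not_le.2 hb1)
  · exact absurd c (not_le.2 hb2)
  · exfalso
    omega
  · have hXF : lb (q 4) ≤ kap + lb (q 0) := lb_le (by linarith [abs_nonneg (q 0)])
    have h04 : |q 0 + q 4| ≤ 2 ^ 11 * mu q := by omega
    rcases le_or_gt |∑ l, q l| (2 * |q 2|) with d | d
    · clear low
      refine Or.inr (Or.inr (Or.inr (Or.inr (Or.inr (Or.inl
        ⟨q 0 + q 4, Or.inr (Or.inl rfl), Or.inr ⟨by omega, ?_⟩⟩)))))
      have eN : lb (∑ l, q l) ≤ kap + lb (q 2) := lb_le (by linarith [abs_nonneg (q 2)])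
      revert δ; refine affine_le ?_ ?_ ?_ <;> first | (intro d; ring) | linarith
    · apply low
      apply lb_le_two
      rw [abs_of_nonneg hmu]
      have e : |∑ l, q l| ≤ |q 0 + q 4| + |q 2| + 2 * mu q := by
        rcases abs_cases (∑ l, q l) with ⟨e1, e1'⟩ | ⟨e1, e1'⟩ <;>
        rcases abs_cases (q 0 + q 4) with ⟨e3, e3'⟩ | ⟨e3, e3'⟩ <;>
        rcases abs_cases (q 2) with ⟨e5, e5'⟩ | ⟨e5, e5'⟩ <;> omega
      omega

theorem logBase_harmlessB (δ : ℝ) (hδ : 0 ≤ δ) (hδ' : δ ≤ 1 / 4) {q : Fin 5 → ℤ} (h : exclB q)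
    {G : ℝ} (hG1 : G ≤ lb (q 1 + q 2)) (hG2 : G ≤ lb (q 3 + q 4)) :
    LogBase (1 / 2 + δ) δ q ((1 / 2 + 2 * δ) * lb (∑ l, q l) + G
      - (1 / 2 + 2 * δ) * (lb (q 0) + lb (q 2) + lb (q 4))
      - (1 / 2 + 2 * δ + 1) * (lb (q 1) + lb (q 3)) - 100 * kap) := by
  have hκ := kap_pos
  have n0 := lb_nonneg (∑ l, q l)
  have p0 := lb_nonneg (q 0)
  have p1 := lb_nonneg (q 1)
  have p2 := lb_nonneg (q 2)
  have p3 := lb_nonneg (q 3)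
  have p4 := lb_nonneg (q 4)
  have pm := lb_nonneg (mu q)
  have hmu := mu_nonneg q
  obtain ⟨m1, m2, m3, m4⟩ := abs_le_mu q
  have hsum : (∑ l, q l) = q 0 + q 1 + q 2 + (q 3 + q 4) := by rw [Fin.sum_univ_five]; ring
  have hG1' : G ≤ kap + lb (q 1) ∨ G ≤ kap + lb (q 2) := by
    rcases lb_add_le_or (q 1) (q 2) with c | c
    · exact Or.inl (by linarith)
    · exact Or.inr (by linarith)
  have hG2' : G ≤ kap + lb (q 3) ∨ G ≤ kap + lb (q 4) := by
    rcases lb_add_le_or (q 3) (q 4) with c | c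
    · exact Or.inl (by linarith)
    · exact Or.inr (by linarith)
  have hN : lb (∑ l, q l) ≤ 3 * kap + lb (q 0) ∨ lb (∑ l, q l) ≤ 3 * kap + lb (q 1)
      ∨ lb (∑ l, q l) ≤ 3 * kap + lb (q 2) ∨ lb (∑ l, q l) ≤ 3 * kap + lb (q 3)
      ∨ lb (∑ l, q l) ≤ 3 * kap + lb (q 4) := by
    rw [hsum]
    rcases lb_add_le_or (q 0 + q 1 + q 2) (q 3 + q 4) with c | c
    · rcases lb_add_le_or (q 0 + q 1) (q 2) with d | d
      · rcases lb_add_le_or (q 0) (q 1) with e | e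
        · exact Or.inl (by linarith)
        · exact Or.inr (Or.inl (by linarith))
      · exact Or.inr (Or.inr (Or.inl (by linarith)))
    · rcases lb_add_le_or (q 3) (q 4) with d | d
      · exact Or.inr (Or.inr (Or.inr (Or.inl (by linarith))))
      · exact Or.inr (Or.inr (Or.inr (Or.inr (by linarith))))
  have small : G ≤ 4 * kap + lb (mu q) → LogBase (1 / 2 + δ) δ q
      ((1 / 2 + 2 * δ) * lb (∑ l, q l) + G
      - (1 / 2 + 2 * δ) * (lb (q 0) + lb (q 2) + lb (q 4))
      - (1 / 2 + 2 * δ + 1) * (lb (q 1) + lb (q 3)) - 100 * kap) := by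
    intro hsm
    have hsm' : G ≤ 4 * kap + lb (q 1) ∨ G ≤ 4 * kap + lb (q 3) := by
      rcases lb_mu_cases q with e | e
      · exact Or.inl (by linarith)
      · exact Or.inr (by linarith)
    clear hsm
    rcases hN with c | c | c | c | c
    · left
      rcases hsm' with d | d <;>
      · revert δ; refine affine_le ?_ ?_ ?_ <;> first | (intro d; ring) | linarith
    · refine Or.inr (Or.inr (Or.inl ?_))
      rcases hsm' with d | d <;> rcases hG2' with e | e <;>
      · revert δ; refine affine_le ?_ ?_ ?_ <;> first | (intro d; ring) | linarith
    · refine Or.inr (Or.inl ?_)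
      rcases hsm' with d | d <;>
      · revert δ; refine affine_le ?_ ?_ ?_ <;> first | (intro d; ring) | linarith
    · refine Or.inr (Or.inl ?_)
      rcases hsm' with d | d <;> rcases hG1' with e | e <;>
      · revert δ; refine affine_le ?_ ?_ ?_ <;> first | (intro d; ring) | linarith
    · refine Or.inr (Or.inr (Or.inl ?_))
      rcases hsm' with d | d <;>
      · revert δ; refine affine_le ?_ ?_ ?_ <;> first | (intro d; ring) | linarith
  have mle1 : lb (q 1) ≤ lb (mu q) := lb_le_lb (by rw [abs_of_nonneg hmu]; exact le_max_left _ _)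
  have mle3 : lb (q 3) ≤ lb (mu q) := lb_le_lb (by rw [abs_of_nonneg hmu]; exact le_max_right _ _)
  rcases le_or_gt |q 2| (2 ^ 10 * mu q) with hb | hb2
  · apply small
    have : lb (q 2) ≤ 2 * kap + lb (mu q) := lb_le_two (by rw [abs_of_nonneg hmu]; omega)
    rcases hG1' with e | e <;> linarith
  rcases le_or_gt |q 4| (2 ^ 10 * mu q) with hb | hb4
  · apply small
    have : lb (q 4) ≤ 2 * kap + lb (mu q) := lb_le_two (by rw [abs_of_nonneg hmu]; omega)
    rcases hG2' with e | e <;> linarith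
  clear small
  have z : lb 0 = 0 := by simp [lb, bracket_zero]
  have hG1F : G ≤ kap + lb (q 2) := hG1.trans (lb_le (by
    have := abs_add_le_two_mul (a := q 1) (b := q 2) m1 m2 (by omega)
    linarith [abs_nonneg (q 2)]))
  have hG2F : G ≤ kap + lb (q 4) := hG2.trans (lb_le (by
    have := abs_add_le_two_mul (a := q 3) (b := q 4) m3 m4 (by omega)
    linarith [abs_nonneg (q 4)]))
  rcases exclB_cases h with c | c | c
  · rcases mul_eq_zero.1 c with c | c
    · refine Or.inr (Or.inr (Or.inr (Or.inr (Or.inr (Or.inl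
        ⟨q 0 + q 2, Or.inl rfl, Or.inl ?_⟩)))))
      have e0 : lb (q 0) = lb (q 2) := by rw [← lb_neg (q 2)]; congr 1; omega
      have eN : lb (∑ l, q l) ≤ kap + lb (q 4) := lb_le (by
        have e : (∑ l, q l) = q 1 + q 4 + q 3 := by omega
        rcases abs_cases (∑ l, q l) with ⟨e1, e1'⟩ | ⟨e1, e1'⟩ <;>
        rcases abs_cases (q 4) with ⟨e3, e3'⟩ | ⟨e3, e3'⟩ <;> omega)
      rw [c, z, e0]
      revert δ; refine affine_le ?_ ?_ ?_ <;> first | (intro d; ring) | linarith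
    · refine Or.inr (Or.inr (Or.inr (Or.inr (Or.inr (Or.inl
        ⟨q 0 + q 4, Or.inr (Or.inl rfl), Or.inl ?_⟩)))))
      have e0 : lb (q 0) = lb (q 4) := by rw [← lb_neg (q 4)]; congr 1; omega
      have eN : lb (∑ l, q l) ≤ kap + lb (q 2) := lb_le (by
        have e : (∑ l, q l) = q 1 + q 2 + q 3 := by omega
        rcases abs_cases (∑ l, q l) with ⟨e1, e1'⟩ | ⟨e1, e1'⟩ <;>
        rcases abs_cases (q 2) with ⟨e3, e3'⟩ | ⟨e3, e3'⟩ <;> omega)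
      rw [c, z, e0]
      revert δ; refine affine_le ?_ ?_ ?_ <;> first | (intro d; ring) | linarith
  · omega
  · omega

/-- Exponents of the spaces of the five factors in the harmless terms. -/
def harmExp (s : ℝ) (l : Fin 5) : ℝ := if IsGaugeSlot l then s + 1 else s

open Classical in
/-- The modulus of the harmless multipliers, without constants. -/
def harmKer (i : Fin 7) (q : Fin 5 → ℤ) : ℝ := if IsMain i q then 0 else |multCore i q|

theorem norm_multHatHat_le {σ : ℤ} (hσ : σ = 1 ∨ σ = -1) (i : Fin 7) (q : Fin 5 → ℤ) :
    ‖multHatHat σ i q‖ ≤ 4 * harmKer i q := by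
  unfold multHatHat harmKer
  split_ifs
  · simp
  · exact norm_mult_le hσ i q

theorem prod_bracket_harmExp (s : ℝ) (q : Fin 5 → ℤ) :
    ∏ l, bracket (q l) ^ (-harmExp s l) = Real.exp (-(s * (lb (q 0) + lb (q 2) + lb (q 4)))
      - (s + 1) * (lb (q 1) + lb (q 3))) := by
  simp only [bracket_rpow, Fin.prod_univ_five, ← Real.exp_add, harmExp, IsGaugeSlot]
  congr 1
  simp
  ring

theorem formBdd_harmKer {s : ℝ} (hs : 1 / 2 < s) (hs1 : s ≤ 1) (i : Fin 7) :
    FormBdd fun q => bracket (∑ l, q l) ^ s * harmKer i q * ∏ l, bracket (q l) ^ (-harmExp s l) := by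
  set δ := (s - 1 / 2) / 2 with hδdef
  have hδ : 0 < δ := by rw [hδdef]; linarith
  have hδ' : δ ≤ 1 / 4 := by rw [hδdef]; linarith
  have hsδ : 1 / 2 + 2 * δ = s := by rw [hδdef]; ring
  have hM := (formBdd_kerM hδ hδ').1
  rw [hsδ] at hM
  have hbase := formBdd_kerBase (ρ := 1 / 2 + δ) (by linarith) hδ
  refine (hbase.add hM).mono (c := 3 * Real.exp (100 * kap) + 12) (by positivity) fun q => ?_
  have kb := kerBase_nonneg (1 / 2 + δ) δ q
  have km := mul_nonneg (kerM_nonneg q) (Real.exp_pos (logW s (1 / 2) 0 s q)).le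
  have ek := Real.exp_pos (100 * kap)
  rw [prod_bracket_harmExp, bracket_rpow]
  set E := Real.exp (-(s * (lb (q 0) + lb (q 2) + lb (q 4))) - (s + 1) * (lb (q 1) + lb (q 3))) with hE
  have nn : 0 ≤ Real.exp (s * lb (∑ l, q l)) * E := by positivity
  by_cases hmain : IsMain i q
  · rw [harmKer, if_pos hmain, mul_zero, zero_mul]
    positivity
  rw [harmKer, if_neg hmain]
  suffices hsuf : Real.exp (s * lb (∑ l, q l)) * |multCore i q| * E
      ≤ 3 * (Real.exp (100 * kap) * kerBase (1 / 2 + δ) δ q)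
      ∨ Real.exp (s * lb (∑ l, q l)) * |multCore i q| * E
      ≤ 12 * (kerM q * Real.exp (logW s (1 / 2) 0 s q)) by
    rcases hsuf with h | h
    · nlinarith [mul_nonneg ek.le km]
    · nlinarith [mul_nonneg ek.le km, mul_nonneg ek.le kb]
  by_cases hex : (if (i : ℕ) < 5 then ¬ exclA q else ¬ exclB q)
  swap
  · left
    have core : ∀ G : ℝ, |multCore i q| ≤ 3 * Real.exp G →
        LogBase (1 / 2 + δ) δ q ((1 / 2 + 2 * δ) * lb (∑ l, q l) + G
          - (1 / 2 + 2 * δ) * (lb (q 0) + lb (q 2) + lb (q 4))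
          - (1 / 2 + 2 * δ + 1) * (lb (q 1) + lb (q 3)) - 100 * kap) →
        Real.exp (s * lb (∑ l, q l)) * |multCore i q| * E
          ≤ 3 * (Real.exp (100 * kap) * kerBase (1 / 2 + δ) δ q) := by
      intro G hG hL
      have := hL.exp_le hδ.le
      rw [hsδ] at this
      calc Real.exp (s * lb (∑ l, q l)) * |multCore i q| * E
          ≤ Real.exp (s * lb (∑ l, q l)) * (3 * Real.exp G) * E := by gcongr
        _ = 3 * Real.exp (s * lb (∑ l, q l) + G - s * (lb (q 0) + lb (q 2) + lb (q 4))
              - (s + 1) * (lb (q 1) + lb (q 3))) := by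
            rw [hE, mul_left_comm, mul_assoc, ← Real.exp_add, ← Real.exp_add]
            congr 2; ring
        _ ≤ _ := by gcongr
    have zero : multCore i q = 0 → Real.exp (s * lb (∑ l, q l)) * |multCore i q| * E
          ≤ 3 * (Real.exp (100 * kap) * kerBase (1 / 2 + δ) δ q) := by
      intro h
      rw [h, abs_zero, mul_zero, zero_mul]
      positivity
    by_cases hi : (i : ℕ) < 5
    · rw [if_pos hi, not_not] at hex
      obtain ⟨c, d⟩ := abs_multCore_le_of_lt hi q
      rcases c with c | c
      · exact zero c
      · refine core (lb (q 3 + q 4)) ?_ (logBase_harmlessA δ hδ.le hδ' c hex)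
        rw [← bracket_eq_exp]
        exact d.trans (mul_le_mul_of_nonneg_left (abs_le_bracket _) (by norm_num))
    · rw [if_neg hi, not_not] at hex
      obtain ⟨c, d, d'⟩ := abs_multCore_le_of_ge hi q
      refine core (min (lb (q 1 + q 2)) (lb (q 3 + q 4))) ?_ (logBase_harmlessB δ hδ.le hδ' hex
        (min_le_left _ _) (min_le_right _ _))
      have e1 : |multCore i q| ≤ Real.exp (lb (q 1 + q 2)) := by
        rw [← bracket_eq_exp]; exact d.trans (abs_le_bracket _)
      have e2 : |multCore i q| ≤ Real.exp (lb (q 3 + q 4)) := by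
        rw [← bracket_eq_exp]; exact d'.trans (abs_le_bracket _)
      rcases min_choice (lb (q 1 + q 2)) (lb (q 3 + q 4)) with e | e <;> rw [e] <;>
        linarith [abs_nonneg (multCore i q)]
  · right
    have hphase : ¬ gaugeMax q ^ 2 < |(phase q : ℝ)| := fun hc => hmain ⟨hex, hc⟩
    have hk : |multCore i q| ≤ 6 * kerM q := by
      split_ifs at hex with hi
      · exact abs_multCore_le_kerA hi hex
      · exact abs_multCore_le_kerB hi hex
    have hps : psi q ≤ 4 * bracket (mu q) ^ 2 := by
      rw [gaugeMax_eq, not_lt] at hphase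
      rw [bracket_sq]
      unfold psi
      linarith [sq_nonneg (mu q : ℝ)]
    have hlp : Real.exp (lpsi q / 2) ≤ 2 * Real.exp (lb (q 1) + lb (q 3)) := by
      have h1 : Real.exp (lpsi q / 2) ^ 2 = psi q := by
        rw [← Real.exp_nat_mul, lpsi]
        push_cast
        rw [mul_div_cancel₀ _ (by norm_num), Real.exp_log (psi_pos q)]
      have h2 : Real.exp (lpsi q / 2) ≤ 2 * bracket (mu q) := by
        refine le_of_sq_le_sq ?_ (by have := bracket_pos (mu q); positivity)
        rw [h1]; linarith
      refine h2.trans ?_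
      rw [bracket_eq_exp]
      gcongr
      have p1 := lb_nonneg (q 1)
      have p3 := lb_nonneg (q 3)
      rcases lb_mu_cases q with e | e <;> linarith
    calc Real.exp (s * lb (∑ l, q l)) * |multCore i q| * E
        ≤ Real.exp (s * lb (∑ l, q l)) * (6 * kerM q) * E := by gcongr
      _ = 6 * kerM q * (Real.exp (logW s (1 / 2) 0 s q) * Real.exp (lpsi q / 2)
          * Real.exp (-(lb (q 1) + lb (q 3)))) := by
          rw [hE, mul_comm (Real.exp (s * _)), mul_assoc, ← Real.exp_add, ← Real.exp_add,
            ← Real.exp_add]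
          congr 2
          rw [logW, Fin.sum_univ_five (fun l => lb (q l))]
          ring
      _ ≤ 6 * kerM q * (Real.exp (logW s (1 / 2) 0 s q) * (2 * Real.exp (lb (q 1) + lb (q 3)))
          * Real.exp (-(lb (q 1) + lb (q 3)))) := by
          have := kerM_nonneg q
          gcongr
      _ = _ := by
          rw [Real.exp_neg]
          field_simp
          ring

/-! ### Sums over index functions of a tree -/

/-- The elements of a tree as elements of a tree with one more parent. -/
def liftNode {J : ℕ} : Node J → Node (J + 1) := Option.map (Prod.map Fin.castSucc id)

theorem liftNode_some {J : ℕ} (j : Fin J) (l : Fin 5) :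
    liftNode (some (j, l)) = some (j.castSucc, l) := rfl

theorem liftNode_none {J : ℕ} : liftNode (none : Node J) = none := rfl

theorem liftNode_injective {J : ℕ} : Function.Injective (liftNode (J := J)) :=
  Option.map_injective ((Fin.castSucc_injective J).prodMap Function.injective_id)

theorem liftNode_ne_last {J : ℕ} (a : Node J) (l : Fin 5) :
    liftNode a ≠ some (Fin.last J, l) := by
  rcases a with _ | ⟨j, k⟩
  · simp [liftNode]
  · rw [liftNode_some]
    intro h
    simp only [Option.some.injEq, Prod.mk.injEq] at h
    exact (Fin.castSucc_lt_last j).ne h.1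

/-- The elements of a tree with `J + 1` parents: those of the tree without the last parent, and
the children of the last parent. -/
def nodeMap (J : ℕ) : Node J ⊕ Fin 5 → Node (J + 1) :=
  Sum.elim liftNode fun l => some (Fin.last J, l)

theorem nodeMap_bijective (J : ℕ) : Function.Bijective (nodeMap J) := by
  constructor
  · rintro (a | l) (b | k) h
    · exact congrArg Sum.inl (liftNode_injective h)
    · exact absurd h (liftNode_ne_last a k)
    · exact absurd h.symm (liftNode_ne_last b l)
    · simp only [nodeMap, Sum.elim_inr, Option.some.injEq, Prod.mk.injEq, true_and] at h
      exact congrArg Sum.inr h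
  · rintro (_ | ⟨j, l⟩)
    · exact ⟨Sum.inl none, rfl⟩
    · rcases Fin.eq_castSucc_or_eq_last j with ⟨k, rfl⟩ | rfl
      · exact ⟨Sum.inl (some (k, l)), rfl⟩
      · exact ⟨Sum.inr l, rfl⟩

/-- `nodeMap` as an equivalence. -/
def nodeEquiv (J : ℕ) : Node J ⊕ Fin 5 ≃ Node (J + 1) := Equiv.ofBijective _ (nodeMap_bijective J)

/-- Index functions of a tree with one more parent. -/
def joinEquiv (J : ℕ) : (Node J → ℤ) × (Fin 5 → ℤ) ≃ (Node (J + 1) → ℤ) :=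
  (Equiv.sumArrowEquivProdArrow _ _ _).symm.trans ((nodeEquiv J).arrowCongr (Equiv.refl ℤ))

theorem joinEquiv_nodeEquiv {J : ℕ} (x : (Node J → ℤ) × (Fin 5 → ℤ)) (a : Node J ⊕ Fin 5) :
    joinEquiv J x (nodeEquiv J a) = Sum.elim x.1 x.2 a := by
  simp only [joinEquiv, Equiv.trans_apply, Equiv.arrowCongr_apply, Function.comp_apply,
    Equiv.symm_apply_apply, Equiv.coe_refl, id]
  rfl

theorem joinEquiv_lift {J : ℕ} (x : (Node J → ℤ) × (Fin 5 → ℤ)) (a : Node J) :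
    joinEquiv J x (liftNode a) = x.1 a := joinEquiv_nodeEquiv x (Sum.inl a)

theorem joinEquiv_last {J : ℕ} (x : (Node J → ℤ) × (Fin 5 → ℤ)) (l : Fin 5) :
    joinEquiv J x (some (Fin.last J, l)) = x.2 l := joinEquiv_nodeEquiv x (Sum.inr l)

/-- The elements without children. -/
def leaves {J : ℕ} (p : Fin J → Node J) : Finset (Node J) :=
  Finset.univ.filter fun a => ∀ j, p j ≠ a

/-- The sum over the index functions of a tree, with kernels at the parents and functions at the
leaves. -/
def treeForm {J : ℕ} (p : Fin J → Node J) (κ : Fin J → (Fin 5 → ℤ) → ℝ) (g : Node J → ℤ → ℝ≥0∞)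
    (n : ℤ) : ℝ≥0∞ :=
  ∑' ν : Node J → ℤ, if (∀ j, ν (p j) = ∑ l, ν (some (j, l))) ∧ ν none = n then
    (∏ j, ENNReal.ofReal (κ j (childFreq ν j))) * ∏ a ∈ leaves p, g a (ν a) else 0

theorem prod_leaves_succ {J : ℕ} {p : Fin (J + 1) → Node (J + 1)} {p' : Fin J → Node J} {c : Node J}
    (hp : ∀ j, p j.castSucc = liftNode (p' j)) (hc : p (Fin.last J) = liftNode c)
    {M : Type*} [CommMonoid M] (h : Node (J + 1) → M) :
    ∏ a ∈ leaves p, h a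
      = (∏ a ∈ (leaves p').erase c, h (liftNode a)) * ∏ l, h (some (Fin.last J, l)) := by
  classical
  have m1 : ∀ a : Node J, liftNode a ∈ leaves p ↔ a ∈ (leaves p').erase c := by
    intro a
    simp only [leaves, Finset.mem_filter, Finset.mem_univ, true_and, Finset.mem_erase,
      Fin.forall_fin_succ', hp, hc, liftNode_injective.ne_iff]
    rw [and_comm, ne_comm]
  have m2 : ∀ l, some (Fin.last J, l) ∈ leaves p := by
    intro l
    simp only [leaves, Finset.mem_filter, Finset.mem_univ, true_and, Fin.forall_fin_succ', hp, hc]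
    exact ⟨fun j => liftNode_ne_last _ l, liftNode_ne_last _ l⟩
  have e1 : ∏ a ∈ leaves p, h a = ∏ a, if a ∈ leaves p then h a else 1 := by
    rw [Finset.prod_ite_mem, Finset.univ_inter]
  rw [e1, ← Equiv.prod_comp (nodeEquiv J), Fintype.prod_sum_type]
  congr 1
  · change ∏ a, (if liftNode a ∈ leaves p then h (liftNode a) else 1) = _
    simp_rw [m1]
    rw [Finset.prod_ite_mem, Finset.univ_inter]
  · change ∏ l, (if some (Fin.last J, l) ∈ leaves p then h (some (Fin.last J, l)) else 1) = _
    exact Finset.prod_congr rfl fun l _ => if_pos (m2 l)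

theorem treeForm_succ {J : ℕ} {p : Fin (J + 1) → Node (J + 1)} {p' : Fin J → Node J} {c : Node J}
    (hp : ∀ j, p j.castSucc = liftNode (p' j)) (hc : p (Fin.last J) = liftNode c)
    (hcl : c ∈ leaves p') (κ : Fin (J + 1) → (Fin 5 → ℤ) → ℝ) (g : Node (J + 1) → ℤ → ℝ≥0∞) (n : ℤ) :
    treeForm p κ g n = treeForm p' (fun j => κ j.castSucc) (fun a => if a = c then
      Q5 (κ (Fin.last J)) (fun l => g (some (Fin.last J, l))) else g (liftNode a)) n := by
  unfold treeForm
  rw [← (joinEquiv J).tsum_eq, ENNReal.tsum_prod (f := fun ν q => if (∀ j, joinEquiv J (ν, q) (p j)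
    = ∑ l, joinEquiv J (ν, q) (some (j, l))) ∧ joinEquiv J (ν, q) none = n then
    (∏ j, ENNReal.ofReal (κ j (childFreq (joinEquiv J (ν, q)) j)))
      * ∏ a ∈ leaves p, g a (joinEquiv J (ν, q) a) else 0)]
  refine tsum_congr fun ν => ?_
  have hcond : ∀ q, ((∀ j, joinEquiv J (ν, q) (p j) = ∑ l, joinEquiv J (ν, q) (some (j, l)))
      ∧ joinEquiv J (ν, q) none = n)
      ↔ ((∀ j, ν (p' j) = ∑ l, ν (some (j, l))) ∧ ν none = n) ∧ ∑ l, q l = ν c := by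
    intro q
    rw [Fin.forall_fin_succ']
    simp only [hp, hc, joinEquiv_lift, joinEquiv_last, ← liftNode_some, ← liftNode_none (J := J)]
    tauto
  have hch : ∀ q (j : Fin J), childFreq (joinEquiv J (ν, q)) j.castSucc = childFreq ν j := by
    intro q j
    ext l
    exact joinEquiv_lift (ν, q) (some (j, l))
  have hch' : ∀ q, childFreq (joinEquiv J (ν, q)) (Fin.last J) = q := by
    intro q
    ext l
    exact joinEquiv_last (ν, q) l
  simp only [hcond]
  by_cases h : (∀ j, ν (p' j) = ∑ l, ν (some (j, l))) ∧ ν none = n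
  · rw [if_pos h]
    simp only [and_iff_right h]
    rw [← Finset.mul_prod_erase _ _ hcl, if_pos rfl, Q5]
    rw [Finset.prod_congr rfl (g := fun a => g (liftNode a) (ν a)) fun a ha => by
      rw [if_neg (Finset.ne_of_mem_erase ha)]]
    rw [← ENNReal.tsum_mul_right, ← ENNReal.tsum_mul_left]
    refine tsum_congr fun q => ?_
    split_ifs
    · rw [Fin.prod_univ_castSucc, hch', prod_leaves_succ hp hc]
      simp only [hch, joinEquiv_lift, joinEquiv_last]
      ring
    · simp
  · rw [if_neg h, ENNReal.tsum_eq_zero]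
    exact fun q => if_neg fun hh => h hh.1

/-- The tree without its last parent. -/
theorem IsTree.exists_restrict {J : ℕ} {p : Fin (J + 1) → Node (J + 1)} (hp : IsTree p) :
    ∃ (p' : Fin J → Node J) (c : Node J), IsTree p' ∧ (∀ j, p j.castSucc = liftNode (p' j))
      ∧ p (Fin.last J) = liftNode c ∧ c ∈ leaves p' ∧ (∀ j l, c = some (j, l) → ¬ IsGaugeSlot l) := by
  have key : ∀ j, ∃ a : Node J, p j = liftNode a := by
    intro j
    rcases h : p j with _ | ⟨k, l⟩
    · exact ⟨none, rfl⟩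
    · have hk := (hp.2.2 j k l h).1
      refine ⟨some (⟨k, ?_⟩, l), rfl⟩
      have h1 : (k : ℕ) < j := hk
      have h2 := j.2
      omega
  choose P hP using key
  refine ⟨fun j => P j.castSucc, P (Fin.last J), ⟨?_, ?_, ?_⟩, fun j => hP _, hP _, ?_, ?_⟩
  · intro j k h
    have : p j.castSucc = p k.castSucc := by rw [hP, hP]; exact congrArg _ h
    exact Fin.castSucc_injective J (hp.1 this)
  · intro j
    have := hp.2.1 j.castSucc
    rw [hP] at this
    rw [← Fin.val_castSucc j, ← this]
    constructor
    · intro h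
      have h' : P j.castSucc = none := h
      rw [h']; rfl
    · intro h; exact liftNode_injective (h.trans liftNode_none.symm)
  · intro j k l h
    have h' : P j.castSucc = some (k, l) := h
    have := hp.2.2 j.castSucc k.castSucc l (by rw [hP, h']; rfl)
    exact ⟨by simpa using this.1, this.2⟩
  · simp only [leaves, Finset.mem_filter, Finset.mem_univ, true_and]
    intro j h
    have : p j.castSucc = p (Fin.last J) := by rw [hP, hP (Fin.last J)]; exact congrArg _ h
    exact (Fin.castSucc_lt_last j).ne (hp.1 this)
  · intro j l h
    exact (hp.2.2 (Fin.last J) j.castSucc l (by rw [hP, h]; rfl)).2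

/-- The exponent of regularity: `s - 1` at the distinguished element, `s` at all others. -/
def exlow {α : Type*} [DecidableEq α] (s : ℝ) (c : Option α) (a : α) : ℝ := if c = some a then s - 1 else s

/-- The exponent of regularity of the output. -/
def outlow {α : Type*} (s : ℝ) (c : Option α) : ℝ := if c.isSome then s - 1 else s

theorem lN_treeForm_le {s : ℝ} : ∀ {J : ℕ} {p : Fin J → Node J} (_ : IsTree p) (c : Option (Node J))
    (_ : ∀ a, c = some a → a ∈ leaves p ∧ ∀ j l, a = some (j, l) → ¬ IsGaugeSlot l)
    (κ : Fin J → (Fin 5 → ℤ) → ℝ) (C : Fin J → ℝ≥0∞)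
    (_ : ∀ j (b : Option (Fin 5)), (∀ l, b = some l → ¬ IsGaugeSlot l) → (b.isSome → c.isSome) → ∀ f,
      lN (outlow s b) (Q5 (κ j) f) ≤ C j * ∏ l, lN (exlow s b l) (f l))
    (g : Node J → ℤ → ℝ≥0∞),
    lN (outlow s c) (treeForm p κ g) ≤ (∏ j, C j) * ∏ a ∈ leaves p, lN (exlow s c a) (g a) := by
  intro J
  induction J with
  | zero =>
    intro p _ c hc κ C _ g
    have e : treeForm p κ g = g none := by
      ext n
      unfold treeForm
      have hl : leaves p = {none} := by
        ext a
        rcases a with _ | ⟨j, l⟩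
        · exact iff_of_true (Finset.mem_filter.2 ⟨Finset.mem_univ _, fun j => j.elim0⟩)
            (Finset.mem_singleton.2 rfl)
        · exact j.elim0
      rw [hl]
      simp only [Finset.prod_singleton, Finset.univ_eq_empty, Finset.prod_empty, one_mul,
        IsEmpty.forall_iff, true_and]
      let E : ℤ ≃ (Node 0 → ℤ) := ⟨fun m _ => m, fun ν => ν none, fun _ => rfl, fun ν => by
        ext a
        rcases a with _ | ⟨j, l⟩
        · rfl
        · exact j.elim0⟩
      rw [← E.tsum_eq]
      exact tsum_ite_eq n _
    have hl : leaves p = {none} := by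
      ext a
      rcases a with _ | ⟨j, l⟩
      · exact iff_of_true (Finset.mem_filter.2 ⟨Finset.mem_univ _, fun j => j.elim0⟩)
            (Finset.mem_singleton.2 rfl)
      · exact j.elim0
    rw [e, hl]
    simp only [Finset.univ_eq_empty, Finset.prod_empty, one_mul, Finset.prod_singleton]
    rcases c with _ | a
    · simp [outlow, exlow]
    · rcases a with _ | ⟨j, l⟩
      · simp [outlow, exlow]
      · exact j.elim0
  | succ J ih =>
    intro p hp c hc κ C hC g
    obtain ⟨p', c₀, hp', hpp, hpc, hcl, hcg⟩ := hp.exists_restrict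
    have e : treeForm p κ g = _ := funext fun n => treeForm_succ hpp hpc hcl κ g n
    rw [e]
    set Qf := Q5 (κ (Fin.last J)) (fun l => g (some (Fin.last J, l))) with hQf
    rw [Fin.prod_univ_castSucc, prod_leaves_succ hpp hpc]
    have mem : ∀ a : Node J, liftNode a ∈ leaves p → a ∈ leaves p' := by
      intro a ha
      simp only [leaves, Finset.mem_filter, Finset.mem_univ, true_and] at ha ⊢
      intro j h
      exact ha j.castSucc (by rw [hpp, h])
    have memc : liftNode c₀ ∉ leaves p := by
      simp only [leaves, Finset.mem_filter, Finset.mem_univ, true_and, not_forall, not_not]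
      exact ⟨Fin.last J, hpc⟩
    -- the distinguished leaf of the smaller tree and the distinguished slot of the last parent
    obtain ⟨c', b, hcs, hbs, hbg, hcc, hex, hexb, hc0⟩ : ∃ (c' : Option (Node J)) (b : Option (Fin 5)),
        (c'.isSome ↔ c.isSome) ∧ (b.isSome → c.isSome) ∧ (∀ l, b = some l → ¬ IsGaugeSlot l)
        ∧ (∀ a, c' = some a → a ∈ leaves p' ∧ ∀ j l, a = some (j, l) → ¬ IsGaugeSlot l)
        ∧ (∀ a, a ≠ c₀ → exlow s c' a = exlow s c (liftNode a))
        ∧ (∀ l, exlow s b l = exlow s c (some (Fin.last J, l)))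
        ∧ exlow s c' c₀ = outlow s b := by
      rcases c with _ | a
      · refine ⟨none, none, by simp, by simp, by simp, by simp, ?_, ?_, ?_⟩ <;> simp [exlow, outlow]
      · obtain ⟨x, rfl⟩ := (nodeMap_bijective J).2 a
        rcases x with a | l
        · change ∀ a', some (liftNode a) = some a' → _ at hc
          refine ⟨some a, none, by simp, by simp, by simp, ?_, ?_, ?_, ?_⟩
          · rintro a' h
            obtain rfl := Option.some.inj h
            refine ⟨mem a (hc _ rfl).1, ?_⟩
            rintro j l rfl
            exact (hc _ rfl).2 j.castSucc l rfl
          · intro a' _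
            simp only [exlow, nodeMap, Sum.elim_inl, Option.some.injEq, liftNode_injective.eq_iff]
          · intro l
            simp only [exlow, nodeMap, Sum.elim_inl, Option.some.injEq, liftNode_ne_last, if_false]
            simp
          · have : a ≠ c₀ := by
              rintro rfl
              exact memc (hc _ rfl).1
            simp [exlow, outlow, this]
        · refine ⟨some c₀, some l, by simp, by simp, ?_, ?_, ?_, ?_, ?_⟩
          · intro l' h
            obtain rfl := Option.some.inj h
            exact (hc _ rfl).2 (Fin.last J) l rfl
          · intro a h
            obtain rfl := Option.some.inj h
            exact ⟨hcl, hcg⟩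
          · intro a ha
            have h1 : c₀ ≠ a := ha.symm
            have h2 := (liftNode_ne_last a l).symm
            simp [exlow, nodeMap, h1, h2]
          · intro l'
            simp [exlow, nodeMap]
          · simp [exlow, outlow]
    have hout : outlow s c' = outlow s c := by
      unfold outlow
      by_cases h : c.isSome
      · rw [if_pos h, if_pos (hcs.2 h)]
      · rw [if_neg h, if_neg (mt hcs.1 h)]
    have step := ih hp' c' hcc (fun j => κ j.castSucc) (fun j => C j.castSucc)
      (fun j b' h1 h2 f => hC j.castSucc b' h1 (fun h => hcs.1 (h2 h)) f)
      (fun a => if a = c₀ then Qf else g (liftNode a))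
    rw [hout] at step
    refine step.trans ?_
    rw [← Finset.mul_prod_erase _ _ hcl, if_pos rfl, hc0]
    rw [Finset.prod_congr rfl (g := fun a => lN (exlow s c (liftNode a)) (g (liftNode a))) fun a ha => by
      rw [if_neg (Finset.ne_of_mem_erase ha), hex a (Finset.ne_of_mem_erase ha)]]
    have last := hC (Fin.last J) b hbg hbs (fun l => g (some (Fin.last J, l)))
    simp only [hexb] at last
    calc _ ≤ (∏ j : Fin J, C j.castSucc) * ((C (Fin.last J)
          * ∏ l, lN (exlow s c (some (Fin.last J, l))) (g (some (Fin.last J, l))))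
          * ∏ a ∈ (leaves p').erase c₀, lN (exlow s c (liftNode a)) (g (liftNode a))) := by
          gcongr
      _ = _ := by ring

/-! ### Pointwise bounds for the amplitudes -/

theorem norm_parentMult_le {J : ℕ} {σ : ℤ} (hσ : σ = 1 ∨ σ = -1) (i : Types J) (p : Tree J)
    (ν : Node J → ℤ) (j : Fin J) : ‖parentMult σ i p ν j‖ ≤ 24 * kerM (childFreq ν j) := by
  unfold parentMult
  split_ifs
  · rw [multHatStar, RCLike.norm_conj, ← kerM_neg]
    exact norm_multHat_le hσ _ _
  · exact norm_multHat_le hσ _ _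

theorem psi_le_of_parentMult_ne {J : ℕ} {σ : ℤ} {i : Types J} {p : Tree J} {ν : Node J → ℤ}
    {j : Fin J} (h : parentMult σ i p ν j ≠ 0) :
    psi (childFreq ν j) ≤ 3 * |(phase (childFreq ν j) : ℝ)| := by
  unfold parentMult at h
  split_ifs at h
  · have h1 : multHat σ (i j) (-childFreq ν j) ≠ 0 := fun h0 => h (by rw [multHatStar, h0, map_zero])
    have := psi_le_of_multHat_ne h1
    rw [psi_neg, phase_neg] at this
    simpa using this
  · exact psi_le_of_multHat_ne h

theorem phaseSum_zero {J : ℕ} (ν : Node J → ℤ) : phaseSum ν 0 = 0 := by simp [phaseSum]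

theorem phaseSum_succ {J : ℕ} (ν : Node J → ℤ) (j : Fin J) :
    phaseSum ν (j + 1) = phaseSum ν j + phase (childFreq ν j) := by
  unfold phaseSum
  have : Finset.univ.filter (fun k : Fin J => (k : ℕ) < j + 1)
      = insert j (Finset.univ.filter fun k : Fin J => (k : ℕ) < j) := by
    ext k
    simp only [Finset.mem_filter, Finset.mem_univ, true_and, Finset.mem_insert, Fin.ext_iff]
    omega
  rw [this, Finset.sum_insert (by simp), add_comm]

theorem NonRes.le_abs_phaseSum {J : ℕ} {M : ℝ} {ν : Node J → ℤ} {k : ℕ} (h : NonRes M ν k) {j : ℕ}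
    (hj : j + 1 ≤ k) : 2 ^ j * M ≤ |(phaseSum ν (j + 1) : ℝ)| := by
  induction j with
  | zero => simpa using (h.1 hj).le
  | succ j ih =>
    have h1 := ih (by omega)
    have h2 := h.2 (j + 1 + 1) (by omega) hj
    rw [Nat.add_sub_cancel] at h2
    rw [pow_succ]
    linarith

theorem NonRes.abs_phase_le {J : ℕ} {M : ℝ} {ν : Node J → ℤ} {k : ℕ} (h : NonRes M ν k) {j : Fin J}
    (hj : (j : ℕ) + 1 ≤ k) :
    |(phase (childFreq ν j) : ℝ)| ≤ 3 / 2 * |(phaseSum ν (j + 1) : ℝ)| := by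
  have e : (phase (childFreq ν j) : ℝ) = phaseSum ν (j + 1) - phaseSum ν j := by
    rw [phaseSum_succ]; push_cast; ring
  rw [e]
  have h1 : |(phaseSum ν j : ℝ)| ≤ 1 / 2 * |(phaseSum ν (j + 1) : ℝ)| := by
    rcases Nat.eq_zero_or_pos (j : ℕ) with h0 | h0
    · rw [h0, phaseSum_zero]
      simp
    · have := h.2 (j + 1) (by omega) hj
      rw [Nat.add_sub_cancel] at this
      linarith
  exact (abs_sub _ _).trans (by linarith)

/-- The kernel `kerM · psi^{-(1-θ)}`. -/
def kerPow (θ : ℝ) (q : Fin 5 → ℤ) : ℝ := kerM q * psi q ^ (-(1 - θ))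

theorem kerPow_nonneg (θ : ℝ) (q : Fin 5 → ℤ) : 0 ≤ kerPow θ q :=
  mul_nonneg (kerM_nonneg q) (Real.rpow_nonneg (psi_pos q).le _)

theorem norm_parentMult_le_of_phase_le {J : ℕ} {σ : ℤ} (hσ : σ = 1 ∨ σ = -1) (i : Types J) (p : Tree J)
    (ν : Node J → ℤ) (j : Fin J) {θ y : ℝ} (hθ : 0 ≤ θ) (hθ1 : θ ≤ 1) (hy : 0 < y)
    (h : |(phase (childFreq ν j) : ℝ)| ≤ 3 * y) :
    ‖parentMult σ i p ν j‖ ≤ 216 * (y ^ (1 - θ) * kerPow θ (childFreq ν j)) := by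
  by_cases h0 : parentMult σ i p ν j = 0
  · rw [h0, norm_zero]
    have := kerPow_nonneg θ (childFreq ν j)
    positivity
  · set q := childFreq ν j
    have h1 : psi q ≤ 9 * y := (psi_le_of_parentMult_ne h0).trans (by linarith)
    have hp := psi_pos q
    have h2 : psi q ^ (1 - θ) ≤ 9 * y ^ (1 - θ) := by
      calc psi q ^ (1 - θ) ≤ (9 * y) ^ (1 - θ) := Real.rpow_le_rpow hp.le h1 (by linarith)
        _ = 9 ^ (1 - θ) * y ^ (1 - θ) := Real.mul_rpow (by norm_num) hy.le
        _ ≤ 9 ^ (1 : ℝ) * y ^ (1 - θ) := by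
            gcongr
            · norm_num
            · linarith
        _ = _ := by rw [Real.rpow_one]
    calc ‖parentMult σ i p ν j‖ ≤ 24 * kerM q := norm_parentMult_le hσ i p ν j
      _ = 24 * (psi q ^ (1 - θ) * kerPow θ q) := by
          rw [kerPow, mul_left_comm (psi q ^ (1 - θ)), ← Real.rpow_add hp]
          simp
      _ ≤ 24 * ((9 * y ^ (1 - θ)) * kerPow θ q) := by
          have := kerPow_nonneg θ q
          gcongr
      _ = _ := by ring

theorem norm_parentMult_div_le {J : ℕ} {σ : ℤ} (hσ : σ = 1 ∨ σ = -1) (i : Types J) (p : Tree J)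
    {ν : Node J → ℤ} {M : ℝ} (hM : 1 < M) {k : ℕ} (h : NonRes M ν k) {j : Fin J}
    (hj : (j : ℕ) + 1 ≤ k) {θ : ℝ} (hθ : 0 ≤ θ) (hθ1 : θ ≤ 1) :
    ‖parentMult σ i p ν j‖ / |(phaseSum ν (j + 1) : ℝ)|
      ≤ 216 * (|(phaseSum ν (j + 1) : ℝ)| ^ (-θ) * kerPow θ (childFreq ν j)) := by
  have hy : 0 < |(phaseSum ν (j + 1) : ℝ)| :=
    lt_of_lt_of_le (by positivity) (h.le_abs_phaseSum hj)
  have := norm_parentMult_le_of_phase_le hσ i p ν j hθ hθ1 hy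
    ((h.abs_phase_le hj).trans (by linarith))
  rw [div_le_iff₀ hy]
  refine this.trans (le_of_eq ?_)
  rw [show 1 - θ = -θ + 1 by ring, Real.rpow_add hy, Real.rpow_one]
  ring

theorem norm_parentMult_div_le' {J : ℕ} {σ : ℤ} (hσ : σ = 1 ∨ σ = -1) (i : Types J) (p : Tree J)
    {ν : Node J → ℤ} {M : ℝ} (hM : 1 < M) {k : ℕ} (h : NonRes M ν k) {j : Fin J}
    (hj : (j : ℕ) + 1 ≤ k) {θ : ℝ} (hθ : 0 ≤ θ) (hθ1 : θ ≤ 1) :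
    ‖parentMult σ i p ν j‖ / |(phaseSum ν (j + 1) : ℝ)|
      ≤ 216 * (2 ^ (j : ℕ) * M) ^ (-θ) * kerPow θ (childFreq ν j) := by
  refine (norm_parentMult_div_le hσ i p hM h hj hθ hθ1).trans ?_
  rw [mul_assoc]
  have := kerPow_nonneg θ (childFreq ν j)
  gcongr ?_ * (?_ * ?_)
  exact Real.rpow_le_rpow_of_nonpos (by positivity) (h.le_abs_phaseSum hj) (by linarith)

/-- The amplitude without its oscillating factor. -/
def baseAmp {J : ℕ} (σ : ℤ) (k : ℕ) (i : Types J) (p : Tree J) (ν : Node J → ℤ) : ℂ :=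
  (∏ j, parentMult σ i p ν j) / ∏ j ∈ Finset.Icc 1 k, (phaseSum ν j : ℂ)

theorem amplitude_eq {J : ℕ} (σ : ℤ) (k : ℕ) (t : ℝ) (i : Types J) (p : Tree J) (ν : Node J → ℤ) :
    amplitude σ k t i p ν
      = Complex.exp (Complex.I * t * ((phaseSum ν J : ℝ) : ℂ)) * baseAmp σ k i p ν := by
  simp only [amplitude, baseAmp, mul_div_assoc, Complex.ofReal_intCast]

theorem prod_Icc_eq_prod_fin (f : ℕ → ℝ) (k : ℕ) :
    ∏ j ∈ Finset.Icc 1 k, f j = ∏ j : Fin k, f (j + 1) := by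
  induction k with
  | zero => simp
  | succ k ih => rw [Finset.prod_Icc_succ_top (by omega), ih, Fin.prod_univ_castSucc]; simp

theorem norm_baseAmp {J : ℕ} (σ : ℤ) (k : ℕ) (i : Types J) (p : Tree J) (ν : Node J → ℤ) :
    ‖baseAmp σ k i p ν‖
      = (∏ j, ‖parentMult σ i p ν j‖) / ∏ j : Fin k, |(phaseSum ν (j + 1) : ℝ)| := by
  rw [baseAmp, norm_div, norm_prod, norm_prod, ← prod_Icc_eq_prod_fin fun j => |(phaseSum ν j : ℝ)|]
  simp

theorem norm_baseAmp_le {J : ℕ} {σ : ℤ} (hσ : σ = 1 ∨ σ = -1) (i : Types J) (p : Tree J)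
    {ν : Node J → ℤ} {M : ℝ} (hM : 1 < M) (h : NonRes M ν J) :
    ‖baseAmp σ J i p ν‖
      ≤ ∏ j : Fin J, 216 * (2 ^ (j : ℕ) * M) ^ (-(1 / 2) : ℝ) * kerPow (1 / 2) (childFreq ν j) := by
  rw [norm_baseAmp, ← Finset.prod_div_distrib]
  refine Finset.prod_le_prod (fun j _ => by positivity) fun j _ => ?_
  exact norm_parentMult_div_le' hσ i p hM h (by omega) (by norm_num) (by norm_num)

theorem bracket_le_of_gauge {q : Fin 5 → ℤ} {l : Fin 5} (hl : IsGaugeSlot l) :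
    bracket (q l) ≤ psi q ^ (1 / 2 : ℝ) := by
  rw [← Real.sqrt_eq_rpow]
  apply Real.le_sqrt_of_sq_le
  rw [bracket_sq]
  have h1 : |q l| ≤ mu q := by
    rcases hl with rfl | rfl
    · exact le_max_left _ _
    · exact le_max_right _ _
  have h2 : (q l : ℝ) ^ 2 ≤ (mu q : ℝ) ^ 2 := by
    apply sq_le_sq'
    · have := (abs_le.1 h1).1
      exact_mod_cast this
    · have := (abs_le.1 h1).2
      exact_mod_cast this
  unfold psi
  linarith [abs_nonneg (phase q : ℝ)]

theorem combine_gain {x b X R K g G c d : ℝ} (hX : 0 ≤ X) (hK : 0 ≤ K) (hg : 0 ≤ g) (hR : 0 ≤ R)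
    (first : x * b ≤ 648 * K) (rest : X ≤ R) (gain : 1 ≤ G * c * g) (hcd : 3 * c ≤ d) (hG : 0 ≤ G) :
    x * X * b ≤ G * (d * (216 * g * K * R)) := by
  calc x * X * b = x * b * X := by ring
    _ ≤ 648 * K * R := by gcongr
    _ ≤ 648 * K * R * (G * c * g) := le_mul_of_one_le_right (by positivity) gain
    _ = G * ((3 * c) * (216 * g * K * R)) := by ring
    _ ≤ _ := by gcongr

theorem combine_res {X x x' R K K' y y' G c g g' d : ℝ} (hx : 0 ≤ x) (hx' : 0 ≤ x')
    (hR : 0 ≤ R) (hK : 0 ≤ K) (hK' : 0 ≤ K') (hy : y * y' = 1)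
    (h1 : X ≤ R) (h2 : x ≤ 216 * (y * K)) (h3 : x' ≤ 216 * (y' * K')) (hyn : 0 ≤ y)
    (e2 : 1 ≤ d * (c * g)) (hG : G * (g' * g') = 1) :
    X * x * x' ≤ G * (d * (R * (216 * (c * g') * K) * (216 * (g * g') * K'))) := by
  calc X * x * x' ≤ R * (216 * (y * K)) * (216 * (y' * K')) := by gcongr
    _ = (R * (216 * K) * (216 * K')) * (y * y') := by ring
    _ ≤ (R * (216 * K) * (216 * K')) * (d * (c * g)) := by
        rw [hy, mul_one]
        exact le_mul_of_one_le_right (by positivity) e2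
    _ = (R * (216 * K) * (216 * K')) * (d * (c * g)) * (G * (g' * g')) := by rw [hG, mul_one]
    _ = _ := by ring

theorem norm_baseAmp_mul_bracket_le {J : ℕ} {σ : ℤ} (hσ : σ = 1 ∨ σ = -1) (i : Types J) (p : Tree J)
    {ν : Node J → ℤ} {M : ℝ} (hM : 1 < M) (h : NonRes M ν J) {a : Node J} (ha : a ∈ gaugeLeaves J) :
    ‖baseAmp σ J i p ν‖ * bracket (ν a)
      ≤ M ^ (1 / 2 : ℝ) * ∏ j : Fin J, 1296 * (2 ^ (j : ℕ) * M) ^ (-(1 / 2) : ℝ)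
          * kerPow (1 / 2) (childFreq ν j) := by
  simp only [gaugeLeaves, Finset.mem_filter, Finset.mem_univ, true_and] at ha
  obtain ⟨j₀, l, rfl, hl⟩ := ha
  have hb : bracket (ν (some (j₀, l))) ≤ psi (childFreq ν j₀) ^ (1 / 2 : ℝ) :=
    bracket_le_of_gauge (q := childFreq ν j₀) hl
  have hM0 : 0 < M := by linarith
  have hfac : ∀ j : Fin J, 0 ≤ 216 * (2 ^ (j : ℕ) * M) ^ (-(1 / 2) : ℝ) * kerPow (1 / 2) (childFreq ν j) :=
    fun j => by have := kerPow_nonneg (1 / 2) (childFreq ν j); positivity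
  rw [norm_baseAmp, ← Finset.prod_div_distrib, ← Finset.mul_prod_erase _ _ (Finset.mem_univ j₀)]
  have rest : ∏ j ∈ Finset.univ.erase j₀, ‖parentMult σ i p ν j‖ / |(phaseSum ν (j + 1) : ℝ)|
      ≤ ∏ j ∈ Finset.univ.erase j₀, 216 * (2 ^ (j : ℕ) * M) ^ (-(1 / 2) : ℝ)
        * kerPow (1 / 2) (childFreq ν j) :=
    Finset.prod_le_prod (fun j _ => by positivity) fun j _ =>
      norm_parentMult_div_le' hσ i p hM h (by omega) (by norm_num) (by norm_num)
  have hy : 0 < |(phaseSum ν (j₀ + 1) : ℝ)| :=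
    lt_of_lt_of_le (by positivity) (h.le_abs_phaseSum (by omega))
  have first : ‖parentMult σ i p ν j₀‖ / |(phaseSum ν (j₀ + 1) : ℝ)| * bracket (ν (some (j₀, l)))
      ≤ 648 * kerPow (1 / 2) (childFreq ν j₀) := by
    by_cases h0 : parentMult σ i p ν j₀ = 0
    · rw [h0, norm_zero]
      have := kerPow_nonneg (1 / 2) (childFreq ν j₀)
      simp only [zero_div, zero_mul]
      positivity
    set y := |(phaseSum ν (j₀ + 1) : ℝ)|
    have h1 : psi (childFreq ν j₀) ≤ 9 * y :=
      (psi_le_of_parentMult_ne h0).trans (by linarith [h.abs_phase_le (j := j₀) (by omega)])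
    have h2 : psi (childFreq ν j₀) ^ (1 / 2 : ℝ) ≤ 3 * y ^ (1 / 2 : ℝ) := by
      refine (Real.rpow_le_rpow (psi_pos _).le h1 (by norm_num)).trans (le_of_eq ?_)
      rw [Real.mul_rpow (by norm_num) hy.le]
      congr 1
      rw [← Real.sqrt_eq_rpow, show (9 : ℝ) = 3 ^ 2 by norm_num, Real.sqrt_sq (by norm_num)]
    have h3 := norm_parentMult_div_le hσ i p hM h (j := j₀) (by omega) (θ := 1 / 2)
      (by norm_num) (by norm_num)
    calc _ ≤ (216 * (y ^ (-(1 / 2) : ℝ) * kerPow (1 / 2) (childFreq ν j₀))) * (3 * y ^ (1 / 2 : ℝ)) := by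
          refine mul_le_mul h3 (hb.trans h2) (bracket_pos _).le ?_
          have := kerPow_nonneg (1 / 2) (childFreq ν j₀)
          positivity
      _ = 648 * (y ^ (-(1 / 2) : ℝ) * y ^ (1 / 2 : ℝ)) * kerPow (1 / 2) (childFreq ν j₀) := by ring
      _ = _ := by rw [← Real.rpow_add hy]; simp
  have gain : (1 : ℝ) ≤ M ^ (1 / 2 : ℝ) * 2 ^ J * (2 ^ (j₀ : ℕ) * M) ^ (-(1 / 2) : ℝ) := by
    rw [Real.mul_rpow (by positivity) hM0.le]
    have e1 : M ^ (1 / 2 : ℝ) * M ^ (-(1 / 2) : ℝ) = 1 := by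
      rw [← Real.rpow_add hM0]; simp
    have e2 : (1 : ℝ) ≤ 2 ^ J * (2 ^ (j₀ : ℕ)) ^ (-(1 / 2) : ℝ) := by
      have h4 : ((2 : ℝ) ^ J)⁻¹ ≤ (2 ^ (j₀ : ℕ)) ^ (-(1 / 2) : ℝ) := by
        rw [← Real.rpow_natCast, ← Real.rpow_natCast, ← Real.rpow_neg (by norm_num),
          ← Real.rpow_mul (by norm_num)]
        apply Real.rpow_le_rpow_of_exponent_le (by norm_num)
        have : ((j₀ : ℕ) : ℝ) ≤ J := by exact_mod_cast j₀.2.le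
        have h5 : (0 : ℝ) ≤ ((j₀ : ℕ) : ℝ) := Nat.cast_nonneg _
        linarith
      calc (1 : ℝ) = 2 ^ J * (2 ^ J)⁻¹ := by rw [mul_inv_cancel₀]; positivity
        _ ≤ _ := by gcongr
    calc (1 : ℝ) ≤ (M ^ (1 / 2 : ℝ) * M ^ (-(1 / 2) : ℝ)) * (2 ^ J * (2 ^ (j₀ : ℕ)) ^ (-(1 / 2) : ℝ)) := by
          rw [e1]; linarith
      _ = _ := by ring
  have hk := kerPow_nonneg (1 / 2) (childFreq ν j₀)
  have hRn : 0 ≤ ∏ j ∈ Finset.univ.erase j₀, 216 * (2 ^ (j : ℕ) * M) ^ (-(1 / 2) : ℝ)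
        * kerPow (1 / 2) (childFreq ν j) := Finset.prod_nonneg fun j _ => hfac j
  have e3 : ∏ j : Fin J, 1296 * (2 ^ (j : ℕ) * M) ^ (-(1 / 2) : ℝ) * kerPow (1 / 2) (childFreq ν j)
      = 6 ^ J * ∏ j : Fin J, 216 * (2 ^ (j : ℕ) * M) ^ (-(1 / 2) : ℝ)
          * kerPow (1 / 2) (childFreq ν j) := by
    have : (6 : ℝ) ^ J = ∏ _j : Fin J, 6 := by simp
    rw [this, ← Finset.prod_mul_distrib]
    exact Finset.prod_congr rfl fun j _ => by ring
  rw [e3, ← Finset.mul_prod_erase _ _ (Finset.mem_univ j₀)]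
  set Rst := ∏ j ∈ Finset.univ.erase j₀, 216 * (2 ^ (j : ℕ) * M) ^ (-(1 / 2) : ℝ)
        * kerPow (1 / 2) (childFreq ν j)
  have six : (3 : ℝ) * 2 ^ J ≤ 6 ^ J := by
    rw [show (6 : ℝ) = 3 * 2 by norm_num, mul_pow]
    gcongr
    have hJ : J ≠ 0 := by have := j₀.2; omega
    exact le_self_pow₀ (by norm_num) hJ
  have hXn : 0 ≤ ∏ j ∈ Finset.univ.erase j₀, ‖parentMult σ i p ν j‖ / |(phaseSum ν (j + 1) : ℝ)| :=
    Finset.prod_nonneg fun j _ => by positivity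
  exact combine_gain hXn hk (by positivity) hRn first rest gain six (by positivity)

theorem norm_baseAmp_le_of_res {J : ℕ} {σ : ℤ} (hσ : σ = 1 ∨ σ = -1) (i : Types J) (p : Tree J)
    {ν : Node J → ℤ} {M : ℝ} (hM : 1 < M) (hJ : 1 ≤ J) (h : Res M ν J) :
    ‖baseAmp σ (J - 1) i p ν‖
      ≤ M * ∏ j : Fin J, 1296 * (2 ^ (j : ℕ) * M) ^ (-(1 / 2) : ℝ)
          * kerPow (1 / 2) (childFreq ν j) := by
  have hM0 : 0 < M := by linarith
  obtain ⟨k, rfl⟩ : ∃ k, J = k + 1 := ⟨J - 1, by omega⟩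
  obtain ⟨hn, hr⟩ := h
  rw [Nat.add_sub_cancel] at hn ⊢
  rw [norm_baseAmp]
  have hlast : ((Fin.last k : Fin (k + 1)) : ℕ) = k := rfl
  have hsucc := phaseSum_succ ν (Fin.last k)
  rw [hlast] at hsucc
  rcases k with _ | k
  · rw [if_pos rfl] at hr
    have hsucc : phaseSum ν 1 = phase (childFreq ν 0) := by
      have := hsucc
      rw [phaseSum_zero] at this
      simpa using this
    have := norm_parentMult_le_of_phase_le hσ i p ν 0 (θ := 1 / 2) (by norm_num) (by norm_num) hM0
      (by
        have e : phase (childFreq ν 0) = phaseSum ν 1 := hsucc.symm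
        rw [e]; linarith)
    change (∏ j : Fin 1, ‖parentMult σ i p ν j‖) / (∏ j : Fin 0, |(phaseSum ν (j + 1) : ℝ)|)
      ≤ M * ∏ j : Fin 1, 1296 * (2 ^ (j : ℕ) * M) ^ (-(1 / 2) : ℝ) * kerPow (1 / 2) (childFreq ν j)
    rw [Fin.prod_univ_one, Fin.prod_univ_zero, Fin.prod_univ_one, div_one]
    simp only [Fin.val_zero, pow_zero, one_mul]
    refine this.trans ?_
    have e : M ^ (1 - 1 / 2 : ℝ) = M * M ^ (-(1 / 2) : ℝ) := by
      rw [show (1 - 1 / 2 : ℝ) = 1 + -(1 / 2) by norm_num, Real.rpow_add hM0, Real.rpow_one]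
    rw [e]
    have := kerPow_nonneg (1 / 2) (childFreq ν (0 : Fin 1))
    have h2 : 0 ≤ M * (M ^ (-(1 / 2) : ℝ) * kerPow (1 / 2) (childFreq ν (0 : Fin 1))) := by positivity
    simp only [Nat.reduceAdd] at *
    nlinarith
  · rw [if_neg (by omega), Nat.add_sub_cancel] at hr
    set y := |(phaseSum ν (k + 1) : ℝ)| with hy
    have hle : 2 ^ k * M ≤ y := hn.le_abs_phaseSum (j := k) (by omega)
    have hy0 : 0 < y := lt_of_lt_of_le (by positivity) hle
    have hph : |(phase (childFreq ν (Fin.last (k + 1))) : ℝ)| ≤ 3 * y := by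
      have e : (phase (childFreq ν (Fin.last (k + 1))) : ℝ) = phaseSum ν (k + 1 + 1) - phaseSum ν (k + 1) := by
        rw [hsucc]; push_cast; ring
      rw [e]
      exact (abs_sub _ _).trans (by linarith)
    have b1 := norm_parentMult_le_of_phase_le hσ i p ν (Fin.last (k + 1)) (θ := 1 / 2) (by norm_num)
      (by norm_num) hy0 hph
    have b2 := norm_parentMult_div_le hσ i p hM hn (j := (Fin.last k).castSucc) (θ := 1 / 2)
      (by simp) (by norm_num) (by norm_num)
    have b3 : ∏ j : Fin k, ‖parentMult σ i p ν j.castSucc.castSucc‖ / |(phaseSum ν (j + 1) : ℝ)|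
        ≤ ∏ j : Fin k, 216 * (2 ^ (j : ℕ) * M) ^ (-(1 / 2) : ℝ)
          * kerPow (1 / 2) (childFreq ν j.castSucc.castSucc) :=
      Finset.prod_le_prod (fun j _ => by positivity) fun j _ => by
        have := norm_parentMult_div_le' hσ i p hM hn (j := j.castSucc.castSucc) (θ := 1 / 2)
          (by simp) (by norm_num) (by norm_num)
        simpa using this
    have e3 : ∏ j : Fin (k + 1 + 1), 1296 * (2 ^ (j : ℕ) * M) ^ (-(1 / 2) : ℝ) * kerPow (1 / 2) (childFreq ν j)
        = 6 ^ (k + 2) * ∏ j : Fin (k + 1 + 1), 216 * (2 ^ (j : ℕ) * M) ^ (-(1 / 2) : ℝ)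
            * kerPow (1 / 2) (childFreq ν j) := by
      have : (6 : ℝ) ^ (k + 2) = ∏ _j : Fin (k + 1 + 1), 6 := by simp
      rw [this, ← Finset.prod_mul_distrib]
      exact Finset.prod_congr rfl fun j _ => by ring
    rw [e3]
    simp only [Fin.prod_univ_castSucc, Fin.val_castSucc, Fin.val_last] at b1 b2 b3 ⊢
    rw [show ((2 : ℝ) ^ k * M) ^ (-(1 / 2) : ℝ) = ((2 : ℝ) ^ k) ^ (-(1 / 2) : ℝ) * M ^ (-(1 / 2) : ℝ) from
        Real.mul_rpow (by positivity) hM0.le,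
      show ((2 : ℝ) ^ (k + 1) * M) ^ (-(1 / 2) : ℝ) = ((2 : ℝ) ^ (k + 1)) ^ (-(1 / 2) : ℝ)
        * M ^ (-(1 / 2) : ℝ) from Real.mul_rpow (by positivity) hM0.le]
    have n1 := kerPow_nonneg (1 / 2) (childFreq ν (Fin.last (k + 1)))
    have n2 := kerPow_nonneg (1 / 2) (childFreq ν (Fin.last k).castSucc)
    set K1 := kerPow (1 / 2) (childFreq ν (Fin.last (k + 1)))
    set K2 := kerPow (1 / 2) (childFreq ν (Fin.last k).castSucc)
    set P3 := ∏ j : Fin k, 216 * (2 ^ (j : ℕ) * M) ^ (-(1 / 2) : ℝ)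
          * kerPow (1 / 2) (childFreq ν j.castSucc.castSucc)
    have n3 : 0 ≤ P3 := Finset.prod_nonneg fun j _ => by
      have := kerPow_nonneg (1 / 2) (childFreq ν j.castSucc.castSucc)
      positivity
    have eM : M * (M ^ (-(1 / 2) : ℝ) * M ^ (-(1 / 2) : ℝ)) = 1 := by
      rw [← Real.rpow_add hM0]; norm_num
      rw [Real.rpow_neg_one]; field_simp
    have e2 : (1 : ℝ) ≤ 6 ^ (k + 2) * (((2 : ℝ) ^ k) ^ (-(1 / 2) : ℝ) * ((2 : ℝ) ^ (k + 1)) ^ (-(1 / 2) : ℝ)) := by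
      have h4 : ((2 : ℝ) ^ (k + 2))⁻¹ ≤ ((2 : ℝ) ^ k) ^ (-(1 / 2) : ℝ) * ((2 : ℝ) ^ (k + 1)) ^ (-(1 / 2) : ℝ) := by
        rw [← Real.rpow_natCast, ← Real.rpow_natCast, ← Real.rpow_natCast, ← Real.rpow_neg (by norm_num),
          ← Real.rpow_mul (by norm_num), ← Real.rpow_mul (by norm_num), ← Real.rpow_add (by norm_num)]
        apply Real.rpow_le_rpow_of_exponent_le (by norm_num)
        push_cast
        linarith
      calc (1 : ℝ) = 2 ^ (k + 2) * (2 ^ (k + 2))⁻¹ := by rw [mul_inv_cancel₀]; positivity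
        _ ≤ _ := by gcongr; norm_num
    have hyy : y ^ (-(1 / 2) : ℝ) * y ^ (1 - 1 / 2 : ℝ) = 1 := by
      rw [← Real.rpow_add hy0]; norm_num
    have fin := combine_res (by positivity) (norm_nonneg _) n3 n2 n1 hyy b3 b2 b1 (by positivity) e2 eM
    refine le_trans (le_of_eq ?_) fin
    rw [Finset.prod_div_distrib, ← hy, div_mul_div_comm, div_mul_eq_mul_div]

theorem norm_baseAmp_next_le {J : ℕ} {σ : ℤ} (hσ : σ = 1 ∨ σ = -1) (i : Types (J + 1)) (p : Tree (J + 1))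
    {ν : Node (J + 1) → ℤ} {M θ : ℝ} (hM : 1 < M) (h : NonRes M ν J) (hθ : 0 ≤ θ) (hθ1 : θ ≤ 1) :
    ‖baseAmp σ J i p ν‖
      ≤ (∏ j : Fin J, 216 * (2 ^ (j : ℕ) * M) ^ (-θ) * kerPow θ (childFreq ν j.castSucc))
        * (24 * kerM (childFreq ν (Fin.last J))) := by
  rw [norm_baseAmp, Fin.prod_univ_castSucc, mul_div_right_comm, ← Finset.prod_div_distrib]
  gcongr with j hj
  · exact Finset.prod_nonneg fun j _ => by
      have := kerPow_nonneg θ (childFreq ν j.castSucc)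
      positivity
  · exact norm_parentMult_div_le' hσ i p hM h (j := j.castSucc) (by simp) hθ hθ1
  · exact norm_parentMult_le hσ i p ν _

section

/-! ### Boundedness of the forms attached to trees -/

open Classical in
/-- The amplitude `A`, restricted to the index functions with `n_root = n`. -/
def treeAmp {J : ℕ} (p : Tree J) (A : (Node J → ℤ) → ℂ) (n : ℤ) (ν : Node J → ℤ) : ℂ :=
  if ν ∈ indexSet p n then A ν else 0

/-- Evaluation of index functions. -/
def evalNode (J : ℕ) (_ : ℤ) (ν : Node J → ℤ) (a : Node J) : ℤ := ν a

theorem tsum_treeAmp_le {J : ℕ} (p : Tree J) {A : (Node J → ℤ) → ℂ} {K : ℝ}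
    {κ : Fin J → (Fin 5 → ℤ) → ℝ} (hK : 0 ≤ K) (hκ : ∀ j q, 0 ≤ κ j q)
    (hA : ∀ ν, ‖A ν‖ ≤ K * ∏ j, κ j (childFreq ν j)) (g : Node J → ℤ → ℝ≥0∞) (n : ℤ) :
    ∑' ν, ‖treeAmp p A n ν‖ₑ * ∏ a ∈ leaves p.1, g a (evalNode J n ν a)
      ≤ ENNReal.ofReal K * treeForm p.1 κ g n := by
  unfold treeForm
  rw [← ENNReal.tsum_mul_left]
  refine ENNReal.tsum_le_tsum fun ν => ?_
  unfold treeAmp evalNode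
  by_cases h : ν ∈ indexSet p n
  · have h' : (∀ j, ν (p.1 j) = ∑ l, ν (some (j, l))) ∧ ν none = n := h
    rw [if_pos h, if_pos h', ← mul_assoc]
    gcongr
    rw [← ENNReal.ofReal_prod_of_nonneg fun j _ => hκ j _, ← ENNReal.ofReal_mul hK, ← ofReal_norm]
    exact ENNReal.ofReal_le_ofReal (hA ν)
  · rw [if_neg h]
    simp

theorem Q5_const_mul {c : ℝ} (hc : 0 ≤ c) (K : (Fin 5 → ℤ) → ℝ) (f : Fin 5 → ℤ → ℝ≥0∞) (n : ℤ) :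
    Q5 (fun q => c * K q) f n = ENNReal.ofReal c * Q5 K f n := by
  unfold Q5
  rw [← ENNReal.tsum_mul_left]
  refine tsum_congr fun q => ?_
  split_ifs
  · rw [ENNReal.ofReal_mul hc, mul_assoc]
  · simp

theorem Q5_mono {K K' : (Fin 5 → ℤ) → ℝ} (h : ∀ q, K q ≤ K' q) (f : Fin 5 → ℤ → ℝ≥0∞) (n : ℤ) :
    Q5 K f n ≤ Q5 K' f n := by
  unfold Q5
  refine ENNReal.tsum_le_tsum fun q => ?_
  split_ifs
  · gcongr; exact h q
  · exact le_rfl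

theorem mbound_tree {s : ℝ} (hs : 1 / 2 < s) (hs1 : s ≤ 1) : ∃ C : ℝ, 1 ≤ C ∧
    ∀ {J : ℕ} (p : Tree J) {A : (Node J → ℤ) → ℂ} {K : ℝ} {c : Fin J → ℝ} (_ : 0 ≤ K) (_ : ∀ j, 0 ≤ c j)
      (_ : ∀ ν, ‖A ν‖ ≤ K * ∏ j, c j * kerPow (1 / 2) (childFreq ν j)),
      MBound (leaves p.1) (evalNode J) (treeAmp p A) s (fun _ => s) (K * ∏ j, c j * C) := by
  obtain ⟨C, hC⟩ := main_estimate hs hs1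
  refine ⟨C + 1, by linarith [C.2], fun {J} p A K c hK hc hA g => ?_⟩
  refine (lN_mono fun n => tsum_treeAmp_le p (κ := fun j q => c j * kerPow (1 / 2) q) hK
    (fun j q => mul_nonneg (hc j) (kerPow_nonneg _ q)) hA g n).trans ?_
  rw [lN_const_mul, ENNReal.ofReal_mul hK, mul_assoc]
  gcongr
  have := lN_treeForm_le (s := s) p.2 none (by simp) (fun j q => c j * kerPow (1 / 2) q)
    (fun j => ENNReal.ofReal (c j * (C + 1))) (fun j b _ hb f => by
      obtain rfl : b = none := by
        rcases b with _ | b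
        · rfl
        · simp at hb
      have e : Q5 (fun q => c j * kerPow (1 / 2) q) f
          = fun n => ENNReal.ofReal (c j) * Q5 (kerPow (1 / 2)) f n :=
        funext fun n => Q5_const_mul (hc j) _ f n
      rw [e, lN_const_mul, ENNReal.ofReal_mul (hc j), mul_assoc]
      gcongr
      have h1 := hC f
      rw [show (fun q => kerM q * psi q ^ (-(1 / 2) : ℝ)) = kerPow (1 / 2) by
        unfold kerPow; norm_num] at h1
      simp only [outlow, exlow, Option.isSome_none, Bool.false_eq_true, if_false, reduceCtorEq]
      refine h1.trans ?_
      gcongr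
      rw [← ENNReal.ofReal_coe_nnreal]
      exact ENNReal.ofReal_le_ofReal (by linarith)) g
  simp only [outlow, exlow, Option.isSome_none, Bool.false_eq_true, if_false, reduceCtorEq] at this
  rwa [ENNReal.ofReal_prod_of_nonneg fun j _ => mul_nonneg (hc j) (by positivity)]

theorem lN_kerPow_le {s : ℝ} (hs : 1 / 2 < s) (hs1 : s ≤ 1) : ∃ C : ℝ, 1 ≤ C ∧
    (∀ b : Option (Fin 5), (∀ l, b = some l → ¬ IsGaugeSlot l) → ∀ f,
      lN (outlow s b) (Q5 (kerPow ((s - 1 / 2) / 2)) f)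
        ≤ ENNReal.ofReal C * ∏ l, lN (exlow s b l) (f l))
    ∧ ∀ f, lN (s - 1) (Q5 kerM f) ≤ ENNReal.ofReal C * ∏ l, lN s (f l) := by
  obtain ⟨C₁, hC₁⟩ := main_estimate hs hs1
  obtain ⟨C₂, hC₂⟩ := main_estimate_last hs hs1
  have hlow : ∀ b : Fin 5, ∃ C : ℝ≥0, ¬ IsGaugeSlot b → ∀ f,
      lN (s - 1) (Q5 (fun q => kerM q * psi q ^ (-(1 - (s - 1 / 2) / 2))) f)
        ≤ C * ∏ l, lN (if l = b then s - 1 else s) (f l) := by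
    intro b
    by_cases hb : IsGaugeSlot b
    · exact ⟨0, fun h => absurd hb h⟩
    · obtain ⟨C, hC⟩ := main_estimate_low hs hs1 hb
      exact ⟨C, fun _ => hC⟩
  choose C₃ hC₃ using hlow
  have hn : 0 ≤ ∑ b, (C₃ b : ℝ) := Finset.sum_nonneg fun b _ => (C₃ b).2
  have n1 := C₁.2
  have n2 := C₂.2
  have up : ∀ (c : ℝ≥0) (X : ℝ≥0∞), (c : ℝ) ≤ 1 + C₁ + C₂ + ∑ b, (C₃ b : ℝ) →
      (c : ℝ≥0∞) * X ≤ ENNReal.ofReal (1 + C₁ + C₂ + ∑ b, (C₃ b : ℝ)) * X := by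
    intro c X h
    gcongr
    rw [← ENNReal.ofReal_coe_nnreal]
    exact ENNReal.ofReal_le_ofReal h
  refine ⟨1 + C₁ + C₂ + ∑ b, (C₃ b : ℝ), by linarith [C₁.2, C₂.2], ?_, ?_⟩
  · intro b hb f
    rcases b with _ | b
    · simp only [outlow, exlow, Option.isSome_none, Bool.false_eq_true, if_false, reduceCtorEq]
      refine le_trans (lN_mono fun n => Q5_mono (fun q => ?_) f n) ((hC₁ f).trans (up _ _ (by linarith [C₂.2])))
      unfold kerPow
      have := kerM_nonneg q
      gcongr
      · exact one_le_psi q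
      · linarith
    · simp only [outlow, exlow, Option.isSome_some, if_true, Option.some.injEq, eq_comm (a := b)]
      refine (hC₃ b (hb b rfl) f).trans (up _ _ ?_)
      have := Finset.single_le_sum (f := fun b => (C₃ b : ℝ)) (fun b _ => (C₃ b).2) (Finset.mem_univ b)
      linarith
  · intro f
    exact (hC₂ f).trans (up _ _ (by linarith [C₁.2]))

theorem mbound_tree_next {s : ℝ} (hs : 1 / 2 < s) (hs1 : s ≤ 1) : ∃ C : ℝ, 1 ≤ C ∧
    ∀ {J : ℕ} (p : Tree (J + 1)) {A : (Node (J + 1) → ℤ) → ℂ} {K : ℝ} {c : Fin J → ℝ}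
      (_ : 0 ≤ K) (_ : ∀ j, 0 ≤ c j)
      (_ : ∀ ν, ‖A ν‖ ≤ K * ((∏ j : Fin J, c j * kerPow ((s - 1 / 2) / 2) (childFreq ν j.castSucc))
        * kerM (childFreq ν (Fin.last J)))),
      MBound (leaves p.1) (evalNode (J + 1)) (treeAmp p A) (s - 1) (fun _ => s)
        (K * ((∏ j, c j * C) * C)) := by
  obtain ⟨C, hC1, hC, hC'⟩ := lN_kerPow_le hs hs1
  refine ⟨C, hC1, fun {J} p A K c hK hc hA g => ?_⟩
  let κ : Fin (J + 1) → (Fin 5 → ℤ) → ℝ :=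
    Fin.lastCases (fun q => kerM q) fun j q => c j * kerPow ((s - 1 / 2) / 2) q
  have hκl : κ (Fin.last J) = kerM := by simp [κ]
  have hκc : ∀ j : Fin J, κ j.castSucc = fun q => c j * kerPow ((s - 1 / 2) / 2) q := by simp [κ]
  have hκ : ∀ j q, 0 ≤ κ j q := by
    intro j q
    refine Fin.lastCases ?_ (fun j => ?_) j
    · rw [hκl]; exact kerM_nonneg q
    · rw [hκc]; exact mul_nonneg (hc j) (kerPow_nonneg _ q)
  refine (lN_mono fun n => tsum_treeAmp_le p (κ := κ) hK hκ (fun ν => ?_) g n).trans ?_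
  · rw [Fin.prod_univ_castSucc]
    simp only [hκl, hκc]
    exact hA ν
  rw [lN_const_mul, ENNReal.ofReal_mul hK, mul_assoc]
  gcongr
  obtain ⟨p', c₀, hp', hpp, hpc, hcl, hcg⟩ := p.2.exists_restrict
  have e : treeForm p.1 κ g = _ := funext fun n => treeForm_succ hpp hpc hcl κ g n
  rw [e, hκl]
  have step := lN_treeForm_le (s := s) hp' (some c₀)
    (fun a h => by obtain rfl := Option.some.inj h; exact ⟨hcl, hcg⟩)
    (fun j q => c j * kerPow ((s - 1 / 2) / 2) q) (fun j => ENNReal.ofReal (c j * C))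
    (fun j b hb _ f => by
      have e : Q5 (fun q => c j * kerPow ((s - 1 / 2) / 2) q) f
          = fun n => ENNReal.ofReal (c j) * Q5 (kerPow ((s - 1 / 2) / 2)) f n :=
        funext fun n => Q5_const_mul (hc j) _ f n
      rw [e, lN_const_mul, ENNReal.ofReal_mul (hc j), mul_assoc]
      gcongr
      exact hC b hb f)
    (fun a => if a = c₀ then Q5 kerM (fun l => g (some (Fin.last J, l))) else g (liftNode a))
  simp only [hκc]
  simp only [outlow, Option.isSome_some, if_true] at step
  refine step.trans ?_
  rw [← Finset.mul_prod_erase _ _ hcl, if_pos rfl, prod_leaves_succ hpp hpc]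
  rw [Finset.prod_congr rfl (g := fun a => lN s (g (liftNode a))) fun a ha => by
    have hne := Finset.ne_of_mem_erase ha
    rw [if_neg hne, exlow, if_neg (by simpa using hne.symm)]]
  simp only [exlow, if_true]
  have hCn : 0 ≤ C := by linarith
  rw [ENNReal.ofReal_mul (Finset.prod_nonneg fun j _ => mul_nonneg (hc j) hCn),
    ENNReal.ofReal_prod_of_nonneg fun j _ => mul_nonneg (hc j) hCn]
  calc _ ≤ (∏ j, ENNReal.ofReal (c j * C)) * ((ENNReal.ofReal C
        * ∏ l, lN s (g (some (Fin.last J, l)))) * ∏ a ∈ (leaves p').erase c₀, lN s (g (liftNode a))) := by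
        gcongr
        exact hC' _
    _ = _ := by ring

/-! ### Sums over types and trees -/

theorem memL2_sum_card {ι : Type*} {r B : ℝ} (S : Finset ι) {a : ι → ℤ → ℂ}
    (h : ∀ i ∈ S, MemL2 r (a i) ∧ l2Norm r (a i) ≤ B) :
    MemL2 r (∑ i ∈ S, a i) ∧ l2Norm r (∑ i ∈ S, a i) ≤ S.card * B :=
  ⟨MemL2.sum S fun i hi => (h i hi).1, (l2Norm_sum_le S fun i hi => (h i hi).1).trans
    ((Finset.sum_le_sum fun i hi => (h i hi).2).trans (by simp))⟩

/-- The summand `F` is a sum over `b` of products of functions at the leaves, with an oscillating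
amplitude. -/
def TreeRep {J : ℕ} (T : ℝ) (F : ℝ → Summand J) (Bs : Tree J → Finset (Node J))
    (A : Types J → Tree J → Node J → (Node J → ℤ) → ℂ)
    (f : ℝ → Types J → Tree J → Node J → Node J → ℤ → ℂ) : Prop :=
  ∀ t ∈ Set.Icc 0 T, ∀ i p ν, F t i p ν = ∑ b ∈ Bs p,
    Complex.exp (Complex.I * t * ((phaseSum ν J : ℝ) : ℂ)) * A i p b ν
      * ∏ a ∈ leaves p.1, f t i p b a (ν a)

section

variable {J : ℕ} {T : ℝ} {F : ℝ → Summand J} {Bs : Tree J → Finset (Node J)}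
  {A : Types J → Tree J → Node J → (Node J → ℤ) → ℂ}
  {f : ℝ → Types J → Tree J → Node J → Node J → ℤ → ℂ} {r s B : ℝ}

/-- The form of a tree at time `t`. -/
def treeMform (A : Types J → Tree J → Node J → (Node J → ℤ) → ℂ)
    (f : ℝ → Types J → Tree J → Node J → Node J → ℤ → ℂ) (t : ℝ) (i : Types J) (p : Tree J)
    (b : Node J) : ℤ → ℂ :=
  mform (leaves p.1) (evalNode J) (phased (fun _ ν => (phaseSum ν J : ℝ)) (treeAmp p (A i p b)) t)
    (f t i p b)

theorem TreeRep.hasSum (h : TreeRep T F Bs A f) (hB : 0 ≤ B)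
    (hA : ∀ i p, ∀ b ∈ Bs p, MBound (leaves p.1) (evalNode J) (treeAmp p (A i p b)) r (fun _ => s) B)
    (hf : ∀ t ∈ Set.Icc 0 T, ∀ i p, ∀ b ∈ Bs p, ∀ a ∈ leaves p.1, MemL2 s (f t i p b a)) {t : ℝ}
    (ht : t ∈ Set.Icc 0 T) (i : Types J) (p : Tree J) (n : ℤ) :
    HasSum (fun ν : indexSet p n => F t i p ν.1) (∑ b ∈ Bs p, treeMform A f t i p b n) := by
  have h1 : ∀ b ∈ Bs p, HasSum (fun ν : Node J → ℤ =>
      phased (fun _ ν => (phaseSum ν J : ℝ)) (treeAmp p (A i p b)) t n ν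
        * ∏ a ∈ leaves p.1, f t i p b a (evalNode J n ν a)) (treeMform A f t i p b n) := fun b hb =>
    (((hA i p b hb).phased (fun _ ν => (phaseSum ν J : ℝ)) t).summable hB (hf t ht i p b hb) n).hasSum
  have h2 := hasSum_sum h1
  rw [← hasSum_subtype_iff_of_support_subset (s := indexSet p n)] at h2
  · convert h2 using 1
    funext ν
    rw [h t ht, Function.comp_apply]
    refine Finset.sum_congr rfl fun b _ => ?_
    rw [phased, treeAmp, if_pos ν.2]
    rfl
  · intro ν hν
    by_contra hc
    apply hν
    refine Finset.sum_eq_zero fun b _ => ?_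
    rw [phased, treeAmp, if_neg hc]
    simp

theorem TreeRep.treeSum_eq (h : TreeRep T F Bs A f) (hB : 0 ≤ B)
    (hA : ∀ i p, ∀ b ∈ Bs p, MBound (leaves p.1) (evalNode J) (treeAmp p (A i p b)) r (fun _ => s) B)
    (hf : ∀ t ∈ Set.Icc 0 T, ∀ i p, ∀ b ∈ Bs p, ∀ a ∈ leaves p.1, MemL2 s (f t i p b a)) {t : ℝ}
    (ht : t ∈ Set.Icc 0 T) : treeSum (F t) = ∑ i, ∑ p, ∑ b ∈ Bs p, treeMform A f t i p b := by
  ext n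
  simp only [treeSum, Finset.sum_apply]
  exact Finset.sum_congr rfl fun i _ => Finset.sum_congr rfl fun p _ =>
    (h.hasSum hB hA hf ht i p n).tsum_eq

theorem card_le_of_subset_node {J : ℕ} (S : Finset (Node J)) : S.card ≤ 5 * J + 1 := by
  refine (Finset.card_le_univ S).trans (le_of_eq ?_)
  simp [Node, mul_comm]

end

/-! ### Counting -/

theorem card_tree_le (J : ℕ) : Fintype.card (Tree J) ≤ ∏ j : Fin J, (5 * (j : ℕ) + 1) := by
  let Φ : Tree J → ∀ j : Fin J, Option (Fin j × Fin 5) := fun p j =>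
    (p.1 j).pmap (fun x (hx : x.1 < j) => (⟨x.1, hx⟩, x.2))
      (fun x hx => (p.2.2.2 j x.1 x.2 hx).1)
  have hΦ : Function.Injective Φ := by
    intro p p' h
    apply Subtype.ext
    funext j
    have hj := congrFun h j
    simp only [Φ] at hj
    rcases hp : p.1 j with _ | ⟨k, l⟩ <;> rcases hp' : p'.1 j with _ | ⟨k', l'⟩ <;>
      simp [hp, hp'] at hj ⊢
    exact ⟨Fin.ext hj.1, hj.2⟩
  refine (Fintype.card_le_of_injective Φ hΦ).trans (le_of_eq ?_)
  rw [Fintype.card_pi]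
  refine Finset.prod_congr rfl fun j _ => ?_
  simp [mul_comm]

theorem count_factor_le {θ : ℝ} (hθ : 0 < θ) (hθ1 : θ ≤ 1) (j : ℕ) :
    (5 * (j : ℝ) + 1) * ((2 : ℝ) ^ j) ^ (-θ) ≤ 10 / θ := by
  have h1 : (1 : ℝ) + θ * j / 2 ≤ ((2 : ℝ) ^ j) ^ θ := by
    rw [← Real.rpow_natCast, ← Real.rpow_mul (by norm_num), Real.rpow_def_of_pos (by norm_num)]
    have h2 := Real.add_one_le_exp (Real.log 2 * (j * θ))
    have h3 : (1 / 2 : ℝ) ≤ Real.log 2 := by linarith [Real.log_two_gt_d9]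
    have h4 : 0 ≤ (j : ℝ) * θ := by positivity
    nlinarith
  rw [Real.rpow_neg (by positivity), ← div_eq_mul_inv, div_le_div_iff₀ (by positivity) hθ]
  have h4 : 0 ≤ (j : ℝ) := by positivity
  nlinarith

theorem card_tree_mul_prod_le {θ M : ℝ} (hθ : 0 < θ) (hθ1 : θ ≤ 1) (hM : 1 < M) (J : ℕ) :
    (∏ j : Fin J, (5 * ((j : ℕ) : ℝ) + 1)) * ∏ j : Fin J, (2 ^ (j : ℕ) * M) ^ (-θ)
      ≤ (10 / θ * M ^ (-θ)) ^ J := by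
  have hM0 : 0 < M := by linarith
  rw [← Finset.prod_mul_distrib]
  have : ((10 / θ * M ^ (-θ)) ^ J : ℝ) = ∏ _j : Fin J, 10 / θ * M ^ (-θ) := by simp
  rw [this]
  refine Finset.prod_le_prod (fun j _ => by positivity) fun j _ => ?_
  rw [Real.mul_rpow (by positivity) hM0.le, ← mul_assoc]
  gcongr
  exact count_factor_le hθ hθ1 j

theorem five_mul_add_one_le (J : ℕ) : (5 * (J : ℝ) + 1) ≤ 6 ^ J := by
  have := one_add_mul_le_pow (a := (5 : ℝ)) (by norm_num) J
  norm_num at this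
  linarith

theorem total_le {M G C X : ℝ} (hM : 1 < M) (hG : 0 ≤ G) (hC : 0 ≤ C) (hX : 1 ≤ X) {J : ℕ} (hJ : 1 ≤ J) :
    7 ^ J * (Fintype.card (Tree J) * ((5 * J + 1) * ((G * ∏ j : Fin J,
      1296 * (2 ^ (j : ℕ) * M) ^ (-(1 / 2) : ℝ) * C) * ((5 * J + 1) * X ^ (5 * J + 1)))))
      ≤ G * ((7 * 20 * 36 * 1296 * C * X ^ 6) * M ^ (-(1 / 2) : ℝ)) ^ J := by
  have hM0 : 0 < M := by linarith
  have h1 := card_tree_mul_prod_le (θ := 1 / 2) (by norm_num) (by norm_num) hM J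
  have h2 : (Fintype.card (Tree J) : ℝ) ≤ ∏ j : Fin J, (5 * ((j : ℕ) : ℝ) + 1) := by
    have := card_tree_le J
    exact_mod_cast this
  have e : ∏ j : Fin J, 1296 * (2 ^ (j : ℕ) * M) ^ (-(1 / 2) : ℝ) * C
      = (1296 * C) ^ J * ∏ j : Fin J, (2 ^ (j : ℕ) * M) ^ (-(1 / 2) : ℝ) := by
    have : ((1296 * C) ^ J : ℝ) = ∏ _j : Fin J, 1296 * C := by simp
    rw [this, ← Finset.prod_mul_distrib]
    exact Finset.prod_congr rfl fun j _ => by ring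
  rw [e]
  have hP : 0 ≤ ∏ j : Fin J, ((2 : ℝ) ^ (j : ℕ) * M) ^ (-(1 / 2) : ℝ) :=
    Finset.prod_nonneg fun j _ => by positivity
  set P := ∏ j : Fin J, ((2 : ℝ) ^ (j : ℕ) * M) ^ (-(1 / 2) : ℝ)
  have h3 := five_mul_add_one_le J
  have h4 : X ^ (5 * J + 1) ≤ X ^ (6 * J) := pow_le_pow_right₀ hX (by omega)
  have hXn : 0 ≤ X := by linarith
  calc _ = G * (1296 * C) ^ J * (7 ^ J * ((5 * J + 1) * (5 * J + 1) * X ^ (5 * J + 1)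
          * (Fintype.card (Tree J) * P))) := by ring
    _ ≤ G * (1296 * C) ^ J * (7 ^ J * (6 ^ J * 6 ^ J * X ^ (6 * J)
          * (10 / (1 / 2) * M ^ (-(1 / 2) : ℝ)) ^ J)) := by
        gcongr
        exact le_trans (by gcongr) h1
    _ = _ := by
        rw [pow_mul]
        simp only [← mul_pow, mul_assoc]
        congr 2
        ring

theorem total_next_le {M θ C X : ℝ} (hM : 1 < M) (hθ : 0 < θ) (hθ1 : θ ≤ 1) (hC : 1 ≤ C) (hX : 1 ≤ X)
    (J : ℕ) :
    7 ^ (J + 1) * (Fintype.card (Tree (J + 1)) * ((5 * (J + 1 : ℕ) + 1) * ((24 * ((∏ j : Fin J,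
      216 * (2 ^ (j : ℕ) * M) ^ (-θ) * C) * C)) * X ^ (5 * (J + 1) + 1))))
      ≤ (7 * 6 * 24 * 216 * 36 * (10 / θ) * C * X ^ 6)
        * ((7 * 6 * 24 * 216 * 36 * (10 / θ) * C * X ^ 6) * M ^ (-θ)) ^ J := by
  have hM0 : 0 < M := by linarith
  have h1 := card_tree_mul_prod_le hθ hθ1 hM J
  have h2 : (Fintype.card (Tree (J + 1)) : ℝ) ≤ (∏ j : Fin J, (5 * ((j : ℕ) : ℝ) + 1)) * (5 * J + 1) := by
    have := card_tree_le (J + 1)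
    rw [Fin.prod_univ_castSucc] at this
    simp only [Fin.val_castSucc, Fin.val_last] at this
    exact_mod_cast this
  have hCn : 0 ≤ C := by linarith
  have e : ∏ j : Fin J, 216 * (2 ^ (j : ℕ) * M) ^ (-θ) * C
      = (216 * C) ^ J * ∏ j : Fin J, (2 ^ (j : ℕ) * M) ^ (-θ) := by
    have : ((216 * C) ^ J : ℝ) = ∏ _j : Fin J, 216 * C := by simp
    rw [this, ← Finset.prod_mul_distrib]
    exact Finset.prod_congr rfl fun j _ => by ring
  rw [e]
  have hP : 0 ≤ ∏ j : Fin J, ((2 : ℝ) ^ (j : ℕ) * M) ^ (-θ) :=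
    Finset.prod_nonneg fun j _ => by positivity
  have hQ : 0 ≤ ∏ j : Fin J, (5 * ((j : ℕ) : ℝ) + 1) := Finset.prod_nonneg fun j _ => by positivity
  set P := ∏ j : Fin J, ((2 : ℝ) ^ (j : ℕ) * M) ^ (-θ)
  set Q := ∏ j : Fin J, (5 * ((j : ℕ) : ℝ) + 1)
  have h3 := five_mul_add_one_le J
  have h3' : (5 * ((J + 1 : ℕ) : ℝ) + 1) ≤ 6 * 6 ^ J := by
    push_cast
    have : (1 : ℝ) ≤ 6 ^ J := one_le_pow₀ (by norm_num)
    linarith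
  have h4 : X ^ (5 * (J + 1) + 1) ≤ X ^ 6 * X ^ (6 * J) := by
    rw [← pow_add]
    exact pow_le_pow_right₀ hX (by omega)
  have hXn : 0 ≤ X := by linarith
  have hX6 : (1 : ℝ) ≤ X ^ 6 := one_le_pow₀ hX
  have hθ2 : 1 ≤ 10 / θ := by rw [le_div_iff₀ hθ]; linarith
  calc _ = (216 * C) ^ J * (7 ^ (J + 1) * ((5 * (J + 1 : ℕ) + 1) * (24 * C) * X ^ (5 * (J + 1) + 1)
          * (Fintype.card (Tree (J + 1)) * P))) := by ring
    _ ≤ (216 * C) ^ J * (7 ^ (J + 1) * ((6 * 6 ^ J) * (24 * C) * (X ^ 6 * X ^ (6 * J))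
          * ((Q * 6 ^ J) * P))) := by
        gcongr
        exact h2.trans (by gcongr)
    _ = (216 * C) ^ J * (7 ^ (J + 1) * ((6 * 6 ^ J) * (24 * C) * (X ^ 6 * X ^ (6 * J))
          * (6 ^ J * (Q * P)))) := by ring
    _ ≤ (216 * C) ^ J * (7 ^ (J + 1) * ((6 * 6 ^ J) * (24 * C) * (X ^ 6 * X ^ (6 * J))
          * (6 ^ J * (10 / θ * M ^ (-θ)) ^ J))) := by
        gcongr
    _ = (7 * 6 * 24 * C * X ^ 6) * ((7 * 216 * 36 * (10 / θ) * C * X ^ 6) * M ^ (-θ)) ^ J := by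
        rw [pow_mul, pow_succ]
        simp only [mul_pow]
        rw [show (36 : ℝ) ^ J = 6 ^ J * 6 ^ J by rw [← mul_pow]; norm_num]
        ring
    _ ≤ _ := by
        have hpos : 0 ≤ 10 / θ := by positivity
        have a1 : 7 * 6 * 24 * C * X ^ 6 ≤ 7 * 6 * 24 * 216 * 36 * (10 / θ) * C * X ^ 6 := by
          calc 7 * 6 * 24 * C * X ^ 6 ≤ 7 * 6 * 24 * C * X ^ 6 * (216 * 36 * (10 / θ)) :=
                le_mul_of_one_le_right (by positivity) (by linarith)
            _ = _ := by ring
        have a2 : 7 * 216 * 36 * (10 / θ) * C * X ^ 6 ≤ 7 * 6 * 24 * 216 * 36 * (10 / θ) * C * X ^ 6 := by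
          calc 7 * 216 * 36 * (10 / θ) * C * X ^ 6 ≤ 7 * 216 * 36 * (10 / θ) * C * X ^ 6 * (6 * 24) :=
                le_mul_of_one_le_right (by positivity) (by norm_num)
            _ = _ := by ring
        gcongr

end

/-! ### Bilinear forms of convolution type -/

theorem n2_conv_le (f g : ℤ → ℝ≥0∞) :
    n2 (fun n => ∑' k, f (n - k) * g k) ≤ (∑' m, f m) * n2 g := by
  refine n2_le_of_dual fun h => ?_
  calc ∑' n, (∑' k, f (n - k) * g k) * h n = ∑' k, ∑' n, f (n - k) * g k * h n := by
        rw [ENNReal.tsum_comm]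
        exact tsum_congr fun n => ENNReal.tsum_mul_right.symm
    _ = ∑' k, ∑' m, f m * (g k * h (m + k)) := by
        refine tsum_congr fun k => ?_
        rw [← (Equiv.addRight k).tsum_eq]
        exact tsum_congr fun m => by simp [mul_assoc]
    _ = ∑' m, f m * ∑' k, g k * h (m + k) := by
        rw [ENNReal.tsum_comm]
        exact tsum_congr fun m => ENNReal.tsum_mul_left
    _ ≤ ∑' m, f m * (n2 g * n2 h) := by
        refine ENNReal.tsum_le_tsum fun m => ?_
        gcongr
        refine (tsum_mul_le_n2 _ _).trans (le_of_eq ?_)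
        rw [← n2_equiv (Equiv.addLeft m) h]
        rfl
    _ = _ := by rw [ENNReal.tsum_mul_right, mul_assoc]

theorem tsum_conv_symm {α : Type*} [AddCommMonoid α] [TopologicalSpace α] (F : ℤ → ℤ → α) (n : ℤ) :
    ∑' k, F (n - k) k = ∑' k, F k (n - k) := by
  rw [← (Equiv.subLeft n).tsum_eq]
  exact tsum_congr fun k => by simp

theorem n2_conv_le' (f g : ℤ → ℝ≥0∞) :
    n2 (fun n => ∑' k, f (n - k) * g k) ≤ n2 f * ∑' m, g m := by
  rw [mul_comm]
  refine le_trans (le_of_eq ?_) (n2_conv_le g f)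
  congr 1
  ext n
  rw [tsum_conv_symm fun i j => f i * g j]
  exact tsum_congr fun k => mul_comm _ _

theorem tsum_conv_le (f g : ℤ → ℝ≥0∞) (n : ℤ) : ∑' k, f (n - k) * g k ≤ n2 f * n2 g := by
  refine (tsum_mul_le_n2 _ _).trans (le_of_eq ?_)
  rw [← n2_equiv (Equiv.subLeft n) f]
  rfl

/-- The bilinear form `∑ₖ A(n,k) a(n-k) b(k)`. -/
def bil (A : ℤ → ℤ → ℂ) (a b : ℤ → ℂ) (n : ℤ) : ℂ := ∑' k, A n k * (a (n - k) * b k)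

/-- Boundedness of `bil A` from `ℓ²_p × ℓ²_q` to `ℓ²_r`, with absolute values inside. -/
def BilBdd (A : ℤ → ℤ → ℂ) (p q r : ℝ) : Prop := ∃ C : ℝ≥0, ∀ f g : ℤ → ℝ≥0∞,
  lN r (fun n => ∑' k, ‖A n k‖ₑ * (f (n - k) * g k)) ≤ C * (lN p f * lN q g)

theorem BilBdd.of_le {A : ℤ → ℤ → ℂ} {p q r ρ c : ℝ} (hρ : 1 / 2 < ρ) (hc : 0 ≤ c)
    (h : ∀ n k, ‖A n k‖ * bracket n ^ r ≤ c * (bracket (n - k) ^ p * bracket k ^ (q - ρ)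
      + bracket (n - k) ^ (p - ρ) * bracket k ^ q
      + bracket (n - k) ^ p * bracket k ^ q * bracket n ^ (-ρ))) : BilBdd A p q r := by
  have hW := n2_wt_ne_top hρ
  set W := n2 (wt (-ρ)) with hWdef
  refine ⟨(c.toNNReal * (3 * W.toNNReal)), fun f g => ?_⟩
  have eW : (W.toNNReal : ℝ≥0∞) = W := ENNReal.coe_toNNReal hW
  have pt : ∀ n, wt r n * ∑' k, ‖A n k‖ₑ * (f (n - k) * g k)
      ≤ ENNReal.ofReal c * ((∑' k, (wt p (n - k) * f (n - k)) * (wt (q - ρ) k * g k)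
        + ∑' k, (wt (p - ρ) (n - k) * f (n - k)) * (wt q k * g k))
        + wt (-ρ) n * ∑' k, (wt p (n - k) * f (n - k)) * (wt q k * g k)) := by
    intro n
    rw [← ENNReal.tsum_mul_left, ← ENNReal.tsum_mul_left, ← ENNReal.tsum_add, ← ENNReal.tsum_add,
      ← ENNReal.tsum_mul_left]
    refine ENNReal.tsum_le_tsum fun k => ?_
    have e1 : ‖A n k‖ₑ * wt r n ≤ ENNReal.ofReal c * (wt p (n - k) * wt (q - ρ) k
        + wt (p - ρ) (n - k) * wt q k + wt p (n - k) * wt q k * wt (-ρ) n) := by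
      unfold wt
      have b := fun m x => (bracket_rpow_pos m x).le
      rw [← ofReal_norm, ← ENNReal.ofReal_mul (norm_nonneg _), ← ENNReal.ofReal_mul (b _ _),
        ← ENNReal.ofReal_mul (b _ _), ← ENNReal.ofReal_mul (b _ _), ← ENNReal.ofReal_mul
        (mul_nonneg (b _ _) (b _ _)), ← ENNReal.ofReal_add, ← ENNReal.ofReal_add,
        ← ENNReal.ofReal_mul hc]
      · exact ENNReal.ofReal_le_ofReal (h n k)
      all_goals
        have := b (n - k) p
        have := b k (q - ρ)
        have := b (n - k) (p - ρ)
        have := b k q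
        have := b n (-ρ)
        positivity
    calc wt r n * (‖A n k‖ₑ * (f (n - k) * g k)) = (‖A n k‖ₑ * wt r n) * (f (n - k) * g k) := by ring
      _ ≤ (ENNReal.ofReal c * (wt p (n - k) * wt (q - ρ) k
        + wt (p - ρ) (n - k) * wt q k + wt p (n - k) * wt q k * wt (-ρ) n)) * (f (n - k) * g k) := by
          gcongr
      _ = _ := by ring
  have l1 : ∀ (e : ℝ) (g : ℤ → ℝ≥0∞), ∑' k, wt (e - ρ) k * g k ≤ W * lN e g := by
    intro e g
    have := tsum_le_lN (r := ρ) fun k => wt (e - ρ) k * g k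
    rwa [lN_wt_mul, show ρ + (e - ρ) = e by ring] at this
  calc lN r (fun n => ∑' k, ‖A n k‖ₑ * (f (n - k) * g k))
      ≤ n2 fun n => ENNReal.ofReal c * ((∑' k, (wt p (n - k) * f (n - k)) * (wt (q - ρ) k * g k)
        + ∑' k, (wt (p - ρ) (n - k) * f (n - k)) * (wt q k * g k))
        + wt (-ρ) n * ∑' k, (wt p (n - k) * f (n - k)) * (wt q k * g k)) := n2_mono pt
    _ ≤ ENNReal.ofReal c * ((lN p f * (W * lN q g) + (W * lN p f) * lN q g)
        + W * (lN p f * lN q g)) := by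
        rw [n2_const_mul]
        gcongr
        refine (n2_add_le _ _).trans (add_le_add ((n2_add_le _ _).trans (add_le_add ?_ ?_)) ?_)
        · refine (n2_conv_le' (fun m => wt p m * f m) (fun m => wt (q - ρ) m * g m)).trans ?_
          gcongr
          · exact le_rfl
          · exact l1 q g
        · refine (n2_conv_le (fun m => wt (p - ρ) m * f m) (fun m => wt q m * g m)).trans ?_
          gcongr
          · exact l1 p f
          · exact le_rfl
        · calc _ ≤ n2 (fun n => (lN p f * lN q g) * wt (-ρ) n) := n2_mono fun n => by
                rw [mul_comm]
                gcongr
                exact tsum_conv_le (fun m => wt p m * f m) (fun m => wt q m * g m) n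
            _ = _ := by rw [n2_const_mul, mul_comm]
    _ = _ := by
        push_cast
        rw [eW]
        change _ = ENNReal.ofReal c * _ * _
        ring

theorem bracket_le_of_abs_le {m n : ℤ} (h : |m| ≤ 2 * |n|) : bracket m ≤ 2 * bracket n := by
  unfold bracket
  rw [show (2 : ℝ) * √(1 + (n : ℝ) ^ 2) = √(4 * (1 + (n : ℝ) ^ 2)) by
    rw [Real.sqrt_mul (by norm_num), show (4 : ℝ) = 2 ^ 2 by norm_num, Real.sqrt_sq (by norm_num)]]
  apply Real.sqrt_le_sqrt
  have : |(m : ℝ)| ≤ 2 * |(n : ℝ)| := by exact_mod_cast h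
  nlinarith [sq_abs (m : ℝ), sq_abs (n : ℝ), abs_nonneg (m : ℝ), abs_nonneg (n : ℝ)]

theorem bracket_rpow_le_add {r : ℝ} (hr : 0 ≤ r) (n k : ℤ) :
    bracket n ^ r ≤ 2 ^ r * (bracket (n - k) ^ r + bracket k ^ r) := by
  have key : ∀ m : ℤ, |n| ≤ 2 * |m| → bracket n ^ r ≤ 2 ^ r * bracket m ^ r := fun m hm => by
    rw [← Real.mul_rpow (by norm_num) (bracket_pos _).le]
    exact Real.rpow_le_rpow (bracket_pos _).le (bracket_le_of_abs_le hm) hr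
  have p1 := bracket_rpow_pos (n - k) r
  have p2 := bracket_rpow_pos k r
  have h2 : (0 : ℝ) < 2 ^ r := by positivity
  rw [mul_add]
  rcases le_total |n - k| |k| with h | h
  · have := key k (by have := abs_add_le (n - k) k; rw [sub_add_cancel] at this; linarith)
    nlinarith
  · have := key (n - k) (by have := abs_add_le (n - k) k; rw [sub_add_cancel] at this; linarith)
    nlinarith

theorem bilBdd_algebra {r : ℝ} (hr : 1 / 2 < r) : BilBdd (fun _ _ => 1) r r r := by
  refine BilBdd.of_le hr (c := 2 ^ r) (by positivity) fun n k => ?_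
  have h := bracket_rpow_le_add (by linarith : 0 ≤ r) n k
  rw [sub_self, Real.rpow_zero, Real.rpow_zero, norm_one, one_mul, one_mul, mul_one]
  refine h.trans ?_
  have := bracket_rpow_pos n (-r)
  have := mul_pos (mul_pos (bracket_rpow_pos (n - k) r) (bracket_rpow_pos k r)) this
  exact mul_le_mul_of_nonneg_left (by linarith) (by positivity)

theorem bracket_rpow_low_le {s : ℝ} (hs : 1 / 2 < s) (hs1 : s ≤ 1) (n k : ℤ) :
    bracket n ^ (s - 1) ≤ 2 * (bracket k ^ (s - 1)
      + bracket (n - k) ^ s * bracket k ^ (s - 1) * bracket n ^ (-s)) := by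
  have p1 := bracket_rpow_pos (n - k) s
  have p2 := bracket_rpow_pos k (s - 1)
  have p3 := bracket_rpow_pos n (-s)
  rcases le_total |k| (2 * |n|) with h | h
  · have h1 := bracket_le_of_abs_le h
    have : bracket n ^ (s - 1) ≤ 2 * bracket k ^ (s - 1) := by
      have h2 : bracket k ^ (1 - s) ≤ 2 * bracket n ^ (1 - s) := by
        calc bracket k ^ (1 - s) ≤ (2 * bracket n) ^ (1 - s) :=
              Real.rpow_le_rpow (bracket_pos _).le h1 (by linarith)
          _ = 2 ^ (1 - s) * bracket n ^ (1 - s) := Real.mul_rpow (by norm_num) (bracket_pos _).le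
          _ ≤ 2 ^ (1 : ℝ) * bracket n ^ (1 - s) := by
              have := bracket_rpow_pos n (1 - s)
              gcongr
              · norm_num
              · linarith
          _ = _ := by rw [Real.rpow_one]
      rw [show s - 1 = -(1 - s) by ring, Real.rpow_neg (bracket_pos _).le, Real.rpow_neg (bracket_pos _).le]
      have q1 := bracket_rpow_pos k (1 - s)
      have q2 := bracket_rpow_pos n (1 - s)
      rw [← div_eq_mul_inv, inv_le_comm₀ q2 (by positivity), inv_div, div_le_iff₀ (by norm_num)]
      linarith
    nlinarith [mul_pos (mul_pos p1 p2) p3]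
  · have h1 : bracket k ≤ 2 * bracket (n - k) := bracket_le_of_abs_le (by
      have := abs_sub_abs_le_abs_sub k n
      rw [abs_sub_comm k n] at this
      linarith)
    have h2 : bracket n ≤ bracket k := bracket_mono (by linarith [abs_nonneg n])
    have : bracket n ^ (s - 1) ≤ 2 * (bracket (n - k) ^ s * bracket k ^ (s - 1) * bracket n ^ (-s)) := by
      have h3 : bracket k ^ s ≤ 2 * bracket (n - k) ^ s := by
        calc bracket k ^ s ≤ (2 * bracket (n - k)) ^ s :=
              Real.rpow_le_rpow (bracket_pos _).le h1 (by linarith)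
          _ = 2 ^ s * bracket (n - k) ^ s := Real.mul_rpow (by norm_num) (bracket_pos _).le
          _ ≤ 2 ^ (1 : ℝ) * bracket (n - k) ^ s := by
              gcongr
              norm_num
          _ = _ := by rw [Real.rpow_one]
      have e1 : bracket n ^ (s - 1) = bracket n ^ (2 * s - 1) * bracket n ^ (-s) := by
        rw [← Real.rpow_add (bracket_pos _)]; congr 1; ring
      have e2 : bracket k ^ (2 * s - 1) = bracket k ^ s * bracket k ^ (s - 1) := by
        rw [← Real.rpow_add (bracket_pos _)]; congr 1; ring
      have h4 : bracket n ^ (2 * s - 1) ≤ bracket k ^ (2 * s - 1) :=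
        Real.rpow_le_rpow (bracket_pos _).le h2 (by linarith)
      rw [e1]
      calc _ ≤ (2 * bracket (n - k) ^ s * bracket k ^ (s - 1)) * bracket n ^ (-s) := by
            gcongr
            exact h4.trans (e2 ▸ by gcongr)
        _ = _ := by ring
    nlinarith

theorem bilBdd_low {s p : ℝ} (hs : 1 / 2 < s) (hs1 : s ≤ 1) (hp : s ≤ p) :
    BilBdd (fun _ _ => 1) p (s - 1) (s - 1) := by
  refine BilBdd.of_le hs (c := 2) (by norm_num) fun n k => ?_
  have h := bracket_rpow_low_le hs hs1 n k
  have p1 := bracket_rpow_pos (n - k) s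
  have p2 := bracket_rpow_pos k (s - 1)
  have p3 := bracket_rpow_pos n (-s)
  have p4 := bracket_rpow_pos k (s - 1 - s)
  have p5 := bracket_rpow_pos (n - k) p
  rw [norm_one, one_mul]
  refine h.trans ?_
  have g1 : 1 ≤ bracket (n - k) ^ (p - s) := Real.one_le_rpow (one_le_bracket _) (by linarith)
  have g2 : bracket (n - k) ^ s ≤ bracket (n - k) ^ p :=
    Real.rpow_le_rpow_of_exponent_le (one_le_bracket _) hp
  have g3 : bracket k ^ (s - 1) ≤ bracket (n - k) ^ (p - s) * bracket k ^ (s - 1) :=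
    le_mul_of_one_le_left p2.le g1
  have g4 : bracket (n - k) ^ s * bracket k ^ (s - 1) * bracket n ^ (-s)
      ≤ bracket (n - k) ^ p * bracket k ^ (s - 1) * bracket n ^ (-s) := by gcongr
  have g5 : 0 < bracket (n - k) ^ p * bracket k ^ (s - 1 - s) := mul_pos p5 p4
  linarith

/-- Forms in which the first frequency dominates. -/
theorem bilBdd_separated {A : ℤ → ℤ → ℂ} {s m : ℝ} (hs : 1 / 2 < s) (hm : 0 ≤ m)
    (hA : ∀ n k, ‖A n k‖ ≤ 1) (h : ∀ n k, A n k ≠ 0 → |n| ≤ |n - k| ∧ |k| ≤ |n - k|) :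
    BilBdd A (s + m) (s - m) s := by
  refine BilBdd.of_le hs (c := 1) (by norm_num) fun n k => ?_
  have p1 := bracket_rpow_pos (n - k) (s + m)
  have p2 := bracket_rpow_pos k (s - m - s)
  have p3 := bracket_rpow_pos n (-s)
  have p4 := bracket_rpow_pos k (s - m)
  have p5 := bracket_rpow_pos (n - k) (s + m - s)
  rw [one_mul, add_assoc]
  refine le_trans ?_ (le_add_of_nonneg_right (by positivity))
  by_cases h0 : A n k = 0
  · rw [h0]; simp only [norm_zero, zero_mul]; positivity
  obtain ⟨h1, h2⟩ := h n k h0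
  have g1 : bracket n ^ s ≤ bracket (n - k) ^ s :=
    Real.rpow_le_rpow (bracket_pos _).le (bracket_mono h1) (by linarith)
  have g2 : bracket (n - k) ^ (-m) ≤ bracket k ^ (-m) :=
    Real.rpow_le_rpow_of_nonpos (bracket_pos _) (bracket_mono h2) (by linarith)
  calc ‖A n k‖ * bracket n ^ s ≤ 1 * bracket (n - k) ^ s := by
        gcongr
        · exact (bracket_rpow_pos _ _).le
        · exact hA n k
    _ = bracket (n - k) ^ (s + m) * bracket (n - k) ^ (-m) := by
        rw [← Real.rpow_add (bracket_pos _), one_mul]; congr 1; ring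
    _ ≤ bracket (n - k) ^ (s + m) * bracket k ^ (-m) := by gcongr
    _ = _ := by congr 2; ring

/-- The mean value of a product. -/
theorem bilBdd_mean {p q : ℝ} (h : 0 ≤ p + q) (r : ℝ) :
    BilBdd (fun n _ => if n = 0 then 1 else 0) p q r := by
  refine BilBdd.of_le (ρ := 1) (by norm_num) (c := 1) (by norm_num) fun n k => ?_
  have p1 := bracket_rpow_pos (n - k) p
  have p2 := bracket_rpow_pos k q
  have p3 := bracket_rpow_pos n (-1)
  have p4 := bracket_rpow_pos k (q - 1)
  have p5 := bracket_rpow_pos (n - k) (p - 1)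
  rw [one_mul]
  refine le_trans ?_ (le_add_of_nonneg_left (by positivity))
  by_cases hn : n = 0
  · subst hn
    rw [if_pos rfl, norm_one, one_mul, zero_sub, bracket_neg, bracket_zero, Real.one_rpow,
      Real.one_rpow, mul_one, ← Real.rpow_add (bracket_pos k)]
    exact Real.one_le_rpow (one_le_bracket k) h
  · rw [if_neg hn, norm_zero, zero_mul]
    positivity

theorem bilBdd_deriv {A : ℤ → ℤ → ℂ} {s : ℝ} (hs : 1 / 2 < s) (hs1 : s ≤ 1)
    (hA : ∀ n k, ‖A n k‖ ≤ bracket (n - k) + bracket k) : BilBdd A s s (s - 1) := by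
  refine BilBdd.of_le hs (c := 4) (by norm_num) fun n k => ?_
  have h1 := bracket_rpow_low_le hs hs1 n k
  have h2 := bracket_rpow_low_le hs hs1 n (n - k)
  rw [sub_sub_cancel] at h2
  have e : ∀ m, bracket m * bracket m ^ (s - 1) = bracket m ^ s := fun m => by
    rw [mul_comm, ← Real.rpow_add_one (bracket_pos m).ne']; congr 1; ring
  rw [sub_self, Real.rpow_zero, Real.rpow_zero, mul_one, one_mul]
  have p0 := bracket_rpow_pos n (s - 1)
  calc ‖A n k‖ * bracket n ^ (s - 1) ≤ (bracket (n - k) + bracket k) * bracket n ^ (s - 1) := by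
        gcongr; exact hA n k
    _ = bracket (n - k) * bracket n ^ (s - 1) + bracket k * bracket n ^ (s - 1) := by ring
    _ ≤ bracket (n - k) * (bracket (n - k) ^ (s - 1)
          + bracket k ^ s * bracket (n - k) ^ (s - 1) * bracket n ^ (-s)) * 2
        + bracket k * (bracket k ^ (s - 1)
          + bracket (n - k) ^ s * bracket k ^ (s - 1) * bracket n ^ (-s)) * 2 := by
        have := bracket_pos (n - k)
        have := bracket_pos k
        refine add_le_add ?_ ?_
        · rw [mul_assoc]; gcongr; linarith
        · rw [mul_assoc]; gcongr; linarith
    _ = 2 * ((bracket (n - k) * bracket (n - k) ^ (s - 1)) + (bracket k * bracket k ^ (s - 1))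
        + (bracket (n - k) * bracket (n - k) ^ (s - 1)) * bracket k ^ s * bracket n ^ (-s)
        + bracket (n - k) ^ s * (bracket k * bracket k ^ (s - 1)) * bracket n ^ (-s)) := by ring
    _ ≤ _ := by
        rw [e, e]
        have q := mul_pos (mul_pos (bracket_rpow_pos (n - k) s) (bracket_rpow_pos k s))
          (bracket_rpow_pos n (-s))
        have := bracket_rpow_pos (n - k) s
        have := bracket_rpow_pos k s
        linarith

/-! ### Locally Lipschitz maps between weighted sequence spaces -/

/-- Maps from `ℓ²_s` to `ℓ²_r` that are bounded and Lipschitz on bounded sets. -/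
def LocLip (s r : ℝ) (G : (ℤ → ℂ) → ℤ → ℂ) : Prop := ∀ R : ℝ, ∃ C : ℝ, 0 ≤ C ∧ ∀ a b : ℤ → ℂ,
  MemL2 s a → MemL2 s b → l2Norm s a ≤ R → l2Norm s b ≤ R →
    MemL2 r (G a) ∧ l2Norm r (G a) ≤ C ∧ l2Norm r (G a - G b) ≤ C * l2Norm s (a - b)

theorem LocLip.id (s : ℝ) : LocLip s s fun a => a := fun R => ⟨max R 1, by positivity,
  fun a b ha hb hR _ => ⟨ha, hR.trans (le_max_left _ _),
    le_mul_of_one_le_left (l2Norm_nonneg _ _) (le_max_right _ _)⟩⟩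

theorem LocLip.memL2 {s r : ℝ} {G : (ℤ → ℂ) → ℤ → ℂ} (h : LocLip s r G) {a : ℤ → ℂ} (ha : MemL2 s a) :
    MemL2 r (G a) := by
  obtain ⟨C, -, hC⟩ := h (l2Norm s a)
  exact (hC a a ha ha le_rfl le_rfl).1

theorem LocLip.mult {s r : ℝ} {G : (ℤ → ℂ) → ℤ → ℂ} (h : LocLip s r G) {m : ℤ → ℂ} {c d : ℝ}
    (hm : ∀ n, ‖m n‖ ≤ c * bracket n ^ d) : LocLip s (r - d) fun a n => m n * G a n := by
  have hc : 0 ≤ c := by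
    have := (norm_nonneg _).trans (hm 0)
    rwa [bracket_zero, Real.one_rpow, mul_one] at this
  have key : ∀ b : ℤ → ℂ, MemL2 r b → MemL2 (r - d) (fun n => m n * b n)
      ∧ l2Norm (r - d) (fun n => m n * b n) ≤ c * l2Norm r b := by
    intro b hb
    have : lN (r - d) (fun n => ‖m n * b n‖ₑ) ≤ ENNReal.ofReal (c * l2Norm r b) := by
      rw [ENNReal.ofReal_mul hc, ofReal_l2Norm hb]
      calc lN (r - d) (fun n => ‖m n * b n‖ₑ)
          ≤ lN (r - d) (fun n => ENNReal.ofReal c * (wt d n * ‖b n‖ₑ)) := lN_mono fun n => by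
            rw [enorm_mul, ← mul_assoc, wt, ← ENNReal.ofReal_mul hc, ← ofReal_norm (m n)]
            gcongr
            exact hm n
        _ = _ := by rw [lN_const_mul, lN_wt_mul, sub_add_cancel]
    exact ⟨memL2_of_lN_le this, l2Norm_le_of_lN_le (mul_nonneg hc (l2Norm_nonneg _ _)) this⟩
  intro R
  obtain ⟨C, hC0, hC⟩ := h R
  refine ⟨c * C, mul_nonneg hc hC0, fun a b ha hb hRa hRb => ?_⟩
  obtain ⟨h1, h2, h3⟩ := hC a b ha hb hRa hRb
  obtain ⟨g1, -, -⟩ := hC b a hb ha hRb hRa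
  refine ⟨(key _ h1).1, (key _ h1).2.trans (by gcongr), ?_⟩
  have := (key _ (h1.sub g1)).2
  rw [show ((fun n => m n * G a n) - fun n => m n * G b n) = fun n => m n * (G a - G b) n by
    ext n; simp [mul_sub], mul_assoc]
  exact this.trans (by gcongr)

theorem LocLip.mono {s r r' : ℝ} {G : (ℤ → ℂ) → ℤ → ℂ} (h : LocLip s r G) (hr : r' ≤ r) :
    LocLip s r' G := fun R => by
  obtain ⟨C, hC0, hC⟩ := h R
  refine ⟨C, hC0, fun a b ha hb hRa hRb => ?_⟩
  obtain ⟨h1, h2, h3⟩ := hC a b ha hb hRa hRb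
  exact ⟨h1.mono hr, (l2Norm_mono_exponent hr h1).trans h2,
    (l2Norm_mono_exponent hr (h1.sub (h.memL2 hb))).trans h3⟩

theorem LocLip.add {s r : ℝ} {G H : (ℤ → ℂ) → ℤ → ℂ} (hG : LocLip s r G) (hH : LocLip s r H) :
    LocLip s r fun a => G a + H a := fun R => by
  obtain ⟨C, hC0, hC⟩ := hG R
  obtain ⟨C', hC0', hC'⟩ := hH R
  refine ⟨C + C', by positivity, fun a b ha hb hRa hRb => ?_⟩
  obtain ⟨h1, h2, h3⟩ := hC a b ha hb hRa hRb
  obtain ⟨h1', h2', h3'⟩ := hC' a b ha hb hRa hRb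
  refine ⟨h1.add h1', (l2Norm_add_le h1 h1').trans (by linarith), ?_⟩
  rw [add_sub_add_comm, add_mul]
  exact (l2Norm_add_le (h1.sub (hG.memL2 hb)) (h1'.sub (hH.memL2 hb))).trans (by linarith)

theorem LocLip.comp {s p r : ℝ} {G H : (ℤ → ℂ) → ℤ → ℂ} (hH : LocLip p r H) (hG : LocLip s p G) :
    LocLip s r fun a => H (G a) := fun R => by
  obtain ⟨C, hC0, hC⟩ := hG R
  obtain ⟨C', hC0', hC'⟩ := hH C
  refine ⟨max C' (C' * C), by positivity, fun a b ha hb hRa hRb => ?_⟩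
  obtain ⟨h1, h2, h3⟩ := hC a b ha hb hRa hRb
  obtain ⟨g1, g2, -⟩ := hC b a hb ha hRb hRa
  obtain ⟨k1, k2, k3⟩ := hC' _ _ h1 g1 h2 g2
  refine ⟨k1, k2.trans (le_max_left _ _), k3.trans ?_⟩
  calc _ ≤ C' * (C * l2Norm s (a - b)) := by gcongr
    _ = (C' * C) * l2Norm s (a - b) := by ring
    _ ≤ _ := by
        have := l2Norm_nonneg s (a - b)
        gcongr
        exact le_max_right _ _

theorem LocLip.congr {s r : ℝ} {G H : (ℤ → ℂ) → ℤ → ℂ} (hG : LocLip s r G)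
    (h : ∀ a, MemL2 s a → H a = G a) : LocLip s r H := fun R => by
  obtain ⟨C, hC0, hC⟩ := hG R
  refine ⟨C, hC0, fun a b ha hb hRa hRb => ?_⟩
  rw [h a ha, h b hb]
  exact hC a b ha hb hRa hRb

theorem LocLip.inCT {s r T : ℝ} {G : (ℤ → ℂ) → ℤ → ℂ} (h : LocLip s r G) {a : ℝ → ℤ → ℂ}
    (ha : InCT s T a) : InCT r T fun t => G (a t) := by
  obtain ⟨R, -, hR⟩ := ha.exists_bound
  obtain ⟨C, hC0, hC⟩ := h R
  exact ha.of_le (c := C) (fun t ht => h.memL2 (ha.1 t ht)) fun t ht t' ht' =>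
    (hC _ _ (ha.1 t ht) (ha.1 t' ht') (hR t ht) (hR t' ht')).2.2

/-! ### Bilinear maps -/

theorem bil_eq_mform (A : ℤ → ℤ → ℂ) (a b : ℤ → ℂ) :
    bil A a b = mform (Finset.univ : Finset (Fin 2)) (fun n k => ![n - k, k]) A ![a, b] := by
  ext n
  simp [bil, mform]

theorem BilBdd.mbound {A : ℤ → ℤ → ℂ} {p q r : ℝ} (h : BilBdd A p q r) : ∃ C : ℝ, 0 ≤ C ∧
    MBound (Finset.univ : Finset (Fin 2)) (fun n k => ![n - k, k]) A r ![p, q] C := by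
  obtain ⟨C, hC⟩ := h
  refine ⟨C, C.2, fun g => ?_⟩
  simpa [ENNReal.ofReal_coe_nnreal] using hC (g 0) (g 1)

theorem BilBdd.summable {A : ℤ → ℤ → ℂ} {p q r : ℝ} (h : BilBdd A p q r) {a b : ℤ → ℂ} (ha : MemL2 p a)
    (hb : MemL2 q b) (n : ℤ) : Summable fun k => A n k * (a (n - k) * b k) := by
  obtain ⟨C, hC0, hC⟩ := h.mbound
  have := hC.summable hC0 (f := ![a, b]) (by simp [Fin.forall_fin_two, ha, hb]) n
  simpa using this

theorem BilBdd.bound {A : ℤ → ℤ → ℂ} {p q r : ℝ} (h : BilBdd A p q r) : ∃ C : ℝ, 0 ≤ C ∧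
    ∀ a b, MemL2 p a → MemL2 q b → MemL2 r (bil A a b)
      ∧ l2Norm r (bil A a b) ≤ C * (l2Norm p a * l2Norm q b) := by
  obtain ⟨C, hC0, hC⟩ := h.mbound
  refine ⟨C, hC0, fun a b ha hb => ?_⟩
  have := hC.bound hC0 (f := ![a, b]) (R := ![l2Norm p a, l2Norm q b])
    (by simp [Fin.forall_fin_two, ha, hb]) (by simp [Fin.forall_fin_two])
  rw [← bil_eq_mform] at this
  simpa using this

theorem BilBdd.bil_sub {A : ℤ → ℤ → ℂ} {p q r : ℝ} (h : BilBdd A p q r) {a a' b b' : ℤ → ℂ}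
    (ha : MemL2 p a) (ha' : MemL2 p a') (hb : MemL2 q b) (hb' : MemL2 q b') :
    bil A a b - bil A a' b' = bil A (a - a') b + bil A a' (b - b') := by
  ext n
  change bil A a b n - bil A a' b' n = bil A (a - a') b n + bil A a' (b - b') n
  unfold bil
  rw [← (h.summable ha hb n).tsum_sub (h.summable ha' hb' n),
    ← (h.summable (ha.sub ha') hb n).tsum_add (h.summable ha' (hb.sub hb') n)]
  exact tsum_congr fun k => by simp only [Pi.sub_apply]; ring

theorem LocLip.bil {A : ℤ → ℤ → ℂ} {s p q r : ℝ} {G H : (ℤ → ℂ) → ℤ → ℂ} (hG : LocLip s p G)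
    (hH : LocLip s q H) (h : BilBdd A p q r) : LocLip s r fun a => bil A (G a) (H a) := fun R => by
  obtain ⟨C, hC0, hC⟩ := hG R
  obtain ⟨C', hC0', hC'⟩ := hH R
  obtain ⟨B, hB0, hB⟩ := h.bound
  refine ⟨2 * (B * (C * C')), by positivity, fun a b ha hb hRa hRb => ?_⟩
  obtain ⟨h1, h2, h3⟩ := hC a b ha hb hRa hRb
  obtain ⟨h1', h2', h3'⟩ := hC' a b ha hb hRa hRb
  obtain ⟨g1, g2, -⟩ := hC b a hb ha hRb hRa
  have g1' := hH.memL2 hb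
  refine ⟨(hB _ _ h1 h1').1, (hB _ _ h1 h1').2.trans ?_, ?_⟩
  · calc B * (l2Norm p (G a) * l2Norm q (H a)) ≤ B * (C * C') := by
          gcongr
          exact l2Norm_nonneg _ _
      _ ≤ _ := by linarith [show 0 ≤ B * (C * C') by positivity]
  · rw [h.bil_sub h1 g1 h1' g1']
    obtain ⟨m1, n1⟩ := hB _ _ (h1.sub g1) h1'
    obtain ⟨m2, n2⟩ := hB _ _ g1 (h1'.sub g1')
    refine (l2Norm_add_le m1 m2).trans ?_
    have nn := l2Norm_nonneg s (a - b)
    calc _ ≤ B * ((C * l2Norm s (a - b)) * C') + B * (C * (C' * l2Norm s (a - b))) := by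
          refine add_le_add (n1.trans ?_) (n2.trans ?_)
          · gcongr
            exact l2Norm_nonneg _ _
          · gcongr
            exact l2Norm_nonneg _ _
      _ = _ := by ring

theorem conv_eq_bil : conv = bil fun _ _ => 1 := by
  ext a b n
  simp [conv, bil]

theorem LocLip.conv {s p q r : ℝ} {G H : (ℤ → ℂ) → ℤ → ℂ} (hG : LocLip s p G)
    (hH : LocLip s q H) (h : BilBdd (fun _ _ => 1) p q r) : LocLip s r fun a => conv (G a) (H a) := by
  rw [conv_eq_bil]; exact hG.bil hH h

/-! ### The exponential series -/

/-- The powers of a sequence under convolution. -/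
def convPow (φ : ℤ → ℂ) : ℕ → ℤ → ℂ
  | 0 => fun n => if n = 0 then 1 else 0
  | m + 1 => conv φ (convPow φ m)

/-- The exponential series `∑ zᵐ φ^{*m} / m!`. -/
def expSeq (z : ℂ) (φ : ℤ → ℂ) (n : ℤ) : ℂ := ∑' m : ℕ, z ^ m / m.factorial * convPow φ m n

theorem lN_tsum_le {ι : Type*} (r : ℝ) (f : ι → ℤ → ℝ≥0∞) :
    lN r (fun n => ∑' i, f i n) ≤ ∑' i, lN r (f i) := by
  refine n2_le_of_dual fun g => ?_
  calc ∑' n, wt r n * (∑' i, f i n) * g n = ∑' i, ∑' n, wt r n * f i n * g n := by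
        rw [ENNReal.tsum_comm]
        refine tsum_congr fun n => ?_
        rw [← ENNReal.tsum_mul_left, ENNReal.tsum_mul_right]
    _ ≤ ∑' i, lN r (f i) * n2 g := ENNReal.tsum_le_tsum fun i => tsum_mul_le_n2 _ _
    _ = _ := ENNReal.tsum_mul_right

theorem convPow_bound {r : ℝ} (hr : 1 / 2 < r) : ∃ C : ℝ, 1 ≤ C ∧ ∀ (R : ℝ) (φ ψ : ℤ → ℂ), 1 ≤ R →
    MemL2 r φ → MemL2 r ψ → l2Norm r φ ≤ R → l2Norm r ψ ≤ R → ∀ m,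
      MemL2 r (convPow φ m) ∧ l2Norm r (convPow φ m) ≤ (C * R) ^ m
      ∧ l2Norm r (convPow φ m - convPow ψ m) ≤ m * (C * R) ^ m * l2Norm r (φ - ψ) := by
  obtain ⟨C, hC0, hC⟩ := (bilBdd_algebra hr).bound
  rw [← conv_eq_bil] at hC
  have bd : ∀ (R : ℝ) (φ : ℤ → ℂ), 1 ≤ R → MemL2 r φ → l2Norm r φ ≤ R → ∀ m,
      MemL2 r (convPow φ m) ∧ l2Norm r (convPow φ m) ≤ ((C + 1) * R) ^ m := by
    intro R φ hR hφ hφR m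
    induction m with
    | zero =>
      have : lN r (fun n => ‖convPow φ 0 n‖ₑ) ≤ ENNReal.ofReal 1 := by
        unfold lN n2
        rw [tsum_eq_single 0]
        · simp [convPow, wt, bracket_zero]
        · intro n hn
          simp [convPow, hn]
      exact ⟨memL2_of_lN_le this, by simpa using l2Norm_le_of_lN_le zero_le_one this⟩
    | succ m ih =>
      obtain ⟨h1, h2⟩ := hC _ _ hφ ih.1
      refine ⟨h1, h2.trans ?_⟩
      rw [pow_succ']
      calc _ ≤ C * (R * ((C + 1) * R) ^ m) := by
            gcongr
            · exact l2Norm_nonneg _ _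
            · exact ih.2
        _ ≤ (C + 1) * (R * ((C + 1) * R) ^ m) := by gcongr; linarith
        _ = _ := by ring
  refine ⟨C + 1, by linarith, fun R φ ψ hR hφ hψ hφR hψR m => ?_⟩
  refine ⟨(bd R φ hR hφ hφR m).1, (bd R φ hR hφ hφR m).2, ?_⟩
  induction m with
  | zero => simp [convPow, l2Norm_zero]
  | succ m ih =>
    obtain ⟨p1, p2⟩ := bd R φ hR hφ hφR m
    obtain ⟨q1, q2⟩ := bd R ψ hR hψ hψR m
    have e : convPow φ (m + 1) - convPow ψ (m + 1)
        = conv (φ - ψ) (convPow φ m) + conv ψ (convPow φ m - convPow ψ m) := by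
      simp only [convPow, conv_eq_bil]
      exact (bilBdd_algebra hr).bil_sub hφ hψ p1 q1
    obtain ⟨m1, n1⟩ := hC _ _ (hφ.sub hψ) p1
    obtain ⟨m2, n2⟩ := hC _ _ hψ (p1.sub q1)
    rw [e]
    refine (l2Norm_add_le m1 m2).trans ?_
    have nn := l2Norm_nonneg r (φ - ψ)
    set d := l2Norm r (φ - ψ)
    set X := (C + 1) * R with hX
    have hXn : 0 ≤ X := by positivity
    have hCX : C ≤ X := by rw [hX]; nlinarith
    have hCR : C * R ≤ X := by rw [hX]; nlinarith
    calc _ ≤ C * (d * X ^ m) + C * (R * (m * X ^ m * d)) := by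
          refine add_le_add (n1.trans (by gcongr)) (n2.trans ?_)
          gcongr
          exact l2Norm_nonneg _ _
      _ = C * (d * X ^ m) + (C * R) * (m * X ^ m * d) := by ring
      _ ≤ X * (d * X ^ m) + X * (m * X ^ m * d) := by gcongr
      _ = _ := by push_cast; ring

theorem enorm_expTerm (z : ℂ) (m : ℕ) (w : ℂ) :
    ‖z ^ m / m.factorial * w‖ₑ = ENNReal.ofReal (‖z‖ ^ m / m.factorial) * ‖w‖ₑ := by
  rw [enorm_mul, ← ofReal_norm (z ^ m / m.factorial), norm_div, norm_pow, Complex.norm_natCast]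

theorem lN_expSeries_le {r : ℝ} (z : ℂ) {f : ℕ → ℤ → ℂ} {X D : ℝ} (hX : 0 ≤ X) (hD : 0 ≤ D)
    (hf : ∀ m, MemL2 r (f m)) (h : ∀ m, l2Norm r (f m) ≤ X ^ m * D) :
    lN r (fun n => ∑' m : ℕ, ‖z ^ m / m.factorial * f m n‖ₑ)
      ≤ ENNReal.ofReal (Real.exp (‖z‖ * X) * D) := by
  refine (lN_tsum_le r _).trans ?_
  have hsum : Summable fun m : ℕ => (‖z‖ * X) ^ m / m.factorial * D :=
    (Real.summable_pow_div_factorial (‖z‖ * X)).mul_right D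
  calc _ ≤ ∑' m : ℕ, ENNReal.ofReal ((‖z‖ * X) ^ m / m.factorial * D) := by
        refine ENNReal.tsum_le_tsum fun m => ?_
        simp_rw [enorm_expTerm]
        rw [lN_const_mul, show (‖z‖ * X) ^ m / m.factorial * D
          = ‖z‖ ^ m / m.factorial * (X ^ m * D) by rw [mul_pow]; ring,
          ENNReal.ofReal_mul (by positivity)]
        gcongr
        exact lN_le_of_l2Norm_le (hf m) (h m)
    _ = ENNReal.ofReal (∑' m : ℕ, (‖z‖ * X) ^ m / m.factorial * D) :=
        (ENNReal.ofReal_tsum_of_nonneg (fun m => by positivity) hsum).symm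
    _ = _ := by
        rw [tsum_mul_right, Real.exp_eq_exp_ℝ, NormedSpace.exp_eq_tsum_div]

theorem summable_expSeq {r : ℝ} (hr : 1 / 2 < r) (z : ℂ) {φ : ℤ → ℂ} (hφ : MemL2 r φ) (n : ℤ) :
    Summable fun m : ℕ => z ^ m / m.factorial * convPow φ m n := by
  obtain ⟨C, hC, h⟩ := convPow_bound hr
  have hb := h (max 1 (l2Norm r φ)) φ φ (le_max_left _ _) hφ hφ (le_max_right _ _) (le_max_right _ _)
  have := lN_expSeries_le (r := r) z (f := convPow φ) (X := C * max 1 (l2Norm r φ)) (D := 1)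
    (by positivity) zero_le_one (fun m => (hb m).1) (fun m => by rw [mul_one]; exact (hb m).2.1)
  have h2 := lN_lt_top_apply (this.trans_lt ENNReal.ofReal_lt_top).ne n
  rw [← summable_norm_iff]
  exact (ENNReal.summable_toReal h2).congr fun m => toReal_enorm _

theorem locLip_expSeq {r : ℝ} (hr : 1 / 2 < r) (z : ℂ) : LocLip r r (expSeq z) := fun R => by
  obtain ⟨C, hC, h⟩ := convPow_bound hr
  set X := C * max 1 R with hX
  have hXn : 0 ≤ X := by positivity
  refine ⟨Real.exp (‖z‖ * X) + Real.exp (‖z‖ * (2 * X)), by positivity, fun a b ha hb hRa hRb => ?_⟩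
  have key := h (max 1 R) a b (le_max_left _ _) ha hb (hRa.trans (le_max_right _ _))
    (hRb.trans (le_max_right _ _))
  have key' := h (max 1 R) b b (le_max_left _ _) hb hb (hRb.trans (le_max_right _ _))
    (hRb.trans (le_max_right _ _))
  have l1 := (lN_mono fun n => enorm_tsum_le_tsum fun m : ℕ => z ^ m / m.factorial * convPow a m n).trans
    (lN_expSeries_le (r := r) z (f := convPow a) hXn zero_le_one (fun m => (key m).1)
      (fun m => by rw [mul_one]; exact (key m).2.1))
  have l2 := (lN_mono fun n => enorm_tsum_le_tsum
      fun m : ℕ => z ^ m / m.factorial * (convPow a m - convPow b m) n).trans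
    (lN_expSeries_le (r := r) z (f := fun m => convPow a m - convPow b m) (X := 2 * X)
      (D := l2Norm r (a - b)) (by positivity) (l2Norm_nonneg _ _)
      (fun m => (key m).1.sub (key' m).1) (fun m => by
        refine (key m).2.2.trans ?_
        rw [mul_pow 2 X, hX]
        have h2 : (m : ℝ) ≤ 2 ^ m := by exact_mod_cast (Nat.lt_two_pow_self).le
        have := l2Norm_nonneg r (a - b)
        gcongr))
  refine ⟨memL2_of_lN_le l1, (l2Norm_le_of_lN_le (by positivity) l1).trans ?_, ?_⟩
  · rw [mul_one]
    linarith [Real.exp_pos (‖z‖ * (2 * X))]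
  · have e : expSeq z a - expSeq z b
        = fun n => ∑' m : ℕ, z ^ m / m.factorial * (convPow a m - convPow b m) n := by
      ext n
      rw [Pi.sub_apply, expSeq, expSeq, ← (summable_expSeq hr z ha n).tsum_sub (summable_expSeq hr z hb n)]
      exact tsum_congr fun m => by rw [Pi.sub_apply, mul_sub]
    rw [e]
    have nn := l2Norm_nonneg r (a - b)
    refine (l2Norm_le_of_lN_le (by positivity) l2).trans ?_
    gcongr
    linarith [Real.exp_pos (‖z‖ * X)]

section

/-! ### Absolutely convergent Fourier series -/

theorem MemL2.summable {r : ℝ} (hr : 1 / 2 < r) {a : ℤ → ℂ} (ha : MemL2 r a) : Summable a := by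
  rw [← summable_norm_iff]
  have h : ∑' n, ‖a n‖ₑ ≠ ⊤ := ((tsum_le_lN (r := r) fun n => ‖a n‖ₑ).trans_lt
    (ENNReal.mul_lt_top (n2_wt_ne_top hr).lt_top ((memL2_iff r a).1 ha).lt_top)).ne
  exact (ENNReal.summable_toReal h).congr fun n => toReal_enorm _

theorem norm_fourier_apply (n : ℤ) (x : Torus) : ‖(fourier n x : ℂ)‖ = 1 := by
  rw [fourier_apply]; exact Circle.norm_coe _

/-- The sum of an absolutely convergent Fourier series as a continuous function. -/
def invFourierC (g : ℤ → ℂ) : C(Torus, ℂ) := ∑' n : ℤ, g n • (fourier n : C(Torus, ℂ))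

theorem hasSum_invFourierC {g : ℤ → ℂ} (hg : Summable g) :
    HasSum (fun n => g n • (fourier n : C(Torus, ℂ))) (invFourierC g) := by
  refine Summable.hasSum (.of_norm ?_)
  simp_rw [norm_smul, fourier_norm, mul_one]
  exact hg.norm

theorem hasSum_invFourier {g : ℤ → ℂ} (hg : Summable g) (x : Torus) :
    HasSum (fun n => g n * fourier n x) (invFourierC g x) := by
  have := (ContinuousMap.evalCLM ℂ x).hasSum (hasSum_invFourierC hg)
  simpa [Function.comp_def] using this

theorem invFourier_eq {g : ℤ → ℂ} (hg : Summable g) : invFourier g = invFourierC g :=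
  funext fun x => (hasSum_invFourier hg x).tsum_eq

/-- Fourier coefficients as a continuous functional. -/
def coeffCLM (n : ℤ) : C(Torus, ℂ) →L[ℂ] ℂ :=
  (innerSL ℂ (fourierLp 2 n)).comp (ContinuousMap.toLp (E := ℂ) 2 AddCircle.haarAddCircle ℂ)

theorem coeffCLM_apply (n : ℤ) (f : C(Torus, ℂ)) : coeffCLM n f = fourierCoeff f n := by
  rw [← fourierCoeff_toLp, ← fourierBasis_repr, HilbertBasis.repr_apply_apply, coe_fourierBasis]
  rfl

theorem fourierCoeff_invFourierC {g : ℤ → ℂ} (hg : Summable g) : fourierCoeff (invFourierC g) = g := by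
  ext m
  have h := (coeffCLM m).hasSum (hasSum_invFourierC hg)
  rw [coeffCLM_apply] at h
  refine h.unique ?_
  have e : (fun n => coeffCLM m (g n • (fourier n : C(Torus, ℂ)))) = fun n => if n = m then g m else 0 := by
    ext n
    rw [map_smul, coeffCLM_apply, fourierCoeff_fourier, Pi.single_apply, smul_eq_mul]
    split_ifs with h1 h2 h2
    · rw [h1, mul_one]
    · exact absurd h1.symm h2
    · exact absurd h2.symm h1
    · rw [mul_zero]
  change HasSum (fun n => coeffCLM m (g n • (fourier n : C(Torus, ℂ)))) (g m)
  rw [e]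
  exact hasSum_ite_eq m (g m)

theorem fourierCoeff_invFourier {g : ℤ → ℂ} (hg : Summable g) : fourierCoeff (invFourier g) = g := by
  rw [invFourier_eq hg, fourierCoeff_invFourierC hg]

theorem summable_conv_prod {g h : ℤ → ℂ} (hg : Summable g) (hh : Summable h) :
    Summable fun x : ℤ × ℤ => g (x.1 - x.2) * h x.2 := by
  have h1 : Summable fun x : ℤ × ℤ => g x.1 * h x.2 :=
    summable_mul_of_summable_norm hg.norm hh.norm
  let e : ℤ × ℤ ≃ ℤ × ℤ := ⟨fun x => (x.1 - x.2, x.2), fun x => (x.1 + x.2, x.2),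
    fun x => by simp, fun x => by simp⟩
  exact e.summable_iff.2 h1

theorem summable_conv {g h : ℤ → ℂ} (hg : Summable g) (hh : Summable h) : Summable (conv g h) :=
  (summable_conv_prod hg hh).prod

theorem invFourier_mul {g h : ℤ → ℂ} (hg : Summable g) (hh : Summable h) (x : Torus) :
    invFourier g x * invFourier h x = invFourier (conv g h) x := by
  have hn : ∀ {g : ℤ → ℂ}, Summable g → Summable fun n => g n * fourier n x :=
    fun hg => (hasSum_invFourier hg x).summable
  have h2 := summable_conv_prod (hn hg) (hn hh)
  let e : ℤ × ℤ ≃ ℤ × ℤ := ⟨fun x => (x.1 - x.2, x.2), fun x => (x.1 + x.2, x.2),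
    fun x => by simp, fun x => by simp⟩
  unfold invFourier
  rw [tsum_mul_tsum_of_summable_norm (hn hg).norm (hn hh).norm, ← e.tsum_eq]
  change ∑' y : ℤ × ℤ, (g (y.1 - y.2) * fourier (y.1 - y.2) x) * (h y.2 * fourier y.2 x) = _
  rw [h2.tsum_prod]
  refine tsum_congr fun n => ?_
  rw [conv, ← tsum_mul_right]
  refine tsum_congr fun k => ?_
  have : (fourier n x : ℂ) = fourier (n - k) x * fourier k x := by
    rw [← fourier_add, sub_add_cancel]
  rw [this]
  ring

theorem fourierCoeff_mul {g h : ℤ → ℂ} (hg : Summable g) (hh : Summable h) :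
    fourierCoeff (fun x => invFourier g x * invFourier h x) = conv g h := by
  simp_rw [invFourier_mul hg hh]
  exact fourierCoeff_invFourier (summable_conv hg hh)

theorem summable_convPow {φ : ℤ → ℂ} (hφ : Summable φ) (m : ℕ) : Summable (convPow φ m) := by
  induction m with
  | zero => exact (hasSum_ite_eq 0 1).summable
  | succ m ih => exact summable_conv hφ ih

theorem invFourier_pow {φ : ℤ → ℂ} (hφ : Summable φ) (m : ℕ) (x : Torus) :
    invFourier φ x ^ m = invFourier (convPow φ m) x := by
  induction m with
  | zero =>
    rw [pow_zero]
    unfold invFourier convPow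
    rw [tsum_eq_single 0]
    · simp
    · intro n hn; simp [hn]
  | succ m ih => rw [pow_succ', ih, invFourier_mul hφ (summable_convPow hφ m)]; rfl

theorem exp_invFourier {r : ℝ} (hr : 1 / 2 < r) (z : ℂ) {φ : ℤ → ℂ} (hφ : MemL2 r φ) (x : Torus) :
    Complex.exp (z * invFourier φ x) = invFourier (expSeq z φ) x := by
  have hs := hφ.summable hr
  obtain ⟨C, hC, h⟩ := convPow_bound hr
  have hb := h (max 1 (l2Norm r φ)) φ φ (le_max_left _ _) hφ hφ (le_max_right _ _) (le_max_right _ _)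
  have h1 := lN_expSeries_le (r := r) z (f := convPow φ) (X := C * max 1 (l2Norm r φ)) (D := 1)
    (by positivity) zero_le_one (fun m => (hb m).1) (fun m => by rw [mul_one]; exact (hb m).2.1)
  have h2 : ∑' n, ∑' m : ℕ, ‖z ^ m / m.factorial * convPow φ m n‖ₑ ≠ ⊤ :=
    ((tsum_le_lN (r := r) _).trans_lt (ENNReal.mul_lt_top (n2_wt_ne_top hr).lt_top
      (h1.trans_lt ENNReal.ofReal_lt_top))).ne
  have h3 : Summable fun y : ℤ × ℕ => z ^ y.2 / y.2.factorial * convPow φ y.2 y.1 * fourier y.1 x := by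
    rw [← summable_norm_iff]
    rw [← ENNReal.tsum_prod] at h2
    refine (ENNReal.summable_toReal h2).congr fun y => ?_
    rw [toReal_enorm, norm_mul _ (fourier y.1 x), norm_fourier_apply, mul_one]
  rw [Complex.exp_eq_exp_ℂ, NormedSpace.exp_eq_tsum_div]
  calc ∑' m : ℕ, (z * invFourier φ x) ^ m / m.factorial
      = ∑' (m : ℕ) (n : ℤ), z ^ m / m.factorial * convPow φ m n * fourier n x := by
        refine tsum_congr fun m => ?_
        rw [mul_pow, invFourier_pow hs, invFourier, ← tsum_mul_left, ← tsum_div_const]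
        exact tsum_congr fun n => by ring
    _ = ∑' (n : ℤ) (m : ℕ), z ^ m / m.factorial * convPow φ m n * fourier n x :=
        h3.tsum_comm (f := fun (n : ℤ) (m : ℕ) => z ^ m / m.factorial * convPow φ m n * fourier n x)
    _ = _ := tsum_congr fun n => by rw [tsum_mul_right]; rfl

theorem tsum_sq_invFourierC {g : ℤ → ℂ} (hg : Summable g) :
    ∫ x, ‖invFourierC g x‖ ^ 2 ∂AddCircle.haarAddCircle = ∑' n, ‖g n‖ ^ 2 := by
  have h := tsum_sq_fourierCoeff (ContinuousMap.toLp (E := ℂ) 2 AddCircle.haarAddCircle ℂ (invFourierC g))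
  simp_rw [fourierCoeff_toLp, fourierCoeff_invFourierC hg] at h
  rw [h]
  refine MeasureTheory.integral_congr_ae ?_
  filter_upwards [ContinuousMap.coeFn_toAEEqFun AddCircle.haarAddCircle (invFourierC g)] with x hx
  have : (ContinuousMap.toLp (E := ℂ) 2 AddCircle.haarAddCircle ℂ (invFourierC g)) x = invFourierC g x := hx
  rw [this]

theorem norm_invFourier_le {g : ℤ → ℂ} (hg : Summable g) (x : Torus) :
    ‖invFourier g x‖ ≤ ∑' n, ‖g n‖ := by
  refine (norm_tsum_le_tsum_norm (hasSum_invFourier hg x).summable.norm).trans (le_of_eq ?_)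
  exact tsum_congr fun n => by rw [norm_mul, norm_fourier_apply, mul_one]

/-- Second order expansion of the exponential series. -/
theorem norm_expSeq_add_sub_le {r : ℝ} (hr : 1 / 2 < r) (z : ℂ) {φ d : ℤ → ℂ} (hφ : MemL2 r φ)
    (hd : MemL2 r d) (n : ℤ) :
    ‖expSeq z (φ + d) n - expSeq z φ n - z * conv (expSeq z φ) d n‖
      ≤ Real.exp (‖z‖ * (∑' n, ‖φ n‖ + ∑' n, ‖d n‖)) * ‖z‖ ^ 2 * ∑' n, ‖d n‖ ^ 2 := by
  have sφ := hφ.summable hr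
  have sd := hd.summable hr
  have e1 := (locLip_expSeq hr z).memL2 (hφ.add hd)
  have e2 := (locLip_expSeq hr z).memL2 hφ
  have s1 := e1.summable hr
  have s2 := e2.summable hr
  have s3 := summable_conv s2 sd
  set g : ℤ → ℂ := expSeq z (φ + d) - expSeq z φ - z • conv (expSeq z φ) d with hg
  have sg : Summable g := (s1.sub s2).sub (s3.const_smul z)
  have pt : ∀ x, invFourierC g x = Complex.exp (z * invFourier φ x)
      * (Complex.exp (z * invFourier d x) - 1 - z * invFourier d x) := by
    intro x
    have l1 : invFourierC g x = invFourier (expSeq z (φ + d)) x - invFourier (expSeq z φ) x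
        - z * invFourier (conv (expSeq z φ) d) x := by
      have := ((hasSum_invFourier s1 x).sub (hasSum_invFourier s2 x)).sub
        ((hasSum_invFourier s3 x).mul_left z)
      rw [invFourier_eq s1, invFourier_eq s2, invFourier_eq s3]
      refine (hasSum_invFourier sg x).unique (this.congr_fun fun n => ?_)
      simp only [hg, Pi.sub_apply, Pi.smul_apply, smul_eq_mul]
      ring
    have l2 : invFourier (φ + d) x = invFourier φ x + invFourier d x := by
      have := (hasSum_invFourier sφ x).add (hasSum_invFourier sd x)
      have sa : Summable (φ + d) := sφ.add sd
      rw [invFourier_eq sa, invFourier_eq sφ, invFourier_eq sd]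
      refine (hasSum_invFourier sa x).unique (this.congr_fun fun n => ?_)
      simp only [Pi.add_apply]
      ring
    rw [l1, ← exp_invFourier hr z (hφ.add hd), ← exp_invFourier hr z hφ, ← invFourier_mul s2 sd,
      ← exp_invFourier hr z hφ, l2, mul_add, Complex.exp_add]
    ring
  have c1 : fourierCoeff (invFourierC g) n
      = expSeq z (φ + d) n - expSeq z φ n - z * conv (expSeq z φ) d n := by
    rw [fourierCoeff_invFourierC sg]; rfl
  rw [← c1, ← tsum_sq_invFourierC sd, ← MeasureTheory.integral_const_mul]
  unfold fourierCoeff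
  refine MeasureTheory.norm_integral_le_of_norm_le ?_ (Filter.Eventually.of_forall fun x => ?_)
  · exact ((ContinuousMap.continuous (invFourierC d)).norm.pow 2 |>.const_mul
      (Real.exp (‖z‖ * (∑' n, ‖φ n‖ + ∑' n, ‖d n‖)) * ‖z‖ ^ 2)
      |>.integrable_of_hasCompactSupport (HasCompactSupport.of_compactSpace _))
  · rw [norm_smul, pt, norm_mul]
    have b1 : ‖Complex.exp (z * invFourier φ x)‖ ≤ Real.exp (‖z‖ * ∑' n, ‖φ n‖) := by
      rw [Complex.norm_exp]
      refine Real.exp_le_exp.2 ((Complex.re_le_norm _).trans ?_)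
      rw [norm_mul]
      gcongr
      exact norm_invFourier_le sφ x
    have b2 : ‖Complex.exp (z * invFourier d x) - 1 - z * invFourier d x‖
        ≤ Real.exp (‖z‖ * ∑' n, ‖d n‖) * (‖z‖ ^ 2 * ‖invFourierC d x‖ ^ 2) := by
      have := Complex.norm_exp_sub_sum_le_norm_mul_exp (z * invFourier d x) 2
      simp only [Finset.sum_range_succ, Finset.sum_range_zero, pow_zero, Nat.factorial_zero, Nat.cast_one,
        div_one, zero_add, pow_one, Nat.factorial_one] at this
      rw [sub_sub]
      refine this.trans ?_
      rw [mul_comm, norm_mul, mul_pow, invFourier_eq sd]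
      gcongr
      rw [← invFourier_eq sd]
      exact norm_invFourier_le sd x
    rw [norm_fourier_apply, one_mul, mul_add, Real.exp_add]
    calc _ ≤ Real.exp (‖z‖ * ∑' n, ‖φ n‖) * (Real.exp (‖z‖ * ∑' n, ‖d n‖)
          * (‖z‖ ^ 2 * ‖invFourierC d x‖ ^ 2)) := by gcongr
      _ = _ := by ring

/-! ### The nonlinear quantities in terms of Fourier coefficients -/

/-- Coefficients of `F`. -/
def phaseSeq (a : ℤ → ℂ) : ℤ → ℂ := dxInv (projNonconst (conv a a))

/-- Coefficients of `e^{ikF}`. -/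
def gaugeSeq (k : ℤ) (a : ℤ → ℂ) : ℤ → ℂ := expSeq (Complex.I * k) (phaseSeq a)

/-- Coefficients of `P₊f + ½ P_c f`. -/
def halfSeq (a : ℤ → ℂ) : ℤ → ℂ := projPos a + (1 / 2 : ℂ) • projConst a

theorem ae_eq_invFourier {f : Torus → ℝ} (hf : MeasureTheory.MemLp f 2 AddCircle.haarAddCircle)
    (h : Summable (coeff f)) :
    (fun x => (f x : ℂ)) =ᵐ[AddCircle.haarAddCircle] invFourierC (coeff f) := by
  have hc : MeasureTheory.MemLp (fun x => (f x : ℂ)) 2 (AddCircle.haarAddCircle (T := 2 * Real.pi)) :=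
    hf.ofReal
  have key : hc.toLp = ContinuousMap.toLp (E := ℂ) 2 AddCircle.haarAddCircle ℂ (invFourierC (coeff f)) := by
    apply fourierBasis.repr.injective
    ext n
    rw [fourierBasis_repr, fourierBasis_repr, fourierCoeff_toLp, fourierCoeff_invFourierC h,
      fourierCoeff_congr_ae hc.coeFn_toLp]
    rfl
  refine hc.coeFn_toLp.symm.trans ?_
  rw [key]
  exact ContinuousMap.coeFn_toAEEqFun AddCircle.haarAddCircle _

variable {s : ℝ} {f : Torus → ℝ}

theorem sqCoeff_eq (hs : 1 / 2 < s) (hf : MeasureTheory.MemLp f 2 AddCircle.haarAddCircle)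
    (ha : MemL2 s (coeff f)) : sqCoeff f = conv (coeff f) (coeff f) := by
  have h := ha.summable hs
  rw [sqCoeff, ← fourierCoeff_mul h h]
  refine fourierCoeff_congr_ae ?_
  filter_upwards [ae_eq_invFourier hf h] with x hx
  rw [hx, invFourier_eq h, sq]

theorem LocLip.dxInv {r : ℝ} {G : (ℤ → ℂ) → ℤ → ℂ} (h : LocLip s r G) :
    LocLip s (r + 1) fun a => dxInv (G a) := by
  have h2 := h.mult (m := fun n => if n = 0 then 0 else 1 / (Complex.I * n)) (c := 2) (d := -1) (by
    intro n
    split_ifs with hn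
    · rw [norm_zero]; have := bracket_rpow_pos n (-1); positivity
    · rw [norm_div, norm_one, norm_mul, Complex.norm_I, one_mul, Complex.norm_intCast,
        Real.rpow_neg_one, ← div_eq_mul_inv, div_le_div_iff₀ (by positivity) (bracket_pos n)]
      have h3 := bracket_le n
      have h4 : (1 : ℝ) ≤ |(n : ℝ)| := by exact_mod_cast Int.one_le_abs hn
      linarith)
  rw [sub_neg_eq_add] at h2
  refine h2.congr fun a _ => ?_
  ext n
  simp only [MBO.dxInv]
  split_ifs <;> ring

theorem norm_ite_le_one (p : Prop) [Decidable p] (n : ℤ) :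
    ‖(if p then (1 : ℂ) else 0)‖ ≤ 1 * bracket n ^ (0 : ℝ) := by
  split_ifs <;> simp

theorem LocLip.projNonconst {r : ℝ} {G : (ℤ → ℂ) → ℤ → ℂ} (h : LocLip s r G) :
    LocLip s r fun a => projNonconst (G a) := by
  have := h.mult (m := fun n => if n ≠ 0 then 1 else 0) (fun n => norm_ite_le_one (n ≠ 0) n)
  rw [sub_zero] at this
  exact this.congr fun a _ => funext fun n => by simp [MBO.projNonconst]

theorem locLip_phaseSeq (hs : 1 / 2 < s) : LocLip s (s + 1) phaseSeq :=
  ((LocLip.id s).conv (LocLip.id s) (bilBdd_algebra hs)).projNonconst.dxInv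

theorem locLip_gaugeSeq (hs : 1 / 2 < s) (k : ℤ) : LocLip s (s + 1) (gaugeSeq k) :=
  (locLip_expSeq (by linarith) _).comp (locLip_phaseSeq hs)

theorem LocLip.projPos {r : ℝ} {G : (ℤ → ℂ) → ℤ → ℂ} (h : LocLip s r G) :
    LocLip s r fun a => projPos (G a) := by
  have := h.mult (m := fun n => if 0 < n then 1 else 0) (fun n => norm_ite_le_one (0 < n) n)
  rw [sub_zero] at this
  exact this.congr fun a _ => funext fun n => by simp [MBO.projPos]

theorem LocLip.projNeg {r : ℝ} {G : (ℤ → ℂ) → ℤ → ℂ} (h : LocLip s r G) :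
    LocLip s r fun a => projNeg (G a) := by
  have := h.mult (m := fun n => if n < 0 then 1 else 0) (fun n => norm_ite_le_one (n < 0) n)
  rw [sub_zero] at this
  exact this.congr fun a _ => funext fun n => by simp [MBO.projNeg]

theorem LocLip.projConst {r : ℝ} {G : (ℤ → ℂ) → ℤ → ℂ} (h : LocLip s r G) (r' : ℝ) :
    LocLip s r' fun a => projConst (G a) := by
  have := h.mult (m := fun n => if n = 0 then 1 else 0) (c := 1) (d := r - r') (fun n => by
    split_ifs with hn
    · subst hn; simp [bracket_zero]
    · rw [norm_zero, one_mul]; exact (bracket_rpow_pos _ _).le)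
  rw [sub_sub_cancel] at this
  exact this.congr fun a _ => funext fun n => by simp [MBO.projConst]

theorem LocLip.dx {r : ℝ} {G : (ℤ → ℂ) → ℤ → ℂ} (h : LocLip s r G) :
    LocLip s (r - 1) fun a => dx (G a) :=
  h.mult (m := fun n => Complex.I * n) (c := 1) (d := 1) (fun n => by
    rw [norm_mul, Complex.norm_I, one_mul, one_mul, Real.rpow_one, Complex.norm_intCast]
    exact abs_le_bracket n)

theorem LocLip.hilbert {r : ℝ} {G : (ℤ → ℂ) → ℤ → ℂ} (h : LocLip s r G) :
    LocLip s r fun a => hilbert (G a) := by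
  have := h.mult (m := fun n => -Complex.I * (n.sign : ℂ)) (c := 1) (d := 0) (fun n => by
    rw [norm_mul, norm_neg, Complex.norm_I, one_mul, one_mul, Real.rpow_zero, Complex.norm_intCast]
    rcases lt_trichotomy n 0 with hn | hn | hn
    · simp [Int.sign_eq_neg_one_of_neg hn]
    · simp [hn]
    · simp [Int.sign_eq_one_of_pos hn])
  rw [sub_zero] at this
  exact this

theorem LocLip.const_smul {r : ℝ} {G : (ℤ → ℂ) → ℤ → ℂ} (h : LocLip s r G) (c : ℂ) :
    LocLip s r fun a => c • G a := by
  have := h.mult (m := fun _ => c) (c := ‖c‖) (d := 0) (fun n => by simp)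
  rw [sub_zero] at this
  exact this

theorem locLip_halfSeq (s : ℝ) : LocLip s s halfSeq :=
  (LocLip.id s).projPos.add (((LocLip.id s).projConst s).const_smul _)

theorem gaugePhase_eq (hs : 1 / 2 < s) (hf : MeasureTheory.MemLp f 2 AddCircle.haarAddCircle)
    (ha : MemL2 s (coeff f)) : gaugePhase f = invFourier (phaseSeq (coeff f)) := by
  rw [gaugePhase, sqCoeff_eq hs hf ha]; rfl

theorem gaugeCoeff_eq (hs : 1 / 2 < s) (hf : MeasureTheory.MemLp f 2 AddCircle.haarAddCircle)
    (ha : MemL2 s (coeff f)) (k : ℤ) : gaugeCoeff f k = gaugeSeq k (coeff f) := by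
  have hφ := (locLip_phaseSeq hs).memL2 ha
  have hr : 1 / 2 < s + 1 := by linarith
  rw [gaugeCoeff, gaugePhase_eq hs hf ha]
  simp_rw [exp_invFourier hr _ hφ]
  exact fourierCoeff_invFourier (((locLip_expSeq hr _).memL2 hφ).summable hr)

theorem fourierCoeff_gaugeTransform (hs : 1 / 2 < s)
    (hf : MeasureTheory.MemLp f 2 AddCircle.haarAddCircle) (ha : MemL2 s (coeff f)) (σ : ℤ) :
    fourierCoeff (gaugeTransform σ f) = conv (gaugeSeq (-σ) (coeff f)) (halfSeq (coeff f)) := by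
  have hφ := (locLip_phaseSeq hs).memL2 ha
  have hr : 1 / 2 < s + 1 := by linarith
  have h1 := ((locLip_gaugeSeq hs (-σ)).memL2 ha).summable hr
  have h2 := ((locLip_halfSeq s).memL2 ha).summable hs
  have h3 := (((LocLip.id s).projPos).memL2 ha).summable hs
  rw [← fourierCoeff_mul h1 h2]
  congr 1
  ext x
  have e1 : -Complex.I * σ * gaugePhase f x
      = Complex.I * ((-σ : ℤ) : ℂ) * invFourier (phaseSeq (coeff f)) x := by
    rw [gaugePhase_eq hs hf ha]; push_cast; ring
  have e2 : invFourier (halfSeq (coeff f)) x = invFourier (projPos (coeff f)) x + 1 / 2 * coeff f 0 := by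
    have g : HasSum (fun n => (1 / 2 * projConst (coeff f) n) * fourier n x) (1 / 2 * coeff f 0) := by
      have := hasSum_ite_eq (0 : ℤ) (1 / 2 * coeff f 0)
      refine this.congr_fun fun n => ?_
      by_cases hn : n = 0
      · subst hn; simp [projConst]
      · simp [projConst, hn]
    have := (hasSum_invFourier h3 x).add g
    rw [invFourier_eq h3, invFourier_eq h2]
    refine (hasSum_invFourier h2 x).unique (this.congr_fun fun n => ?_)
    simp only [halfSeq, Pi.add_apply, Pi.smul_apply, smul_eq_mul]
    ring
  rw [gaugeTransform, e1, exp_invFourier hr _ hφ, e2]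
  rfl

end

section

/-! ### Estimates for the remainder and the time derivatives -/

theorem bil_ite (P Q : ℤ → Prop) [DecidablePred P] [DecidablePred Q] (a b : ℤ → ℂ) (n : ℤ) :
    bil (fun n k => if P n ∧ Q k then 1 else 0) a b n
      = if P n then conv a (fun k => if Q k then b k else 0) n else 0 := by
  unfold bil conv
  split_ifs with h
  · exact tsum_congr fun k => by by_cases hk : Q k <;> simp [h, hk]
  · simp [h]

theorem bil_mean (a b : ℤ → ℂ) : bil (fun n _ => if n = 0 then 1 else 0) a b = projConst (conv a b) := by
  ext n
  unfold bil conv projConst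
  by_cases h : n = 0 <;> simp [h]

theorem conv_projConst (a b : ℤ → ℂ) (n : ℤ) : conv (projConst a) b n = a 0 * b n := by
  unfold conv
  rw [tsum_eq_single n]
  · simp [projConst]
  · intro k hk
    have : n - k ≠ 0 := fun h => hk (by omega)
    simp [projConst, this]

/-- Coefficients of `P_{≠c}(f²) ∂ₓf`. -/
def cubicSeq (a : ℤ → ℂ) : ℤ → ℂ := conv (projNonconst (conv a a)) (dx a)

/-- Coefficients of the remainder. -/
def remSeq (σ : ℤ) (a : ℤ → ℂ) (n : ℤ) : ℂ :=
  let w := gaugeSeq (-σ) a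
  let g := halfSeq a
  let q := projNonconst (conv a a)
  let ihdx := Complex.I • hilbert (dx a)
  (-Complex.I) * conv (conv w (projNonconst (conv q q))) g n
    - hilbert (conv (conv w (conv q q)) g) n
    - 2 * (σ : ℂ) * conv a ihdx 0 * conv w g n
    + 2 * (σ : ℂ) * projConst (conv (conv (conv w a) g) ihdx) n
    + 2 * (σ : ℂ) * (projConst (conv w (projPos (cubicSeq a))) n
        + projNeg (conv w (projPos (cubicSeq a))) n)
    - 2 * (σ : ℂ) * projPos (conv w (projConst (cubicSeq a) + projNeg (cubicSeq a))) n
    - 2 * (σ : ℂ) * conv a a 0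
        * (projPos (conv w (dx (projNeg a))) n + projNeg (conv w (dx (projPos a))) n)
    + Complex.I * projConst (conv w (projPos (dx (dx a)))) n
    - 2 * (σ : ℂ) * conv a a 0
        * projNeg (conv (dxInv (projNeg w)) (dx (dx (projPos a)))) n

variable {s : ℝ} {f : Torus → ℝ}

theorem cubicCoeff_eq (hs : 1 / 2 < s) (hf : MeasureTheory.MemLp f 2 AddCircle.haarAddCircle)
    (ha : MemL2 s (coeff f)) : cubicCoeff f = cubicSeq (coeff f) := by
  rw [cubicCoeff, sqCoeff_eq hs hf ha]; rfl

theorem remainder_eq (hs : 1 / 2 < s) (hf : MeasureTheory.MemLp f 2 AddCircle.haarAddCircle)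
    (ha : MemL2 s (coeff f)) (σ : ℤ) : remainder σ f = remSeq σ (coeff f) := by
  ext n
  unfold remainder
  rw [gaugeCoeff_eq hs hf ha, sqCoeff_eq hs hf ha, cubicCoeff_eq hs hf ha]
  rfl

theorem locLip_cubicSeq (hs : 1 / 2 < s) (hs1 : s ≤ 1) : LocLip s (s - 1) cubicSeq :=
  ((LocLip.id s).conv (LocLip.id s) (bilBdd_algebra hs)).projNonconst.conv (LocLip.id s).dx
    (bilBdd_low hs hs1 le_rfl)

theorem bilBdd_ite {m : ℝ} (hs : 1 / 2 < s) (hm : 0 ≤ m) (P Q : ℤ → Prop) [DecidablePred P]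
    [DecidablePred Q] (h : ∀ n k, P n → Q k → |n| ≤ |n - k| ∧ |k| ≤ |n - k|) :
    BilBdd (fun n k => if P n ∧ Q k then 1 else 0) (s + m) (s - m) s :=
  bilBdd_separated hs hm (fun n k => by split_ifs <;> simp) fun n k h0 => by
    have : P n ∧ Q k := by by_contra hc; simp [hc] at h0
    exact h n k this.1 this.2

theorem abs_le_sub_of_opposite {n k : ℤ} (h : n ≤ 0 ∧ 0 ≤ k ∨ 0 ≤ n ∧ k ≤ 0) :
    |n| ≤ |n - k| ∧ |k| ≤ |n - k| := by
  rcases h with ⟨h1, h2⟩ | ⟨h1, h2⟩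
  · rw [abs_of_nonpos h1, abs_of_nonneg h2, abs_of_nonpos (by omega)]; omega
  · rw [abs_of_nonneg h1, abs_of_nonpos h2, abs_of_nonneg (by omega)]; omega

theorem locLip_remSeq (hs : 1 / 2 < s) (hs1 : s ≤ 1) (σ : ℤ) : LocLip s s (remSeq σ) := by
  have alg := bilBdd_algebra hs
  have La := LocLip.id s
  have LS := La.conv La alg
  have Lq := LS.projNonconst
  have Lw := locLip_gaugeSeq hs (-σ)
  have Lw' := Lw.mono (by linarith : s ≤ s + 1)
  have Lg := locLip_halfSeq s
  have Li := La.dx.hilbert.const_smul Complex.I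
  have Lc := locLip_cubicSeq hs hs1
  have Lwg := Lw'.conv Lg alg
  have T1 := ((Lw'.conv (Lq.conv Lq alg).projNonconst alg).conv Lg alg).const_smul (-Complex.I)
  have T2 := ((Lw'.conv (Lq.conv Lq alg) alg).conv Lg alg).hilbert.const_smul (-1)
  have T3 := ((La.bil Li (bilBdd_mean (by linarith) s)).conv Lwg alg).const_smul (-(2 * (σ : ℂ)))
  have T4 := (((Lw'.conv La alg).conv Lg alg).bil Li (bilBdd_mean (by linarith) s)).const_smul (2 * (σ : ℂ))
  have T5 := (Lw.bil Lc (bilBdd_ite hs zero_le_one (fun n => n ≤ 0) (fun k => 0 < k)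
    fun n k h1 h2 => abs_le_sub_of_opposite (.inl ⟨h1, h2.le⟩))).const_smul (2 * (σ : ℂ))
  have T6 := (Lw.bil Lc (bilBdd_ite hs zero_le_one (fun n => 0 < n) (fun k => k ≤ 0)
    fun n k h1 h2 => abs_le_sub_of_opposite (.inr ⟨h1.le, h2⟩))).const_smul (-(2 * (σ : ℂ)))
  have T7 := (Lw.bil La.dx (bilBdd_ite hs zero_le_one (fun n => 0 < n) (fun k => k < 0)
    fun n k h1 h2 => abs_le_sub_of_opposite (.inr ⟨h1.le, h2.le⟩))).add
    (Lw.bil La.dx (bilBdd_ite hs zero_le_one (fun n => n < 0) (fun k => 0 < k)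
    fun n k h1 h2 => abs_le_sub_of_opposite (.inl ⟨h1.le, h2.le⟩)))
  have T7' := ((LS.projConst s).conv T7 alg).const_smul (-(2 * (σ : ℂ)))
  have T8 := (Lw.bil La.dx.dx.projPos (bilBdd_mean (by linarith) s)).const_smul Complex.I
  have L9 := Lw.projNeg.dxInv
  have L9' := La.projPos.dx.dx
  rw [show s + 1 + 1 = s + 2 by ring] at L9
  rw [show s - 1 - 1 = s - 2 by ring] at L9'
  have T9 := L9.bil L9' (bilBdd_ite hs zero_le_two (fun n => n < 0) (fun k => 0 < k)
    fun n k h1 h2 => abs_le_sub_of_opposite (.inl ⟨h1.le, h2.le⟩))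
  have T9' := ((LS.projConst s).conv T9 alg).const_smul (-(2 * (σ : ℂ)))
  refine ((((((((T1.add T2).add T3).add T4).add T5).add T6).add T7').add T8).add T9').congr fun a _ => ?_
  ext n
  have e5 : ∀ X : ℤ → ℂ, (if n ≤ 0 then X n else 0) = projConst X n + projNeg X n := fun X => by
    unfold projConst projNeg
    rcases lt_trichotomy n 0 with h | h | h
    · simp [h, h.le, h.ne]
    · simp [h]
    · simp [h.not_ge, h.ne', h.not_gt]
  have e6 : ∀ c : ℤ → ℂ, (fun k => if k ≤ 0 then c k else 0) = projConst c + projNeg c := fun c => by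
    ext k
    simp only [Pi.add_apply]
    unfold projConst projNeg
    rcases lt_trichotomy k 0 with h | h | h
    · simp [h, h.le, h.ne]
    · simp [h]
    · simp [h.not_ge, h.ne', h.not_gt]
  have e7 : (fun k => if k < 0 then dx a k else 0) = dx (projNeg a) := by
    ext k; simp [dx, projNeg]
  have e8 : (fun k => if 0 < k then dx a k else 0) = dx (projPos a) := by
    ext k; simp [dx, projPos]
  have e9 : (fun k => if 0 < k then dx (dx (projPos a)) k else 0) = dx (dx (projPos a)) := by
    ext k; by_cases h : 0 < k <;> simp [dx, projPos, h]
  have ep : ∀ c : ℤ → ℂ, (fun k => if 0 < k then c k else 0) = projPos c := fun c => rfl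
  have ep' : ∀ X : ℤ → ℂ, (if 0 < n then X n else 0) = projPos X n := fun X => rfl
  have en' : ∀ X : ℤ → ℂ, (if n < 0 then X n else 0) = projNeg X n := fun X => rfl
  simp only [Pi.add_apply, Pi.smul_apply, smul_eq_mul, bil_mean, conv_projConst, bil_ite, e7, e8, e9, e6,
    e5, ep, ep', en', remSeq]
  ring

/-- Kernel of the time derivative of `F`. -/
def phaseKer (n k : ℤ) : ℂ := if n = 0 then 0 else -(((n - k) * |n - k| + k * |k| : ℤ) : ℂ) / n

/-- Coefficients of the time derivative of `F` along solutions. -/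
def phaseDot (σ : ℤ) (a : ℤ → ℂ) : ℤ → ℂ :=
  bil phaseKer a a + (4 * σ : ℂ) • dxInv (projNonconst (conv a (cubicSeq a)))

/-- Coefficients of the time derivative of `e^{ikF}` along solutions. -/
def gaugeDot (σ k : ℤ) (a : ℤ → ℂ) : ℤ → ℂ := (Complex.I * k) • conv (gaugeSeq k a) (phaseDot σ a)

theorem abs_mul_abs_add_le (x y : ℤ) : |(x * |x| + y * |y|)| ≤ |x + y| * (|x| + |y|) := by
  rcases le_total 0 x with hx | hx <;> rcases le_total 0 y with hy | hy
  · rw [abs_of_nonneg hx, abs_of_nonneg hy, abs_of_nonneg (by positivity), abs_of_nonneg (by positivity)]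
    nlinarith [mul_nonneg hx hy]
  · rw [abs_of_nonneg hx, abs_of_nonpos hy, show x * x + y * -y = (x + y) * (x - y) by ring, abs_mul,
      abs_of_nonneg (show 0 ≤ x - y by omega)]
    nlinarith [abs_nonneg (x + y)]
  · rw [abs_of_nonpos hx, abs_of_nonneg hy, show x * -x + y * y = (x + y) * (y - x) by ring, abs_mul,
      abs_of_nonneg (show 0 ≤ y - x by omega)]
    nlinarith [abs_nonneg (x + y)]
  · rw [abs_of_nonpos hx, abs_of_nonpos hy, abs_of_nonpos (by nlinarith), abs_of_nonpos (by omega)]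
    nlinarith [mul_nonneg_of_nonpos_of_nonpos hx hy]

theorem norm_phaseKer_le (n k : ℤ) : ‖phaseKer n k‖ ≤ bracket (n - k) + bracket k := by
  unfold phaseKer
  split_ifs with hn
  · rw [norm_zero]; have := bracket_pos (n - k); have := bracket_pos k; positivity
  · rw [norm_div, norm_neg, Complex.norm_intCast, Complex.norm_intCast]
    have h0 : (0 : ℝ) < |(n : ℝ)| := by positivity
    rw [div_le_iff₀ h0]
    have h1 := abs_mul_abs_add_le (n - k) k
    rw [sub_add_cancel] at h1
    have h2 : |(((n - k) * |n - k| + k * |k| : ℤ) : ℝ)| ≤ |(n : ℝ)| * (|((n - k : ℤ) : ℝ)| + |(k : ℝ)|) := by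
      exact_mod_cast h1
    refine h2.trans ?_
    rw [mul_comm]
    gcongr
    · exact abs_le_bracket (n - k)
    · exact abs_le_bracket k

theorem locLip_phaseDot (hs : 1 / 2 < s) (hs1 : s ≤ 1) (σ : ℤ) : LocLip s (s - 1) (phaseDot σ) := by
  have La := LocLip.id s
  have h := (La.conv (locLip_cubicSeq hs hs1) (bilBdd_low hs hs1 le_rfl)).projNonconst.dxInv.const_smul
    (4 * σ : ℂ)
  exact (La.bil La (bilBdd_deriv hs hs1 norm_phaseKer_le)).add (h.mono (by linarith))

theorem locLip_gaugeDot (hs : 1 / 2 < s) (hs1 : s ≤ 1) (σ k : ℤ) : LocLip s (s - 1) (gaugeDot σ k) :=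
  ((locLip_gaugeSeq hs k).conv (locLip_phaseDot hs hs1 σ) (bilBdd_low hs hs1 (by linarith))).const_smul _

end

/-! ### Continuous functions whose weak derivative is continuous -/

open MeasureTheory in
theorem const_of_integral_mul_deriv_eq_zero {T : ℝ} (hT : 0 < T) {B : ℝ → ℂ} (hB : Continuous B)
    (h : ∀ η : ℝ → ℝ, ContDiff ℝ (⊤ : ℕ∞) η → (∃ c d, 0 < c ∧ d < T ∧ ∀ t, t ∉ Set.Icc c d → η t = 0) →
      ∫ t in (0 : ℝ)..T, ((deriv η t : ℝ) : ℂ) * B t = 0) : ∀ t ∈ Set.Icc 0 T, B t = B 0 := by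
  let χ : ContDiffBump (T / 2) := ⟨T / 8, T / 4, by positivity, by linarith⟩
  set X : ℝ → ℝ := χ.normed volume with hX
  have hXc : ContDiff ℝ (⊤ : ℕ∞) X := χ.contDiff_normed
  have hXs : ∀ t, t ∉ Set.Icc (T / 4) (3 * T / 4) → X t = 0 := by
    intro t ht
    by_contra h0
    apply ht
    have : t ∈ Function.support X := h0
    rw [hX, χ.support_normed_eq] at this
    rw [Real.ball_eq_Ioo] at this
    change t ∈ Set.Ioo (T / 2 - T / 4) (T / 2 + T / 4) at this
    exact ⟨by linarith [this.1], by linarith [this.2]⟩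
  have whole : ∀ (g : ℝ → ℝ) (F : ℝ → ℂ) (c d : ℝ), 0 < c → d < T → (∀ t, t ∉ Set.Icc c d → g t = 0) →
      ∫ t, g t • F t = ∫ t in (0 : ℝ)..T, (g t : ℂ) * F t := by
    intro g F c d hc hd hg
    rw [intervalIntegral.integral_of_le hT.le, setIntegral_eq_integral_of_forall_compl_eq_zero]
    · rfl
    · intro t ht
      rw [hg t (fun h => ht ⟨by linarith [h.1], by linarith [h.2]⟩)]
      simp
  set κ : ℂ := ∫ t in (0 : ℝ)..T, (X t : ℂ) * B t with hκ
  have hX1 : ∫ t in (0 : ℝ)..T, X t = 1 := by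
    have h1 := whole X (fun _ => 1) (T / 4) (3 * T / 4) (by linarith) (by linarith) hXs
    have h2 : ∫ t, X t • (1 : ℂ) = 1 := by
      rw [integral_smul_const, hX, χ.integral_normed, one_smul]
    rw [h2] at h1
    simp only [mul_one] at h1
    rw [intervalIntegral.integral_ofReal] at h1
    exact_mod_cast h1.symm
  have key : ∀ (g : ℝ → ℝ) (c d : ℝ), ContDiff ℝ (⊤ : ℕ∞) g → 0 < c → d < T →
      (∀ t, t ∉ Set.Icc c d → g t = 0) → ∫ t, g t • (B t - κ) = 0 := by
    intro g c d hg hc hd hgs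
    set G := ∫ t in (0 : ℝ)..T, g t with hG
    set k : ℝ → ℝ := fun t => g t - G * X t with hk
    have hkc : ContDiff ℝ (⊤ : ℕ∞) k := hg.sub (contDiff_const.mul hXc)
    have hkcont : Continuous k := hkc.continuous
    have hks : ∀ t, t ∉ Set.Icc (min c (T / 4)) (max d (3 * T / 4)) → k t = 0 := by
      intro t ht
      simp only [hk]
      rw [hgs t fun h => ht ⟨(min_le_left _ _).trans h.1, h.2.trans (le_max_left _ _)⟩,
        hXs t fun h => ht ⟨(min_le_right _ _).trans h.1, h.2.trans (le_max_right _ _)⟩]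
      ring
    have hkint : ∫ t in (0 : ℝ)..T, k t = 0 := by
      simp only [hk]
      have hGX : Continuous fun t => G * X t := continuous_const.mul hXc.continuous
      rw [intervalIntegral.integral_sub (hg.continuous.intervalIntegrable _ _)
        (hGX.intervalIntegrable _ _),
        intervalIntegral.integral_const_mul, hX1, ← hG]
      ring
    set η : ℝ → ℝ := fun t => ∫ τ in (0 : ℝ)..t, k τ with hη
    have hηd : ∀ t, HasDerivAt η (k t) t := fun t =>
      intervalIntegral.integral_hasDerivAt_right (hkcont.intervalIntegrable _ _)
        hkcont.stronglyMeasurable.stronglyMeasurableAtFilter hkcont.continuousAt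
    have hηd' : deriv η = k := funext fun t => (hηd t).deriv
    have hηc : ContDiff ℝ (⊤ : ℕ∞) η := by
      rw [contDiff_infty_iff_deriv]
      exact ⟨fun t => (hηd t).differentiableAt, hηd' ▸ hkc⟩
    have hη0 : ∀ t, t ∉ Set.Icc (min c (T / 4)) (max d (3 * T / 4)) → η t = 0 := by
      intro t ht
      simp only [hη]
      have hmin : 0 < min c (T / 4) := lt_min hc (by linarith)
      have hmax : max d (3 * T / 4) < T := max_lt hd (by linarith)
      by_cases h1 : t < min c (T / 4)
      · rw [intervalIntegral.integral_congr (g := fun _ => (0 : ℝ))]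
        · simp
        · intro τ hτ
          refine hks τ fun h => ?_
          have := hτ.2
          have : τ < min c (T / 4) := lt_of_le_of_lt this (max_lt hmin h1)
          linarith [h.1]
      · have h2 : max d (3 * T / 4) < t := by
          by_contra h3
          exact ht ⟨not_lt.1 h1, not_lt.1 h3⟩
        rw [← intervalIntegral.integral_add_adjacent_intervals (b := T)
          (hkcont.intervalIntegrable _ _) (hkcont.intervalIntegrable _ _), hkint, zero_add,
          intervalIntegral.integral_congr (g := fun _ => (0 : ℝ))]
        · simp
        · intro τ hτ
          refine hks τ fun h => ?_
          have : max d (3 * T / 4) < τ := lt_of_lt_of_le (lt_min hmax h2) hτ.1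
          linarith [h.2]
    have h0 := h η hηc ⟨_, _, lt_min hc (by linarith), max_lt hd (by linarith), hη0⟩
    rw [hηd'] at h0
    rw [whole g _ c d hc hd hgs]
    have hgB : Continuous fun t => (g t : ℂ) * B t := (Complex.continuous_ofReal.comp hg.continuous).mul hB
    have hXB : Continuous fun t => (X t : ℂ) * B t := (Complex.continuous_ofReal.comp hXc.continuous).mul hB
    have hgk : Continuous fun t => (g t : ℂ) * κ :=
      (Complex.continuous_ofReal.comp hg.continuous).mul continuous_const
    have e1 : ∫ t in (0 : ℝ)..T, (k t : ℂ) * B t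
        = (∫ t in (0 : ℝ)..T, (g t : ℂ) * B t) - G * κ := by
      have hGXB : Continuous fun t => (G : ℂ) * ((X t : ℂ) * B t) := continuous_const.mul hXB
      rw [hκ, ← intervalIntegral.integral_const_mul, ← intervalIntegral.integral_sub
        (hgB.intervalIntegrable _ _) (hGXB.intervalIntegrable _ _)]
      refine intervalIntegral.integral_congr fun t _ => ?_
      simp only [hk]
      push_cast
      ring
    simp only [mul_sub]
    rw [intervalIntegral.integral_sub (hgB.intervalIntegrable _ _) (hgk.intervalIntegrable _ _),
      intervalIntegral.integral_mul_const, intervalIntegral.integral_ofReal, ← hG, ← e1, h0]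
  have hae := isOpen_Ioo (a := (0 : ℝ)) (b := T) |>.ae_eq_zero_of_integral_contDiff_smul_eq_zero
    (f := fun t => B t - κ) (μ := volume)
    ((hB.sub continuous_const).locallyIntegrable.locallyIntegrableOn _) (fun g hg hgc hgs => by
      obtain ⟨c, d, hc, hd, hcd⟩ : ∃ c d, 0 < c ∧ d < T ∧ tsupport g ⊆ Set.Icc c d := by
        rcases (tsupport g).eq_empty_or_nonempty with h0 | h0
        · exact ⟨T, 0, hT, hT, by rw [h0]; exact Set.empty_subset _⟩
        · obtain ⟨c, hc⟩ := hgc.isCompact.exists_isLeast h0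
          obtain ⟨d, hd⟩ := hgc.isCompact.exists_isGreatest h0
          exact ⟨c, d, (hgs hc.1).1, (hgs hd.1).2, fun t ht => ⟨hc.2 ht, hd.2 ht⟩⟩
      exact key g c d hg hc hd fun t ht => by
        by_contra h0
        exact ht (hcd (subset_tsupport g h0)))
  have hz : ∀ t ∈ Set.Icc 0 T, B t - κ = 0 := by
    have hcl : IsClosed {t | B t - κ = 0} := isClosed_eq (hB.sub continuous_const) continuous_const
    have hIoo : ∀ t ∈ Set.Ioo 0 T, B t - κ = 0 := by
      intro t ht
      by_contra h0
      have hopen : IsOpen ({t | B t - κ ≠ 0} ∩ Set.Ioo 0 T) := hcl.isOpen_compl.inter isOpen_Ioo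
      have hpos := hopen.measure_pos volume ⟨t, h0, ht⟩
      refine hpos.ne' (measure_mono_null (fun x hx => ?_) (ae_iff.1 hae))
      simp only [Set.mem_ofPred_eq, Classical.not_imp]
      exact ⟨hx.2, hx.1⟩
    intro t ht
    rw [← closure_Ioo hT.ne] at ht
    exact hcl.closure_subset_iff.2 hIoo ht
  intro t ht
  rw [← sub_eq_zero, ← sub_sub_sub_cancel_right _ _ κ, hz t ht, hz 0 ⟨le_rfl, hT.le⟩, sub_zero]

theorem eq_integral_of_weak {T : ℝ} (hT : 0 < T) {b r : ℝ → ℂ} (hb : Continuous b) (hr : Continuous r)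
    (h : ∀ η : ℝ → ℝ, ContDiff ℝ (⊤ : ℕ∞) η → (∃ c d, 0 < c ∧ d < T ∧ ∀ t, t ∉ Set.Icc c d → η t = 0) →
      ∫ t in (0 : ℝ)..T, (((deriv η t : ℝ) : ℂ) * b t + (η t : ℂ) * r t) = 0) :
    ∀ t ∈ Set.Icc 0 T, b t = b 0 + ∫ τ in (0 : ℝ)..t, r τ := by
  have hI : ∀ t, HasDerivAt (fun t => ∫ τ in (0 : ℝ)..t, r τ) (r t) t := fun t =>
    intervalIntegral.integral_hasDerivAt_right (hr.intervalIntegrable _ _)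
      hr.stronglyMeasurable.stronglyMeasurableAtFilter hr.continuousAt
  have hIc : Continuous fun t => ∫ τ in (0 : ℝ)..t, r τ :=
    continuous_iff_continuousAt.2 fun t => (hI t).continuousAt
  have := const_of_integral_mul_deriv_eq_zero hT (B := fun t => b t - ∫ τ in (0 : ℝ)..t, r τ)
    (hb.sub hIc) (fun η hη hs => by
      obtain ⟨c, d, hc, hd, h0⟩ := hs
      have hw := h η hη ⟨c, d, hc, hd, h0⟩
      have hdη : ∀ t, HasDerivAt (fun t => (η t : ℂ)) ((deriv η t : ℝ) : ℂ) t := fun t =>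
        ((hη.differentiable (by simp)) t).hasDerivAt.ofReal_comp
      have hdc : Continuous fun t => ((deriv η t : ℝ) : ℂ) :=
        Complex.continuous_ofReal.comp (hη.continuous_deriv (by simp))
      have hηc : Continuous fun t => (η t : ℂ) := Complex.continuous_ofReal.comp hη.continuous
      have ibp := intervalIntegral.integral_mul_deriv_eq_deriv_mul (a := 0) (b := T)
        (u := fun t => ∫ τ in (0 : ℝ)..t, r τ) (v := fun t => (η t : ℂ))
        (fun t _ => hI t) (fun t _ => hdη t) (hr.intervalIntegrable _ _) (hdc.intervalIntegrable _ _)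
      have e0 : η 0 = 0 := h0 0 fun hh => by linarith [hh.1]
      have eT : η T = 0 := h0 T fun hh => by linarith [hh.2]
      rw [e0, eT] at ibp
      simp only [Complex.ofReal_zero, mul_zero, sub_zero, zero_sub] at ibp
      have hdb : Continuous fun t => ((deriv η t : ℝ) : ℂ) * b t := hdc.mul hb
      have hηr : Continuous fun t => (η t : ℂ) * r t := hηc.mul hr
      have hId : Continuous fun t => (∫ τ in (0 : ℝ)..t, r τ) * ((deriv η t : ℝ) : ℂ) := hIc.mul hdc
      have e1 : ∫ t in (0 : ℝ)..T, ((deriv η t : ℝ) : ℂ) * (b t - ∫ τ in (0 : ℝ)..t, r τ)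
          = (∫ t in (0 : ℝ)..T, ((deriv η t : ℝ) : ℂ) * b t)
            - ∫ t in (0 : ℝ)..T, (∫ τ in (0 : ℝ)..t, r τ) * ((deriv η t : ℝ) : ℂ) := by
        rw [← intervalIntegral.integral_sub (hdb.intervalIntegrable _ _)
          (hId.intervalIntegrable _ _)]
        exact intervalIntegral.integral_congr fun t _ => by ring
      rw [intervalIntegral.integral_add (hdb.intervalIntegrable _ _)
        (hηr.intervalIntegrable _ _)] at hw
      rw [e1, ibp, sub_neg_eq_add, ← hw]
      congr 1
      exact intervalIntegral.integral_congr fun t _ => mul_comm _ _)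
  intro t ht
  have h2 := this t ht
  simp only [intervalIntegral.integral_same, sub_zero] at h2
  rw [← h2]
  ring

/-! ### Pointwise consequences of norm bounds -/

theorem norm_apply_le {r : ℝ} {a : ℤ → ℂ} (ha : MemL2 r a) (n : ℤ) :
    ‖a n‖ ≤ bracket n ^ (-r) * l2Norm r a := by
  have h1 : bracket n ^ r * ‖a n‖ ≤ l2Norm r a := by
    refine Real.le_sqrt_of_sq_le ?_
    exact ha.le_tsum n fun _ _ => sq_nonneg _
  have h0 := bracket_rpow_pos n r
  rw [Real.rpow_neg (bracket_pos n).le, inv_mul_eq_div, le_div_iff₀ h0, mul_comm]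
  exact h1

theorem sum_norm_mul_le {r : ℝ} {c z : ℤ → ℂ} (hc : MemL2 (-r) c) (hz : MemL2 r z) (F : Finset ℤ) :
    ∑ n ∈ F, ‖c n‖ * ‖z n‖ ≤ l2Norm (-r) c * l2Norm r z := by
  have e : ∀ n ∈ F, ‖c n‖ * ‖z n‖ = (bracket n ^ (-r) * ‖c n‖) * (bracket n ^ r * ‖z n‖) := fun n _ => by
    rw [Real.rpow_neg (bracket_pos n).le]
    have := (bracket_rpow_pos n r).ne'
    field_simp
  rw [Finset.sum_congr rfl e]
  refine (Real.sum_mul_le_sqrt_mul_sqrt F _ _).trans ?_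
  unfold l2Norm
  gcongr
  · exact hc.sum_le_tsum F fun _ _ => sq_nonneg _
  · exact hz.sum_le_tsum F fun _ _ => sq_nonneg _

theorem memL2_one {r : ℝ} (hr : 1 / 2 < r) : MemL2 (-r) fun _ => 1 := by
  refine (summable_bracket_rpow (r := 2 * r) (by linarith)).congr fun n => ?_
  rw [norm_one, mul_one, ← Real.rpow_natCast, ← Real.rpow_mul (bracket_pos n).le]
  congr 1
  push_cast
  ring

theorem tsum_norm_le {r : ℝ} (hr : 1 / 2 < r) {a : ℤ → ℂ} (ha : MemL2 r a) :
    ∑' n, ‖a n‖ ≤ l2Norm (-r) (fun _ => 1) * l2Norm r a :=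
  (ha.summable hr).norm.tsum_le_of_sum_le fun F => by
    simpa using sum_norm_mul_le (memL2_one hr) ha F

theorem tsum_norm_sq_le {r : ℝ} {a : ℤ → ℂ} (ha : MemL2 (-r) a) (ha' : MemL2 r a) :
    ∑' n, ‖a n‖ ^ 2 ≤ l2Norm (-r) a * l2Norm r a := by
  have h : ∀ F : Finset ℤ, ∑ n ∈ F, ‖a n‖ ^ 2 ≤ l2Norm (-r) a * l2Norm r a := fun F => by
    simpa [sq] using sum_norm_mul_le ha ha' F
  exact (summable_of_sum_le (fun _ => sq_nonneg _) h).tsum_le_of_sum_le h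

theorem InCT.continuousOn_apply {r T : ℝ} {f : ℝ → ℤ → ℂ} (hf : InCT r T f) (n : ℤ) :
    ContinuousOn (fun t => f t n) (Set.Icc 0 T) := by
  intro t₀ ht₀
  rw [ContinuousWithinAt, tendsto_iff_norm_sub_tendsto_zero]
  have h := (hf.2 t₀ ht₀).const_mul (bracket n ^ (-r))
  rw [mul_zero] at h
  refine squeeze_zero' (Filter.Eventually.of_forall fun _ => norm_nonneg _) ?_ h
  filter_upwards [self_mem_nhdsWithin] with t ht
  exact norm_apply_le ((hf.1 t ht).sub (hf.1 t₀ ht₀)) n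

theorem BilBdd.sum_norm_le {A : ℤ → ℤ → ℂ} {p q r : ℝ} (h : BilBdd A p q r) (n : ℤ) : ∃ C : ℝ, 0 ≤ C ∧
    ∀ a b, MemL2 p a → MemL2 q b → ∀ F : Finset ℤ,
      ∑ k ∈ F, ‖A n k * (a (n - k) * b k)‖ ≤ C * (l2Norm p a * l2Norm q b) := by
  have h' : BilBdd (fun n k => (‖A n k‖ : ℂ)) p q r := by
    obtain ⟨C, hC⟩ := h
    exact ⟨C, fun f g => by
      have e : ∀ w : ℂ, ‖((‖w‖ : ℝ) : ℂ)‖ₑ = ‖w‖ₑ := fun w => by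
        rw [← ofReal_norm, Complex.norm_real, norm_norm, ofReal_norm]
      simpa only [e] using hC f g⟩
  obtain ⟨C, hC0, hC⟩ := h'.bound
  have hw := (bracket_rpow_pos n (-r)).le
  refine ⟨bracket n ^ (-r) * C, by positivity, fun a b ha hb F => ?_⟩
  have hn : ∀ {p : ℝ} {a : ℤ → ℂ}, MemL2 p a → MemL2 p (fun k => (‖a k‖ : ℂ))
      ∧ l2Norm p (fun k => (‖a k‖ : ℂ)) = l2Norm p a := fun {p a} ha =>
    ⟨by simpa [MemL2] using ha, by simp [l2Norm]⟩
  have hm := hC _ _ (hn ha).1 (hn hb).1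
  have hsum := h'.summable (hn ha).1 (hn hb).1 n
  rw [(hn ha).2, (hn hb).2] at hm
  have h1 := (norm_apply_le hm.1 n).trans (mul_le_mul_of_nonneg_left hm.2 hw)
  have e : bil (fun n k => (‖A n k‖ : ℂ)) (fun k => (‖a k‖ : ℂ)) (fun k => (‖b k‖ : ℂ)) n
      = ((∑' k, ‖A n k * (a (n - k) * b k)‖ : ℝ) : ℂ) := by
    rw [bil, Complex.ofReal_tsum]
    exact tsum_congr fun k => by simp
  rw [e, Complex.norm_real, Real.norm_of_nonneg (tsum_nonneg fun _ => norm_nonneg _), ← mul_assoc] at h1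
  refine le_trans ?_ h1
  refine Summable.sum_le_tsum F (fun _ _ => norm_nonneg _) ?_
  refine (h.summable ha hb n).norm

/-! ### Integrals of sequences -/

theorem l2Norm_integral_le {r T K : ℝ} {g : ℝ → ℤ → ℂ} (hg : InCT r T g) (hK : 0 ≤ K) {t₀ t : ℝ}
    (ht₀ : t₀ ∈ Set.Icc 0 T) (ht : t ∈ Set.Icc 0 T)
    (hb : ∀ τ ∈ Set.uIcc t₀ t, l2Norm r (g τ) ≤ K) :
    MemL2 r (fun m => ∫ τ in t₀..t, g τ m) ∧
      l2Norm r (fun m => ∫ τ in t₀..t, g τ m) ≤ |t - t₀| * K := by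
  set e : ℤ → ℂ := fun m => ∫ τ in t₀..t, g τ m with he
  have hsub : Set.uIcc t₀ t ⊆ Set.Icc 0 T := Set.uIcc_subset_Icc ht₀ ht
  have hint : ∀ m, IntervalIntegrable (fun τ => g τ m) MeasureTheory.volume t₀ t := fun m =>
    ((hg.continuousOn_apply m).mono hsub).intervalIntegrable
  have key : ∀ F : Finset ℤ, ∑ m ∈ F, (bracket m ^ r * ‖e m‖) ^ 2 ≤ (|t - t₀| * K) ^ 2 := by
    intro F
    set S := ∑ m ∈ F, (bracket m ^ r * ‖e m‖) ^ 2 with hS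
    have hS0 : 0 ≤ S := Finset.sum_nonneg fun _ _ => sq_nonneg _
    let c : ℤ → ℂ := fun m => ((bracket m ^ r : ℝ) : ℂ) ^ 2 * (starRingEnd ℂ) (e m)
    have e1 : (S : ℂ) = ∫ τ in t₀..t, ∑ m ∈ F, c m * g τ m := by
      rw [intervalIntegral.integral_finsetSum fun m _ => (hint m).const_mul _, hS]
      push_cast
      refine Finset.sum_congr rfl fun m _ => ?_
      rw [intervalIntegral.integral_const_mul]
      change _ = ((bracket m ^ r : ℝ) : ℂ) ^ 2 * (starRingEnd ℂ) (e m) * e m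
      rw [mul_assoc, mul_comm ((starRingEnd ℂ) (e m)), Complex.mul_conj, Complex.normSq_eq_norm_sq]
      push_cast
      ring
    have e2 : ‖(S : ℂ)‖ ≤ (Real.sqrt S * K) * |t - t₀| := by
      rw [e1]
      refine intervalIntegral.norm_integral_le_of_norm_le_const fun τ hτ => ?_
      have hτ' := Set.uIoc_subset_uIcc hτ
      refine (norm_sum_le _ _).trans ?_
      have e3 : ∀ m ∈ F, ‖c m * g τ m‖ = (bracket m ^ r * ‖e m‖) * (bracket m ^ r * ‖g τ m‖) :=
        fun m _ => by
          simp only [c, norm_mul, norm_pow, Complex.norm_real, RCLike.norm_conj,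
            Real.norm_of_nonneg (bracket_rpow_pos m r).le]
          ring
      rw [Finset.sum_congr rfl e3]
      refine (Real.sum_mul_le_sqrt_mul_sqrt F _ _).trans ?_
      gcongr
      refine le_trans ?_ (hb τ hτ')
      exact Real.sqrt_le_sqrt ((hg.1 τ (hsub hτ')).sum_le_tsum F fun _ _ => sq_nonneg _)
    rw [Complex.norm_real, Real.norm_of_nonneg hS0] at e2
    have e4 : Real.sqrt S ≤ |t - t₀| * K := by
      rcases hS0.eq_or_lt with h0 | h0
      · rw [← h0, Real.sqrt_zero]; positivity
      · have hp := Real.sqrt_pos.2 h0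
        nlinarith [Real.mul_self_sqrt hS0]
    calc S = Real.sqrt S ^ 2 := (Real.sq_sqrt hS0).symm
      _ ≤ _ := by gcongr
  have hm : MemL2 r e := summable_of_sum_le (fun _ => sq_nonneg _) key
  refine ⟨hm, ?_⟩
  rw [l2Norm]
  exact Real.sqrt_le_iff.2 ⟨by positivity, hm.tsum_le_of_sum_le key⟩

/-- Differentiability in time of the coefficients of `e^{zφ}`. -/
theorem hasDerivWithinAt_expSeq {s T : ℝ} (hs : 1 / 2 < s) (hs1 : s ≤ 1) {φ ψ : ℝ → ℤ → ℂ}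
    (hφ : InCT (s + 1) T φ) (hψ : InCT (s - 1) T ψ)
    (hint : ∀ t₀ ∈ Set.Icc 0 T, ∀ t ∈ Set.Icc 0 T, ∀ m, φ t m - φ t₀ m = ∫ τ in t₀..t, ψ τ m)
    (z : ℂ) (n : ℤ) {t₀ : ℝ} (ht₀ : t₀ ∈ Set.Icc 0 T) :
    HasDerivWithinAt (fun t => expSeq z (φ t) n) (z * conv (expSeq z (φ t₀)) (ψ t₀) n) (Set.Icc 0 T) t₀ := by
  have hr : 1 / 2 < s + 1 := by linarith
  have hW : MemL2 (s + 1) (expSeq z (φ t₀)) := (locLip_expSeq hr z).memL2 (hφ.1 t₀ ht₀)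
  obtain ⟨C, hC0, hC⟩ := (bilBdd_low hs hs1 (show s ≤ s + 1 by linarith)).bound
  rw [← conv_eq_bil] at hC
  obtain ⟨Kψ, hK0, hKψ⟩ := hψ.exists_bound
  set L := l2Norm (-(s + 1)) (fun _ => 1)
  have hL : 0 ≤ L := l2Norm_nonneg _ _
  set E := Real.exp (‖z‖ * (∑' n, ‖φ t₀ n‖ + L)) * ‖z‖ ^ 2
  have hE : 0 ≤ E := by positivity
  set w := bracket n ^ (-(s - 1))
  have hw : 0 ≤ w := (bracket_rpow_pos _ _).le
  set Q := E * Kψ + ‖z‖ * (w * (C * l2Norm (s + 1) (expSeq z (φ t₀))))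
  have hWn := l2Norm_nonneg (s + 1) (expSeq z (φ t₀))
  have hQ : 0 ≤ Q := by positivity
  rw [hasDerivWithinAt_iff_isLittleO, Asymptotics.isLittleO_iff]
  intro ε hε
  set ε' := min 1 (ε / (Q + 1))
  have hε' : 0 < ε' := lt_min one_pos (by positivity)
  have hQε : Q * ε' ≤ ε := by
    have : ε' ≤ ε / (Q + 1) := min_le_right _ _
    rw [le_div_iff₀ (by positivity)] at this
    nlinarith
  have h1 := (hφ.2 t₀ ht₀).eventually (gt_mem_nhds hε')
  have h2 := (hψ.2 t₀ ht₀).eventually (gt_mem_nhds hε')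
  rw [eventually_nhdsWithin_iff, Metric.eventually_nhds_iff] at h2
  obtain ⟨δ, hδ, h2⟩ := h2
  filter_upwards [h1, self_mem_nhdsWithin, mem_nhdsWithin_of_mem_nhds (Metric.ball_mem_nhds t₀ hδ)]
    with t hφt ht hball
  set d := φ t - φ t₀ with hd
  have hdm : MemL2 (s + 1) d := (hφ.1 t ht).sub (hφ.1 t₀ ht₀)
  have hdt : φ t = φ t₀ + d := by rw [hd]; abel
  have hsub : Set.uIcc t₀ t ⊆ Set.Icc 0 T := Set.uIcc_subset_Icc ht₀ ht
  have hnear : ∀ τ ∈ Set.uIcc t₀ t, l2Norm (s - 1) (ψ τ - ψ t₀) ≤ ε' := fun τ hτ => by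
    refine (h2 ?_ (hsub hτ)).le
    have h3 : |τ - t₀| ≤ |t - t₀| := Set.abs_sub_left_of_mem_uIcc hτ
    exact lt_of_le_of_lt h3 hball
  have hd1 := l2Norm_integral_le hψ hK0 ht₀ ht fun τ hτ => hKψ τ (hsub hτ)
  have ed : (fun m => ∫ τ in t₀..t, ψ τ m) = d := funext fun m => (hint t₀ ht₀ t ht m).symm
  rw [ed] at hd1
  have hconst : InCT (s - 1) T fun _ => ψ t₀ :=
    ⟨fun _ _ => hψ.1 t₀ ht₀, fun _ _ => by simpa [l2Norm_zero] using tendsto_const_nhds⟩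
  have he1 := l2Norm_integral_le (hψ.sub hconst) hε'.le ht₀ ht hnear
  have ee : (fun m => ∫ τ in t₀..t, (ψ - fun _ => ψ t₀ : ℝ → ℤ → ℂ) τ m) = d - (t - t₀ : ℂ) • ψ t₀ := by
    funext m
    have hi : IntervalIntegrable (fun τ => ψ τ m) MeasureTheory.volume t₀ t :=
      ((hψ.continuousOn_apply m).mono hsub).intervalIntegrable
    simp only [Pi.sub_apply]
    rw [intervalIntegral.integral_sub hi intervalIntegrable_const, intervalIntegral.integral_const,
      ← hint t₀ ht₀ t ht m]
    simp [hd]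
  rw [ee] at he1
  have hsq : ∑' m, ‖d m‖ ^ 2 ≤ ε' * (|t - t₀| * Kψ) := by
    have hm : MemL2 (-(s - 1)) d := hdm.mono (by linarith)
    refine (tsum_norm_sq_le hm hd1.1).trans ?_
    gcongr
    · exact l2Norm_nonneg _ _
    · exact (l2Norm_mono_exponent (by linarith) hdm).trans hφt.le
    · exact hd1.2
  have hexp := norm_expSeq_add_sub_le hr z (hφ.1 t₀ ht₀) hdm n
  have hdl : ∑' m, ‖d m‖ ≤ L := (tsum_norm_le hr hdm).trans
    (mul_le_of_le_one_right hL (hφt.le.trans (min_le_left _ _)))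
  have hexp2 : ‖expSeq z (φ t) n - expSeq z (φ t₀) n - z * conv (expSeq z (φ t₀)) d n‖
      ≤ E * (ε' * (|t - t₀| * Kψ)) := by
    rw [hdt]
    refine hexp.trans (mul_le_mul ?_ hsq (tsum_nonneg fun _ => by positivity) hE)
    simp only [E]
    gcongr
  have hcm := hC _ _ hW he1.1
  have hcv : ‖conv (expSeq z (φ t₀)) (d - (t - t₀ : ℂ) • ψ t₀) n‖
      ≤ w * (C * (l2Norm (s + 1) (expSeq z (φ t₀)) * (|t - t₀| * ε'))) := by
    refine (norm_apply_le hcm.1 n).trans ?_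
    gcongr
    refine hcm.2.trans ?_
    gcongr
    exact he1.2
  have hlin : conv (expSeq z (φ t₀)) (d - (t - t₀ : ℂ) • ψ t₀) n
      = conv (expSeq z (φ t₀)) d n - (t - t₀ : ℂ) * conv (expSeq z (φ t₀)) (ψ t₀) n := by
    have s1 := (bilBdd_low hs hs1 (show s ≤ s + 1 by linarith)).summable hW hd1.1 n
    have s2 := (bilBdd_low hs hs1 (show s ≤ s + 1 by linarith)).summable hW (hψ.1 t₀ ht₀) n
    simp only [one_mul] at s1 s2
    unfold conv
    rw [← tsum_mul_left, ← s1.tsum_sub (s2.mul_left _)]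
    exact tsum_congr fun k => by simp only [Pi.sub_apply, Pi.smul_apply, smul_eq_mul]; ring
  have split : expSeq z (φ t) n - expSeq z (φ t₀) n
        - (t - t₀) • (z * conv (expSeq z (φ t₀)) (ψ t₀) n)
      = (expSeq z (φ t) n - expSeq z (φ t₀) n - z * conv (expSeq z (φ t₀)) d n)
        + z * conv (expSeq z (φ t₀)) (d - (t - t₀ : ℂ) • ψ t₀) n := by
    rw [hlin, Complex.real_smul]; push_cast; ring
  rw [split]
  refine (norm_add_le _ _).trans ?_
  rw [norm_mul, Real.norm_eq_abs]
  calc _ ≤ E * (ε' * (|t - t₀| * Kψ))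
        + ‖z‖ * (w * (C * (l2Norm (s + 1) (expSeq z (φ t₀)) * (|t - t₀| * ε')))) := by gcongr
    _ = (Q * ε') * |t - t₀| := by simp only [Q]; ring
    _ ≤ _ := by gcongr

section

/-! ### Time derivatives along solutions -/

/-- Coefficients of the right-hand side of the equation. -/
def rhsSeq (σ : ℤ) (a : ℤ → ℂ) : ℤ → ℂ := -hilbert (dx (dx a)) + (2 * σ : ℂ) • cubicSeq a

theorem locLip_rhsSeq {s : ℝ} (hs : 1 / 2 < s) (hs1 : s ≤ 1) (σ : ℤ) : LocLip s (s - 2) (rhsSeq σ) := by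
  have h := ((LocLip.id s).dx.dx.hilbert.const_smul (-1)).mono (show s - 2 ≤ s - 1 - 1 by linarith)
  have := h.add (((locLip_cubicSeq hs hs1).const_smul (2 * σ : ℂ)).mono (by linarith))
  exact this.congr fun a _ => by simp only [rhsSeq, neg_one_smul]

theorem rhsSeq_apply (σ : ℤ) (a : ℤ → ℂ) (n : ℤ) :
    rhsSeq σ a n = -Complex.I * ((n * |n| : ℤ) : ℂ) * a n + 2 * σ * cubicSeq a n := by
  have h : (n.sign : ℂ) * n = ((|n| : ℤ) : ℂ) := by exact_mod_cast Int.sign_mul_self_eq_abs n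
  have hI := Complex.I_mul_I
  simp only [rhsSeq, Pi.add_apply, Pi.neg_apply, Pi.smul_apply, smul_eq_mul, hilbert, dx]
  push_cast
  rw [← h]
  linear_combination (Complex.I * n.sign * n * n * a n) * hI

theorem isTest_mul_fourier {T : ℝ} {η : ℝ → ℝ} (hη : ContDiff ℝ (⊤ : ℕ∞) η)
    (hs : ∃ c d, 0 < c ∧ d < T ∧ ∀ t, t ∉ Set.Icc c d → η t = 0) (n : ℤ) :
    IsTest T fun t x => (η t : ℂ) * fourier n x := by
  obtain ⟨c, d, hc, hd, h0⟩ := hs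
  refine ⟨?_, c, d, hc, hd, fun t ht x => by simp [h0 t ht]⟩
  refine ContDiff.mul (Complex.ofRealCLM.contDiff.comp (hη.comp contDiff_fst)) ?_
  simp only [fourier_coe_apply]
  refine Complex.contDiff_exp.comp ?_
  refine ContDiff.div_const (contDiff_const.mul ?_) _
  exact Complex.ofRealCLM.contDiff.comp contDiff_snd

theorem pairing_fourier (a : ℤ → ℂ) (c : ℂ) (n : ℤ) :
    pairing a (fun x => c * fourier (-n) x) = 2 * (Real.pi : ℂ) * (c * a n) := by
  have h : fourierCoeff (fun x : Torus => c * fourier (-n) x) = fun m => c * (Pi.single (-n) 1 : ℤ → ℂ) m := by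
    have := fourierCoeff_fourier (T := 2 * Real.pi) (-n)
    ext m
    rw [← this]
    exact fourierCoeff.const_mul _ c m
  rw [pairing, h, tsum_eq_single n]
  · simp only [Pi.single_eq_same]; ring
  · intro m hm
    have : -m ≠ -n := by simpa using hm
    simp [this]

section

variable {σ : ℤ} {s T : ℝ} {u : ℝ → Torus → ℝ}

theorem IsSolution.coeff_eq (hu : IsSolution σ s T u) (hs : 1 / 2 < s) (hs1 : s ≤ 1) (hT : 0 < T) (n : ℤ)
    {t : ℝ} (ht : t ∈ Set.Icc 0 T) :
    coeff (u t) n = coeff (u 0) n + ∫ τ in (0 : ℝ)..t, rhsSeq σ (coeff (u τ)) n := by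
  have ca := hu.inCT.continuousOn_apply n
  have cr := ((locLip_rhsSeq hs hs1 σ).inCT hu.inCT).continuousOn_apply n
  let P : ℝ → ℝ := fun t => Set.projIcc 0 T hT.le t
  have hP : Continuous P := continuous_subtype_val.comp continuous_projIcc
  have hPm : ∀ t, P t ∈ Set.Icc 0 T := fun t => (Set.projIcc 0 T hT.le t).2
  have hPe : ∀ t ∈ Set.Icc 0 T, P t = t := fun t ht => by simp only [P]; rw [Set.projIcc_of_mem _ ht]
  have key := eq_integral_of_weak hT (ca.comp_continuous hP hPm) (cr.comp_continuous hP hPm)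
    (fun η hη hsupp => by
      have hw := hu.weak _ (isTest_mul_fourier hη hsupp (-n))
      have hI : Set.EqOn (fun t => pairing (coeff (u t)) (fun x => deriv (fun τ => (η τ : ℂ) * fourier (-n) x) t)
            + pairing (rhsCoeff σ (u t)) (fun x => (η t : ℂ) * fourier (-n) x))
          (fun t => 2 * (Real.pi : ℂ) * (((deriv η t : ℝ) : ℂ) * coeff (u (P t)) n
            + (η t : ℂ) * rhsSeq σ (coeff (u (P t))) n)) (Set.uIcc 0 T) := by
        intro t ht
        rw [Set.uIcc_of_le hT.le] at ht
        have e1 : (fun x : Torus => deriv (fun τ => (η τ : ℂ) * fourier (-n) x) t)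
            = fun x => ((deriv η t : ℝ) : ℂ) * fourier (-n) x := by
          ext x
          exact (((hη.differentiable (by simp)) t).hasDerivAt.ofReal_comp.mul_const _).deriv
        have e2 : rhsCoeff σ (u t) = rhsSeq σ (coeff (u t)) := by
          ext m
          rw [rhsCoeff, cubicCoeff_eq hs (hu.memLp t ht) (hu.inCT.1 t ht)]
          rfl
        simp only [e1, e2, pairing_fourier, hPe t ht]
        ring
      rw [intervalIntegral.integral_congr hI, intervalIntegral.integral_const_mul] at hw
      exact (mul_eq_zero.1 hw).resolve_left (by simp [Real.pi_ne_zero])) t ht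
  simp only [Function.comp_apply, hPe t ht, hPe 0 ⟨le_rfl, hT.le⟩] at key
  rw [key]
  congr 1
  refine intervalIntegral.integral_congr fun τ hτ => ?_
  rw [Set.uIcc_of_le ht.1] at hτ
  simp only [hPe τ ⟨hτ.1, hτ.2.trans ht.2⟩]

theorem IsSolution.hasDerivWithinAt_coeff (hu : IsSolution σ s T u) (hs : 1 / 2 < s) (hs1 : s ≤ 1)
    (hT : 0 < T) (n : ℤ) {t : ℝ} (ht : t ∈ Set.Icc 0 T) :
    HasDerivWithinAt (fun t => coeff (u t) n) (rhsSeq σ (coeff (u t)) n) (Set.Icc 0 T) t := by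
  have cr := ((locLip_rhsSeq hs hs1 σ).inCT hu.inCT).continuousOn_apply n
  have hi : IntervalIntegrable (fun τ => rhsSeq σ (coeff (u τ)) n) MeasureTheory.volume 0 t :=
    (cr.mono (by rw [Set.uIcc_of_le ht.1]; exact Set.Icc_subset_Icc_right ht.2)).intervalIntegrable
  have : Fact (t ∈ Set.Icc 0 T) := ⟨ht⟩
  have h := intervalIntegral.integral_hasDerivWithinAt_right hi (s := Set.Icc 0 T) (t := Set.Icc 0 T)
    (cr.stronglyMeasurableAtFilter_nhdsWithin measurableSet_Icc t) (cr t ht)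
  refine (h.const_add (coeff (u 0) n)).congr (fun τ hτ => ?_) ?_
  · exact hu.coeff_eq hs hs1 hT n hτ
  · exact hu.coeff_eq hs hs1 hT n ht

/-- The summand of the time derivative of `F`. -/
def phaseTerm (σ : ℤ) (a : ℤ → ℂ) (n k : ℤ) : ℂ :=
  rhsSeq σ a (n - k) * a k + a (n - k) * rhsSeq σ a k

theorem phaseTerm_eq (σ : ℤ) (a : ℤ → ℂ) {n : ℤ} (hn : n ≠ 0) (k : ℤ) :
    phaseTerm σ a n k = Complex.I * n * (phaseKer n k * (a (n - k) * a k))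
      + 2 * σ * (cubicSeq a (n - k) * a k) + 2 * σ * (a (n - k) * cubicSeq a k) := by
  have hn' : (n : ℂ) ≠ 0 := by exact_mod_cast hn
  rw [phaseTerm, rhsSeq_apply, rhsSeq_apply, phaseKer, if_neg hn]
  push_cast
  field_simp
  ring

theorem hasSum_phaseTerm (hs : 1 / 2 < s) (hs1 : s ≤ 1) (σ : ℤ) {a : ℤ → ℂ} (ha : MemL2 s a) {n : ℤ}
    (hn : n ≠ 0) : HasSum (phaseTerm σ a n) (Complex.I * n * phaseDot σ a n) := by
  have hc := (locLip_cubicSeq hs hs1).memL2 ha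
  have h1 := ((bilBdd_deriv hs hs1 norm_phaseKer_le).summable ha ha n).hasSum.mul_left (Complex.I * n)
  have h2 := ((bilBdd_low hs hs1 le_rfl).summable ha hc n).hasSum
  simp only [one_mul] at h2
  have h3 : HasSum (fun k => cubicSeq a (n - k) * a k) (∑' k, a (n - k) * cubicSeq a k) := by
    have := (Equiv.subLeft n).hasSum_iff.2 h2
    refine this.congr_fun fun k => ?_
    simp [mul_comm]
  have h := (h1.add (h3.mul_left (2 * σ : ℂ))).add (h2.mul_left (2 * σ : ℂ))
  have e : Complex.I * n * phaseDot σ a n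
      = Complex.I * n * (∑' k, phaseKer n k * (a (n - k) * a k))
        + 2 * σ * (∑' k, a (n - k) * cubicSeq a k) + 2 * σ * ∑' k, a (n - k) * cubicSeq a k := by
    have hn' : (n : ℂ) ≠ 0 := by exact_mod_cast hn
    simp only [phaseDot, Pi.add_apply, Pi.smul_apply, smul_eq_mul, dxInv, projNonconst, if_neg hn, bil, conv]
    have hI := Complex.I_ne_zero
    field_simp
    ring
  rw [e]
  exact h.congr_fun fun k => phaseTerm_eq σ a hn k

theorem sum_norm_phaseTerm_le (hs : 1 / 2 < s) (hs1 : s ≤ 1) (σ : ℤ) {n : ℤ} (hn : n ≠ 0) (R : ℝ) :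
    ∃ K : ℝ, ∀ a : ℤ → ℂ, MemL2 s a → l2Norm s a ≤ R → ∀ F : Finset ℤ, ‖∑ k ∈ F, phaseTerm σ a n k‖ ≤ K := by
  obtain ⟨C1, h10, h1⟩ := (bilBdd_deriv hs hs1 norm_phaseKer_le).sum_norm_le n
  obtain ⟨C2, h20, h2⟩ := (bilBdd_low hs hs1 le_rfl).sum_norm_le n
  obtain ⟨C3, h30, h3⟩ := locLip_cubicSeq hs hs1 R
  refine ⟨‖Complex.I * n‖ * (C1 * (R * R)) + ‖(2 * σ : ℂ)‖ * (C2 * (R * C3))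
    + ‖(2 * σ : ℂ)‖ * (C2 * (R * C3)), fun a ha hR F => ?_⟩
  have hR0 := (l2Norm_nonneg s a).trans hR
  obtain ⟨hc, hc', -⟩ := h3 a a ha ha hR hR
  have b2 : ∀ F : Finset ℤ, ‖∑ k ∈ F, a (n - k) * cubicSeq a k‖ ≤ C2 * (R * C3) := fun F => by
    refine (norm_sum_le _ _).trans ?_
    have := h2 a _ ha hc F
    simp only [one_mul] at this
    refine this.trans ?_
    gcongr
    exact l2Norm_nonneg _ _
  have b3 : ‖∑ k ∈ F, cubicSeq a (n - k) * a k‖ ≤ C2 * (R * C3) := by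
    have := b2 (F.map (Equiv.subLeft n).toEmbedding)
    rw [Finset.sum_map] at this
    simpa [mul_comm] using this
  have b1 : ‖∑ k ∈ F, phaseKer n k * (a (n - k) * a k)‖ ≤ C1 * (R * R) := by
    refine (norm_sum_le _ _).trans ((h1 a a ha ha F).trans ?_)
    gcongr
    exact l2Norm_nonneg _ _
  simp only [phaseTerm_eq σ a hn, Finset.sum_add_distrib, ← Finset.mul_sum]
  refine (norm_add₃_le).trans ?_
  simp only [norm_mul _ (∑ k ∈ F, _)]
  gcongr
  exact b2 F

theorem IsSolution.phaseSeq_sub (hu : IsSolution σ s T u) (hs : 1 / 2 < s) (hs1 : s ≤ 1) (hT : 0 < T)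
    {t₀ t : ℝ} (ht₀ : t₀ ∈ Set.Icc 0 T) (ht : t ∈ Set.Icc 0 T) (n : ℤ) :
    phaseSeq (coeff (u t)) n - phaseSeq (coeff (u t₀)) n
      = ∫ τ in t₀..t, phaseDot σ (coeff (u τ)) n := by
  have hsub : Set.uIcc t₀ t ⊆ Set.Icc 0 T := Set.uIcc_subset_Icc ht₀ ht
  by_cases hn : n = 0
  · subst hn
    simp [phaseSeq, phaseDot, dxInv, bil, phaseKer]
  have ca := fun n => hu.inCT.continuousOn_apply n
  have cr := fun n => ((locLip_rhsSeq hs hs1 σ).inCT hu.inCT).continuousOn_apply n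
  have cp : ∀ k, ContinuousOn (fun τ => phaseTerm σ (coeff (u τ)) n k) (Set.Icc 0 T) := fun k =>
    ((cr (n - k)).mul (ca k)).add ((ca (n - k)).mul (cr k))
  obtain ⟨R, -, hR⟩ := hu.inCT.exists_bound
  obtain ⟨K, hK⟩ := sum_norm_phaseTerm_le hs hs1 σ hn R
  have part : ∀ F : Finset ℤ, ∫ τ in t₀..t, ∑ k ∈ F, phaseTerm σ (coeff (u τ)) n k
      = (∑ k ∈ F, coeff (u t) (n - k) * coeff (u t) k) - ∑ k ∈ F, coeff (u t₀) (n - k) * coeff (u t₀) k := by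
    intro F
    have hd : ∀ τ ∈ Set.Icc 0 T, HasDerivWithinAt (fun t => ∑ k ∈ F, coeff (u t) (n - k) * coeff (u t) k)
        (∑ k ∈ F, phaseTerm σ (coeff (u τ)) n k) (Set.Icc 0 T) τ := fun τ hτ =>
      HasDerivWithinAt.fun_sum fun k _ => (hu.hasDerivWithinAt_coeff hs hs1 hT (n - k) hτ).mul
        (hu.hasDerivWithinAt_coeff hs hs1 hT k hτ)
    refine intervalIntegral.integral_eq_sub_of_hasDeriv_right
      (f := fun t => ∑ k ∈ F, coeff (u t) (n - k) * coeff (u t) k) ?_ ?_ ?_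
    · exact fun τ hτ => ((hd τ (hsub hτ)).continuousWithinAt).mono hsub
    · intro τ hτ
      have h1 : τ ∈ Set.Ioo 0 T := by
        have h2 : min t₀ t ∈ Set.Icc 0 T := hsub ⟨le_rfl, min_le_max⟩
        have h3 : max t₀ t ∈ Set.Icc 0 T := hsub ⟨min_le_max, le_rfl⟩
        exact ⟨lt_of_le_of_lt h2.1 hτ.1, lt_of_lt_of_le hτ.2 h3.2⟩
      exact ((hd τ (Set.Ioo_subset_Icc_self h1)).hasDerivAt (Icc_mem_nhds h1.1 h1.2)).hasDerivWithinAt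
    · exact ((continuousOn_finsetSum F fun k _ => cp k).mono hsub).intervalIntegrable
  have lim1 : Filter.Tendsto (fun F : Finset ℤ => ∫ τ in t₀..t, ∑ k ∈ F, phaseTerm σ (coeff (u τ)) n k)
      Filter.atTop (nhds (∫ τ in t₀..t, Complex.I * n * phaseDot σ (coeff (u τ)) n)) := by
    refine intervalIntegral.tendsto_integral_filter_of_dominated_convergence (fun _ => K) ?_ ?_ ?_ ?_
    · refine Filter.Eventually.of_forall fun F => ?_
      exact ((continuousOn_finsetSum F fun k _ => cp k).mono
        (Set.uIoc_subset_uIcc.trans hsub)).aestronglyMeasurable measurableSet_uIoc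
    · refine Filter.Eventually.of_forall fun F => Filter.Eventually.of_forall fun τ hτ => ?_
      have := hsub (Set.uIoc_subset_uIcc hτ)
      exact hK _ (hu.inCT.1 τ this) (hR τ this) F
    · exact intervalIntegrable_const
    · refine Filter.Eventually.of_forall fun τ hτ => ?_
      exact hasSum_phaseTerm hs hs1 σ (hu.inCT.1 τ (hsub (Set.uIoc_subset_uIcc hτ))) hn
  have hsum : ∀ τ ∈ Set.Icc 0 T, HasSum (fun k => coeff (u τ) (n - k) * coeff (u τ) k)
      (conv (coeff (u τ)) (coeff (u τ)) n) := fun τ hτ => by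
    have := ((bilBdd_algebra hs).summable (hu.inCT.1 τ hτ) (hu.inCT.1 τ hτ) n).hasSum
    simp only [one_mul] at this
    exact this
  have lim2 := (hsum t ht).sub (hsum t₀ ht₀)
  have e := tendsto_nhds_unique lim1 (by
    simp only [part, ← Finset.sum_sub_distrib]
    exact lim2)
  rw [intervalIntegral.integral_const_mul] at e
  have hn' : (n : ℂ) ≠ 0 := by exact_mod_cast hn
  have hI := Complex.I_ne_zero
  simp only [phaseSeq, dxInv, projNonconst, if_neg hn]
  rw [← sub_div, ← e]
  field_simp

theorem IsSolution.hasDerivWithinAt_gaugeSeq (hu : IsSolution σ s T u) (hs : 1 / 2 < s) (hs1 : s ≤ 1)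
    (hT : 0 < T) (k n : ℤ) {t : ℝ} (ht : t ∈ Set.Icc 0 T) :
    HasDerivWithinAt (fun t => gaugeCoeff (u t) k n) (gaugeDot σ k (coeff (u t)) n) (Set.Icc 0 T) t := by
  have h := hasDerivWithinAt_expSeq hs hs1 ((locLip_phaseSeq hs).inCT hu.inCT)
    ((locLip_phaseDot hs hs1 σ).inCT hu.inCT)
    (fun t₀ ht₀ t ht m => hu.phaseSeq_sub hs hs1 hT ht₀ ht m) (Complex.I * k) n ht
  have e : ∀ τ ∈ Set.Icc 0 T, gaugeCoeff (u τ) k n = expSeq (Complex.I * k) (phaseSeq (coeff (u τ))) n :=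
    fun τ hτ => by rw [gaugeCoeff_eq hs (hu.memLp τ hτ) (hu.inCT.1 τ hτ)]; rfl
  exact h.congr e (e t ht)

end

end

section

/-! ### Calculus of bounds in `C([0,T]; ℓ²_r)` -/

section

variable {r r' T B B' : ℝ} {f g : ℝ → ℤ → ℂ}

theorem InCT.ctBound (hT : 0 < T) (h : InCT r T f) (hB : ∀ t ∈ Set.Icc 0 T, l2Norm r (f t) ≤ B) :
    CTBound r T f B := ⟨h, ctNorm_le hT hB⟩

theorem CTBound.le (h : CTBound r T f B) {t : ℝ} (ht : t ∈ Set.Icc 0 T) : l2Norm r (f t) ≤ B :=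
  (h.1.le_ctNorm ht).trans h.2

theorem CTBound.mono (h : CTBound r T f B) (hB : B ≤ B') : CTBound r T f B' := ⟨h.1, h.2.trans hB⟩

theorem CTBound.congr (hT : 0 < T) (h : CTBound r T f B) (he : ∀ t ∈ Set.Icc 0 T, g t = f t) :
    CTBound r T g B :=
  (h.1.congr he).ctBound hT fun t ht => (he t ht).symm ▸ h.le ht

theorem CTBound.add (hT : 0 < T) (h : CTBound r T f B) (h' : CTBound r T g B') :
    CTBound r T (f + g) (B + B') :=
  (h.1.add h'.1).ctBound hT fun _ ht =>
    (l2Norm_add_le (h.1.1 _ ht) (h'.1.1 _ ht)).trans (add_le_add (h.le ht) (h'.le ht))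

theorem CTBound.sum {ι : Type*} (hT : 0 < T) (S : Finset ι) {f : ι → ℝ → ℤ → ℂ}
    (h : ∀ i ∈ S, CTBound r T (f i) B) : CTBound r T (∑ i ∈ S, f i) (S.card * B) :=
  (InCT.sum S fun i hi => (h i hi).1).ctBound hT fun t ht => by
    rw [Finset.sum_apply]
    exact (memL2_sum_card S fun i hi => ⟨(h i hi).1.1 t ht, (h i hi).le ht⟩).2

/-- Multipliers act on bounds. -/
theorem CTBound.map (hT : 0 < T) {c : ℝ} (hc : 0 ≤ c) (h : CTBound r T f B) {L : (ℤ → ℂ) → ℤ → ℂ}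
    (hL : ∀ a, MemL2 r a → MemL2 r' (L a) ∧ l2Norm r' (L a) ≤ c * l2Norm r a)
    (hsub : ∀ a b, L (a - b) = L a - L b) : CTBound r' T (fun t => L (f t)) (c * B) :=
  (h.1.of_le (c := c) (fun t ht => (hL _ (h.1.1 t ht)).1) fun t ht t' ht' => by
    rw [← hsub]; exact (hL _ ((h.1.1 t ht).sub (h.1.1 t' ht'))).2).ctBound hT fun t ht =>
      (hL _ (h.1.1 t ht)).2.trans (by gcongr; exact h.le ht)

theorem CTBound.mono_exponent (hT : 0 < T) (h : CTBound r T f B) (hr : r' ≤ r) : CTBound r' T f B := by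
  simpa using h.map hT (L := fun a => a) zero_le_one
    (fun a ha => ⟨ha.mono hr, by simpa using l2Norm_mono_exponent hr ha⟩) fun _ _ => rfl

theorem l2Norm_reflect_conj (a : ℤ → ℂ) (ha : MemL2 r a) :
    MemL2 r (fun n => starRingEnd ℂ (a (-n))) ∧ l2Norm r (fun n => starRingEnd ℂ (a (-n))) ≤ 1 * l2Norm r a := by
  have e : (fun n : ℤ => (bracket n ^ r * ‖starRingEnd ℂ (a (-n))‖) ^ 2)
      = (fun n => (bracket n ^ r * ‖a n‖) ^ 2) ∘ Equiv.neg ℤ := by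
    ext n
    simp [bracket_neg]
  constructor
  · rw [MemL2, e]; exact (Equiv.neg ℤ).summable_iff.2 ha
  · rw [l2Norm, e, one_mul]; exact le_of_eq (congrArg Real.sqrt ((Equiv.neg ℤ).tsum_eq fun n => (bracket n ^ r * ‖a n‖) ^ 2))

theorem CTBound.star (hT : 0 < T) (h : CTBound r T f B) : CTBound r T (starSeq f) B := by
  have := h.map hT zero_le_one l2Norm_reflect_conj fun a b => by ext n; simp
  rwa [one_mul] at this

theorem CTBound.bracketInv (hT : 0 < T) (h : CTBound (r - 1) T f B) :
    CTBound r T (fun t n => (bracket n : ℂ)⁻¹ * f t n) B := by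
  have e : ∀ (a : ℤ → ℂ) n, bracket n ^ r * ‖(bracket n : ℂ)⁻¹ * a n‖ = bracket n ^ (r - 1) * ‖a n‖ :=
    fun a n => by
      rw [norm_mul, norm_inv, Complex.norm_real, Real.norm_of_nonneg (bracket_pos n).le,
        Real.rpow_sub_one (bracket_pos n).ne']
      ring
  simpa only [one_mul] using h.map hT (r' := r) (L := fun a n => (bracket n : ℂ)⁻¹ * a n) zero_le_one
    (fun a ha => by
      unfold MemL2 l2Norm
      simp only [e, one_mul]
      exact ⟨ha, le_rfl⟩) fun a b => by
    ext n; simp [mul_sub]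

theorem CTBound.oscillate (hT : 0 < T) (h : CTBound r T f B) (θ : ℤ → ℝ) :
    CTBound r T (fun t n => Complex.exp (Complex.I * t * θ n) * f t n) B :=
  (h.1.oscillate θ).ctBound hT fun t ht => by
    refine le_trans (le_of_eq ?_) (h.le ht)
    simp only [l2Norm, norm_mul, norm_exp_I_mul, one_mul]

theorem LocLip.ctBound {s : ℝ} {G : (ℤ → ℂ) → ℤ → ℂ} (h : LocLip s r G) (A : ℝ) : ∃ C : ℝ, 0 ≤ C ∧
    ∀ T : ℝ, 0 < T → ∀ a b : ℝ → ℤ → ℂ, CTBound s T a A → CTBound s T b A →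
      CTBound r T (fun t => G (a t)) C ∧
      CTBound r T ((fun t => G (a t)) - fun t => G (b t)) (C * ctNorm s T (a - b)) := by
  obtain ⟨C, hC0, hC⟩ := h A
  refine ⟨C, hC0, fun T hT a b ha hb => ?_⟩
  have k := fun t (ht : t ∈ Set.Icc 0 T) => hC _ _ (ha.1.1 t ht) (hb.1.1 t ht) (ha.le ht) (hb.le ht)
  refine ⟨(h.inCT ha.1).ctBound hT fun t ht => (k t ht).2.1,
    ((h.inCT ha.1).sub (h.inCT hb.1)).ctBound hT fun t ht => (k t ht).2.2.trans ?_⟩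
  gcongr
  exact (ha.1.sub hb.1).le_ctNorm ht

end

section

variable {ι Λ : Type*} {S : Finset Λ} {ev : ℤ → ι → Λ → ℤ} {A : ℤ → ι → ℂ} {r : ℝ}
  {e : Λ → ℝ} {B R d T : ℝ} {f f' : ℝ → Λ → ℤ → ℂ}

theorem MBound.ctBound (h : MBound S ev A r e B) (hT : 0 < T) (hB : 0 ≤ B) (θ : ℤ → ι → ℝ)
    (hf : ∀ a ∈ S, CTBound (e a) T (fun t => f t a) R) :
    CTBound r T (fun t => mform S ev (MBO.phased θ A t) (f t)) (B * R ^ S.card) :=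
  (h.inCT hB θ fun a ha => (hf a ha).1).ctBound hT fun t ht => by
    simpa using ((h.phased θ t).bound hB (fun a ha => (hf a ha).1.1 t ht) fun a ha => (hf a ha).le ht).2

theorem MBound.ctBound_sub [DecidableEq Λ] (h : MBound S ev A r e B) (hT : 0 < T) (hB : 0 ≤ B) (θ : ℤ → ι → ℝ)
    (hR : 1 ≤ R) (hd : 0 ≤ d)
    (hf : ∀ a ∈ S, CTBound (e a) T (fun t => f t a) R) (hf' : ∀ a ∈ S, CTBound (e a) T (fun t => f' t a) R)
    (hff : ∀ a ∈ S, CTBound (e a) T ((fun t => f t a) - fun t => f' t a) d) :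
    CTBound r T ((fun t => mform S ev (MBO.phased θ A t) (f t)) - fun t => mform S ev (MBO.phased θ A t) (f' t))
      (B * (S.card * ((2 * R) ^ S.card * d))) :=
  ((h.ctBound hT hB θ hf).1.sub (h.ctBound hT hB θ hf').1).ctBound hT fun t ht => by
    refine ((h.phased θ t).diff hB (fun a ha => (hf a ha).1.1 t ht) (fun a ha => (hf a ha).le ht)
      (fun a ha => (hf' a ha).1.1 t ht) (fun a ha => (hf' a ha).le ht)
      (fun a ha => (hff a ha).le ht)).trans ?_
    gcongr
    rw [← nsmul_eq_mul]
    refine Finset.sum_le_card_nsmul _ _ _ fun a ha => ?_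
    rw [← Finset.mul_prod_erase _ _ ha, if_pos rfl, mul_comm]
    gcongr
    rw [Finset.prod_congr rfl (g := fun _ => 2 * R) fun x hx => by
      rw [if_neg (Finset.ne_of_mem_erase hx)], Finset.prod_const]
    exact pow_le_pow_right₀ (by linarith) (Finset.card_le_card (Finset.erase_subset _ _))

end

/-! ### Bounds for the functions at the leaves -/

/-- Bounds by `B` for the sequences that occur at the leaves. -/
structure SeqBound (s T B : ℝ) (ω : ℝ → ℤ → ℂ) (W D : ℤ → ℝ → ℤ → ℂ) (ρ : ℝ → ℤ → ℂ) : Prop where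
  sol : CTBound s T ω B
  gauge : ∀ k ∈ Finset.Icc (-3 : ℤ) 3, CTBound (s + 1) T (W k) B
  dot : ∀ k ∈ Finset.Icc (-3 : ℤ) 3, CTBound (s - 1) T (D k) B
  rem : CTBound s T ρ B

theorem SeqBound.mono {s T B B' : ℝ} {ω : ℝ → ℤ → ℂ} {W D : ℤ → ℝ → ℤ → ℂ} {ρ : ℝ → ℤ → ℂ}
    (h : SeqBound s T B ω W D ρ) (hB : B ≤ B') : SeqBound s T B' ω W D ρ :=
  ⟨h.sol.mono hB, fun k hk => (h.gauge k hk).mono hB, fun k hk => (h.dot k hk).mono hB, h.rem.mono hB⟩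

/-- Coefficients of `e^{ikF[u]}` in time. -/
def gaugeT (u : ℝ → Torus → ℝ) (k : ℤ) (t : ℝ) : ℤ → ℂ := gaugeCoeff (u t) k

/-- Their time derivatives. -/
def dotT (σ : ℤ) (u : ℝ → Torus → ℝ) (k : ℤ) (t : ℝ) : ℤ → ℂ := gaugeDot σ k (coeff (u t))

/-- The remainder in time. -/
def remT (σ : ℤ) (u : ℝ → Torus → ℝ) (t : ℝ) : ℤ → ℂ := remainder σ (u t)

/-- The bounds on the data of one solution. -/
def DataBound (s T B : ℝ) (σ : ℤ) (u : ℝ → Torus → ℝ) (ω : ℝ → ℤ → ℂ) : Prop :=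
  SeqBound s T B ω (gaugeT u) (dotT σ u) (remT σ u)

/-- The bounds on the differences of the data of two solutions. -/
def DataBoundSub (s T B : ℝ) (σ : ℤ) (u u' : ℝ → Torus → ℝ) (ω ω' : ℝ → ℤ → ℂ) : Prop :=
  SeqBound s T B (ω - ω') (gaugeT u - gaugeT u') (dotT σ u - dotT σ u') (remT σ u - remT σ u')

theorem IsSolution.ctHsNorm_sub {σ : ℤ} {s T : ℝ} {u u' : ℝ → Torus → ℝ} (h : IsSolution σ s T u)
    (h' : IsSolution σ s T u') :
    ctHsNorm s T (u - u') = ctNorm s T ((fun t => coeff (u t)) - fun t => coeff (u' t)) := by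
  unfold ctHsNorm ctNorm
  congr 1
  ext t
  congr 1
  ext n
  have hi : ∀ {f : Torus → ℝ}, MeasureTheory.MemLp f 2 AddCircle.haarAddCircle →
      MeasureTheory.Integrable (fun x => fourier (-n) x • (f x : ℂ)) AddCircle.haarAddCircle := fun hf =>
    ((hf.ofReal (K := ℂ)).integrable (by norm_num)).bdd_mul (c := 1)
      (fourier (-n) : C(Torus, ℂ)).continuous.aestronglyMeasurable
      (Filter.Eventually.of_forall fun x => (norm_fourier_apply _ x).le)
  simp only [Pi.sub_apply, coeff, fourierCoeff]
  rw [← MeasureTheory.integral_sub (hi (h.memLp t t.2)) (hi (h'.memLp t t.2))]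
  congr 1
  ext x
  simp [mul_sub]

theorem exists_dataBound {s : ℝ} (hs : 1 / 2 < s) (hs1 : s ≤ 1) (A : ℝ) : ∃ R : ℝ, 1 ≤ R ∧
    ∀ σ : ℤ, σ = 1 ∨ σ = -1 → ∀ T : ℝ, 0 < T → ∀ u u' : ℝ → Torus → ℝ,
      IsSolution σ s T u → IsSolution σ s T u' → ctHsNorm s T u ≤ A → ctHsNorm s T u' ≤ A →
      DataBound s T R σ u (omega σ u) ∧ DataBoundSub s T
        (R * (ctHsNorm s T (u - u') + ctNorm s T (omega σ u - omega σ u'))) σ u u' (omega σ u) (omega σ u') := by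
  have hone : ∀ σ : ℤ, ∃ R : ℝ, 1 ≤ R ∧ ∀ T : ℝ, 0 < T → ∀ u u' : ℝ → Torus → ℝ,
      IsSolution σ s T u → IsSolution σ s T u' → ctHsNorm s T u ≤ A → ctHsNorm s T u' ≤ A →
      DataBound s T R σ u (omega σ u) ∧ DataBoundSub s T
        (R * (ctHsNorm s T (u - u') + ctNorm s T (omega σ u - omega σ u'))) σ u u' (omega σ u)
          (omega σ u') := by
    intro σ
    have hV : LocLip s s fun a => conv (gaugeSeq (-σ) a) (halfSeq a) :=
      ((locLip_gaugeSeq hs (-σ)).mono (by linarith)).conv (locLip_halfSeq s) (bilBdd_algebra hs)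
    obtain ⟨C1, h10, h1⟩ := hV.ctBound A
    choose C2 h20 h2 using fun k => (locLip_gaugeSeq hs k).ctBound A
    choose C3 h30 h3 using fun k => (locLip_gaugeDot hs hs1 σ k).ctBound A
    obtain ⟨C4, h40, h4⟩ := (locLip_remSeq hs hs1 σ).ctBound A
    have n2 : 0 ≤ ∑ k ∈ Finset.Icc (-3 : ℤ) 3, C2 k := Finset.sum_nonneg fun k _ => h20 k
    have n3 : 0 ≤ ∑ k ∈ Finset.Icc (-3 : ℤ) 3, C3 k := Finset.sum_nonneg fun k _ => h30 k
    set R := 1 + C1 + (∑ k ∈ Finset.Icc (-3 : ℤ) 3, C2 k) + (∑ k ∈ Finset.Icc (-3 : ℤ) 3, C3 k) + C4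
    have i2 : ∀ k ∈ Finset.Icc (-3 : ℤ) 3, C2 k ≤ R := fun k hk => by
      have := Finset.single_le_sum (fun k _ => h20 k) hk
      linarith
    have i3 : ∀ k ∈ Finset.Icc (-3 : ℤ) 3, C3 k ≤ R := fun k hk => by
      have := Finset.single_le_sum (fun k _ => h30 k) hk
      linarith
    refine ⟨R, by linarith, fun T hT u u' hu hu' hA hA' => ?_⟩
    have ba : CTBound s T (fun t => coeff (u t)) A := ⟨hu.inCT, hA⟩
    have ba' : CTBound s T (fun t => coeff (u' t)) A := ⟨hu'.inCT, hA'⟩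
    rw [hu.ctHsNorm_sub hu']
    have nD := ctNorm_nonneg s T ((fun t => coeff (u t)) - fun t => coeff (u' t))
    have nE := ctNorm_nonneg s T (omega σ u - omega σ u')
    have eW : ∀ {u}, IsSolution σ s T u → ∀ k, ∀ t ∈ Set.Icc 0 T, gaugeT u k t = gaugeSeq k (coeff (u t)) :=
      fun hu k t ht => gaugeCoeff_eq hs (hu.memLp t ht) (hu.inCT.1 t ht) k
    have eR : ∀ {u}, IsSolution σ s T u → ∀ t ∈ Set.Icc 0 T, remT σ u t = remSeq σ (coeff (u t)) :=
      fun hu t ht => remainder_eq hs (hu.memLp t ht) (hu.inCT.1 t ht) σ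
    have bω : ∀ {u}, IsSolution σ s T u → CTBound s T (fun t => coeff (u t)) A →
        CTBound s T (omega σ u) R := fun {u} hu ba => by
      have := ((h1 T hT _ _ ba ba).1.oscillate hT fun n => ((n * |n| : ℤ) : ℝ)).congr hT
        (g := omega σ u) fun t ht => ?_
      · exact this.mono (by linarith)
      · ext n
        rw [omega, fourierCoeff_gaugeTransform hs (hu.memLp t ht) (hu.inCT.1 t ht)]
        rw [Complex.ofReal_intCast]
    set d := ctNorm s T ((fun t => coeff (u t)) - fun t => coeff (u' t))
    have hle : ∀ c, c ≤ R → c * d ≤ R * (d + ctNorm s T (omega σ u - omega σ u')) := fun c hc => by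
      gcongr
      linarith
    refine ⟨⟨bω hu ba, fun k hk => ?_, fun k hk => ((h3 k T hT _ _ ba ba).1).mono (i3 k hk), ?_⟩,
      ⟨(bω hu ba).1.sub (bω hu' ba').1, ?_⟩, fun k hk => ?_,
      fun k hk => ((h3 k T hT _ _ ba ba').2).mono (hle _ (i3 k hk)), ?_⟩
    · exact ((h2 k T hT _ _ ba ba).1.mono (i2 k hk)).congr hT fun t ht => eW hu k t ht
    · exact ((h4 T hT _ _ ba ba).1.mono (by linarith)).congr hT fun t ht => eR hu t ht
    · nlinarith
    · exact ((h2 k T hT _ _ ba ba').2.mono (hle _ (i2 k hk))).congr hT fun t ht => by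
        simp only [Pi.sub_apply, eW hu k t ht, eW hu' k t ht]
    · exact ((h4 T hT _ _ ba ba').2.mono (hle _ (by linarith))).congr hT fun t ht => by
        simp only [Pi.sub_apply, eR hu t ht, eR hu' t ht]
  obtain ⟨R1, hR1, h1⟩ := hone 1
  obtain ⟨R2, hR2, h2⟩ := hone (-1)
  refine ⟨max R1 R2, hR1.trans (le_max_left _ _), fun σ hσ T hT u u' hu hu' hA hA' => ?_⟩
  have nD := ctNorm_nonneg s T (omega σ u - omega σ u')
  have nE : 0 ≤ ctHsNorm s T (u - u') := ctNorm_nonneg _ _ _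
  rcases hσ with rfl | rfl
  · obtain ⟨k1, k2⟩ := h1 T hT u u' hu hu' hA hA'
    exact ⟨k1.mono (le_max_left _ _), k2.mono (by gcongr; exact le_max_left _ _)⟩
  · obtain ⟨k1, k2⟩ := h2 T hT u u' hu hu' hA hA'
    exact ⟨k1.mono (le_max_right _ _), k2.mono (by gcongr; exact le_max_right _ _)⟩

/-! ### The harmless terms -/

/-- The amplitude of the harmless terms. -/
def harmAmp (σ : ℤ) (i : Fin 7) (n : ℤ) (q : Fin 5 → ℤ) : ℂ := if ∑ l, q l = n then multHatHat σ i q else 0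

theorem mbound_harm {s : ℝ} (hs : 1 / 2 < s) (hs1 : s ≤ 1) : ∃ B : ℝ, 0 ≤ B ∧ ∀ σ : ℤ, σ = 1 ∨ σ = -1 →
    ∀ i, MBound (Finset.univ : Finset (Fin 5)) (fun _ q l => q l) (harmAmp σ i) s (harmExp s) B := by
  have hk : ∀ i q, 0 ≤ harmKer i q := fun i q => by unfold harmKer; split_ifs <;> positivity
  choose C hC using fun i => (formBdd_harmKer hs hs1 i).lN_Q5_le (hk i)
  refine ⟨4 * ∑ i, (C i : ℝ), by positivity, fun σ hσ i => ?_⟩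
  refine MBound.mono (B := 4 * C i) (fun g => ?_) (by
    gcongr
    exact Finset.single_le_sum (f := fun i => (C i : ℝ)) (fun i _ => (C i).2) (Finset.mem_univ i))
  have : ∀ n, ∑' q : Fin 5 → ℤ, ‖harmAmp σ i n q‖ₑ * ∏ l, g l (q l)
      ≤ ENNReal.ofReal 4 * Q5 (harmKer i) g n := fun n => by
    rw [← Q5_const_mul (by norm_num), Q5]
    refine ENNReal.tsum_le_tsum fun q => ?_
    unfold harmAmp
    split_ifs
    · gcongr
      rw [← ofReal_norm]
      exact ENNReal.ofReal_le_ofReal (norm_multHatHat_le hσ i q)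
    · simp
  refine (lN_mono this).trans ?_
  rw [lN_const_mul, ENNReal.ofReal_mul (by norm_num), mul_assoc, ENNReal.ofReal_coe_nnreal]
  gcongr
  exact hC i g

theorem abs_slotGauge_le (i : Fin 7) (l : Fin 5) : |slotGauge i l| ≤ 3 := by
  fin_cases i <;> fin_cases l <;> decide

theorem gauge_index_mem {σ : ℤ} (hσ : σ = 1 ∨ σ = -1) (i : Fin 7) (l : Fin 5) (e : ℤ) (he : e = 1 ∨ e = -1) :
    e * (σ * slotGauge i l) ∈ Finset.Icc (-3 : ℤ) 3 := by
  have := abs_le.1 (abs_slotGauge_le i l)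
  rw [Finset.mem_Icc]
  rcases hσ with rfl | rfl <;> rcases he with rfl | rfl <;> constructor <;> linarith [this.1, this.2]

section

variable {s T R : ℝ} {σ : ℤ} {u u' : ℝ → Torus → ℝ} {ω ω' : ℝ → ℤ → ℂ}

theorem DataBound.slotFun (hT : 0 < T) (hσ : σ = 1 ∨ σ = -1) (h : DataBound s T R σ u ω) (i : Fin 7)
    (l : Fin 5) : CTBound (harmExp s l) T (fun t => slotFun σ u ω i l t) R := by
  unfold MBO.slotFun harmExp
  by_cases hl : IsGaugeSlot l
  · simp only [if_pos hl]
    have := h.gauge _ (gauge_index_mem hσ i l 1 (Or.inl rfl))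
    rw [one_mul] at this
    exact this
  · simp only [if_neg hl]
    cases slotStar i l
    · simpa using h.sol
    · simpa using h.sol.star hT

theorem DataBoundSub.slotFun (hT : 0 < T) (hσ : σ = 1 ∨ σ = -1) (h : DataBoundSub s T R σ u u' ω ω')
    (i : Fin 7) (l : Fin 5) :
    CTBound (harmExp s l) T ((fun t => slotFun σ u ω i l t) - fun t => MBO.slotFun σ u' ω' i l t) R := by
  unfold MBO.slotFun harmExp
  by_cases hl : IsGaugeSlot l
  · simp only [if_pos hl]
    have := h.gauge _ (gauge_index_mem hσ i l 1 (Or.inl rfl))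
    rw [one_mul] at this
    exact this
  · simp only [if_neg hl]
    cases slotStar i l
    · simpa using h.sol
    · refine (h.sol.star hT).congr hT fun t _ => ?_
      ext n
      simp [starSeq]

theorem R0_eq {B : ℝ} (hB : 0 ≤ B) (hT : 0 < T) (hσ : σ = 1 ∨ σ = -1) (h : DataBound s T R σ u ω)
    (hM : ∀ i, MBound (Finset.univ : Finset (Fin 5)) (fun _ q l => q l) (harmAmp σ i) s (harmExp s) B)
    {t : ℝ} (ht : t ∈ Set.Icc 0 T) :
    (∀ n i, Summable fun q : {q : Fin 5 → ℤ // ∑ l, q l = n} => harmlessTerm σ u ω t i q.1) ∧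
    R0 σ u ω t = (∑ i, fun t => mform (Finset.univ : Finset (Fin 5)) (fun _ q l => q l)
        (phased (fun _ q => (phase q : ℝ)) (harmAmp σ i) t) fun l => slotFun σ u ω i l t) t
      + fun n => Complex.exp (Complex.I * t * (((n * |n| : ℤ) : ℝ) : ℂ)) * remT σ u t n := by
  have key : ∀ n i, HasSum (fun q : {q : Fin 5 → ℤ // ∑ l, q l = n} => harmlessTerm σ u ω t i q.1)
      (mform (Finset.univ : Finset (Fin 5)) (fun _ q l => q l)
        (phased (fun _ q => (phase q : ℝ)) (harmAmp σ i) t) (fun l => slotFun σ u ω i l t) n) := by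
    intro n i
    have h2 := (((hM i).phased (fun _ q => (phase q : ℝ)) t).summable hB
      (f := fun l => slotFun σ u ω i l t) (fun l _ => (h.slotFun hT hσ i l).1.1 t ht) n).hasSum
    rw [← hasSum_subtype_iff_of_support_subset (s := {q | ∑ l, q l = n})] at h2
    · refine h2.congr_fun fun q => ?_
      have hq : ∑ l, q.1 l = n := q.2
      simp only [Function.comp_apply, phased, harmAmp, if_pos hq, harmlessTerm, Complex.ofReal_intCast]
    · intro q hq
      by_contra hc
      apply hq
      have hc' : ¬ ∑ l, q l = n := hc
      simp [phased, harmAmp, if_neg hc']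
  refine ⟨fun n i => (key n i).summable, ?_⟩
  ext n
  rw [R0]
  simp only [(key n _).tsum_eq, Pi.add_apply, Finset.sum_apply, Complex.ofReal_intCast]
  rfl

theorem exists_R0_bound {s : ℝ} (hs : 1 / 2 < s) (hs1 : s ≤ 1) (R : ℝ) (hR : 1 ≤ R) : ∃ K : ℝ, 1 ≤ K ∧
    ∀ σ : ℤ, σ = 1 ∨ σ = -1 → ∀ T : ℝ, 0 < T → ∀ (u u' : ℝ → Torus → ℝ) (ω ω' : ℝ → ℤ → ℂ),
      DataBound s T R σ u ω → DataBound s T R σ u' ω' →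
      (∀ t ∈ Set.Icc 0 T, ∀ n i,
        Summable fun q : {q : Fin 5 → ℤ // ∑ l, q l = n} => harmlessTerm σ u ω t i q.1) ∧
      CTBound s T (R0 σ u ω) K ∧ ∀ d : ℝ, 0 ≤ d → DataBoundSub s T d σ u u' ω ω' →
        CTBound s T (R0 σ u ω - R0 σ u' ω') (K * d) := by
  obtain ⟨B, hB, hM⟩ := mbound_harm hs hs1
  have hR0 : 0 ≤ R := by linarith
  refine ⟨(7 * (B * R ^ 5) + R) + (7 * (B * (5 * (2 * R) ^ 5)) + 1),
    by nlinarith [show 0 ≤ B * R ^ 5 by positivity, show 0 ≤ B * (5 * (2 * R) ^ 5) by positivity],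
    fun σ hσ T hT u u' ω ω' h h' => ⟨fun t ht => (R0_eq hB hT hσ h (hM σ hσ) ht).1, ?_, fun d hd hd' => ?_⟩⟩
  · have h1 := CTBound.sum hT Finset.univ fun i _ => (hM σ hσ i).ctBound hT hB
      (fun _ q => (phase q : ℝ)) (f := fun t l => slotFun σ u ω i l t) fun l _ => h.slotFun hT hσ i l
    have h2 := h1.add hT (h.rem.oscillate hT fun n => ((n * |n| : ℤ) : ℝ))
    refine (h2.mono ?_).congr hT fun t ht => (R0_eq hB hT hσ h (hM σ hσ) ht).2
    simp only [Finset.card_univ, Fintype.card_fin]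
    push_cast
    have : 0 ≤ 7 * (B * (5 * (2 * R) ^ 5)) + 1 := by positivity
    linarith
  · have h1 := CTBound.sum hT Finset.univ fun i _ => (hM σ hσ i).ctBound_sub hT hB
      (fun _ q => (phase q : ℝ)) hR hd (f := fun t l => slotFun σ u ω i l t)
      (f' := fun t l => slotFun σ u' ω' i l t) (fun l _ => h.slotFun hT hσ i l)
      (fun l _ => h'.slotFun hT hσ i l) fun l _ => hd'.slotFun hT hσ i l
    have h2 := h1.add hT (hd'.rem.oscillate hT fun n => ((n * |n| : ℤ) : ℝ))
    refine (h2.mono ?_).congr hT fun t ht => ?_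
    · simp only [Finset.card_univ, Fintype.card_fin]
      push_cast
      have : 0 ≤ (7 * (B * R ^ 5) + R) * d := by positivity
      nlinarith
    · rw [Pi.sub_apply, (R0_eq hB hT hσ h (hM σ hσ) ht).2, (R0_eq hB hT hσ h' (hM σ hσ) ht).2]
      ext n
      simp only [Pi.add_apply, Pi.sub_apply, Finset.sum_apply, Finset.sum_sub_distrib]
      ring

end

end

section

/-! ### The summands as products over the leaves -/

section

variable {J : ℕ} {s T R d M : ℝ} {σ : ℤ} {W W' V V' : ℤ → ℝ → ℤ → ℂ} {ω ω' ρ ρ' : ℝ → ℤ → ℂ}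

/-- The gauge-type sequence `W` at an element of the tree. -/
def leafOf (σ : ℤ) (W : ℤ → ℝ → ℤ → ℂ) (i : Types J) (p : Tree J) (t : ℝ) : Node J → ℤ → ℂ
  | none => 0
  | some (j, l) => W ((if starred i p (p.1 j) then -1 else 1) * (σ * slotGauge (i j) l)) t

/-- The functions at the leaves: `W` and `ω`, and `V` or `ρ` at the distinguished leaf `b`. -/
def leafFun (σ : ℤ) (W V : ℤ → ℝ → ℤ → ℂ) (ω ρ : ℝ → ℤ → ℂ) (t : ℝ) (i : Types J) (p : Tree J)
    (b a : Node J) : ℤ → ℂ :=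
  if a ∈ gaugeLeaves J then (if a = b then leafOf σ V i p t a else leafOf σ W i p t a)
  else (if a = b then leafSol ρ i p t a else leafSol ω i p t a)

/-- The sequences `⟨n⟩⁻¹ D`. -/
def scaled (D : ℤ → ℝ → ℤ → ℂ) (k : ℤ) (t : ℝ) (n : ℤ) : ℂ := (bracket n : ℂ)⁻¹ * D k t n

theorem scaled_sub (D D' : ℤ → ℝ → ℤ → ℂ) : scaled (D - D') = scaled D - scaled D' := by
  ext k t n
  simp [scaled, mul_sub]

/-- Bounds for the functions at the leaves. -/
structure LeafBound (s T R : ℝ) (W V : ℤ → ℝ → ℤ → ℂ) (ω ρ : ℝ → ℤ → ℂ) : Prop where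
  gauge : ∀ k ∈ Finset.Icc (-3 : ℤ) 3, CTBound s T (W k) R ∧ CTBound s T (V k) R
  sol : CTBound s T ω R ∧ CTBound s T ρ R

theorem leafFun_ctBound (hT : 0 < T) (hσ : σ = 1 ∨ σ = -1) (h : LeafBound s T R W V ω ρ) (i : Types J)
    (p : Tree J) (b a : Node J) : CTBound s T (fun t => leafFun σ W V ω ρ t i p b a) R := by
  unfold leafFun
  by_cases ha : a ∈ gaugeLeaves J
  · obtain ⟨j, l, rfl, -⟩ := (Finset.mem_filter.1 ha).2
    simp only [if_pos ha, leafOf]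
    have := h.gauge _ (gauge_index_mem hσ (i j) l (if starred i p (p.1 j) then -1 else 1)
      (by split_ifs <;> simp))
    split_ifs at this ⊢
    exacts [this.2, this.2, this.1, this.1]
  · simp only [if_neg ha, leafSol]
    split_ifs
    exacts [h.sol.2.star hT, h.sol.2, h.sol.1.star hT, h.sol.1]

theorem leafFun_sub (t : ℝ) (i : Types J) (p : Tree J) (b a : Node J) :
    leafFun σ W V ω ρ t i p b a - leafFun σ W' V' ω' ρ' t i p b a
      = leafFun σ (W - W') (V - V') (ω - ω') (ρ - ρ') t i p b a := by
  have hstar : ∀ f g : ℝ → ℤ → ℂ, starSeq f t - starSeq g t = starSeq (f - g) t := fun f g => by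
    ext n; simp [starSeq]
  have hleaf : ∀ X Y : ℤ → ℝ → ℤ → ℂ, leafOf σ X i p t a - leafOf σ Y i p t a = leafOf σ (X - Y) i p t a := by
    intro X Y
    rcases a with _ | ⟨j, l⟩
    · exact sub_zero _
    · rfl
  have hsol : ∀ f g : ℝ → ℤ → ℂ, leafSol f i p t a - leafSol g i p t a = leafSol (f - g) i p t a :=
    fun f g => by
      unfold leafSol
      split_ifs
      exacts [hstar f g, rfl]
  unfold leafFun
  split_ifs
  exacts [hleaf V V', hleaf W W', hsol ρ ρ', hsol ω ω']

theorem prod_leaves (p : Tree J) (F : Node J → ℂ) :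
    ∏ a ∈ leaves p.1, F a = (∏ a ∈ gaugeLeaves J, F a) * ∏ a ∈ solLeaves p, F a := by
  have hd : Disjoint (gaugeLeaves J) (solLeaves p) := Finset.disjoint_left.2 fun a ha hb =>
    (Finset.mem_filter.1 hb).2.2 ha
  rw [← Finset.prod_union hd]
  congr 1
  ext a
  simp only [leaves, solLeaves, Finset.mem_union, Finset.mem_filter, Finset.mem_univ, true_and]
  refine ⟨fun h => (em _).imp_right fun h' => ⟨h, h'⟩, fun h => h.elim (fun ha j hj => ?_) And.left⟩
  obtain ⟨k, l, rfl, hl⟩ := (Finset.mem_filter.1 ha).2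
  exact (p.2.2.2 j k l hj).2 hl

theorem leafFun_gauge {u : ℝ → Torus → ℝ} {t : ℝ} {i : Types J} {p : Tree J} {a : Node J}
    (ha : a ∈ gaugeLeaves J) (b : Node J) :
    leafFun σ (gaugeT u) (gaugeT u) ω ρ t i p b a = leafGauge σ u i p t a := by
  rw [leafFun, if_pos ha, ite_self]
  rcases a with _ | ⟨j, l⟩ <;> rfl

theorem leafFun_sol {t : ℝ} {i : Types J} {p : Tree J} {a : Node J} (ha : a ∈ solLeaves p) (b : Node J) :
    leafFun σ W V ω ρ t i p b a = if a = b then leafSol ρ i p t a else leafSol ω i p t a := by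
  rw [leafFun, if_neg (Finset.mem_filter.1 ha).2.2]

open Classical in
/-- The amplitude of a summand, without the oscillating factor. -/
def condAmp (P : (Node J → ℤ) → Prop) (c : ℂ) (σ : ℤ) (k : ℕ) (x : Node J → (Node J → ℤ) → ℂ) (i : Types J)
    (p : Tree J) (b : Node J) (ν : Node J → ℤ) : ℂ := if P ν then c * baseAmp σ k i p ν * x b ν else 0

theorem norm_condAmp_le {P : (Node J → ℤ) → Prop} {c : ℂ} {k : ℕ} {x : Node J → (Node J → ℤ) → ℂ}
    {i : Types J} {p : Tree J} {b : Node J} {ν : Node J → ℤ} {y : ℝ} (hc : ‖c‖ = 1) (hy : 0 ≤ y)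
    (h : P ν → ‖baseAmp σ k i p ν‖ * ‖x b ν‖ ≤ y) : ‖condAmp P c σ k x i p b ν‖ ≤ y := by
  unfold condAmp
  split_ifs with hP
  · rw [norm_mul, norm_mul, hc, one_mul]; exact h hP
  · rwa [norm_zero]

open Classical in
theorem treeRep_main (P : (Node J → ℤ) → Prop) (c : ℂ) (σ : ℤ) (k : ℕ) (u : ℝ → Torus → ℝ)
    (ω : ℝ → ℤ → ℂ) :
    TreeRep T (fun t i p ν => if P ν then c * (amplitude σ k t i p ν * gaugeProd σ u i p ν t
      * solProd ω i p ν t) else 0) (fun _ => {none}) (condAmp P c σ k fun _ _ => 1)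
      (leafFun σ (gaugeT u) (gaugeT u) ω ω) := by
  intro t _ i p ν
  rw [Finset.sum_singleton, prod_leaves, condAmp, Finset.prod_congr (s₁ := gaugeLeaves J) rfl (fun a ha => by
      rw [leafFun_gauge ha]), Finset.prod_congr (s₁ := solLeaves p) rfl (fun a ha => by
      rw [leafFun_sol ha, ite_self])]
  by_cases hP : P ν
  · simp only [if_pos hP, amplitude_eq, gaugeProd, solProd]
    ring
  · simp [hP]

theorem treeRep_rem (M : ℝ) (σ : ℤ) (u : ℝ → Torus → ℝ) (ω : ℝ → ℤ → ℂ) (J : ℕ) :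
    TreeRep T (summandRem σ M u ω J) solLeaves (condAmp (fun ν => NonRes M ν J) (Complex.I ^ J) σ J fun _ _ => 1)
      (leafFun σ (gaugeT u) (gaugeT u) ω (R0 σ u ω)) := by
  intro t _ i p ν
  unfold summandRem
  by_cases hP : NonRes M ν J
  · rw [if_pos hP, amplitude_eq, Finset.mul_sum, Finset.mul_sum]
    refine Finset.sum_congr rfl fun b hb => ?_
    have e : ∀ a ∈ (solLeaves p).erase b, leafFun σ (gaugeT u) (gaugeT u) ω (R0 σ u ω) t i p b a (ν a)
        = leafSol ω i p t a (ν a) := fun a ha => by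
      rw [leafFun_sol (Finset.mem_of_mem_erase ha), if_neg (Finset.ne_of_mem_erase ha)]
    rw [prod_leaves, condAmp, if_pos hP, Finset.prod_congr (s₁ := gaugeLeaves J) rfl (fun a ha => by
      rw [leafFun_gauge (ω := ω) (ρ := R0 σ u ω) ha b]), ← Finset.mul_prod_erase (solLeaves p) _ hb,
      Finset.prod_congr rfl e, leafFun_sol hb, if_pos rfl, gaugeProd]
    ring
  · simp [hP, condAmp]

theorem treeRep_dot {u : ℝ → Torus → ℝ} (hu : IsSolution σ s T u) (hs : 1 / 2 < s) (hs1 : s ≤ 1)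
    (hT : 0 < T) (M : ℝ) (ω : ℝ → ℤ → ℂ) (J : ℕ) :
    TreeRep T (summand1 σ T M u ω J) (fun _ => gaugeLeaves J)
      (condAmp (fun ν => NonRes M ν J) (Complex.I ^ J) σ J fun b ν => (bracket (ν b) : ℂ))
      (leafFun σ (gaugeT u) (scaled (dotT σ u)) ω ω) := by
  intro t ht i p ν
  have hd : ∀ a ∈ gaugeLeaves J, HasDerivWithinAt (fun t => leafGauge σ u i p t a (ν a))
      (leafOf σ (dotT σ u) i p t a (ν a)) (Set.Icc 0 T) t := fun a ha => by
    obtain ⟨j, l, rfl, -⟩ := (Finset.mem_filter.1 ha).2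
    exact hu.hasDerivWithinAt_gaugeSeq hs hs1 hT _ _ ht
  have hp := (HasDerivWithinAt.fun_finsetProd hd).derivWithin (uniqueDiffOn_Icc hT t ht)
  have hg : gaugeProd σ u i p ν = fun t => ∏ a ∈ gaugeLeaves J, leafGauge σ u i p t a (ν a) := rfl
  unfold summand1
  by_cases hP : NonRes M ν J
  · rw [if_pos hP, amplitude_eq, hg, hp, Finset.mul_sum, Finset.sum_mul, Finset.mul_sum]
    refine Finset.sum_congr rfl fun b hb => ?_
    have e : ∀ a ∈ (gaugeLeaves J).erase b, leafFun σ (gaugeT u)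
        (scaled (dotT σ u)) ω ω t i p b a (ν a)
        = leafGauge σ u i p t a (ν a) := fun a ha => by
      obtain ⟨h1, h2⟩ := Finset.mem_erase.1 ha
      rw [leafFun, if_pos h2, if_neg h1]
      rcases a with _ | ⟨j, l⟩ <;> rfl
    have hb' : leafOf σ (scaled (dotT σ u)) i p t b (ν b)
        = (bracket (ν b) : ℂ)⁻¹ * leafOf σ (dotT σ u) i p t b (ν b) := by
      rcases b with _ | ⟨j, l⟩
      · simp [leafOf]
      · rfl
    have hne : (bracket (ν b) : ℂ) ≠ 0 := by exact_mod_cast (bracket_pos (ν b)).ne'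
    rw [prod_leaves, condAmp, if_pos hP, Finset.prod_congr (s₁ := solLeaves p) rfl (fun a ha => by
      rw [leafFun_sol ha, ite_self]),
      ← Finset.mul_prod_erase (gaugeLeaves J) _ hb, Finset.prod_congr rfl e, leafFun, if_pos hb, if_pos rfl,
      hb', solProd, smul_eq_mul]
    field_simp
  · simp [hP, condAmp]

/-! ### Estimates of the tree sums -/

section

variable {J : ℕ} {r s T B R d : ℝ} {F F' : ℝ → Summand J} {Bs : Tree J → Finset (Node J)}
  {A : Types J → Tree J → Node J → (Node J → ℤ) → ℂ}
  {f f' : ℝ → Types J → Tree J → Node J → Node J → ℤ → ℂ}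

theorem ctBound_sum_trees {X : Types J → Tree J → Node J → ℝ → ℤ → ℂ} (hT : 0 < T) (hB : 0 ≤ B)
    (h : ∀ i p, ∀ b ∈ Bs p, CTBound r T (X i p b) B) : CTBound r T (∑ i, ∑ p, ∑ b ∈ Bs p, X i p b)
      (7 ^ J * (Fintype.card (Tree J) * ((5 * J + 1) * B))) := by
  refine (CTBound.sum hT _ fun i _ => CTBound.sum hT _ fun p _ => (CTBound.sum hT _ (h i p)).mono
    (B' := (5 * J + 1) * B) ?_).mono (by simp)
  gcongr
  exact_mod_cast card_le_of_subset_node (Bs p)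

theorem TreeRep.estimate (h : TreeRep T F Bs A f) (hT : 0 < T) (hB : 0 ≤ B)
    (hA : ∀ i p, ∀ b ∈ Bs p, MBound (leaves p.1) (evalNode J) (treeAmp p (A i p b)) r (fun _ => s) B)
    (hf : ∀ i p b a, CTBound s T (fun t => f t i p b a) R) (hR1 : 1 ≤ R) :
    TreeConverges T F ∧ CTBound r T (fun t => treeSum (F t))
      (7 ^ J * (Fintype.card (Tree J) * ((5 * J + 1) * (B * R ^ (5 * J + 1))))) := by
  have hf' : ∀ t ∈ Set.Icc 0 T, ∀ i p, ∀ b ∈ Bs p, ∀ a ∈ leaves p.1, MemL2 s (f t i p b a) :=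
    fun t ht i p b _ a _ => (hf i p b a).1.1 t ht
  refine ⟨fun t ht n i p => (h.hasSum hB hA hf' ht i p n).summable, (ctBound_sum_trees hT (by positivity)
    fun i p b hb => ((hA i p b hb).ctBound hT hB (fun _ ν => (phaseSum ν J : ℝ))
      fun a _ => hf i p b a).mono ?_).congr hT fun t ht => ?_⟩
  · gcongr
    exact card_le_of_subset_node _
  · rw [h.treeSum_eq hB hA hf' ht]
    simp only [Finset.sum_apply]
    rfl

theorem TreeRep.estimate_sub (h : TreeRep T F Bs A f) (h' : TreeRep T F' Bs A f') (hT : 0 < T) (hB : 0 ≤ B)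
    (hA : ∀ i p, ∀ b ∈ Bs p, MBound (leaves p.1) (evalNode J) (treeAmp p (A i p b)) r (fun _ => s) B)
    (hf : ∀ i p b a, CTBound s T (fun t => f t i p b a) R)
    (hf' : ∀ i p b a, CTBound s T (fun t => f' t i p b a) R) (hR1 : 1 ≤ R)
    (hd : ∀ i p b a, CTBound s T ((fun t => f t i p b a) - fun t => f' t i p b a) d) (hd0 : 0 ≤ d) :
    CTBound r T ((fun t => treeSum (F t)) - fun t => treeSum (F' t)) (7 ^ J * (Fintype.card (Tree J)
      * ((5 * J + 1) * (B * ((5 * J + 1) * ((2 * R) ^ (5 * J + 1) * d)))))) := by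
  refine (ctBound_sum_trees hT (by positivity) fun i p b hb => ((hA i p b hb).ctBound_sub hT hB
    (fun _ ν => (phaseSum ν J : ℝ)) hR1 hd0 (fun a _ => hf i p b a) (fun a _ => hf' i p b a)
    fun a _ => hd i p b a).mono ?_).congr hT fun t ht => ?_
  · have := card_le_of_subset_node (leaves p.1)
    gcongr
    · exact_mod_cast this
    · linarith
  · rw [Pi.sub_apply, h.treeSum_eq hB hA (fun t ht i p b _ a _ => (hf i p b a).1.1 t ht) ht,
      h'.treeSum_eq hB hA (fun t ht i p b _ a _ => (hf' i p b a).1.1 t ht) ht]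
    simp only [Finset.sum_apply, Pi.sub_apply, ← Finset.sum_sub_distrib]
    rfl

end

theorem tree_bound {s : ℝ} (hs : 1 / 2 < s) (hs1 : s ≤ 1) : ∃ C : ℝ, 1 ≤ C ∧
    ∀ {J : ℕ} {T M G R : ℝ} {σ : ℤ} {F : ℝ → Summand J} {Bs : Tree J → Finset (Node J)}
      {A : Types J → Tree J → Node J → (Node J → ℤ) → ℂ} {W V : ℤ → ℝ → ℤ → ℂ} {ω ρ : ℝ → ℤ → ℂ},
      1 ≤ J → 0 < T → 1 < M → 0 ≤ G → 1 ≤ R → σ = 1 ∨ σ = -1 →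
      (∀ i p, ∀ b ∈ Bs p, ∀ ν, ‖A i p b ν‖ ≤ G * ∏ j : Fin J, 1296 * (2 ^ (j : ℕ) * M) ^ (-(1 / 2) : ℝ)
          * kerPow (1 / 2) (childFreq ν j)) →
      TreeRep T F Bs A (leafFun σ W V ω ρ) → LeafBound s T R W V ω ρ →
      TreeConverges T F ∧ CTBound s T (fun t => treeSum (F t)) (G * (C * R ^ 6 * M ^ (-(1 / 2) : ℝ)) ^ J) ∧
      ∀ {F' : ℝ → Summand J} {W' V' : ℤ → ℝ → ℤ → ℂ} {ω' ρ' : ℝ → ℤ → ℂ} {d : ℝ}, 0 ≤ d →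
        TreeRep T F' Bs A (leafFun σ W' V' ω' ρ') → LeafBound s T R W' V' ω' ρ' →
        LeafBound s T d (W - W') (V - V') (ω - ω') (ρ - ρ') →
        CTBound s T ((fun t => treeSum (F t)) - fun t => treeSum (F' t))
          (G * (C * R ^ 6 * M ^ (-(1 / 2) : ℝ)) ^ J * d) := by
  obtain ⟨C, hC1, hC⟩ := mbound_tree hs hs1
  refine ⟨7 * 20 * 36 * 1296 * C * 2 ^ 6, by linarith, fun {J T M G R σ F Bs A W V ω ρ} hJ hT hM hG hR hσ hA hF
    hL => ?_⟩
  have hM0 : 0 < M := by linarith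
  have hC0 : 0 ≤ C := by linarith
  have hB : 0 ≤ G * ∏ j : Fin J, 1296 * (2 ^ (j : ℕ) * M) ^ (-(1 / 2) : ℝ) * C := by
    have : 0 ≤ ∏ j : Fin J, 1296 * (2 ^ (j : ℕ) * M) ^ (-(1 / 2) : ℝ) * C :=
      Finset.prod_nonneg fun j _ => by positivity
    positivity
  have hAB := fun i p b hb => hC p hG (fun j => by positivity) (hA i p b hb)
  have hT1 := total_le hM hG hC0 (show 1 ≤ 2 * R by linarith) hJ
  have e : (7 * 20 * 36 * 1296 * C * (2 * R) ^ 6) = 7 * 20 * 36 * 1296 * C * 2 ^ 6 * R ^ 6 := by ring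
  rw [e] at hT1
  have hl := leafFun_ctBound (J := J) hT hσ hL
  have hmono : 7 ^ J * (Fintype.card (Tree J) * ((5 * J + 1) * ((G * ∏ j : Fin J,
      1296 * (2 ^ (j : ℕ) * M) ^ (-(1 / 2) : ℝ) * C) * R ^ (5 * J + 1)))) ≤ _ := le_trans (by
    gcongr
    refine (pow_le_pow_left₀ (by linarith) (show R ≤ 2 * R by linarith) _).trans ?_
    exact le_mul_of_one_le_left (by positivity) (by linarith [(Nat.cast_nonneg J : (0 : ℝ) ≤ J)])) hT1
  obtain ⟨k1, k2⟩ := hF.estimate hT hB hAB hl hR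
  refine ⟨k1, k2.mono hmono, fun {F' W' V' ω' ρ' d} hd hF' hL' hLd => ?_⟩
  refine (hF.estimate_sub hF' hT hB hAB hl (leafFun_ctBound (J := J) hT hσ hL') hR (fun i p b a =>
    (leafFun_ctBound (J := J) hT hσ hLd i p b a).congr hT fun t _ => leafFun_sub t i p b a) hd).mono ?_
  refine le_trans (le_of_eq ?_) (mul_le_mul_of_nonneg_right hT1 hd)
  ring

theorem tree_bound_next {s : ℝ} (hs : 1 / 2 < s) (hs1 : s ≤ 1) : ∃ C : ℝ, 1 ≤ C ∧
    ∀ {T M R : ℝ} {σ : ℤ} {u : ℝ → Torus → ℝ} {ω : ℝ → ℤ → ℂ},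
      0 < T → 1 < M → 1 ≤ R → σ = 1 ∨ σ = -1 → LeafBound s T R (gaugeT u) (gaugeT u) ω ω → ∀ J : ℕ,
      TreeConverges T (summandNext σ M u ω J) ∧ CTBound (s - 1) T (Next σ M u ω J)
        (C * R ^ 6 * (C * R ^ 6 * M ^ (-((s - 1 / 2) / 2))) ^ J) := by
  obtain ⟨C, hC1, hC⟩ := mbound_tree_next hs hs1
  set θ := (s - 1 / 2) / 2
  have hθ : 0 < θ := by simp only [θ]; linarith
  have hθ1 : θ ≤ 1 := by simp only [θ]; linarith
  have hθ2 : 1 ≤ 10 / θ := by rw [le_div_iff₀ hθ]; linarith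
  refine ⟨7 * 6 * 24 * 216 * 36 * (10 / θ) * C, by nlinarith, fun {T M R σ u ω} hT hM hR hσ hL J => ?_⟩
  have hM0 : 0 < M := by linarith
  have hC0 : 0 ≤ C := by linarith
  have hP : ∀ c : Fin J → ℝ, (∀ j, 0 ≤ c j) → 0 ≤ ∏ j : Fin J, 216 * (2 ^ (j : ℕ) * M) ^ (-θ) * c j :=
    fun c hc => Finset.prod_nonneg fun j _ => by have := hc j; positivity
  have hB : 0 ≤ 24 * ((∏ j : Fin J, 216 * (2 ^ (j : ℕ) * M) ^ (-θ) * C) * C) := by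
    have := hP (fun _ => C) fun _ => hC0
    positivity
  have hF := treeRep_main (T := T) (fun ν : Node (J + 1) → ℤ => NonRes M ν J) (Complex.I ^ J) σ J u ω
  have hA := fun (i : Types (J + 1)) (p : Tree (J + 1)) (b : Node (J + 1)) => hC p (K := 24)
    (A := condAmp (fun ν => NonRes M ν J) (Complex.I ^ J) σ J (fun _ _ => 1) i p b)
    (c := fun j => 216 * (2 ^ (j : ℕ) * M) ^ (-θ)) (by norm_num) (fun j => by positivity) fun ν => by
      have h0 := hP (fun j => kerPow θ (childFreq ν j.castSucc)) fun j => kerPow_nonneg _ _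
      have h1 := kerM_nonneg (childFreq ν (Fin.last J))
      refine norm_condAmp_le (by simp) (by positivity) fun h => ?_
      rw [norm_one, mul_one]
      refine (norm_baseAmp_next_le hσ i p hM h hθ.le hθ1).trans (le_of_eq ?_)
      ring
  obtain ⟨k1, k2⟩ := hF.estimate hT hB (fun i p b _ => hA i p b) (leafFun_ctBound hT hσ hL) hR
  exact ⟨k1, k2.mono (total_next_le hM hθ hθ1 hC1 hR J)⟩

end

end

theorem pow_absorb {c x L C : ℝ} (hc : 0 ≤ c) (hx : 0 ≤ x) (hL : 1 ≤ L) (h : c * L ≤ C) {J : ℕ} (hJ : 1 ≤ J) :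
    (c * x) ^ J * L ≤ (C * x) ^ J :=
  calc (c * x) ^ J * L ≤ (c * x) ^ J * L ^ J := by gcongr; exact le_self_pow₀ hL (by omega)
    _ = (c * L * x) ^ J := by rw [← mul_pow]; ring
    _ ≤ _ := by
      have : 0 ≤ L := by linarith
      gcongr

theorem SeqBound.leafBound {s T B C : ℝ} {ω ρ ρ' : ℝ → ℤ → ℂ} {W D : ℤ → ℝ → ℤ → ℂ} (hT : 0 < T)
    (h : SeqBound s T B ω W D ρ) (hρ : CTBound s T ρ' C) (hB : B ≤ C) :
    LeafBound s T C W (scaled D) ω ρ' :=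
  ⟨fun k hk => ⟨((h.gauge k hk).mono_exponent hT (by linarith)).mono hB, ((h.dot k hk).bracketInv hT).mono hB⟩,
    h.sol.mono hB, hρ⟩

theorem LeafBound.main {s T C : ℝ} {ω ρ : ℝ → ℤ → ℂ} {W V : ℤ → ℝ → ℤ → ℂ} (h : LeafBound s T C W V ω ρ) :
    LeafBound s T C W V ω ω ∧ LeafBound s T C W W ω ρ ∧ LeafBound s T C W W ω ω :=
  have g : ∀ k ∈ Finset.Icc (-3 : ℤ) 3, CTBound s T (W k) C ∧ CTBound s T (W k) C := fun k hk =>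
    ⟨(h.gauge k hk).1, (h.gauge k hk).1⟩
  ⟨⟨h.gauge, h.sol.1, h.sol.1⟩, ⟨g, h.sol⟩, ⟨g, h.sol.1, h.sol.1⟩⟩

theorem ampProd_nonneg {J : ℕ} {M G : ℝ} (hM : 1 < M) (hG : 0 ≤ G) (ν : Node J → ℤ) :
    0 ≤ G * ∏ j : Fin J, 1296 * (2 ^ (j : ℕ) * M) ^ (-(1 / 2) : ℝ) * kerPow (1 / 2) (childFreq ν j) :=
  mul_nonneg hG (Finset.prod_nonneg fun j _ => by
    have := kerPow_nonneg (1 / 2) (childFreq ν j)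
    have : 0 < M := by linarith
    positivity)

theorem norm_baseAmp_le_one_mul {J : ℕ} {σ : ℤ} (hσ : σ = 1 ∨ σ = -1) (i : Types J) (p : Tree J)
    {ν : Node J → ℤ} {M : ℝ} (hM : 1 < M) (h : NonRes M ν J) : ‖baseAmp σ J i p ν‖ ≤ 1 * ∏ j : Fin J,
      1296 * (2 ^ (j : ℕ) * M) ^ (-(1 / 2) : ℝ) * kerPow (1 / 2) (childFreq ν j) := by
  have hM0 : 0 < M := by linarith
  rw [one_mul]
  refine (norm_baseAmp_le hσ i p hM h).trans ?_
  have := fun j => kerPow_nonneg (1 / 2) (childFreq ν j)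
  refine Finset.prod_le_prod (fun j _ => by have := this j; positivity) fun j _ => ?_
  have := this j
  gcongr
  norm_num

theorem exists_bounds {s : ℝ} (hs : 1 / 2 < s) (hs1 : s ≤ 1) (A : ℝ) : ∃ C₀ : ℝ, 0 < C₀ ∧
    ∀ σ : ℤ, σ = 1 ∨ σ = -1 → ∀ T : ℝ, 0 < T → ∀ u u' : ℝ → Torus → ℝ,
      IsSolution σ s T u → IsSolution σ s T u' → ctHsNorm s T u ≤ A → ctHsNorm s T u' ≤ A →
      ∀ M : ℝ, 1 < M → ∀ ω ω' : ℝ → ℤ → ℂ, ω = omega σ u → ω' = omega σ u' →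
      (WellDefined σ s T M u ω
        ∧ InCT s T (R0 σ u ω) ∧ InCT (s - 1) T (Next σ M u ω 0)
        ∧ ctNorm s T (R0 σ u ω) + ctNorm (s - 1) T (Next σ M u ω 0) ≤ C₀
        ∧ ∀ J : ℕ, 1 ≤ J →
          CTBound s T (NR σ M u ω J) (M * (C₀ * M ^ (-(1 / 2) : ℝ)) ^ J)
          ∧ CTBound s T (N0 σ M u ω J) ((C₀ * M ^ (-(1 / 2) : ℝ)) ^ J)
          ∧ CTBound s T (N1 σ T M u ω J) (C₀ * M ^ (1 / 2 : ℝ) * (C₀ * M ^ (-(1 / 2) : ℝ)) ^ J)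
          ∧ CTBound s T (Rem σ M u ω J) (C₀ * (C₀ * M ^ (-(1 / 2) : ℝ)) ^ J)
          ∧ CTBound (s - 1) T (Next σ M u ω J) (C₀ * (C₀ * M ^ (-((s - 1 / 2) / 2))) ^ J)) ∧
      ∀ D : ℝ, D = ctHsNorm s T (u - u') + ctNorm s T (ω - ω') →
        CTBound s T (R0 σ u ω - R0 σ u' ω') (C₀ * D)
        ∧ ∀ J : ℕ, 1 ≤ J →
          CTBound s T (NR σ M u ω J - NR σ M u' ω' J) (M * (C₀ * M ^ (-(1 / 2) : ℝ)) ^ J * D)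
          ∧ CTBound s T (N0 σ M u ω J - N0 σ M u' ω' J) ((C₀ * M ^ (-(1 / 2) : ℝ)) ^ J * D)
          ∧ CTBound s T (N1 σ T M u ω J - N1 σ T M u' ω' J)
              (C₀ * M ^ (1 / 2 : ℝ) * (C₀ * M ^ (-(1 / 2) : ℝ)) ^ J * D)
          ∧ CTBound s T (Rem σ M u ω J - Rem σ M u' ω' J) (C₀ * (C₀ * M ^ (-(1 / 2) : ℝ)) ^ J * D) := by
  obtain ⟨R, hR, hdata⟩ := exists_dataBound hs hs1 A
  obtain ⟨K, hK, hR0⟩ := exists_R0_bound hs hs1 R hR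
  obtain ⟨C, hC1, hC⟩ := tree_bound hs hs1
  obtain ⟨C', hC1', hC'⟩ := tree_bound_next hs hs1
  set L := R + K * R with hL
  have hKR : K ≤ K * R := le_mul_of_one_le_right (by linarith) hR
  have hL1 : 1 ≤ L := by linarith
  set c := C * L ^ 6 with hc
  set c' := C' * L ^ 6 with hc'
  have hL6 : 1 ≤ L ^ 6 := one_le_pow₀ hL1
  have hc1 : 1 ≤ c := one_le_mul_of_one_le_of_one_le hC1 hL6
  have hc1' : 1 ≤ c' := one_le_mul_of_one_le_of_one_le hC1' hL6
  have hcL : 1 ≤ c * L := one_le_mul_of_one_le_of_one_le hc1 hL1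
  set C₀ := c * L + c' + K * R with hC₀
  have h1 : 1 ≤ C₀ := by linarith
  have i1 : c * L ≤ C₀ := by linarith
  have i2 : c' ≤ C₀ := by linarith
  have i3 : K * R ≤ C₀ := by linarith
  have i4 : K + c' ≤ C₀ := by linarith
  have i5 : c * 1 ≤ C₀ := by nlinarith
  refine ⟨C₀, by linarith, fun σ hσ T hT u u' hu hu' hA hA' M hM ω ω' hω hω' => ?_⟩
  subst hω hω'
  set ω := omega σ u
  set ω' := omega σ u'
  obtain ⟨d1, d2⟩ := hdata σ hσ T hT u u' hu hu' hA hA'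
  have d1' := (hdata σ hσ T hT u' u' hu' hu' hA' hA').1
  obtain ⟨b1, b2, b3⟩ := hR0 σ hσ T hT u u' ω ω' d1 d1'
  have b2' := (hR0 σ hσ T hT u' u' ω' ω' d1' d1').2.1
  have l1 := (d1.leafBound hT (b2.mono (by linarith : K ≤ L)) (by linarith)).main
  have l1' := (d1'.leafBound hT (b2'.mono (by linarith : K ≤ L)) (by linarith)).main
  set D := ctHsNorm s T (u - u') + ctNorm s T (ω - ω')
  have hD : 0 ≤ D := add_nonneg (ctNorm_nonneg _ _ _) (ctNorm_nonneg _ _ _)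
  have hRD : 0 ≤ R * D := by positivity
  have b4 := b3 _ hRD d2
  have l2 := (d2.leafBound hT (b4.mono (show K * (R * D) ≤ L * D by nlinarith)) (by
    have : 0 ≤ K * R * D := by positivity
    nlinarith)).main
  rw [scaled_sub] at l2
  have hLD : 0 ≤ L * D := by positivity
  have hM0 : 0 < M := by linarith
  set x := M ^ (-(1 / 2) : ℝ)
  have hx : 0 ≤ x := Real.rpow_nonneg hM0.le _
  have hy : 0 ≤ M ^ (1 / 2 : ℝ) := Real.rpow_nonneg hM0.le _
  have f1 : ∀ {f G H J}, 0 ≤ G → G ≤ H → 1 ≤ J → CTBound s T f (G * (C * L ^ 6 * x) ^ J) →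
      CTBound s T f (H * (C₀ * x) ^ J) := fun {f G H J} hG hGH hJ h => h.mono (by
    have := pow_absorb (c := c) (by linarith) hx le_rfl i5 hJ
    rw [mul_one] at this
    exact mul_le_mul hGH this (by positivity) (hG.trans hGH))
  have f2 : ∀ {f G H J}, 0 ≤ G → G ≤ H → 1 ≤ J → CTBound s T f (G * (C * L ^ 6 * x) ^ J * (L * D)) →
      CTBound s T f (H * (C₀ * x) ^ J * D) := fun {f G H J} hG hGH hJ h => h.mono (by
    rw [← mul_assoc, mul_assoc G]
    gcongr
    · exact hG.trans hGH
    · exact pow_absorb (c := c) (by linarith) hx hL1 i1 hJ)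
  have kR := fun J (hJ : 1 ≤ J) => hC (F := summandR σ M u ω J) hJ hT hM hM0.le hL1 hσ
    (fun i p b _ ν => norm_condAmp_le (by simp) (ampProd_nonneg hM hM0.le ν) fun h => by
      simpa using norm_baseAmp_le_of_res hσ i p hM hJ h)
    (treeRep_main (fun ν => Res M ν J) (Complex.I ^ (J - 1)) σ (J - 1) u ω) l1.2.2
  have k0 := fun J (hJ : 1 ≤ J) => hC (F := summand0 σ M u ω J) hJ hT hM zero_le_one hL1 hσ
    (fun i p b _ ν => norm_condAmp_le (by simp) (ampProd_nonneg hM zero_le_one ν) fun h => by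
      simpa using norm_baseAmp_le_one_mul hσ i p hM h)
    (treeRep_main (fun ν => NonRes M ν J) (-Complex.I ^ J) σ J u ω) l1.2.2
  have k1 := fun J (hJ : 1 ≤ J) => hC (F := summand1 σ T M u ω J) hJ hT hM hy hL1 hσ
    (fun i p b hb ν => norm_condAmp_le (by simp) (ampProd_nonneg hM hy ν) fun h => by
      rw [Complex.norm_real, Real.norm_of_nonneg (bracket_pos _).le]
      exact norm_baseAmp_mul_bracket_le hσ i p hM h hb)
    (treeRep_dot hu hs hs1 hT M ω J) l1.1
  have kρ := fun J (hJ : 1 ≤ J) => hC (F := summandRem σ M u ω J) hJ hT hM zero_le_one hL1 hσ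
    (fun i p b _ ν => norm_condAmp_le (by simp) (ampProd_nonneg hM zero_le_one ν) fun h => by
      simpa using norm_baseAmp_le_one_mul hσ i p hM h)
    (treeRep_rem M σ u ω J) l1.2.1
  have kN := hC' hT hM hL1 hσ l1.2.2
  have hyC : M ^ (1 / 2 : ℝ) ≤ C₀ * M ^ (1 / 2 : ℝ) := le_mul_of_one_le_left hy h1
  refine ⟨⟨⟨d1.sol.1, fun k _ n t ht =>
    (hu.hasDerivWithinAt_gaugeSeq hs hs1 hT k n ht).differentiableWithinAt, b1, (kN 0).1, fun J hJ =>
      ⟨(kR J hJ).1, (k0 J hJ).1, (k1 J hJ).1, (kρ J hJ).1, (kN J).1⟩⟩, b2.1, (kN 0).2.1, ?_, fun J hJ =>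
    ⟨f1 hM0.le le_rfl hJ (kR J hJ).2.1, ?_, f1 hy hyC hJ (k1 J hJ).2.1, f1 zero_le_one h1 hJ (kρ J hJ).2.1,
      (kN J).2.mono ?_⟩⟩, fun D' hD' => ?_⟩
  · have := (kN 0).2.2
    rw [pow_zero, mul_one] at this
    linarith [b2.2]
  · exact (f1 zero_le_one le_rfl hJ (k0 J hJ).2.1).mono (one_mul _).le
  · have := Real.rpow_nonneg hM0.le (-((s - 1 / 2) / 2))
    gcongr
  · subst hD'
    refine ⟨b4.mono (by rw [← mul_assoc]; gcongr), fun J hJ => ⟨?_, ?_, ?_, ?_⟩⟩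
    · exact f2 hM0.le le_rfl hJ ((kR J hJ).2.2 (F' := summandR σ M u' ω' J) hLD
        (treeRep_main (fun ν => Res M ν J) (Complex.I ^ (J - 1)) σ (J - 1) u' ω') l1'.2.2 l2.2.2)
    · exact (f2 zero_le_one le_rfl hJ ((k0 J hJ).2.2 (F' := summand0 σ M u' ω' J) hLD
        (treeRep_main (fun ν => NonRes M ν J) (-Complex.I ^ J) σ J u' ω') l1'.2.2 l2.2.2)).mono
        (by rw [one_mul])
    · exact f2 hy hyC hJ ((k1 J hJ).2.2 (F' := summand1 σ T M u' ω' J) hLD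
        (treeRep_dot hu' hs hs1 hT M ω' J) l1'.1 l2.1)
    · exact f2 zero_le_one h1 hJ ((kρ J hJ).2.2 (F' := summandRem σ M u' ω' J) hLD
        (treeRep_rem M σ u' ω' J) l1'.2.1 l2.2.1)

end

end MBO

open MBO in
theorem proposition3p2 (s : ℝ) (hs : 1 / 2 < s) (hs1 : s ≤ 1) :
    (∃ δ : ℝ, 0 < δ ∧ δ < 1 / 2 ∧
      ∀ A : ℝ, ∃ C₀ : ℝ, 0 < C₀ ∧
        ∀ (σ : ℤ), σ = 1 ∨ σ = -1 → ∀ T : ℝ, 0 < T → ∀ u : ℝ → Torus → ℝ,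
          IsSolution σ s T u → ctHsNorm s T u ≤ A →
          ∀ M : ℝ, 1 < M →
          ∀ ω : ℝ → ℤ → ℂ, ω = omega σ u →
            WellDefined σ s T M u ω
            ∧ InCT s T (R0 σ u ω) ∧ InCT (s - 1) T (Next σ M u ω 0)
            ∧ ctNorm s T (R0 σ u ω) + ctNorm (s - 1) T (Next σ M u ω 0) ≤ C₀
            ∧ ∀ J : ℕ, 1 ≤ J →
              CTBound s T (NR σ M u ω J) (M * (C₀ * M ^ (-(1 / 2) : ℝ)) ^ J)
              ∧ CTBound s T (N0 σ M u ω J) ((C₀ * M ^ (-(1 / 2) : ℝ)) ^ J)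
              ∧ CTBound s T (N1 σ T M u ω J)
                  (C₀ * M ^ (1 / 2 : ℝ) * (C₀ * M ^ (-(1 / 2) : ℝ)) ^ J)
              ∧ CTBound s T (Rem σ M u ω J) (C₀ * (C₀ * M ^ (-(1 / 2) : ℝ)) ^ J)
              ∧ CTBound (s - 1) T (Next σ M u ω J) (C₀ * (C₀ * M ^ (-δ)) ^ J))
    ∧
    (∀ A A' : ℝ, ∃ C₀ : ℝ, 0 < C₀ ∧
      ∀ (σ : ℤ), σ = 1 ∨ σ = -1 → ∀ T : ℝ, 0 < T → ∀ u u' : ℝ → Torus → ℝ,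
        IsSolution σ s T u → IsSolution σ s T u' →
        ctHsNorm s T u ≤ A → ctHsNorm s T u' ≤ A' →
        ∀ M : ℝ, 1 < M →
        ∀ ω ω' : ℝ → ℤ → ℂ, ω = omega σ u → ω' = omega σ u' →
        ∀ D : ℝ, D = ctHsNorm s T (u - u') + ctNorm s T (ω - ω') →
          CTBound s T (R0 σ u ω - R0 σ u' ω') (C₀ * D)
          ∧ ∀ J : ℕ, 1 ≤ J →
            CTBound s T (NR σ M u ω J - NR σ M u' ω' J)
                (M * (C₀ * M ^ (-(1 / 2) : ℝ)) ^ J * D)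
            ∧ CTBound s T (N0 σ M u ω J - N0 σ M u' ω' J)
                ((C₀ * M ^ (-(1 / 2) : ℝ)) ^ J * D)
            ∧ CTBound s T (N1 σ T M u ω J - N1 σ T M u' ω' J)
                (C₀ * M ^ (1 / 2 : ℝ) * (C₀ * M ^ (-(1 / 2) : ℝ)) ^ J * D)
            ∧ CTBound s T (Rem σ M u ω J - Rem σ M u' ω' J)
                (C₀ * (C₀ * M ^ (-(1 / 2) : ℝ)) ^ J * D)) := by
  refine ⟨⟨(s - 1 / 2) / 2, by linarith, by linarith, fun A => ?_⟩, fun A A' => ?_⟩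
  · obtain ⟨C₀, h0, h⟩ := exists_bounds hs hs1 A
    exact ⟨C₀, h0, fun σ hσ T hT u hu hA M hM ω hω =>
      (h σ hσ T hT u u hu hu hA hA M hM ω ω hω hω).1⟩
  · obtain ⟨C₀, h0, h⟩ := exists_bounds hs hs1 (max A A')
    exact ⟨C₀, h0, fun σ hσ T hT u u' hu hu' hA hA' M hM ω ω' hω hω' =>
      (h σ hσ T hT u u' hu hu' (hA.trans (le_max_left _ _)) (hA'.trans (le_max_right _ _)) M hM ω ω'
        hω hω').2⟩
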